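/- Let $d\in\{1,2,3\}$, $N\in\mathbb N$, let $1\le p<\infty$, with $p<2$ if $d=3$, and let $\beta_{\mu\nu}=\beta_{\nu\mu}\ge 0$ for $\mu,\nu=1,\dots,N$. Let $u=(u_\mu)_{\mu=1}^N\in\mathcal C(\mathbb R,H^1(\mathbb R^d,\mathbb C)^N)$ be a global (weak, i.e. $H^{-1}$-valued) solution of $$i\partial_t u_\mu+\Delta u_\mu-\sum_{\nu=1}^N\beta_{\mu\nu}|u_\nu|^{p+1}|u_\mu|^{p-1}u_\mu=0,\qquad \mu=1,\dots,N.$$ Let $\Phi(x)=\varphi(|x|)$ be a convex radial function on $\mathbb R^d$, of class $C^4$, whose derivatives of orders $1,2,3,4$ are bounded, and put $\psi(x,y)=\varphi(|x-y|)$. For $f\in H^1(\mathbb R^d,\mathbb C)$ write $m_f=|f|^2$ and $j_f=\operatorname{Im}(\overline f\,\nabla f)$, and let $\nabla m_f$ be the weak gradient of $m_f$. Consider $$I(t)=\sum_{\mu,\kappa=1}^N\iint_{\mathbb R^d\times\mathbb R^d}\psi(x,y)\,m_{u_\mu(t)}(x)\,m_{u_\kappa(t)}(y)\,dx\,dy,\qquad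 M(t)=4\sum_{\mu,\kappa=1}^N\iint j_{u_\mu(t)}(x)\cdot\nabla_x\psi(x,y)\,m_{u_\kappa(t)}(y)\,dx\,dy,$$ $$N_{(p,\psi)}(t)=\frac{4p}{p+1}\sum_{\mu,\nu,\kappa=1}^N\beta_{\mu\nu}\iint|u_\mu(t,x)|^{p+1}|u_\nu(t,x)|^{p+1}m_{u_\kappa(t)}(y)\,\Delta_x\psi(x,y)\,dx\,dy.$$ Then $\nabla m_{u_\mu(t)}$ exists and is integrable for all $t$ and $\mu$, the integrals in $M(t)$ and $N_{(p,\psi)}(t)$ and in the two lower bounds below converge absolutely, and $N_{(p,\psi)}(t)\ge 0$. Moreover: 1. If the integrals defining $I(t_0)$ converge absolutely for one $t_0$, then those defining $I(t)$ converge absolutely for every $t\in\mathbb R$, $I$ is twice differentiable on $\mathbb R$, and $\dot I(t)=M(t)$. 2. $M$ is differentiable on $\mathbb R$ (also when $I$ is not finite), and $\ddot I:=\dot M$ satisfies, for all $t\in\mathbb R$, $$\ddot I(t)\ \ge\ 2\sum_{\mu,\kappa=1}^N\iint\Delta_x\psi(x,y)\,\nabla m_{u_\mu(t)}(x)\cdot\nabla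 m_{u_\kappa(t)}(y)\,dx\,dy+N_{(p,\psi)}(t),$$ $$\ddot I(t)\ \ge\ -2\sum_{\mu,\kappa=1}^N\iint m_{u_\mu(t)}(x)\,m_{u_\kappa(t)}(y)\,\Delta_x^2\psi(x,y)\,dx\,dy+N_{(p,\psi)}(t).$$ -/

import Mathlib

open MeasureTheory
open scoped ContDiff ENNReal

noncomputable section

/-- The space `ℝ^d` with its Euclidean norm. -/
abbrev Rd (d : ℕ) : Type := EuclideanSpace ℝ (Fin d)

/-- The functions `g 0, …, g (d-1)` are the weak partial derivatives of `f` on `ℝ^d`: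
`∫ (∂ₖ η) f = - ∫ η gₖ` for every real test function `η ∈ C_c^∞(ℝ^d)`. -/
def HasWeakGradient {d : ℕ} {F : Type*} [NormedAddCommGroup F] [NormedSpace ℝ F]
    (f : Rd d → F) (g : Fin d → Rd d → F) : Prop :=
  LocallyIntegrable f volume ∧ (∀ k, LocallyIntegrable (g k) volume) ∧
    ∀ η : Rd d → ℝ, ContDiff ℝ ∞ η → HasCompactSupport η → ∀ k : Fin d,
      ∫ x, (fderiv ℝ η x (EuclideanSpace.single k 1)) • f x = - ∫ x, η x • g k x

/-- The Sobolev space `H¹(ℝ^d, ℂ)`, realized as the space of pairs `(f, ∇f)` in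
`L² × (L²)^d`, where `∇f` is the weak gradient of `f`. The distance inherited from the
(Hilbert) ambient space is that of the norm `(‖f‖² + ‖∇f‖²)^(1/2)`. -/
abbrev H1 (d : ℕ) : Type :=
  {U : WithLp 2 (Lp ℂ 2 (volume : Measure (Rd d)) ×
      PiLp 2 (fun _ : Fin d => Lp ℂ 2 (volume : Measure (Rd d)))) //
    HasWeakGradient (fun x => U.fst x) (fun k x => U.snd k x)}

/-- The function `f` underlying an element of `H¹`. -/
def H1.fn {d : ℕ} (U : H1 d) : Rd d → ℂ := fun x => U.1.fst x

/-- The weak partial derivative `∂ₖ f` of an element of `H¹`. -/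
def H1.pd {d : ℕ} (U : H1 d) (k : Fin d) : Rd d → ℂ := fun x => U.1.snd k x

/-- The mass density `m_f = |f|²`. -/
def massDensity {d : ℕ} (U : H1 d) (x : Rd d) : ℝ := ‖U.fn x‖ ^ 2

/-- The momentum density `j_f = Im (conj f ∇f)`. -/
def momentumDensity {d : ℕ} (U : H1 d) (x : Rd d) : Rd d :=
  WithLp.toLp 2 (fun k => ((starRingEnd ℂ) (U.fn x) * U.pd k x).im)

/-- The nonlinearity `∑_ν β_{μν} |u_ν|^{p+1} |u_μ|^{p-1} u_μ` of the `μ`-th equation. -/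
def nonlinearity {d N : ℕ} (p : ℝ) (β : Fin N → Fin N → ℝ) (U : Fin N → H1 d) (μ : Fin N)
    (x : Rd d) : ℂ :=
  ∑ ν, ((β μ ν * ‖(U ν).fn x‖ ^ (p + 1) * ‖(U μ).fn x‖ ^ (p - 1) : ℝ) : ℂ) * (U μ).fn x

/-- `u = (u_μ)` belongs to `C(ℝ, H¹(ℝ^d)^N)` and solves
`i ∂ₜ u_μ + Δ u_μ - ∑_ν β_{μν} |u_ν|^{p+1} |u_μ|^{p-1} u_μ = 0` for all times. The equation
is understood weakly in space: for every test function `η` and every `t`,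
`d/dt ∫ η u_μ = i (- ∫ ∇η · ∇u_μ - ∫ η ∑_ν β_{μν} |u_ν|^{p+1} |u_μ|^{p-1} u_μ)`. -/
structure IsGlobalSolution {d N : ℕ} (p : ℝ) (β : Fin N → Fin N → ℝ)
    (u : ℝ → Fin N → H1 d) : Prop where
  continuous : Continuous u
  equation : ∀ (μ : Fin N) (η : Rd d → ℝ), ContDiff ℝ ∞ η → HasCompactSupport η → ∀ t : ℝ,
    HasDerivAt (fun s => ∫ x, η x • (u s μ).fn x)
      (Complex.I * (- (∑ k, ∫ x, (fderiv ℝ η x (EuclideanSpace.single k 1)) • (u t μ).pd k x)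
        - ∫ x, η x • nonlinearity p β (u t) μ x)) t

/-- The radial function `x ↦ φ(|x|)` on `ℝ^d`. -/
def radial (d : ℕ) (φ : ℝ → ℝ) (x : Rd d) : ℝ := φ ‖x‖

/-- `ψ(x, y) = φ(|x - y|)`. -/
def psi {d : ℕ} (φ : ℝ → ℝ) (x y : Rd d) : ℝ := φ ‖x - y‖

/-- `∇ₓ ψ(x, y)`. -/
def gradPsi {d : ℕ} (φ : ℝ → ℝ) (x y : Rd d) : Rd d := gradient (fun z => psi φ z y) x

/-- `Δₓ ψ(x, y)`. -/
def lapPsi {d : ℕ} (φ : ℝ → ℝ) (x y : Rd d) : ℝ :=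
  Laplacian.laplacian (fun z => psi φ z y) x

/-- `Δₓ² ψ(x, y)`. -/
def bilapPsi {d : ℕ} (φ : ℝ → ℝ) (x y : Rd d) : ℝ :=
  Laplacian.laplacian (fun z => lapPsi φ z y) x

/-- The integrand of the interaction functional, `ψ(x,y) m_U(x) m_V(y)`. -/
def interactionIntegrand {d : ℕ} (φ : ℝ → ℝ) (U V : H1 d) (z : Rd d × Rd d) : ℝ :=
  psi φ z.1 z.2 * massDensity U z.1 * massDensity V z.2

/-- The integrand `j_U(x) · ∇ₓψ(x,y) m_V(y)`. -/
def currentIntegrand {d : ℕ} (φ : ℝ → ℝ) (U V : H1 d) (z : Rd d × Rd d) : ℝ :=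
  inner ℝ (momentumDensity U z.1) (gradPsi φ z.1 z.2) * massDensity V z.2

/-- The integrand `|U(x)|^{p+1} |V(x)|^{p+1} m_W(y) Δₓψ(x,y)`. -/
def nonlinearIntegrand {d : ℕ} (p : ℝ) (φ : ℝ → ℝ) (U V W : H1 d) (z : Rd d × Rd d) : ℝ :=
  ‖U.fn z.1‖ ^ (p + 1) * ‖V.fn z.1‖ ^ (p + 1) * massDensity W z.2 * lapPsi φ z.1 z.2

/-- The integrand `m_U(x) m_V(y) Δₓ²ψ(x,y)`. -/
def bilapIntegrand {d : ℕ} (φ : ℝ → ℝ) (U V : H1 d) (z : Rd d × Rd d) : ℝ :=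
  massDensity U z.1 * massDensity V z.2 * bilapPsi φ z.1 z.2

/-- The integrand `Δₓψ(x,y) G(x) · H(y)` for two vector fields `G`, `H`. -/
def gradientIntegrand {d : ℕ} (φ : ℝ → ℝ) (G H : Rd d → Rd d) (z : Rd d × Rd d) : ℝ :=
  lapPsi φ z.1 z.2 * inner ℝ (G z.1) (H z.2)

/-- The interaction functional `I(t) = ∑_{μ,κ} ∬ ψ(x,y) m_{u_μ}(x) m_{u_κ}(y) dx dy`. -/
def interaction {d N : ℕ} (φ : ℝ → ℝ) (u : ℝ → Fin N → H1 d) (t : ℝ) : ℝ :=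
  ∑ μ, ∑ κ, ∫ z, interactionIntegrand φ (u t μ) (u t κ) z

/-- All the integrals in the definition of `I(t)` converge absolutely. -/
def InteractionFinite {d N : ℕ} (φ : ℝ → ℝ) (u : ℝ → Fin N → H1 d) (t : ℝ) : Prop :=
  ∀ μ κ, Integrable (interactionIntegrand φ (u t μ) (u t κ)) volume

/-- The interaction current `4 ∑_{μ,κ} ∬ j_{u_μ}(x) · ∇ₓψ(x,y) m_{u_κ}(y) dx dy`. -/
def interactionCurrent {d N : ℕ} (φ : ℝ → ℝ) (u : ℝ → Fin N → H1 d) (t : ℝ) : ℝ :=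
  4 * ∑ μ, ∑ κ, ∫ z, currentIntegrand φ (u t μ) (u t κ) z

/-- The nonlinear term `N_{(p,ψ)}(t)`, equal to
`4p/(p+1) ∑_{μ,ν,κ} β_{μν} ∬ |u_μ(x)|^{p+1} |u_ν(x)|^{p+1} m_{u_κ}(y) Δₓψ(x,y) dx dy`. -/
def nonlinearTerm {d N : ℕ} (p : ℝ) (β : Fin N → Fin N → ℝ) (φ : ℝ → ℝ)
    (u : ℝ → Fin N → H1 d) (t : ℝ) : ℝ :=
  4 * p / (p + 1) * ∑ μ, ∑ ν, ∑ κ,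
    β μ ν * ∫ z, nonlinearIntegrand p φ (u t μ) (u t ν) (u t κ) z

end

/-! Formally, everything follows from two local balance laws. Put m = Σ|u_μ|², J_k = Σ Im(ū_μ ∂_k
u_μ), G_k = ½ ∂_k m, S_lk = Σ Re(conj(∂_l u_μ) ∂_k u_μ) and P = Σ β_{μν} |u_μ|^{p+1} |u_ν|^{p+1}.
Then ∂_t m = -2 Σ_k ∂_k J_k and ∂_t J_k = -2 Σ_l ∂_l S_lk + Δ G_k - p/(p+1) ∂_k P. Testing both with
Φ(x-y), in x and in y, gives İ = M and Ï = 8 Σ ∬ ∂_l∂_kΦ(x-y) (S_lk(x) m(y) - J_k(x) J_l(y)) + 4 Σ ∬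
∂_l∂_l∂_kΦ(x-y) G_k(x) m(y) + N. After symmetrization in x and y, the first integrand is a
combination of values of the Hessian of Φ on complex vectors (`interaction_form_nonneg`), hence its
integral is nonnegative by convexity and may be dropped (`le_morawetzRate`). One integration by
parts turns the second term into the integral of ΔΦ ∇m·∇m, another choice turns it into the integral
of -Δ²Φ m m. The sign of N is that of ΔΦ, the trace of the Hessian.

The work is in the momentum law, because u is only in H¹ and ∂_t u only in H⁻¹: the pairing of ∂_k u
with ∂_t u has no meaning. Therefore ∂_k u is replaced by the difference quotient of u in direction
k. A translate of u is again an H¹ solution, so the product rule for weak solutions applies to Im ∫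
Y ū(x) u(x+δe_k), and it remains to let δ → 0 after division by δ
(`SolvesSystem.hasDerivAt_momentum`). The linear terms converge with a majorant. The nonlinear term
equals p/(p+1) times the difference of P, up to a remainder that is quadratic in D = u(·+δe_k) - u
(`abs_integral_cancellation_le`), since the symmetric β makes the nonlinearity a gradient. Divided
by δ, the remainder tends to zero in L¹ in time as soon as ∫ ‖D‖² dt ≤ C δ² locally in time, with
the norm of L^{2p+2} (`SolvesSystem.exists_difference_bound`).

That bound is a local Strichartz estimate in L²_t L^{2p+2}_x for the equation solved by D, with
initial data of size |δ| ‖∂_k u‖ and a source that is Lipschitz in D and is absorbed on a short time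
interval. It comes from the dispersive inequality, Riesz–Thorin interpolation, the TT* method and
Schur's test. The condition d < (2p+2)/p, which is p < 2 in dimension three and void below, serves
twice: it embeds H¹ in L^{2p+2} and makes the dispersive kernel |t|^{-σ}, σ = dp/(2p+2), locally
integrable.

Finally, Φ may be unbounded, so İ = M is first shown for the truncations Ψ/(1+εΨ) of Ψ = Φ - Φ(0).
Their gradients are dominated by that of Φ, which gives finiteness at all times and the passage to
the limit (`SolvesSystem.hasDerivAt_interaction`). -/

noncomputable section
open MeasureTheory Filter Topology
open scoped ContDiff ENNReal SchwartzMap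
-- Complex interpolation of bilinear forms on simple functions
namespace InteractionMorawetz

/-- `c ↦ |c|^ζ c/|c|`, the analytic family used in complex interpolation. -/
def phasePow (ζ c : ℂ) : ℂ := if c = 0 then 0 else Complex.exp (ζ * (Real.log ‖c‖ : ℂ)) * (c / ‖c‖)

lemma phasePow_zero (ζ : ℂ) : phasePow ζ 0 = 0 := by simp [phasePow]

lemma norm_phasePow {ζ c : ℂ} (hζ : 0 < ζ.re) : ‖phasePow ζ c‖ = ‖c‖ ^ ζ.re := by
  by_cases hc : c = 0
  · simp [hc, phasePow_zero, Real.zero_rpow hζ.ne']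
  · have h : 0 < ‖c‖ := norm_pos_iff.2 hc
    simp only [phasePow, hc, if_false, norm_mul, Complex.norm_exp, norm_div, Complex.norm_real,
      norm_norm, div_self h.ne', mul_one]
    rw [Real.rpow_def_of_pos h]
    congr 1
    simp [mul_comm]

lemma phasePow_one (c : ℂ) : phasePow 1 c = c := by
  by_cases hc : c = 0
  · simp [hc, phasePow_zero]
  · have h : 0 < ‖c‖ := norm_pos_iff.2 hc
    simp only [phasePow, hc, if_false, one_mul]
    rw [← Complex.ofReal_exp, Real.exp_log h]
    exact mul_div_cancel₀ _ (by exact_mod_cast h.ne')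

lemma differentiable_phasePow (c : ℂ) : Differentiable ℂ (fun ζ => phasePow ζ c) := by
  by_cases hc : c = 0
  · simp [hc, phasePow_zero]
  · simp only [phasePow, hc, if_false]
    fun_prop

variable {α : Type*} [MeasurableSpace α] {μ : Measure α}

/-- A level set of a simple function, as an element of `L²`. -/
def levelLp (μ : Measure α) (f : SimpleFunc α ℂ) (c : ℂ) : Lp ℂ 2 μ :=
  open Classical in
  if h : MemLp ((f ⁻¹' {c}).indicator (fun _ => (1 : ℂ))) 2 μ then h.toLp else 0

lemma levelLp_coe {f : SimpleFunc α ℂ} (hf : MemLp f 2 μ) {c : ℂ} (hc : c ≠ 0) :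
    levelLp μ f c =ᵐ[μ] (f ⁻¹' {c}).indicator (fun _ => (1 : ℂ)) := by
  have h : MemLp ((f ⁻¹' {c}).indicator (fun _ => (1 : ℂ))) 2 μ := by
    refine memLp_indicator_const 2 (f.measurableSet_fiber c) 1 (Or.inr ?_)
    exact (SimpleFunc.measure_preimage_lt_top_of_memLp (by simp) (by simp) f hf c hc).ne
  simp only [levelLp, h, dif_pos]
  exact h.coeFn_toLp

/-- The simple function `x ↦ phasePow ζ (f x)` as an element of `L²`. -/
def phaseLp (μ : Measure α) (f : SimpleFunc α ℂ) (ζ : ℂ) : Lp ℂ 2 μ :=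
  ∑ c ∈ f.range, phasePow ζ c • levelLp μ f c

lemma phaseLp_coe {f : SimpleFunc α ℂ} (hf : MemLp f 2 μ) (ζ : ℂ) :
    phaseLp μ f ζ =ᵐ[μ] fun x => phasePow ζ (f x) := by
  have h1 : ∀ c ∈ f.range, ((phasePow ζ c • levelLp μ f c : Lp ℂ 2 μ) : α → ℂ) =ᵐ[μ]
      fun x => if f x = c then phasePow ζ c else 0 := by
    intro c _
    -- The level set of the value 0 may have infinite measure, so `levelLp` may be meaningless
    -- there; its coefficient `phasePow ζ 0` vanishes.
    by_cases hc : c = 0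
    · subst hc
      simp only [phasePow_zero, zero_smul, ite_self]
      exact Lp.coeFn_zero ℂ 2 μ
    · filter_upwards [Lp.coeFn_smul (phasePow ζ c) (levelLp μ f c), levelLp_coe hf hc] with x h2 h3
      rw [h2, Pi.smul_apply, h3]
      by_cases hx : f x = c <;> simp [Set.indicator, hx]
  have h2 : ∀ᵐ x ∂μ, ∀ c ∈ f.range, ((phasePow ζ c • levelLp μ f c : Lp ℂ 2 μ) : α → ℂ) x =
      if f x = c then phasePow ζ c else 0 :=
    (f.range.eventually_all).2 h1
  have h3 := Lp.coeFn_finsetSum (f := fun c => phasePow ζ c • levelLp μ f c) (s := f.range)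
  filter_upwards [h2, h3] with x hx h3
  rw [phaseLp, h3, Finset.sum_apply, Finset.sum_congr rfl hx, Finset.sum_ite_eq]
  simp

lemma phaseLp_one {f : SimpleFunc α ℂ} (hf : MemLp f 2 μ) : phaseLp μ f 1 = hf.toLp := by
  apply Lp.ext
  filter_upwards [phaseLp_coe hf 1, hf.coeFn_toLp] with x h1 h2
  rw [h1, h2, phasePow_one]

lemma integral_norm_phaseLp {f : SimpleFunc α ℂ} (hf : MemLp f 2 μ) {ζ : ℂ} (hζ : 0 < ζ.re) :
    ∫ x, ‖phaseLp μ f ζ x‖ ∂μ = ∫ x, ‖f x‖ ^ ζ.re ∂μ := by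
  apply integral_congr_ae
  filter_upwards [phaseLp_coe hf ζ] with x hx
  rw [hx, norm_phasePow hζ]

/-- A simple function in L² has support of finite measure, and `phasePow ζ` maps 0 to 0, so every
member of the family is supported there too. -/
lemma integrable_phaseLp {f : SimpleFunc α ℂ} (hf : MemLp f 2 μ) (ζ : ℂ) :
    Integrable (phaseLp μ f ζ) μ := by
  have h : (fun x => phasePow ζ (f x)) = f.map (phasePow ζ) := rfl
  rw [integrable_congr (phaseLp_coe hf ζ), h, ← memLp_one_iff_integrable,
    SimpleFunc.memLp_iff (by simp) (by simp)]
  intro y hy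
  rw [SimpleFunc.map_preimage]
  have h0 : phasePow ζ 0 ≠ y := by rw [phasePow_zero]; exact hy.symm
  have hs : (f ⁻¹' ((f.range.filter (fun b => phasePow ζ b = y) : Finset ℂ) : Set ℂ)) ⊆
      ⋃ b ∈ f.range.filter (fun b => phasePow ζ b = y), f ⁻¹' {b} := by
    intro x hx
    simp only [Set.mem_iUnion]
    exact ⟨f x, hx, rfl⟩
  refine (measure_mono hs).trans_lt ?_
  refine (measure_biUnion_finset_le _ _).trans_lt ?_
  refine ENNReal.sum_lt_top.2 fun b hb => ?_
  refine SimpleFunc.measure_preimage_lt_top_of_memLp (by simp) (by simp) f hf b ?_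
  rintro rfl
  exact h0 (Finset.mem_filter.1 hb).2

lemma norm_phaseLp {f : SimpleFunc α ℂ} (hf : MemLp f 2 μ) {ζ : ℂ} (hζ : 0 < ζ.re) :
    ‖phaseLp μ f ζ‖ = (∫ x, ‖f x‖ ^ (2 * ζ.re) ∂μ) ^ (1 / 2 : ℝ) := by
  rw [Lp.norm_def, MemLp.eLpNorm_eq_integral_rpow_norm (by simp) (by simp) (Lp.memLp _),
    ENNReal.toReal_ofReal (by positivity)]
  simp only [ENNReal.toReal_ofNat]
  rw [one_div]
  congr 1
  apply integral_congr_ae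
  filter_upwards [phaseLp_coe hf ζ] with x hx
  rw [hx, norm_phasePow hζ, ← Real.rpow_mul (norm_nonneg _), mul_comm]

/-- Riesz–Thorin interpolation between `L¹ × L¹` and `L² × L²` for a bilinear form, on simple
functions. -/
theorem riesz_thorin_simpleFunc (B : Lp ℂ 2 μ →L[ℂ] Lp ℂ 2 μ →L[ℂ] ℂ) {A : ℝ} (hA : 0 ≤ A)
    (hB1 : ∀ f g : Lp ℂ 2 μ, Integrable f μ → Integrable g μ →
      ‖B f g‖ ≤ A * ((∫ x, ‖f x‖ ∂μ) * ∫ x, ‖g x‖ ∂μ))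
    (hB2 : ∀ f g : Lp ℂ 2 μ, ‖B f g‖ ≤ ‖f‖ * ‖g‖)
    {r : ℝ} (hr1 : 1 ≤ r) (hr2 : r ≤ 2) {f g : SimpleFunc α ℂ} (hf : MemLp f 2 μ)
    (hg : MemLp g 2 μ) :
    ‖B hf.toLp hg.toLp‖ ≤ A ^ (2 / r - 1) *
      ((∫ x, ‖f x‖ ^ r ∂μ) ^ (1 / r) * (∫ x, ‖g x‖ ^ r ∂μ) ^ (1 / r)) := by
  have hr0 : 0 < r := by linarith
  -- The exponent has real part `r` on Re ζ = 0, where L¹ norms become ∫|f|^r, and `r/2` on Re ζ =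
  -- 1, where L² norms become (∫|f|^r)^(1/2). It equals 1 at ζ = 2 - 2/r, where the family passes
  -- through `f` and `g` themselves.
  set a : ℂ → ℂ := fun ζ => r * (1 - ζ / 2) with ha
  have hare : ∀ ζ, (a ζ).re = r * (1 - ζ.re / 2) := fun ζ => by simp [ha]
  set h : ℂ → ℂ := fun ζ => B (phaseLp μ f (a ζ)) (phaseLp μ g (a ζ)) with hh
  have had : Differentiable ℂ a := by simp only [ha]; fun_prop
  -- As a finite sum over the values of `f` and `g`, the function is visibly entire and bounded on
  -- the strip.
  have hexp : ∀ ζ, h ζ = ∑ c ∈ f.range, ∑ c' ∈ g.range,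
      phasePow (a ζ) c * (phasePow (a ζ) c' * B (levelLp μ f c) (levelLp μ g c')) := by
    intro ζ
    simp only [hh, phaseLp, map_sum, map_smul, sum_apply, smul_apply, smul_eq_mul,
      Finset.mul_sum]
    rw [Finset.sum_comm]
    exact Finset.sum_congr rfl fun c _ => Finset.sum_congr rfl fun c' _ => by ring
  have hdiff : Differentiable ℂ h := by
    have : h = fun ζ => ∑ c ∈ f.range, ∑ c' ∈ g.range,
      phasePow (a ζ) c * (phasePow (a ζ) c' * B (levelLp μ f c) (levelLp μ g c')) :=
      funext hexp
    rw [this]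
    refine Differentiable.fun_sum fun c _ => Differentiable.fun_sum fun c' _ => ?_
    have h1 : Differentiable ℂ fun ζ => phasePow (a ζ) c := (differentiable_phasePow c).comp had
    have h2 : Differentiable ℂ fun ζ => phasePow (a ζ) c' := (differentiable_phasePow c').comp had
    fun_prop
  set Nf := ∫ x, ‖f x‖ ^ r ∂μ
  set Ng := ∫ x, ‖g x‖ ^ r ∂μ
  have hNf : 0 ≤ Nf := integral_nonneg fun x => by positivity
  have hNg : 0 ≤ Ng := integral_nonneg fun x => by positivity
  have hpow : ∀ ζ ∈ Complex.HadamardThreeLines.verticalClosedStrip 0 1, ∀ c : ℂ,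
      ‖phasePow (a ζ) c‖ ≤ max 1 ‖c‖ ^ r := by
    intro ζ hζ c
    have h1 : 0 ≤ ζ.re := hζ.1
    have h2 : ζ.re ≤ 1 := hζ.2
    rw [norm_phasePow (by rw [hare]; apply mul_pos hr0; linarith), hare]
    calc ‖c‖ ^ (r * (1 - ζ.re / 2)) ≤ max 1 ‖c‖ ^ (r * (1 - ζ.re / 2)) := by
          gcongr
          · apply mul_nonneg hr0.le; linarith
          · exact le_max_right _ _
      _ ≤ max 1 ‖c‖ ^ r := by
          apply Real.rpow_le_rpow_of_exponent_le (le_max_left _ _)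
          nlinarith
  have hbdd : BddAbove ((norm ∘ h) '' Complex.HadamardThreeLines.verticalClosedStrip 0 1) := by
    refine ⟨∑ c ∈ f.range, ∑ c' ∈ g.range,
      max 1 ‖c‖ ^ r * (max 1 ‖c'‖ ^ r * ‖B (levelLp μ f c) (levelLp μ g c')‖), ?_⟩
    rintro _ ⟨ζ, hζ, rfl⟩
    simp only [Function.comp_apply, hexp]
    refine (norm_sum_le _ _).trans (Finset.sum_le_sum fun c _ => ?_)
    refine (norm_sum_le _ _).trans (Finset.sum_le_sum fun c' _ => ?_)
    rw [norm_mul, norm_mul]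
    gcongr
    · exact hpow ζ hζ c
    · exact hpow ζ hζ c'
  -- The interpolation point lies in the strip exactly because 1 ≤ r ≤ 2.
  have hθ : 2 - 2 / r ∈ Set.Icc (0 : ℝ) 1 := by
    constructor
    · rw [sub_nonneg, div_le_iff₀ hr0]; linarith
    · have : 1 ≤ 2 / r := by rw [le_div_iff₀ hr0]; linarith
      linarith
  have key := Complex.HadamardThreeLines.norm_le_interp_of_mem_verticalClosedStrip₀₁' h
    (z := ((2 - 2 / r : ℝ) : ℂ)) (a := A * (Nf * Ng)) (b := (Nf * Ng) ^ (1 / 2 : ℝ))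
    (by simpa [Complex.HadamardThreeLines.verticalClosedStrip] using hθ)
    hdiff.diffContOnCl hbdd
    (by
      intro z hz
      have hz : z.re = 0 := hz
      have hre : (a z).re = r := by rw [hare, hz]; ring
      refine (hB1 _ _ (integrable_phaseLp hf _) (integrable_phaseLp hg _)).trans_eq ?_
      rw [integral_norm_phaseLp hf (by rw [hre]; exact hr0),
        integral_norm_phaseLp hg (by rw [hre]; exact hr0), hre])
    (by
      intro z hz
      have hz : z.re = 1 := hz
      have hre : (a z).re = r / 2 := by rw [hare, hz]; ring
      refine (hB2 _ _).trans_eq ?_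
      rw [norm_phaseLp hf (by rw [hre]; positivity), norm_phaseLp hg (by rw [hre]; positivity), hre,
        mul_div_cancel₀ r two_ne_zero, Real.mul_rpow hNf hNg])
  have hval : h ((2 - 2 / r : ℝ) : ℂ) = B hf.toLp hg.toLp := by
    have : a ((2 - 2 / r : ℝ) : ℂ) = 1 := by
      simp only [ha]
      push_cast
      have : (r : ℂ) ≠ 0 := by exact_mod_cast hr0.ne'
      field_simp
      ring
    simp only [hh, this, phaseLp_one hf, phaseLp_one hg]
  rw [hval] at key
  refine key.trans_eq ?_
  simp only [Complex.ofReal_re]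
  have e1 : 1 - (2 - 2 / r) = 2 / r - 1 := by ring
  rw [e1, Real.mul_rpow hA (by positivity), mul_assoc, ← Real.rpow_mul (by positivity)]
  congr 1
  rw [← Real.mul_rpow hNf hNg]
  -- Exponents cannot be added at base 0. For r = 2 the first power is 0^0 = 1 and the second
  -- vanishes; for r < 2 the first one vanishes.
  rcases (mul_nonneg hNf hNg).eq_or_lt with h0 | h0
  · rw [← h0, Real.zero_rpow (x := 1 / r) (by positivity)]
    by_cases hr : r = 2
    · subst hr; norm_num
    · rw [Real.zero_rpow (x := 2 / r - 1), zero_mul]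
      have : r < 2 := lt_of_le_of_ne hr2 hr
      have : 1 < 2 / r := by rw [lt_div_iff₀ hr0]; linarith
      linarith
  · rw [← Real.rpow_add h0]
    congr 1
    field_simp
    ring

end InteractionMorawetz

end

/-! ### Duality of Lebesgue spaces and averages against bumps -/

noncomputable section
open MeasureTheory Filter Topology
open scoped ContDiff ENNReal SchwartzMap
namespace InteractionMorawetz

section Pairing
variable {α : Type*} [MeasurableSpace α] {μ : Measure α} {q q' : ℝ≥0∞} [Fact (1 ≤ q)]
  [Fact (1 ≤ q')] [q.HolderConjugate q']

variable (μ q q') in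
/-- The bilinear pairing `∫ f g` of `L^q` and `L^q'`. -/
def pairing : Lp ℂ q μ →L[ℂ] Lp ℂ q' μ →L[ℂ] ℂ :=
  (ContinuousLinearMap.mul ℂ ℂ).lpPairing μ q q'

lemma pairing_apply (f : Lp ℂ q μ) (g : Lp ℂ q' μ) : pairing μ q q' f g = ∫ x, f x * g x ∂μ :=
  ContinuousLinearMap.lpPairing_eq_integral _ _ _

lemma norm_pairing_le (f : Lp ℂ q μ) (g : Lp ℂ q' μ) : ‖pairing μ q q' f g‖ ≤ ‖f‖ * ‖g‖ := by
  have h1 := (ContinuousLinearMap.mul ℂ ℂ).norm_holder_apply_apply_le (r := 1) f g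
  have h2 : pairing μ q q' f g = L1.integral ((ContinuousLinearMap.mul ℂ ℂ).holder 1 f g) := by
    rw [pairing_apply, L1.integral_eq_integral]
    exact (integral_congr_ae ((ContinuousLinearMap.mul ℂ ℂ).coeFn_holder f g)).symm
  rw [h2]
  refine (L1.norm_integral_le _).trans (h1.trans ?_)
  have h3 : ‖ContinuousLinearMap.mul ℂ ℂ‖ ≤ 1 := ContinuousLinearMap.opNorm_mul_le ℂ ℂ
  calc _ ≤ 1 * ‖f‖ * ‖g‖ := by gcongr
    _ = _ := by ring

/-- Every `v ∈ L^q`, `1 < q < ∞`, is normed by an element of the dual space. -/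
lemma exists_norming (hq : q ≠ ⊤) (hq' : q' ≠ ⊤) (v : Lp ℂ q μ) :
    ∃ w : Lp ℂ q' μ, ‖w‖ = ‖v‖ ∧ pairing μ q q' v w = ((‖v‖ ^ 2 : ℝ) : ℂ) := by
  by_cases hv : v = 0
  · exact ⟨0, by simp [hv], by simp [hv]⟩
  have hc : q.toReal.HolderConjugate q'.toReal := ENNReal.HolderConjugate.toReal_of_ne_top hq hq'
  set s := q.toReal
  set r := q'.toReal
  have hs : 1 < s := hc.lt
  have hr : 1 < r := hc.symm.lt
  have hsr : (s - 1) * r = s := hc.sub_one_mul_conj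
  have hn : 0 < ‖v‖ := norm_pos_iff.2 hv
  have hq0 : q ≠ 0 := (zero_lt_one.trans_le Fact.out).ne'
  have hq0' : q' ≠ 0 := (zero_lt_one.trans_le Fact.out).ne'
  have hvs : ‖v‖ ^ s = ∫ x, ‖v x‖ ^ s ∂μ := by
    rw [Lp.norm_def, MemLp.eLpNorm_eq_integral_rpow_norm hq0 hq (Lp.memLp v),
      ENNReal.toReal_ofReal (by positivity), ← Real.rpow_mul (by positivity),
      inv_mul_cancel₀ (by linarith), Real.rpow_one]
  -- The classical extremal function conj(v)|v|^{s-2}. The prefactor ‖v‖^{2-s} makes its dual norm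
  -- equal to ‖v‖ and its pairing with `v` equal to ‖v‖².
  set w : α → ℂ := fun x => ((‖v‖ ^ (2 - s) * ‖v x‖ ^ (s - 2) : ℝ) : ℂ) * star (v x) with hw
  have hvm := Lp.aestronglyMeasurable v
  have hwm : AEStronglyMeasurable w μ := by
    apply AEMeasurable.aestronglyMeasurable
    have := hvm.aemeasurable
    have h2 : AEMeasurable (fun x => star (v x)) μ := (continuous_star.measurable).comp_aemeasurable this
    have h3 : AEMeasurable (fun x => ((‖v‖ ^ (2 - s) * ‖v x‖ ^ (s - 2) : ℝ) : ℂ)) μ :=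
      Complex.measurable_ofReal.comp_aemeasurable ((this.norm.pow_const _).const_mul _)
    exact h3.mul h2
  have hwn : ∀ x, ‖w x‖ = ‖v‖ ^ (2 - s) * ‖v x‖ ^ (s - 1) := by
    intro x
    simp only [hw, norm_mul, Complex.norm_real, norm_star, Real.norm_eq_abs]
    rw [abs_of_nonneg (by positivity), abs_of_nonneg (by positivity), mul_assoc]
    congr 1
    rcases (norm_nonneg (v x)).eq_or_lt with h0 | h0
    · rw [← h0, Real.zero_rpow (x := s - 1) (by linarith), mul_zero]
    · rw [← Real.rpow_add_one h0.ne']; congr 1; ring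
  have hwr : ∀ x, ‖w x‖ ^ r = ‖v‖ ^ ((2 - s) * r) * ‖v x‖ ^ s := by
    intro x
    rw [hwn, Real.mul_rpow (by positivity) (by positivity), ← Real.rpow_mul (by positivity),
      ← Real.rpow_mul (by positivity), hsr]
  have hwL : MemLp w q' μ := by
    rw [← integrable_norm_rpow_iff hwm hq0' hq']
    change Integrable (fun x => ‖w x‖ ^ r) μ
    simp only [hwr]
    exact ((Lp.memLp v).integrable_norm_rpow hq0 hq).const_mul _
  refine ⟨hwL.toLp w, ?_, ?_⟩
  · rw [Lp.norm_toLp, MemLp.eLpNorm_eq_integral_rpow_norm hq0' hq' hwL,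
      ENNReal.toReal_ofReal (by positivity)]
    change (∫ x, ‖w x‖ ^ r ∂μ) ^ r⁻¹ = ‖v‖
    simp only [hwr]
    rw [integral_const_mul, ← hvs, ← Real.rpow_add hn, ← Real.rpow_mul hn.le]
    have : ((2 - s) * r + s) * r⁻¹ = 1 := by
      rw [mul_inv_eq_one₀ (by linarith)]; nlinarith
    rw [this, Real.rpow_one]
  · rw [pairing_apply]
    have h1 : ∀ᵐ x ∂μ, v x * (hwL.toLp w : Lp ℂ q' μ) x = ((‖v‖ ^ (2 - s) * ‖v x‖ ^ s : ℝ) : ℂ) := by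
      filter_upwards [hwL.coeFn_toLp] with x hx
      rw [hx]
      have h2 : v x * star (v x) = ((‖v x‖ ^ 2 : ℝ) : ℂ) := by
        rw [Complex.star_def, Complex.mul_conj, Complex.normSq_eq_norm_sq]
      simp only [hw]
      rw [mul_left_comm, h2, ← Complex.ofReal_mul, mul_assoc]
      congr 2
      rcases (norm_nonneg (v x)).eq_or_lt with h0 | h0
      · rw [← h0, Real.zero_rpow (x := s) (by linarith)]; simp
      · rw [← Real.rpow_natCast, ← Real.rpow_add h0]; congr 1; push_cast; ring
    rw [integral_congr_ae h1, integral_complex_ofReal, integral_const_mul, ← hvs, ← Real.rpow_add hn]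
    congr 1
    rw [show 2 - s + s = ((2 : ℕ) : ℝ) by push_cast; ring, Real.rpow_natCast]

/-- The converse of Hölder's inequality: the hypothesis is tested on the norming element of `v`, and
one factor ‖v‖ is cancelled. -/
lemma norm_le_of_pairing_le (hq : q ≠ ⊤) (hq' : q' ≠ ⊤) (v : Lp ℂ q μ) {C : ℝ} (hC : 0 ≤ C)
    (h : ∀ w : Lp ℂ q' μ, ‖pairing μ q q' v w‖ ≤ C * ‖w‖) : ‖v‖ ≤ C := by
  obtain ⟨w, hw, hvw⟩ := exists_norming hq hq' v
  have := h w
  rw [hvw, hw, Complex.norm_real, Real.norm_of_nonneg (by positivity)] at this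
  rcases (norm_nonneg v).eq_or_lt with h0 | h0
  · rwa [← h0]
  · nlinarith

end Pairing

variable {d : ℕ}

/-- A locally integrable function whose averages against probability densities are bounded is
bounded almost everywhere. -/
lemma ae_norm_le_of_integral_le {f : Rd d → ℂ} (hf : LocallyIntegrable f volume) {C : ℝ}
    (h : ∀ η : Rd d → ℝ, ContDiff ℝ ∞ η → HasCompactSupport η → (∀ x, 0 ≤ η x) →
      ∫ x, η x = 1 → ‖∫ x, η x • f x‖ ≤ C) : ∀ᵐ x, ‖f x‖ ≤ C := by
  -- Shrinking bumps with outer radius twice the inner one, as Lebesgue differentiation requires;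
  -- convolution at x is then an admissible average.
  let φ : ℕ → ContDiffBump (0 : Rd d) := fun n =>
    ⟨1 / ((n : ℝ) + 1), 2 / ((n : ℝ) + 1), by positivity, by gcongr; norm_num⟩
  have h1 : Tendsto (fun n => (φ n).rOut) atTop (𝓝 0) := by
    have := (tendsto_one_div_add_atTop_nhds_zero_nat (𝕜 := ℝ)).const_mul 2
    simpa only [φ, mul_one_div, mul_zero] using this
  have h2 : ∀ᶠ n in atTop, (φ n).rOut ≤ 2 * (φ n).rIn :=
    Eventually.of_forall fun n => by simp [φ]; rw [div_eq_mul_inv]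
  filter_upwards [ContDiffBump.ae_convolution_tendsto_right_of_locallyIntegrable h1 h2 hf]
    with x hx
  refine le_of_tendsto hx.norm (Eventually.of_forall fun n => ?_)
  rw [convolution_eq_swap]
  simp only [ContinuousLinearMap.lsmul_apply]
  have hs : HasCompactSupport fun t : Rd d => (φ n).normed volume (x - t) :=
    (φ n).hasCompactSupport_normed.comp_homeomorph (Homeomorph.subLeft x)
  refine h (fun t => (φ n).normed volume (x - t)) ?_ hs
    (fun t => (φ n).nonneg_normed _) ?_
  · exact (φ n).contDiff_normed.comp (contDiff_const.sub contDiff_id)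
  · rw [integral_sub_left_eq_self (fun t => (φ n).normed volume t)]
    exact (φ n).integral_normed

end InteractionMorawetz

end

/-! ### Interpolation for symmetric operators on Schwartz functions -/

noncomputable section
open MeasureTheory Filter Topology
open scoped ContDiff ENNReal SchwartzMap
namespace InteractionMorawetz

variable {d : ℕ}

lemma pairing_toLp {q q' : ℝ≥0∞} [Fact (1 ≤ q)] [Fact (1 ≤ q')] [q.HolderConjugate q']
    (f : 𝓢(Rd d, ℂ)) (g : Lp ℂ q' (volume : Measure (Rd d))) :
    pairing volume q q' (f.toLp q volume) g = ∫ x, f x * g x := by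
  rw [pairing_apply]
  apply integral_congr_ae
  filter_upwards [f.coeFn_toLp q] with x hx
  rw [hx]

lemma pairing_toLp_toLp {q q' : ℝ≥0∞} [Fact (1 ≤ q)] [Fact (1 ≤ q')] [q.HolderConjugate q']
    (f g : 𝓢(Rd d, ℂ)) :
    pairing volume q q' (f.toLp q volume) (g.toLp q' volume) = ∫ x, f x * g x := by
  rw [pairing_toLp]
  apply integral_congr_ae
  filter_upwards [g.coeFn_toLp q'] with x hx
  rw [hx]

lemma pairing_comm {α : Type*} [MeasurableSpace α] {μ : Measure α} {q q' : ℝ≥0∞} [Fact (1 ≤ q)]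
    [Fact (1 ≤ q')] [q.HolderConjugate q'] [q'.HolderConjugate q] (f : Lp ℂ q μ) (g : Lp ℂ q' μ) :
    pairing μ q q' f g = pairing μ q' q g f := by
  simp only [pairing_apply, mul_comm]

lemma integrable_mul_Lp {α : Type*} [MeasurableSpace α] {μ : Measure α} {q q' : ℝ≥0∞}
    [q.HolderConjugate q'] {f g : α → ℂ} (hf : MemLp f q μ) (hg : MemLp g q' μ) :
    Integrable (fun x => f x * g x) μ :=
  memLp_one_iff_integrable.1 (hg.mul hf)

/-- A continuous bilinear estimate on Schwartz functions turns into an a.e. bound. -/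
lemma ae_norm_le_of_schwartz {f : Lp ℂ 2 (volume : Measure (Rd d))} {C : ℝ}
    (h : ∀ g : 𝓢(Rd d, ℂ), ‖∫ x, g x * f x‖ ≤ C * ∫ x, ‖g x‖) : ∀ᵐ x, ‖f x‖ ≤ C := by
  refine ae_norm_le_of_integral_le ((Lp.memLp f).locallyIntegrable (by norm_num)) ?_
  intro η hη hηc hη0 hη1
  have hs : HasCompactSupport fun x => (η x : ℂ) := hηc.comp_left (g := Complex.ofReal) rfl
  have hd : ContDiff ℝ ∞ fun x => (η x : ℂ) := Complex.ofRealCLM.contDiff.comp hη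
  have h1 := h (hs.toSchwartzMap hd)
  have h2 : ∀ x, hs.toSchwartzMap hd x = (η x : ℂ) := fun x => rfl
  simp only [h2, Complex.norm_real, Real.norm_eq_abs, abs_of_nonneg (hη0 _), hη1, mul_one] at h1
  simpa [Complex.real_smul] using h1

lemma continuous_bilin_apply {X Y Z W : Type*} [NormedAddCommGroup X] [NormedSpace ℂ X]
    [NormedAddCommGroup Y] [NormedSpace ℂ Y] [NormedAddCommGroup Z] [NormedSpace ℂ Z]
    [TopologicalSpace W] (B : X →L[ℂ] Y →L[ℂ] Z) {f : W → X} {g : W → Y} (hf : Continuous f)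
    (hg : Continuous g) : Continuous fun w => B (f w) (g w) :=
  (B.continuous.comp hf).clm_apply hg

lemma exists_L2_extension (T : 𝓢(Rd d, ℂ) →ₗ[ℂ] 𝓢(Rd d, ℂ))
    (hT : ∀ f, ‖(T f).toLp 2 volume‖ ≤ ‖f.toLp 2 volume‖) :
    ∃ T2 : Lp ℂ 2 (volume : Measure (Rd d)) →L[ℂ] Lp ℂ 2 (volume : Measure (Rd d)),
      (∀ f : 𝓢(Rd d, ℂ), T2 (f.toLp 2 volume) = (T f).toLp 2 volume) ∧ ∀ v, ‖T2 v‖ ≤ ‖v‖ := by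
  let e : 𝓢(Rd d, ℂ) →ₗ[ℂ] Lp ℂ 2 (volume : Measure (Rd d)) :=
    (SchwartzMap.toLpCLM ℂ ℂ 2 volume).toLinearMap
  have hedense : DenseRange e :=
    SchwartzMap.denseRange_toLpCLM (E := Rd d) (F := ℂ) (p := 2) (by simp)
  have hnorm : ∀ f, ‖(e ∘ₗ T) f‖ ≤ 1 * ‖e f‖ := fun f => by rw [one_mul]; exact hT f
  exact ⟨(e ∘ₗ T).extendOfNorm e, fun f => LinearMap.extendOfNorm_eq hedense ⟨1, hnorm⟩ f,
    fun v => by simpa using LinearMap.norm_extendOfNorm_apply_le hedense 1 hnorm v⟩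

lemma denseRange_toLp (q : ℝ≥0∞) [Fact (1 ≤ q)] (hq : q ≠ ⊤) :
    DenseRange (fun f : 𝓢(Rd d, ℂ) => f.toLp q (volume : Measure (Rd d))) :=
  SchwartzMap.denseRange_toLpCLM (E := Rd d) (F := ℂ) hq

section
variable {q q' : ℝ≥0∞} [Fact (1 ≤ q)] [Fact (1 ≤ q')] [q.HolderConjugate q']

set_option maxHeartbeats 800000 in
/-- Riesz–Thorin interpolation between `L¹ → L^∞` and `L² → L²` for symmetric operators on Schwartz
functions. -/
theorem riesz_thorin_schwartz (hq : q ≠ ⊤) (hq' : q' ≤ 2)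
    (T : 𝓢(Rd d, ℂ) →ₗ[ℂ] 𝓢(Rd d, ℂ)) {A : ℝ} (hA : 0 ≤ A)
    (hT1 : ∀ f x, ‖T f x‖ ≤ A * ∫ y, ‖f y‖)
    (hT2 : ∀ f, ‖(T f).toLp 2 volume‖ ≤ ‖f.toLp 2 volume‖)
    (hT : ∀ f g, ∫ x, T f x * g x = ∫ x, f x * T g x) (f : 𝓢(Rd d, ℂ)) :
    ‖(T f).toLp q volume‖ ≤ A ^ (2 / q'.toReal - 1) * ‖f.toLp q' volume‖ := by
  have hqt' : q' ≠ ⊤ := ne_top_of_le_ne_top (by simp) hq'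
  have hr1 : 1 ≤ q'.toReal := by
    have := ENNReal.toReal_mono hqt' (Fact.out : 1 ≤ q'); simpa using this
  have hr2 : q'.toReal ≤ 2 := by
    have := ENNReal.toReal_mono (by simp) hq'; simpa using this
  have hq0' : q' ≠ 0 := (zero_lt_one.trans_le Fact.out).ne'
  obtain ⟨T2, hT2e, hT2n⟩ := exists_L2_extension T hT2
  -- The symmetry passes by density to the L² extension in its first slot, while the second slot
  -- stays Schwartz.
  have hsym : ∀ (v : Lp ℂ 2 (volume : Measure (Rd d))) (g : 𝓢(Rd d, ℂ)),
      pairing volume 2 2 (T2 v) (g.toLp 2 volume) = pairing volume 2 2 v ((T g).toLp 2 volume) := by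
    intro v g
    refine (denseRange_toLp 2 (by simp)).induction_on (p := fun v => pairing volume 2 2 (T2 v) (g.toLp 2 volume) =
      pairing volume 2 2 v ((T g).toLp 2 volume)) v ?_ ?_
    · exact isClosed_eq
        (continuous_bilin_apply (pairing volume 2 2) T2.continuous continuous_const)
        (continuous_bilin_apply (pairing volume 2 2) continuous_id continuous_const)
    · intro f
      rw [hT2e, pairing_toLp_toLp, pairing_toLp_toLp, hT]
  -- The bound from L¹ to L^∞ for the extension, on L¹ ∩ L². Approximation in both norms is avoided:
  -- the operator is moved onto a Schwartz test function, where the pointwise hypothesis applies.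
  have hbd : ∀ v : Lp ℂ 2 (volume : Measure (Rd d)), Integrable v volume →
      ∀ᵐ x, ‖T2 v x‖ ≤ A * ∫ x, ‖v x‖ := by
    intro v hv
    refine ae_norm_le_of_schwartz fun g => ?_
    rw [← pairing_toLp (q := 2) (q' := 2), pairing_comm, hsym, pairing_comm, pairing_toLp]
    calc _ ≤ ∫ x, ‖T g x * v x‖ := norm_integral_le_integral_norm _
      _ ≤ ∫ x, (A * ∫ y, ‖g y‖) * ‖v x‖ := by
        refine integral_mono_of_nonneg (ae_of_all _ fun x => norm_nonneg _)
          (hv.norm.const_mul _) (ae_of_all _ fun x => ?_)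
        simp only [norm_mul]
        gcongr
        exact hT1 g x
      _ = _ := by rw [integral_const_mul]; ring
  obtain ⟨B, hB⟩ : ∃ B : Lp ℂ 2 (volume : Measure (Rd d)) →L[ℂ] Lp ℂ 2 (volume : Measure (Rd d))
      →L[ℂ] ℂ, ∀ v w, B v w = pairing volume 2 2 (T2 v) w :=
    ⟨(pairing (volume : Measure (Rd d)) 2 2).comp T2, fun v w => rfl⟩
  have hB1 : ∀ f g : Lp ℂ 2 (volume : Measure (Rd d)), Integrable f volume → Integrable g volume →
      ‖B f g‖ ≤ A * ((∫ x, ‖f x‖) * ∫ x, ‖g x‖) := by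
    intro v w hv hw
    have : B v w = ∫ x, T2 v x * w x := by rw [hB, pairing_apply]
    rw [this]
    calc _ ≤ ∫ x, ‖T2 v x * w x‖ := norm_integral_le_integral_norm _
      _ ≤ ∫ x, (A * ∫ y, ‖v y‖) * ‖w x‖ := by
        refine integral_mono_of_nonneg (ae_of_all _ fun x => norm_nonneg _)
          (hw.norm.const_mul _) ?_
        filter_upwards [hbd v hv] with x hx
        simp only [norm_mul]
        gcongr
      _ = _ := by rw [integral_const_mul]; ring
  have hB2 : ∀ f g : Lp ℂ 2 (volume : Measure (Rd d)), ‖B f g‖ ≤ ‖f‖ * ‖g‖ := by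
    intro v w
    rw [hB]
    refine (norm_pairing_le _ _).trans ?_
    gcongr
    exact hT2n v
  have key := fun {f g : SimpleFunc (Rd d) ℂ} (hf : MemLp f 2 volume) (hg : MemLp g 2 volume) =>
    riesz_thorin_simpleFunc B hA hB1 hB2 hr1 hr2 hf hg
  have hnormr : ∀ {v : Rd d → ℂ} (hv : MemLp v q' volume),
      (∫ x, ‖v x‖ ^ q'.toReal) ^ (1 / q'.toReal) = (eLpNorm v q' volume).toReal := by
    intro v hv
    rw [MemLp.eLpNorm_eq_integral_rpow_norm hq0' hqt' hv, ENNReal.toReal_ofReal (by positivity),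
      one_div]
  -- Integrability of a simple function to a finite power only says that its support has finite
  -- measure, so it holds for all finite powers at once.
  have hsimple : ∀ {g : SimpleFunc (Rd d) ℂ} (hg : MemLp g q' volume), MemLp g 2 volume :=
    fun {g} hg => (SimpleFunc.memLp_iff_integrable (by simp) (by simp)).2
      ((SimpleFunc.memLp_iff_integrable hq0' hqt').1 hg)
  -- approximation of the first argument, simultaneously in `L²` and `L^q'`
  have bound_simpleFunc : ∀ {g : SimpleFunc (Rd d) ℂ} (hg : MemLp g 2 volume) (hg' : MemLp g q' volume),
      ‖B (f.toLp 2 volume) hg.toLp‖ ≤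
        A ^ (2 / q'.toReal - 1) * (‖f.toLp q' volume‖ * (eLpNorm g q' volume).toReal) := by
    intro g hg hg'
    have fm : Measurable f := f.continuous.measurable
    set s := fun n => SimpleFunc.approxOn f fm (Set.range f ∪ {0}) 0 (by simp) n
    have hs2 : ∀ n, MemLp (s n) 2 volume := fun n =>
      SimpleFunc.memLp_approxOn_range fm (f.memLp 2) n
    have hsr : ∀ n, MemLp (s n) q' volume := fun n =>
      SimpleFunc.memLp_approxOn_range fm (f.memLp q') n
    have t2 : Tendsto (fun n => (hs2 n).toLp) atTop (𝓝 (f.toLp 2 volume)) :=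
      SimpleFunc.tendsto_approxOn_range_Lp (by simp) fm (f.memLp 2)
    have tr : Tendsto (fun n => (hsr n).toLp) atTop (𝓝 (f.toLp q' volume)) :=
      SimpleFunc.tendsto_approxOn_range_Lp hqt' fm (f.memLp q')
    have l1 : Tendsto (fun n => ‖B (hs2 n).toLp hg.toLp‖) atTop (𝓝 ‖B (f.toLp 2 volume) hg.toLp‖) := by
      exact ((continuous_bilin_apply B continuous_id continuous_const).norm.tendsto _).comp t2
    have l2 : Tendsto (fun n => A ^ (2 / q'.toReal - 1) *
        (‖(hsr n).toLp‖ * (eLpNorm g q' volume).toReal)) atTop (𝓝 (A ^ (2 / q'.toReal - 1) *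
        (‖f.toLp q' volume‖ * (eLpNorm g q' volume).toReal))) :=
      (tr.norm.mul_const _).const_mul _
    refine le_of_tendsto_of_tendsto' l1 l2 fun n => ?_
    rw [Lp.norm_toLp, ← hnormr (hsr n), ← hnormr hg']
    exact key (hs2 n) hg
  -- By duality it suffices to pair with simple functions, which are dense; there the pairing is `B`
  -- and the interpolated bound applies.
  refine norm_le_of_pairing_le (q' := q') hq hqt' _ (by positivity) fun w => ?_
  refine (Lp.simpleFunc.denseRange (E := ℂ) (μ := (volume : Measure (Rd d))) hqt').induction_on
    (p := fun w => ‖pairing volume q q' ((T f).toLp q volume) w‖ ≤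
      A ^ (2 / q'.toReal - 1) * ‖f.toLp q' volume‖ * ‖w‖) w ?_ ?_
  · exact isClosed_le
      (continuous_bilin_apply (pairing volume q q') continuous_const continuous_id).norm
      (continuous_const.mul continuous_norm)
  · intro w
    set g := Lp.simpleFunc.toSimpleFunc w
    have hg' : MemLp g q' volume := Lp.simpleFunc.memLp w
    have hg : MemLp g 2 volume := hsimple hg'
    have e1 : pairing volume q q' ((T f).toLp q volume) w = B (f.toLp 2 volume) hg.toLp := by
      have : B (f.toLp 2 volume) hg.toLp = pairing volume 2 2 ((T f).toLp 2 volume) hg.toLp := by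
        rw [hB, hT2e]
      rw [this, pairing_toLp, pairing_toLp]
      apply integral_congr_ae
      filter_upwards [hg.coeFn_toLp, Lp.simpleFunc.toSimpleFunc_eq_toFun w] with x h1 h2
      rw [h1, ← h2]
    have e2 : ‖(w : Lp ℂ q' (volume : Measure (Rd d)))‖ = (eLpNorm g q' volume).toReal := by
      rw [Lp.norm_def, eLpNorm_congr_ae (Lp.simpleFunc.toSimpleFunc_eq_toFun w)]
    rw [e1, e2, mul_assoc]
    exact bound_simpleFunc hg hg'

end
end InteractionMorawetz

end

/-! ### The free Schrödinger group and its dispersive estimate -/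

noncomputable section
open MeasureTheory Filter Topology
open scoped ContDiff ENNReal SchwartzMap FourierTransform RealInnerProductSpace Laplacian
namespace InteractionMorawetz

variable {d : ℕ}

lemma iteratedDeriv_cexp_mul_I (c : ℂ) (n : ℕ) :
    iteratedDeriv n (fun y : ℝ => Complex.exp (c * y)) = fun y : ℝ => c ^ n * Complex.exp (c * y) := by
  induction n with
  | zero => simp
  | succ n ih =>
    rw [iteratedDeriv_succ, ih]
    funext y
    have h : HasDerivAt (fun y : ℝ => c * (y : ℂ)) c y := by
      simpa using (Complex.ofRealCLM.hasDerivAt (x := y)).const_mul c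
    rw [((h.cexp).const_mul (c ^ n)).deriv]
    ring

lemma hasTemperateGrowth_cexp_I :
    Function.HasTemperateGrowth (fun y : ℝ => Complex.exp (-Complex.I * y)) := by
  refine ⟨Complex.contDiff_exp.comp (contDiff_const.mul Complex.ofRealCLM.contDiff),
    fun n => ⟨0, 1, fun y => ?_⟩⟩
  rw [norm_iteratedFDeriv_eq_norm_iteratedDeriv, iteratedDeriv_cexp_mul_I]
  simp [Complex.norm_exp]

/-- The symbol `e^{-4π² i t |ξ|²}` of the free Schrödinger group. -/
def schrodingerSymbol (t : ℝ) (ξ : Rd d) : ℂ :=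
  Complex.exp (-Complex.I * ((4 * Real.pi ^ 2 * t * ‖ξ‖ ^ 2 : ℝ) : ℂ))

lemma hasTemperateGrowth_schrodingerSymbol (t : ℝ) :
    (schrodingerSymbol t : Rd d → ℂ).HasTemperateGrowth := by
  have h1 : Function.HasTemperateGrowth (fun ξ : Rd d => 4 * Real.pi ^ 2 * t * ‖ξ‖ ^ 2) := by
    fun_prop
  exact hasTemperateGrowth_cexp_I.comp h1

lemma norm_cexp_neg_I_mul (y : ℝ) : ‖Complex.exp (-Complex.I * y)‖ = 1 := by
  simp [Complex.norm_exp]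

lemma norm_schrodingerSymbol (t : ℝ) (ξ : Rd d) : ‖schrodingerSymbol t ξ‖ = 1 :=
  norm_cexp_neg_I_mul _

lemma schrodingerSymbol_add (s t : ℝ) :
    (schrodingerSymbol (s + t) : Rd d → ℂ) = schrodingerSymbol s * schrodingerSymbol t := by
  funext ξ
  simp only [schrodingerSymbol, Pi.mul_apply, ← Complex.exp_add]
  congr 1
  push_cast
  ring

/-- The free Schrödinger group `e^{itΔ}` on Schwartz functions. -/
def schrodinger (t : ℝ) : 𝓢(Rd d, ℂ) →L[ℂ] 𝓢(Rd d, ℂ) :=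
  SchwartzMap.fourierMultiplierCLM ℂ (schrodingerSymbol t)

lemma schrodinger_apply (t : ℝ) (f : 𝓢(Rd d, ℂ)) :
    schrodinger t f = 𝓕⁻ (SchwartzMap.smulLeftCLM ℂ (schrodingerSymbol t) (𝓕 f)) := rfl

lemma fourier_schrodinger (t : ℝ) (f : 𝓢(Rd d, ℂ)) (ξ : Rd d) :
    𝓕 (schrodinger t f) ξ = schrodingerSymbol t ξ * 𝓕 f ξ := by
  rw [schrodinger_apply, FourierTransform.fourier_fourierInv_eq,
    SchwartzMap.smulLeftCLM_apply_apply (hasTemperateGrowth_schrodingerSymbol t), smul_eq_mul]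

lemma schwartz_ext_fourier {f g : 𝓢(Rd d, ℂ)} (h : ∀ ξ, 𝓕 f ξ = 𝓕 g ξ) : f = g := by
  have : 𝓕 f = 𝓕 g := SchwartzMap.ext h
  have h2 := congrArg (fun h : 𝓢(Rd d, ℂ) => (𝓕⁻ h : 𝓢(Rd d, ℂ))) this
  simpa using h2

lemma schrodinger_add (s t : ℝ) (f : 𝓢(Rd d, ℂ)) :
    schrodinger (s + t) f = schrodinger s (schrodinger t f) := by
  apply schwartz_ext_fourier
  intro ξ
  rw [fourier_schrodinger, fourier_schrodinger, fourier_schrodinger, schrodingerSymbol_add,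
    Pi.mul_apply, mul_assoc]

lemma schrodinger_zero (f : 𝓢(Rd d, ℂ)) : schrodinger 0 f = f := by
  apply schwartz_ext_fourier
  intro ξ
  simp [fourier_schrodinger, schrodingerSymbol]

/-- Plancherel. All L² estimates for the group and for translations below reduce through this to
inequalities between scalar multipliers. -/
lemma norm_toLp_two_le_of_fourier {f g : 𝓢(Rd d, ℂ)} (h : ∀ ξ, ‖𝓕 f ξ‖ ≤ ‖𝓕 g ξ‖) :
    ‖f.toLp 2 volume‖ ≤ ‖g.toLp 2 volume‖ := by
  rw [← SchwartzMap.norm_fourier_toL2_eq f, ← SchwartzMap.norm_fourier_toL2_eq g,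
    SchwartzMap.norm_toLp, SchwartzMap.norm_toLp]
  exact ENNReal.toReal_mono ((𝓕 g).eLpNorm_lt_top 2 volume).ne (eLpNorm_mono h)

lemma norm_schrodinger (t : ℝ) (f : 𝓢(Rd d, ℂ)) :
    ‖(schrodinger t f).toLp 2 volume‖ = ‖f.toLp 2 volume‖ := by
  refine le_antisymm (norm_toLp_two_le_of_fourier fun ξ => ?_)
    (norm_toLp_two_le_of_fourier fun ξ => ?_) <;>
  rw [fourier_schrodinger, norm_mul, norm_schrodingerSymbol, one_mul]

/-- The symbol is even, so the group is symmetric for the bilinear pairing without conjugation,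
which is the form the interpolation theorem asks for. -/
lemma integral_schrodinger_mul (t : ℝ) (f g : 𝓢(Rd d, ℂ)) :
    ∫ x, schrodinger t f x * g x = ∫ x, f x * schrodinger t g x := by
  rw [schrodinger_apply, schrodinger_apply, SchwartzMap.integral_fourierInv_mul_eq,
    ← SchwartzMap.integral_fourierInv_mul_eq f,
    ← integral_neg_eq_self (fun x => 𝓕⁻ f x *
      SchwartzMap.smulLeftCLM ℂ (schrodingerSymbol t) (𝓕 g) x)]
  apply integral_congr_ae
  refine ae_of_all _ fun ξ => ?_
  simp only [SchwartzMap.smulLeftCLM_apply_apply (hasTemperateGrowth_schrodingerSymbol t)]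
  have e1 : 𝓕⁻ f (-ξ) = 𝓕 f ξ := by
    rw [SchwartzMap.fourierInv_coe, SchwartzMap.fourier_coe, Real.fourierInv_eq_fourier_neg, neg_neg]
  have e2 : 𝓕 g (-ξ) = 𝓕⁻ g ξ := by
    rw [SchwartzMap.fourierInv_coe, SchwartzMap.fourier_coe, Real.fourierInv_eq_fourier_neg]
  rw [e1, e2]
  simp only [schrodingerSymbol, norm_neg, smul_eq_mul]
  ring

/-- The inverse Fourier transform damped by a complex Gaussian is bounded by the `L¹` norm. -/
lemma norm_integral_gaussian_mul_fourier_le {b : ℂ} (hb : 0 < b.re) (f : 𝓢(Rd d, ℂ)) (x : Rd d) :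
    ‖∫ ξ, 𝓕 f ξ * Complex.exp (-b * ‖ξ‖ ^ 2 + 2 * Real.pi * Complex.I * ⟪x, ξ⟫)‖ ≤
      (Real.pi / ‖b‖) ^ (d / 2 : ℝ) * ∫ y, ‖f y‖ := by
  set h : Rd d → ℂ := fun ξ => Complex.exp (-b * ‖ξ‖ ^ 2 + 2 * Real.pi * Complex.I * ⟪x, ξ⟫) with hh
  have hint : Integrable h := by
    have := GaussianFourier.integrable_cexp_neg_mul_sq_norm_add hb (2 * Real.pi * Complex.I) x
    simpa [hh] using this
  -- The Fourier transform is moved onto the Gaussian, whose transform is explicit and of modulus at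
  -- most (π/|b|)^{d/2}.
  have h1 : ∫ ξ, 𝓕 f ξ * h ξ = ∫ y, f y * 𝓕 h y := by
    have := VectorFourier.integral_fourierIntegral_smul_eq_flip (V := Rd d) (W := Rd d)
      (μ := volume) (ν := volume) (L := innerₗ (Rd d)) (e := Real.fourierChar)
      Real.continuous_fourierChar continuous_inner f.integrable hint
    simp only [smul_eq_mul] at this
    rw [flip_innerₗ] at this
    exact this
  rw [h1, ← integral_const_mul]
  refine (norm_integral_le_integral_norm _).trans
    (integral_mono_of_nonneg (ae_of_all _ fun _ => norm_nonneg _) (f.integrable.norm.const_mul _)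
      (ae_of_all _ fun y => ?_))
  have hb0 : b ≠ 0 := by rintro rfl; simp at hb
  simp only [hh]
  rw [fourier_gaussian_innerProductSpace' hb, norm_mul, norm_mul, mul_comm]
  gcongr
  have e1 : (Module.finrank ℝ (Rd d) / 2 : ℂ) = ((d / 2 : ℝ) : ℂ) := by simp
  rw [e1, Complex.norm_cpow_real, norm_div, Complex.norm_real, Real.norm_of_nonneg Real.pi_pos.le]
  refine mul_le_of_le_one_right (by positivity) ?_
  rw [Complex.norm_exp, Real.exp_le_one_iff]
  have e2 : -(Real.pi : ℂ) ^ 2 * (‖x - y‖ : ℂ) ^ 2 / b =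
      ((-(Real.pi ^ 2 * ‖x - y‖ ^ 2) : ℝ) : ℂ) * b⁻¹ := by
    push_cast; rw [div_eq_mul_inv]; ring
  rw [e2, Complex.re_ofReal_mul, Complex.inv_re]
  have : 0 ≤ b.re / Complex.normSq b := div_nonneg hb.le (Complex.normSq_nonneg _)
  nlinarith [mul_nonneg (mul_nonneg (sq_nonneg Real.pi) (sq_nonneg ‖x - y‖)) this]

/-- The dispersive estimate for the free Schrödinger group. -/
lemma norm_schrodinger_le {t : ℝ} (ht : t ≠ 0) (f : 𝓢(Rd d, ℂ)) (x : Rd d) :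
    ‖schrodinger t f x‖ ≤ (4 * Real.pi * |t|) ^ (-(d / 2) : ℝ) * ∫ y, ‖f y‖ := by
  -- The oscillating symbol is a Gaussian with purely imaginary parameter. A real part ε > 0 is
  -- added, and removed again by dominated convergence.
  set F : ℝ → Rd d → ℂ := fun ε ξ => 𝓕 f ξ *
    Complex.exp (-((ε : ℂ) + ((4 * Real.pi ^ 2 * t : ℝ) : ℂ) * Complex.I) * ‖ξ‖ ^ 2 +
      2 * Real.pi * Complex.I * ⟪x, ξ⟫) with hF
  have hlim : Tendsto (fun ε => ∫ ξ, F ε ξ) (𝓝[>] 0) (𝓝 (∫ ξ, F 0 ξ)) := by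
    refine tendsto_integral_filter_of_dominated_convergence (fun ξ => ‖𝓕 f ξ‖) ?_ ?_
      (𝓕 f).integrable.norm ?_
    · refine Eventually.of_forall fun ε => Continuous.aestronglyMeasurable ?_
      have := (𝓕 f).continuous
      simp only [hF]
      fun_prop
    · filter_upwards [self_mem_nhdsWithin] with ε hε
      refine ae_of_all _ fun ξ => ?_
      simp only [hF, norm_mul]
      refine mul_le_of_le_one_right (norm_nonneg _) ?_
      rw [Complex.norm_exp, Real.exp_le_one_iff]
      have : (0 : ℝ) < ε := hε
      have h2 : (((‖ξ‖ : ℝ) : ℂ) ^ 2) = ((‖ξ‖ ^ 2 : ℝ) : ℂ) := by push_cast; rfl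
      rw [h2]
      simp only [Complex.add_re, Complex.mul_re, Complex.neg_re, Complex.ofReal_re, Complex.I_re,
        Complex.ofReal_im, Complex.I_im, Complex.neg_im, Complex.add_im, Complex.mul_im,
        Complex.re_ofNat, Complex.im_ofNat]
      nlinarith [sq_nonneg ‖ξ‖]
    · refine ae_of_all _ fun ξ => ?_
      have : Continuous fun ε => F ε ξ := by simp only [hF]; fun_prop
      exact (this.tendsto 0).mono_left nhdsWithin_le_nhds
  have hval : ∫ ξ, F 0 ξ = schrodinger t f x := by
    rw [schrodinger_apply, SchwartzMap.fourierInv_coe, Real.fourierInv_eq']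
    apply integral_congr_ae
    refine ae_of_all _ fun ξ => ?_
    simp only [hF, SchwartzMap.smulLeftCLM_apply_apply (hasTemperateGrowth_schrodingerSymbol t),
      schrodingerSymbol, smul_eq_mul]
    rw [mul_comm (Complex.exp (-Complex.I * _)), mul_left_comm, ← Complex.exp_add]
    congr 2
    rw [real_inner_comm]
    push_cast
    ring
  rw [← hval]
  refine le_of_tendsto hlim.norm ?_
  filter_upwards [self_mem_nhdsWithin] with ε hε
  have hε : (0 : ℝ) < ε := hε
  set b : ℂ := (ε : ℂ) + ((4 * Real.pi ^ 2 * t : ℝ) : ℂ) * Complex.I with hb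
  have hbre : b.re = ε := by
    rw [hb, Complex.add_re, Complex.re_ofReal_mul, Complex.ofReal_re, Complex.I_re, mul_zero,
      add_zero]
  have hbim : b.im = 4 * Real.pi ^ 2 * t := by
    rw [hb, Complex.add_im, Complex.im_ofReal_mul, Complex.ofReal_im, Complex.I_im, mul_one,
      zero_add]
  refine (norm_integral_gaussian_mul_fourier_le (by rw [hbre]; exact hε) f x).trans ?_
  -- The imaginary part alone bounds |b| from below, so that π/|b| ≤ 1/(4π|t|) uniformly in ε.
  have hbn : 4 * Real.pi ^ 2 * |t| ≤ ‖b‖ := by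
    have := Complex.abs_im_le_norm b
    rwa [hbim, abs_mul, abs_of_nonneg (by positivity)] at this
  have ht' : 0 < |t| := abs_pos.2 ht
  have hpos : 0 < ‖b‖ := lt_of_lt_of_le (by positivity) hbn
  refine mul_le_mul_of_nonneg_right ?_ (integral_nonneg (f := fun y => ‖f y‖) fun _ => norm_nonneg _)
  rw [Real.rpow_neg (by positivity), ← Real.inv_rpow (by positivity)]
  gcongr
  rw [div_le_iff₀ hpos, ← div_eq_inv_mul, le_div_iff₀ (by positivity)]
  nlinarith [hbn]

/-- The `L^q'`–`L^q` dispersive estimate. -/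
lemma norm_schrodinger_toLp_le {q q' : ℝ≥0∞} [Fact (1 ≤ q)] [Fact (1 ≤ q')] [q.HolderConjugate q']
    (hq : q ≠ ⊤) (hq' : q' ≤ 2) {t : ℝ} (ht : t ≠ 0) (f : 𝓢(Rd d, ℂ)) :
    ‖(schrodinger t f).toLp q volume‖ ≤
      ((4 * Real.pi * |t|) ^ (-(d / 2) : ℝ)) ^ (2 / q'.toReal - 1) * ‖f.toLp q' volume‖ :=
  riesz_thorin_schwartz hq hq' (schrodinger t).toLinearMap (by positivity)
    (norm_schrodinger_le ht) (fun f => (norm_schrodinger t f).le) (integral_schrodinger_mul t) f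

/-- A second order Taylor remainder valid for all y: for |y| ≤ 1 by the power series, for |y| ≥ 1 by
2 + |y| ≤ 3y². -/
lemma norm_cexp_sub_le (y : ℝ) : ‖Complex.exp (-Complex.I * y) - 1 + Complex.I * y‖ ≤ 3 * y ^ 2 := by
  have hn : ‖-Complex.I * (y : ℂ)‖ = |y| := by simp
  rcases le_total |y| 1 with h | h
  · have := Complex.norm_exp_sub_one_sub_id_le (x := -Complex.I * y) (by rw [hn]; exact h)
    rw [hn, sq_abs] at this
    have e : Complex.exp (-Complex.I * y) - 1 + Complex.I * y =
      Complex.exp (-Complex.I * y) - 1 - -Complex.I * y := by ring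
    rw [e]
    nlinarith [sq_nonneg y]
  · have h1 : ‖Complex.exp (-Complex.I * y)‖ = 1 := by simp [Complex.norm_exp]
    have h2 : ‖Complex.I * (y : ℂ)‖ = |y| := by simp
    calc _ ≤ ‖Complex.exp (-Complex.I * y)‖ + ‖(1 : ℂ)‖ + ‖Complex.I * (y : ℂ)‖ :=
          (norm_add_le _ _).trans (by gcongr; exact norm_sub_le _ _)
      _ ≤ 3 * y ^ 2 := by
          rw [h1, h2, norm_one, ← sq_abs]; nlinarith

lemma fourier_laplacian (f : 𝓢(Rd d, ℂ)) (ξ : Rd d) :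
    𝓕 (Δ f) ξ = -(4 * Real.pi ^ 2 * ‖ξ‖ ^ 2 : ℝ) * 𝓕 f ξ := by
  rw [SchwartzMap.laplacian_eq_fourierMultiplierCLM, SchwartzMap.fourierMultiplierCLM_apply]
  have h : Function.HasTemperateGrowth (fun ξ : Rd d => ‖ξ‖ ^ 2) :=
    Function.hasTemperateGrowth_norm_sq (Rd d)
  rw [FourierTransform.fourier_smul, FourierTransform.fourier_fourierInv_eq]
  rw [smul_apply, SchwartzMap.smulLeftCLM_apply_apply h]
  simp only [Complex.real_smul]
  push_cast
  ring

/-- On the Fourier side this is `norm_cexp_sub_le` at y = 4π²τ|ξ|², whose square is the symbol of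
τ²Δ². It makes the orbit of a Schwartz function differentiable in L². -/
lemma norm_schrodinger_sub_le (τ : ℝ) (f : 𝓢(Rd d, ℂ)) :
    ‖(schrodinger τ f).toLp 2 volume - f.toLp 2 volume - τ • (Complex.I • (Δ f).toLp 2 volume)‖ ≤
      3 * τ ^ 2 * ‖(Δ (Δ f)).toLp 2 volume‖ := by
  have e1 : (schrodinger τ f).toLp 2 volume - f.toLp 2 volume - τ • (Complex.I • (Δ f).toLp 2 volume)
      = (schrodinger τ f - f - ((τ : ℂ) * Complex.I) • Δ f).toLp 2 volume := by
    change _ = SchwartzMap.toLpCLM ℂ ℂ 2 volume _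
    rw [map_sub, map_sub, map_smul, mul_smul]
    rfl
  have e2 : ((3 * τ ^ 2 : ℝ) : ℂ) • (Δ (Δ f)).toLp 2 volume =
      (((3 * τ ^ 2 : ℝ) : ℂ) • (Δ (Δ f))).toLp 2 volume := by
    change _ = SchwartzMap.toLpCLM ℂ ℂ 2 volume _
    rw [map_smul]; rfl
  have e3 : 3 * τ ^ 2 * ‖(Δ (Δ f)).toLp 2 volume‖ =
      ‖((3 * τ ^ 2 : ℝ) : ℂ) • (Δ (Δ f)).toLp 2 volume‖ := by
    rw [norm_smul, Complex.norm_real, Real.norm_of_nonneg (by positivity)]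
  rw [e1, e3, e2]
  refine norm_toLp_two_le_of_fourier fun ξ => ?_
  have e0 : 𝓕 (schrodinger τ f - f - ((τ : ℂ) * Complex.I) • Δ f) =
      𝓕 (schrodinger τ f) - 𝓕 f - ((τ : ℂ) * Complex.I) • 𝓕 (Δ f) := by
    change FourierTransform.fourierCLM ℂ 𝓢(Rd d, ℂ) _ = _
    rw [map_sub, map_sub, map_smul]
    rfl
  rw [e0, FourierTransform.fourier_smul]
  simp only [sub_apply, smul_apply, fourier_laplacian, fourier_schrodinger,
    schrodingerSymbol, smul_eq_mul]
  set l := 4 * Real.pi ^ 2 * ‖ξ‖ ^ 2 with hl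
  have e4 : 4 * Real.pi ^ 2 * τ * ‖ξ‖ ^ 2 = τ * l := by rw [hl]; ring
  rw [e4]
  have h := norm_cexp_sub_le (τ * l)
  have e5 : Complex.exp (-Complex.I * ((τ * l : ℝ) : ℂ)) * 𝓕 f ξ - 𝓕 f ξ -
      (τ : ℂ) * Complex.I * (-(l : ℂ) * 𝓕 f ξ) =
      (Complex.exp (-Complex.I * ((τ * l : ℝ) : ℂ)) - 1 + Complex.I * ((τ * l : ℝ) : ℂ)) * 𝓕 f ξ := by
    push_cast; ring
  have e6 : ((3 * τ ^ 2 : ℝ) : ℂ) * (-(l : ℂ) * (-(l : ℂ) * 𝓕 f ξ)) =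
      ((3 * (τ * l) ^ 2 : ℝ) : ℂ) * 𝓕 f ξ := by push_cast; ring
  rw [e5, e6, norm_mul, norm_mul, Complex.norm_real, Real.norm_of_nonneg (by positivity)]
  gcongr

lemma hasDerivAt_schrodinger (t : ℝ) (f : 𝓢(Rd d, ℂ)) :
    HasDerivAt (fun s => (schrodinger s f).toLp 2 volume)
      (Complex.I • (Δ (schrodinger t f)).toLp 2 volume) t := by
  rw [hasDerivAt_iff_isLittleO_nhds_zero]
  have h : ∀ τ : ℝ, ‖(schrodinger (t + τ) f).toLp 2 volume - (schrodinger t f).toLp 2 volume -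
      τ • (Complex.I • (Δ (schrodinger t f)).toLp 2 volume)‖ ≤
      3 * ‖(Δ (Δ (schrodinger t f))).toLp 2 volume‖ * ‖τ ^ 2‖ := by
    intro τ
    rw [add_comm t τ, schrodinger_add]
    refine (norm_schrodinger_sub_le τ _).trans_eq ?_
    rw [Real.norm_of_nonneg (sq_nonneg τ)]; ring
  refine (Asymptotics.IsBigO.of_bound _ (Eventually.of_forall h)).trans_isLittleO ?_
  simpa using Asymptotics.isLittleO_pow_id (𝕜 := ℝ) (n := 2) (by norm_num)

end InteractionMorawetz

end

/-! ### Compactly supported approximation in H¹ and L^q -/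

noncomputable section
open MeasureTheory Filter Topology
open scoped ContDiff ENNReal SchwartzMap FourierTransform RealInnerProductSpace Laplacian LineDeriv
namespace InteractionMorawetz

variable {d : ℕ}

/-- The complex Lebesgue spaces on `ℝ^d`. -/
abbrev LL (d : ℕ) (q : ℝ≥0∞) : Type := Lp ℂ q (volume : Measure (Rd d))

/-- The ambient Hilbert space of `H¹(ℝ^d)`. -/
abbrev H1Ambient (d : ℕ) : Type := WithLp 2 (LL d 2 × PiLp 2 (fun _ : Fin d => LL d 2))

/-- Triples of a function, a candidate for its gradient, and the same function seen in `L^q`. -/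
abbrev XS (d : ℕ) (q : ℝ≥0∞) : Type := LL d 2 × (Fin d → LL d 2) × LL d q

/-- The `k`-th unit vector. -/
abbrev unitVec (k : Fin d) : Rd d := EuclideanSpace.single k (1 : ℝ)

/-- A Schwartz function as an element of `XS d q`. -/
def toXS (q : ℝ≥0∞) [Fact (1 ≤ q)] : 𝓢(Rd d, ℂ) →L[ℂ] XS d q :=
  (SchwartzMap.toLpCLM ℂ ℂ 2 volume).prod
    ((ContinuousLinearMap.pi fun k =>
      (SchwartzMap.toLpCLM ℂ ℂ 2 volume).comp
        (LineDeriv.lineDerivOpCLM ℂ 𝓢(Rd d, ℂ) (unitVec k))).prod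
    (SchwartzMap.toLpCLM ℂ ℂ q volume))

variable {q : ℝ≥0∞} [Fact (1 ≤ q)]

lemma toXS_fst (f : 𝓢(Rd d, ℂ)) : (toXS q f).1 = f.toLp 2 volume := rfl
lemma toXS_grad (f : 𝓢(Rd d, ℂ)) (k : Fin d) :
    (toXS q f).2.1 k = (∂_{unitVec k} f : 𝓢(Rd d, ℂ)).toLp 2 volume := rfl
lemma toXS_snd (f : 𝓢(Rd d, ℂ)) : (toXS q f).2.2 = f.toLp q volume := rfl

lemma norm_toLp_le_of_norm_le {r : ℝ≥0∞} {f g : 𝓢(Rd d, ℂ)} {c : ℝ} (hc : 0 ≤ c)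
    (h : ∀ x, ‖f x‖ ≤ c * ‖g x‖) : ‖f.toLp r volume‖ ≤ c * ‖g.toLp r volume‖ := by
  rw [SchwartzMap.norm_toLp, SchwartzMap.norm_toLp]
  have := eLpNorm_le_mul_eLpNorm_of_ae_le_mul (ae_of_all volume h) r
  have h2 := ENNReal.toReal_mono (ENNReal.mul_ne_top ENNReal.ofReal_ne_top
    (g.eLpNorm_lt_top r volume).ne) this
  rwa [ENNReal.toReal_mul, ENNReal.toReal_ofReal hc] at h2

/-- Dilated bumps b(x/(n+1)). The error 1 - χ is bounded by a quadratic weight with a small factor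
instead of by an indicator; Schwartz functions absorb the weight, so the same bound serves all L^r
norms. -/
lemma exists_cutoff : ∃ (χ : ℕ → Rd d → ℝ) (C : ℝ), 0 ≤ C ∧ (∀ n, ContDiff ℝ ∞ (χ n)) ∧
    (∀ n, HasCompactSupport (χ n)) ∧ (∀ n x, 0 ≤ χ n x ∧ χ n x ≤ 1) ∧
    (∀ n x, |1 - χ n x| ≤ (1 / (n + 1 : ℝ)) * ‖x‖ ^ 2) ∧
    ∀ n x, ‖fderiv ℝ (χ n) x‖ ≤ (1 / (n + 1 : ℝ)) * C := by
  let b : ContDiffBump (0 : Rd d) := ⟨1, 2, one_pos, one_lt_two⟩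
  obtain ⟨C, hC⟩ := (b.hasCompactSupport.fderiv (𝕜 := ℝ)).exists_bound_of_continuous
    (b.contDiff.continuous_fderiv (n := ∞) (by simp))
  have hC0 : 0 ≤ C := (norm_nonneg _).trans (hC 0)
  have hpos : ∀ n : ℕ, 0 < (1 / (n + 1 : ℝ)) := fun n => by positivity
  refine ⟨fun n x => b ((1 / (n + 1 : ℝ)) • x), C, hC0, fun n => ?_, fun n => ?_, fun n x =>
    ⟨b.nonneg, b.le_one⟩, fun n x => ?_, fun n x => ?_⟩
  · exact b.contDiff.comp (contDiff_const_smul _)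
  · exact b.hasCompactSupport.comp_smul (hpos n).ne'
  · beta_reduce
    rcases le_or_gt ‖(1 / (n + 1 : ℝ)) • x‖ 1 with h | h
    · have : b ((1 / (n + 1 : ℝ)) • x) = 1 :=
        b.one_of_mem_closedBall (by simpa [Metric.mem_closedBall, b] using h)
      rw [this]; simp only [sub_self, abs_zero]; positivity
    -- Outside the ball |x| ≤ n+1 the right-hand side is at least |x|, hence at least 1.
    · rw [norm_smul, Real.norm_of_nonneg (hpos n).le] at h
      have h1 : |1 - b ((1 / (n + 1 : ℝ)) • x)| ≤ 1 := by
        rw [abs_le]; constructor <;> linarith [b.nonneg (x := (1 / (n + 1 : ℝ)) • x), b.le_one (x := (1 / (n + 1 : ℝ)) • x)]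
      have h2 : (1 / (n + 1 : ℝ)) ≤ 1 := by
        rw [div_le_one (by positivity)]; linarith [(Nat.cast_nonneg n : (0 : ℝ) ≤ n)]
      have h3 : 1 ≤ ‖x‖ := by nlinarith [norm_nonneg x]
      nlinarith
  · have hd : fderiv ℝ (fun x => b ((1 / (n + 1 : ℝ)) • x)) x =
        (1 / (n + 1 : ℝ)) • fderiv ℝ b ((1 / (n + 1 : ℝ)) • x) := by
      exact fderiv_comp_smul _
    rw [hd, norm_smul, Real.norm_of_nonneg (hpos n).le]
    exact mul_le_mul_of_nonneg_left (hC _) (hpos n).le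

lemma hasTemperateGrowth_ofReal_of_compact {η : Rd d → ℝ} (h : ContDiff ℝ ∞ η)
    (hc : HasCompactSupport η) : Function.HasTemperateGrowth (fun x => (η x : ℂ)) :=
  (hc.comp_left (g := Complex.ofReal) rfl).hasTemperateGrowth (Complex.ofRealCLM.contDiff.comp h)

lemma fderiv_ofReal_comp {η : Rd d → ℝ} {x : Rd d} (h : DifferentiableAt ℝ η x) (v : Rd d) :
    fderiv ℝ (fun x => (η x : ℂ)) x v = (fderiv ℝ η x v : ℂ) := by
  have := (Complex.ofRealCLM.hasFDerivAt.comp x h.hasFDerivAt).fderiv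
  exact congrArg (fun L : Rd d →L[ℝ] ℂ => L v) this

/-- Multiplication by the cutoffs costs at most 1/(n+1) times norms of |x|²f, |x|²∂f and, from the
derivative falling on the cutoff, f. -/
lemma toXS_mem_closure_compact (f : 𝓢(Rd d, ℂ)) :
    toXS q f ∈ closure (toXS q '' {f : 𝓢(Rd d, ℂ) | HasCompactSupport f}) := by
  obtain ⟨χ, C, hC, hχ, hχc, hχ01, hχ1, hχd⟩ := exists_cutoff (d := d)
  have hN : Function.HasTemperateGrowth (fun x : Rd d => ((‖x‖ ^ 2 : ℝ) : ℂ)) := by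
    have := Function.hasTemperateGrowth_norm_sq (Rd d)
    fun_prop
  let W : 𝓢(Rd d, ℂ) → 𝓢(Rd d, ℂ) := SchwartzMap.smulLeftCLM ℂ (fun x : Rd d => ((‖x‖ ^ 2 : ℝ) : ℂ))
  have hW : ∀ g x, ‖W g x‖ = ‖x‖ ^ 2 * ‖g x‖ := fun g x => by
    simp only [W, SchwartzMap.smulLeftCLM_apply_apply hN, smul_eq_mul, norm_mul, Complex.norm_real,
      Real.norm_of_nonneg (sq_nonneg ‖x‖)]
  let F : ℕ → 𝓢(Rd d, ℂ) := fun n => SchwartzMap.smulLeftCLM ℂ (fun x => (χ n x : ℂ)) f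
  have hF : ∀ n x, F n x = χ n x * f x := fun n x => by
    simp only [F, SchwartzMap.smulLeftCLM_apply_apply
      (hasTemperateGrowth_ofReal_of_compact (hχ n) (hχc n)), smul_eq_mul]
  have hFd : ∀ n (k : Fin d) x, (∂_{unitVec k} (F n) : 𝓢(Rd d, ℂ)) x =
      χ n x * (∂_{unitVec k} f : 𝓢(Rd d, ℂ)) x + fderiv ℝ (χ n) x (unitVec k) * f x := by
    intro n k x
    rw [SchwartzMap.lineDerivOp_apply_eq_fderiv, SchwartzMap.lineDerivOp_apply_eq_fderiv]
    have e : (F n : Rd d → ℂ) = fun x => (χ n x : ℂ) * f x := funext (hF n)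
    have hd : DifferentiableAt ℝ (χ n) x := (hχ n).differentiable (by simp) x
    have hd' : DifferentiableAt ℝ (fun x => (χ n x : ℂ)) x :=
      Complex.ofRealCLM.differentiableAt.comp x hd
    rw [e, fderiv_fun_mul hd' f.differentiableAt]
    simp only [add_apply, smul_apply, smul_eq_mul,
      fderiv_ofReal_comp hd]
    ring
  have hn : Tendsto (fun n : ℕ => 1 / (n + 1 : ℝ)) atTop (𝓝 0) := tendsto_one_div_add_atTop_nhds_zero_nat
  have hpos : ∀ n : ℕ, 0 ≤ (1 / (n + 1 : ℝ)) := fun n => by positivity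
  have key : ∀ (r : ℝ≥0∞) [Fact (1 ≤ r)], Tendsto (fun n => (F n).toLp r volume) atTop
      (𝓝 (f.toLp r volume)) := by
    intro r _
    rw [tendsto_iff_norm_sub_tendsto_zero]
    refine squeeze_zero (fun _ => norm_nonneg _) (g := fun n : ℕ => (1 / (n + 1 : ℝ)) * ‖(W f).toLp r volume‖)
      (fun n => ?_) (by simpa using hn.mul_const ‖(W f).toLp r volume‖)
    have e : (F n).toLp r volume - f.toLp r volume = (F n - f).toLp r volume :=
      (map_sub (SchwartzMap.toLpCLM ℂ ℂ r (volume : Measure (Rd d))) _ _).symm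
    rw [e]
    refine norm_toLp_le_of_norm_le (hpos n) fun x => ?_
    rw [sub_apply, hF, hW, ← mul_assoc, show (χ n x : ℂ) * f x - f x = ((χ n x - 1 : ℝ) : ℂ) * f x by
      push_cast; ring, norm_mul, Complex.norm_real, Real.norm_eq_abs, abs_sub_comm]
    gcongr
    exact hχ1 n x
  have key2 : ∀ k : Fin d, Tendsto (fun n => (∂_{unitVec k} (F n) : 𝓢(Rd d, ℂ)).toLp 2 volume) atTop
      (𝓝 ((∂_{unitVec k} f : 𝓢(Rd d, ℂ)).toLp 2 volume)) := by
    intro k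
    set f' : 𝓢(Rd d, ℂ) := ∂_{unitVec k} f with hf'
    rw [tendsto_iff_norm_sub_tendsto_zero]
    have hlim := hn.mul_const (‖(W f').toLp 2 volume‖ + C * ‖f.toLp 2 volume‖)
    rw [zero_mul] at hlim
    refine squeeze_zero (fun _ => norm_nonneg _) (fun n => ?_) hlim
    let G1 : 𝓢(Rd d, ℂ) := SchwartzMap.smulLeftCLM ℂ (fun x => (χ n x : ℂ)) f' - f'
    -- The commutator of the derivative with the cutoff, split off from the plain truncation error
    -- `G1` of the derivative.
    let G2 : 𝓢(Rd d, ℂ) := ∂_{unitVec k} (F n) - f' - G1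
    have e : (∂_{unitVec k} (F n) : 𝓢(Rd d, ℂ)).toLp 2 volume - f'.toLp 2 volume =
        G1.toLp 2 volume + G2.toLp 2 volume := by
      have h1 := map_sub (SchwartzMap.toLpCLM ℂ ℂ 2 (volume : Measure (Rd d))) (∂_{unitVec k} (F n)) f'
      have h2 := map_add (SchwartzMap.toLpCLM ℂ ℂ 2 (volume : Measure (Rd d))) G1 G2
      rw [show G1 + G2 = ∂_{unitVec k} (F n) - f' by simp [G2]] at h2
      exact h1.symm.trans h2
    have hG1 : ∀ x, G1 x = ((χ n x - 1 : ℝ) : ℂ) * f' x := fun x => by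
      simp only [G1, sub_apply, SchwartzMap.smulLeftCLM_apply_apply
        (hasTemperateGrowth_ofReal_of_compact (hχ n) (hχc n)), smul_eq_mul]
      push_cast; ring
    have hG2 : ∀ x, G2 x = fderiv ℝ (χ n) x (unitVec k) * f x := fun x => by
      change (∂_{unitVec k} (F n) : 𝓢(Rd d, ℂ)) x - f' x - G1 x = _
      rw [hG1, hFd]; push_cast; ring
    rw [e, mul_add, ← mul_assoc]
    refine (norm_add_le _ _).trans (add_le_add ?_ ?_)
    · refine norm_toLp_le_of_norm_le (hpos n) fun x => ?_
      rw [hG1, hW, ← mul_assoc, norm_mul, Complex.norm_real, Real.norm_eq_abs, abs_sub_comm]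
      gcongr
      exact hχ1 n x
    · refine norm_toLp_le_of_norm_le (mul_nonneg (hpos n) hC) fun x => ?_
      rw [hG2, norm_mul, Complex.norm_real]
      gcongr
      refine ((fderiv ℝ (χ n) x).le_opNorm _).trans ?_
      simpa using hχd n x
  have hlim : Tendsto (fun n => toXS q (F n)) atTop (𝓝 (toXS q f)) :=
    (key 2).prodMk_nhds ((tendsto_pi_nhds.2 key2).prodMk_nhds (key q))
  refine mem_closure_of_tendsto hlim (Eventually.of_forall fun n => ⟨F n, ?_, rfl⟩)
  have e : (F n : Rd d → ℂ) = fun x => (χ n x : ℂ) * f x := funext (hF n)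
  change HasCompactSupport (F n : Rd d → ℂ)
  rw [e]
  exact ((hχc n).comp_left (g := Complex.ofReal) rfl).mul_right

end InteractionMorawetz

end

/-! ### Hausdorff–Young and the Sobolev embedding -/

noncomputable section
open MeasureTheory Filter Topology
open scoped ContDiff ENNReal SchwartzMap FourierTransform RealInnerProductSpace Laplacian LineDeriv
namespace InteractionMorawetz

variable {d : ℕ} {q : ℝ≥0∞} [Fact (1 ≤ q)]

/-- Forgetting the `L^q` component. -/
def toAmbient : XS d q →L[ℂ] H1Ambient d :=
  ((WithLp.prodContinuousLinearEquiv 2 ℂ (LL d 2)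
      (PiLp 2 (fun _ : Fin d => LL d 2))).symm :
      (LL d 2 × PiLp 2 (fun _ : Fin d => LL d 2)) →L[ℂ] H1Ambient d).comp
    ((ContinuousLinearMap.fst ℂ _ _).prod
      (((PiLp.continuousLinearEquiv 2 ℂ (fun _ : Fin d => LL d 2)).symm :
        (Fin d → LL d 2) →L[ℂ] PiLp 2 (fun _ : Fin d => LL d 2)).comp
        ((ContinuousLinearMap.fst ℂ _ _).comp (ContinuousLinearMap.snd ℂ _ _))))

lemma toAmbient_fst (V : XS d q) : (toAmbient V).fst = V.1 := rfl
lemma toAmbient_snd (V : XS d q) (k : Fin d) : (toAmbient V).snd k = V.2.1 k := rfl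

/-- A Schwartz function as an element of the ambient space of `H¹`. -/
def toH1Ambient : 𝓢(Rd d, ℂ) →ₗ[ℂ] H1Ambient d :=
  (toAmbient (q := 2)).toLinearMap ∘ₗ (toXS 2).toLinearMap

lemma toAmbient_toXS (f : 𝓢(Rd d, ℂ)) : toAmbient (toXS q f) = toH1Ambient f := rfl

lemma toH1Ambient_fst (f : 𝓢(Rd d, ℂ)) : (toH1Ambient f).fst = f.toLp 2 volume := rfl
lemma toH1Ambient_snd (f : 𝓢(Rd d, ℂ)) (k : Fin d) :
    (toH1Ambient f).snd k = (∂_{unitVec k} f : 𝓢(Rd d, ℂ)).toLp 2 volume := rfl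

lemma norm_H1Ambient_sq (v : H1Ambient d) : ‖v‖ ^ 2 = ‖v.fst‖ ^ 2 + ∑ k, ‖v.snd k‖ ^ 2 := by
  rw [WithLp.prod_norm_sq_eq_of_L2, PiLp.norm_sq_eq_of_L2]

lemma norm_toLp_two_sq (f : 𝓢(Rd d, ℂ)) : ‖f.toLp 2 volume‖ ^ 2 = ∫ x, ‖f x‖ ^ 2 := by
  rw [SchwartzMap.norm_toLp' (by norm_num) (by norm_num), ← Real.rpow_natCast, ← Real.rpow_mul
    (integral_nonneg fun _ => by positivity)]
  norm_num

lemma norm_fourier_lineDeriv (f : 𝓢(Rd d, ℂ)) (k : Fin d) (ξ : Rd d) :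
    ‖𝓕 (∂_{unitVec k} f : 𝓢(Rd d, ℂ)) ξ‖ = 2 * Real.pi * |ξ k| * ‖𝓕 f ξ‖ := by
  have h : Function.HasTemperateGrowth (fun ξ : Rd d => inner ℝ ξ (unitVec k)) := by fun_prop
  rw [SchwartzMap.fourier_lineDerivOp_eq, smul_apply, SchwartzMap.smulLeftCLM_apply_apply h]
  simp [EuclideanSpace.inner_single_right, Real.pi_pos.le, mul_assoc]

/-- Plancherel for f and its partial derivatives. The factor (2π)² carried by the gradient is at
least 1 and is discarded. -/
lemma sq_le_of_fourier_weight (f g : 𝓢(Rd d, ℂ)) (h : ∀ ξ, ‖g ξ‖ ^ 2 = (1 + ‖ξ‖ ^ 2) * ‖𝓕 f ξ‖ ^ 2) :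
    ‖g.toLp 2 volume‖ ≤ ‖toH1Ambient f‖ := by
  refine le_of_sq_le_sq ?_ (norm_nonneg _)
  have hint : ∀ g : 𝓢(Rd d, ℂ), Integrable (fun x => ‖g x‖ ^ 2) := fun g =>
    (memLp_two_iff_integrable_sq_norm (g.memLp 2 volume).1).1 (g.memLp 2 volume)
  have e : ∀ f : 𝓢(Rd d, ℂ), ‖f.toLp 2 volume‖ ^ 2 = ∫ x, ‖𝓕 f x‖ ^ 2 := fun f => by
    rw [norm_toLp_two_sq, SchwartzMap.integral_norm_sq_fourier]
  rw [norm_H1Ambient_sq, toH1Ambient_fst]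
  simp only [toH1Ambient_snd, e f, fun k => e (∂_{unitVec k} f), norm_toLp_two_sq g]
  rw [← integral_finsetSum _ (fun k _ => hint _), ← integral_add (hint _)
    (integrable_finsetSum _ fun k _ => hint _)]
  refine integral_mono (hint g) ((hint _).add (integrable_finsetSum _ fun k _ => hint _)) fun ξ => ?_
  simp only [h, norm_fourier_lineDeriv]
  have hpi : 1 ≤ (2 * Real.pi) ^ 2 := by nlinarith [Real.pi_gt_three]
  have h2 : ‖ξ‖ ^ 2 = ∑ k, |ξ k| ^ 2 := by
    rw [EuclideanSpace.norm_sq_eq]; rfl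
  have h3 : ∑ k, (2 * Real.pi * |ξ k| * ‖𝓕 f ξ‖) ^ 2 = (2 * Real.pi) ^ 2 * ‖ξ‖ ^ 2 * ‖𝓕 f ξ‖ ^ 2 := by
    rw [h2, Finset.mul_sum, Finset.sum_mul]
    exact Finset.sum_congr rfl fun k _ => by ring
  rw [h3]
  nlinarith [mul_nonneg (sq_nonneg ‖ξ‖) (sq_nonneg ‖𝓕 f ξ‖)]

/-- The Hausdorff–Young inequality on Schwartz functions. -/
lemma hausdorff_young {q' : ℝ≥0∞} [Fact (1 ≤ q')] [q.HolderConjugate q'] (hq : q ≠ ⊤)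
    (hq' : q' ≤ 2) (f : 𝓢(Rd d, ℂ)) :
    ‖f.toLp q volume‖ ≤ ‖(𝓕 f : 𝓢(Rd d, ℂ)).toLp q' volume‖ := by
  -- The interpolation theorem, with constant 1, is applied to the inverse transform at the point 𝓕
  -- f, so that f itself stands on the left.
  let T : 𝓢(Rd d, ℂ) →ₗ[ℂ] 𝓢(Rd d, ℂ) :=
    (FourierTransform.fourierInvCLM ℂ 𝓢(Rd d, ℂ)).toLinearMap
  have hT : ∀ f, T f = 𝓕⁻ f := fun _ => rfl
  have h := riesz_thorin_schwartz hq hq' T zero_le_one (fun f x => ?_) (fun f => ?_)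
    (fun f g => ?_) (𝓕 f)
  · rw [hT, FourierTransform.fourierInv_fourier_eq, Real.one_rpow, one_mul] at h
    exact h
  · rw [hT, SchwartzMap.fourierInv_coe, Real.fourierInv_eq, one_mul]
    refine (norm_integral_le_integral_norm _).trans_eq ?_
    simp
  · rw [hT, ← SchwartzMap.norm_fourier_toL2_eq, FourierTransform.fourier_fourierInv_eq]
  · simp only [hT]
    exact SchwartzMap.integral_fourierInv_mul_eq f g

/-- The Sobolev embedding of `H¹` into `L^q`, on Schwartz functions. -/
lemma exists_sobolev {q' : ℝ≥0∞} [Fact (1 ≤ q')] [q.HolderConjugate q'] (hq : q ≠ ⊤)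
    (hq' : q' ≤ 2) {s : ℝ} (hs : (d : ℝ) < s) [ENNReal.HolderTriple (ENNReal.ofReal s) 2 q'] :
    ∃ C : ℝ, ∀ f : 𝓢(Rd d, ℂ), ‖f.toLp q volume‖ ≤ C * ‖toH1Ambient f‖ := by
  have hs0 : 0 < s := lt_of_le_of_lt (Nat.cast_nonneg d) hs
  -- The transform of f is `w` times g = (1+|ξ|²)^{1/2} 𝓕f. The weight lies in L^s because s > d, g
  -- is bounded in L² by the H¹ norm, and Hölder with 1/q' = 1/s + 1/2 combines them.
  set w : Rd d → ℝ := fun ξ => (1 + ‖ξ‖ ^ 2) ^ (-(1 / 2) : ℝ) with hw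
  have hwc : Continuous w := by
    refine Continuous.rpow_const (by fun_prop) fun x => Or.inl (by positivity)
  have hwm : MemLp (fun ξ => (w ξ : ℂ)) (ENNReal.ofReal s) (volume : Measure (Rd d)) := by
    rw [← integrable_norm_rpow_iff (by fun_prop) (by simpa using hs0) ENNReal.ofReal_ne_top,
      ENNReal.toReal_ofReal hs0.le]
    have := integrable_rpow_neg_one_add_norm_sq (E := Rd d) (μ := volume) (r := s) (by simpa using hs)
    refine this.congr (ae_of_all _ fun ξ => ?_)
    simp only [hw, Complex.norm_real, Real.norm_eq_abs]
    rw [abs_of_nonneg (by positivity), ← Real.rpow_mul (by positivity)]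
    congr 1; ring
  have hg : Function.HasTemperateGrowth (fun ξ : Rd d => (((1 + ‖ξ‖ ^ 2) ^ (1 / 2 : ℝ) : ℝ) : ℂ)) := by
    have := Function.hasTemperateGrowth_one_add_norm_sq_rpow (Rd d) (1 / 2)
    fun_prop
  refine ⟨(eLpNorm (fun ξ => (w ξ : ℂ)) (ENNReal.ofReal s) volume).toReal, fun f => ?_⟩
  refine (hausdorff_young hq hq' f).trans ?_
  set g : 𝓢(Rd d, ℂ) := SchwartzMap.smulLeftCLM ℂ
    (fun ξ : Rd d => (((1 + ‖ξ‖ ^ 2) ^ (1 / 2 : ℝ) : ℝ) : ℂ)) (𝓕 f) with hgdef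
  have hgx : ∀ ξ, g ξ = (((1 + ‖ξ‖ ^ 2) ^ (1 / 2 : ℝ) : ℝ) : ℂ) * 𝓕 f ξ := fun ξ => by
    rw [hgdef, SchwartzMap.smulLeftCLM_apply_apply hg, smul_eq_mul]
  have h1 : ‖g.toLp 2 volume‖ ≤ ‖toH1Ambient f‖ := by
    refine sq_le_of_fourier_weight f g fun ξ => ?_
    rw [hgx, norm_mul, Complex.norm_real, Real.norm_of_nonneg (by positivity), mul_pow,
      ← Real.sqrt_eq_rpow, Real.sq_sqrt (by positivity)]
  have h2 : (fun ξ => (w ξ : ℂ)) • (g : Rd d → ℂ) = (𝓕 f : 𝓢(Rd d, ℂ)) := by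
    funext ξ
    simp only [Pi.smul_apply', smul_eq_mul, hgx, hw, ← mul_assoc]
    rw [← Complex.ofReal_mul, ← Real.rpow_add (by positivity)]
    norm_num
  have h3 := eLpNorm_smul_le_mul_eLpNorm (p := ENNReal.ofReal s) (q := 2) (r := q')
    (g.memLp 2 volume).1 hwm.1
  rw [h2] at h3
  have h4 := ENNReal.toReal_mono (ENNReal.mul_ne_top hwm.2.ne (g.memLp 2 volume).2.ne) h3
  rw [ENNReal.toReal_mul, ← SchwartzMap.norm_toLp, ← SchwartzMap.norm_toLp] at h4
  exact h4.trans (mul_le_mul_of_nonneg_left h1 ENNReal.toReal_nonneg)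

/-- A continuous functional on `XS d q` vanishing on real test functions vanishes on Schwartz
functions. -/
lemma toXS_ext {Λ : XS d q →L[ℂ] ℂ}
    (h : ∀ η : Rd d → ℝ, ContDiff ℝ ∞ η → HasCompactSupport η →
      ∀ f : 𝓢(Rd d, ℂ), (∀ x, f x = η x) → Λ (toXS q f) = 0) (f : 𝓢(Rd d, ℂ)) :
    Λ (toXS q f) = 0 := by
  have hcl : IsClosed {V : XS d q | Λ V = 0} := isClosed_eq Λ.continuous continuous_const
  refine closure_minimal ?_ hcl (toXS_mem_closure_compact f)
  rintro _ ⟨f, hf, rfl⟩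
  have hre : ContDiff ℝ ∞ (fun x => (f x).re) := Complex.reCLM.contDiff.comp (f.smooth ⊤)
  have him : ContDiff ℝ ∞ (fun x => (f x).im) := Complex.imCLM.contDiff.comp (f.smooth ⊤)
  have hf : HasCompactSupport (f : Rd d → ℂ) := hf
  have hrec : HasCompactSupport (fun x => (f x).re) := hf.comp_left (g := Complex.re) rfl
  have himc : HasCompactSupport (fun x => (f x).im) := hf.comp_left (g := Complex.im) rfl
  let f1 : 𝓢(Rd d, ℂ) := (hrec.comp_left (g := Complex.ofReal) rfl).toSchwartzMap
    (Complex.ofRealCLM.contDiff.comp hre)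
  let f2 : 𝓢(Rd d, ℂ) := (himc.comp_left (g := Complex.ofReal) rfl).toSchwartzMap
    (Complex.ofRealCLM.contDiff.comp him)
  -- Test functions in the problem are real, whereas Λ is complex linear: real and imaginary parts
  -- are treated separately.
  have e : f = f1 + Complex.I • f2 := by
    ext x
    change f x = ((f x).re : ℂ) + Complex.I * ((f x).im : ℂ)
    rw [mul_comm]; exact (Complex.re_add_im _).symm
  change Λ (toXS q f) = 0
  rw [e, map_add, map_smul, map_add, map_smul, h _ hre hrec f1 fun _ => rfl,
    h _ him himc f2 fun _ => rfl, smul_zero, add_zero]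

/-- The norming element of v is a limit of Schwartz functions, so v pairs to zero with it and ‖v‖² =
0. -/
lemma eq_zero_of_schwartz_pairing {q' : ℝ≥0∞} [Fact (1 ≤ q')] [q.HolderConjugate q']
    [q'.HolderConjugate q] (hq : q ≠ ⊤) (hq' : q' ≠ ⊤) {v : LL d q}
    (h : ∀ f : 𝓢(Rd d, ℂ), pairing volume q' q (f.toLp q' volume) v = 0) : v = 0 := by
  obtain ⟨w, -, hw⟩ := exists_norming hq hq' v
  have hcl : IsClosed {w : LL d q' | pairing volume q' q w v = 0} :=
    isClosed_eq (continuous_bilin_apply _ continuous_id continuous_const) continuous_const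
  have : w ∈ {w : LL d q' | pairing volume q' q w v = 0} := by
    refine closure_minimal ?_ hcl ((denseRange_toLp q' hq') w)
    rintro _ ⟨f, rfl⟩
    exact h f
  rw [pairing_comm, this] at hw
  have h0 : ‖v‖ ^ 2 = 0 := by exact_mod_cast hw.symm
  exact norm_eq_zero.1 (pow_eq_zero_iff (two_ne_zero) |>.1 h0)

end InteractionMorawetz

end

/-! ### H¹ as the closure of the Schwartz functions -/

noncomputable section
open MeasureTheory Filter Topology
open scoped ContDiff ENNReal SchwartzMap FourierTransform RealInnerProductSpace Laplacian LineDeriv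
namespace InteractionMorawetz

variable {d : ℕ} {q : ℝ≥0∞} [Fact (1 ≤ q)]

/-- `g` is the gradient of `f`, tested against Schwartz functions. -/
def IsGradL2 (f : LL d 2) (g : Fin d → LL d 2) : Prop :=
  ∀ (η : 𝓢(Rd d, ℂ)) (k : Fin d),
    pairing volume 2 2 ((∂_{unitVec k} η : 𝓢(Rd d, ℂ)).toLp 2 volume) f =
      -pairing volume 2 2 (η.toLp 2 volume) (g k)

/-- Both sides are continuous functionals of (η, ∇η) in L², so real compactly supported test
functions determine them on all Schwartz functions. -/
lemma isGradL2_of_hasWeakGradient {f : LL d 2} {g : Fin d → LL d 2}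
    (h : HasWeakGradient (fun x => f x) (fun k x => g k x)) : IsGradL2 f g := by
  intro η k
  obtain ⟨Λ, hΛ⟩ : ∃ Λ : XS d 2 →L[ℂ] ℂ, ∀ V, Λ V = pairing volume 2 2 (V.2.1 k) f +
      pairing volume 2 2 V.1 (g k) :=
    ⟨((pairing volume 2 2).flip f).comp ((ContinuousLinearMap.proj k).comp
        ((ContinuousLinearMap.fst ℂ _ _).comp (ContinuousLinearMap.snd ℂ _ _))) +
      ((pairing volume 2 2).flip (g k)).comp (ContinuousLinearMap.fst ℂ _ _), fun _ => rfl⟩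
  have key := toXS_ext (Λ := Λ) (fun η hη hηc F hF => ?_) η
  · rw [hΛ] at key
    exact eq_neg_of_add_eq_zero_left key
  · rw [hΛ, toXS_grad, toXS_fst, pairing_toLp, pairing_toLp]
    have e := h.2.2 η hη hηc k
    have e1 : ∀ x, (∂_{unitVec k} F : 𝓢(Rd d, ℂ)) x = (fderiv ℝ η x (unitVec k) : ℂ) := fun x => by
      rw [SchwartzMap.lineDerivOp_apply_eq_fderiv, funext hF]
      exact fderiv_ofReal_comp (hη.differentiable (by simp) x) _
    simp only [Complex.real_smul] at e
    simp only [hF, e1]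
    rw [e, neg_add_cancel]

lemma isGradL2_toXS (f : 𝓢(Rd d, ℂ)) : IsGradL2 (toXS q f).1 (toXS q f).2.1 := by
  intro η k
  rw [toXS_fst, toXS_grad, pairing_toLp_toLp, pairing_toLp_toLp,
    SchwartzMap.integral_mul_lineDerivOp_right_eq_neg_left, neg_neg]

lemma isGradL2_toH1Ambient (f : 𝓢(Rd d, ℂ)) :
    IsGradL2 (toH1Ambient f).fst (fun k => (toH1Ambient f).snd k) := isGradL2_toXS (q := 2) f

lemma continuous_H1Ambient_fst : Continuous fun v : H1Ambient d => v.fst :=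
  (WithLp.prod_continuous_ofLp 2 _ _).fst
lemma continuous_H1Ambient_snd (k : Fin d) : Continuous fun v : H1Ambient d => v.snd k :=
  (continuous_apply k).comp ((PiLp.continuous_ofLp 2 _).comp (WithLp.prod_continuous_ofLp 2 _ _).snd)

lemma isClosed_isGradL2 : IsClosed {v : H1Ambient d | IsGradL2 v.fst (fun k => v.snd k)} := by
  simp only [IsGradL2, Set.ofPred_forall]
  refine isClosed_iInter fun η => isClosed_iInter fun k => isClosed_eq ?_ ?_
  · exact continuous_bilin_apply _ continuous_const continuous_H1Ambient_fst
  · exact (continuous_bilin_apply _ continuous_const (continuous_H1Ambient_snd k)).neg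

lemma IsGradL2.sub {f f' : LL d 2} {g g' : Fin d → LL d 2} (h : IsGradL2 f g) (h' : IsGradL2 f' g') :
    IsGradL2 (f - f') (fun k => g k - g' k) := by
  intro η k
  rw [map_sub, map_sub, h η k, h' η k]
  ring

/-- Division by 1 + 4π²|ξ|² on the Fourier side keeps Schwartz functions. The solvability of this
resolvent equation is what makes Schwartz functions dense in H¹. -/
lemma exists_sub_laplacian_eq (g : 𝓢(Rd d, ℂ)) : ∃ ζ : 𝓢(Rd d, ℂ), ζ - Δ ζ = g := by
  let c : Rd d → ℝ := fun ξ => (1 + ‖(2 * Real.pi) • ξ‖ ^ 2) ^ (-1 : ℝ)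
  have hc : Function.HasTemperateGrowth (fun ξ : Rd d => (c ξ : ℂ)) := by
    have h1 := Function.hasTemperateGrowth_one_add_norm_sq_rpow (Rd d) (-1)
    have h2 : Function.HasTemperateGrowth (fun ξ : Rd d => (2 * Real.pi) • ξ) := by fun_prop
    have h3 := h1.comp h2
    have h4 : Function.HasTemperateGrowth c := h3
    fun_prop
  refine ⟨SchwartzMap.fourierMultiplierCLM ℂ (fun ξ => (c ξ : ℂ)) g, schwartz_ext_fourier fun ξ => ?_⟩
  have e0 : ∀ f h : 𝓢(Rd d, ℂ), 𝓕 (f - h) = 𝓕 f - 𝓕 h := fun f h =>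
    map_sub (FourierTransform.fourierCLM ℂ 𝓢(Rd d, ℂ)) f h
  rw [e0, sub_apply, fourier_laplacian, SchwartzMap.fourierMultiplierCLM_apply,
    FourierTransform.fourier_fourierInv_eq, SchwartzMap.smulLeftCLM_apply_apply hc, smul_eq_mul]
  have e1 : (1 + 4 * Real.pi ^ 2 * ‖ξ‖ ^ 2) * c ξ = 1 := by
    have : 1 + ‖(2 * Real.pi) • ξ‖ ^ 2 = 1 + 4 * Real.pi ^ 2 * ‖ξ‖ ^ 2 := by
      rw [norm_smul, Real.norm_of_nonneg (by positivity)]; ring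
    simp only [c]
    rw [this, Real.rpow_neg_one]
    exact mul_inv_cancel₀ (by positivity)
  have e2 : (1 + ((4 * Real.pi ^ 2 * ‖ξ‖ ^ 2 : ℝ) : ℂ)) * (c ξ : ℂ) = 1 := by
    exact_mod_cast e1
  linear_combination (𝓕 g ξ) * e2

lemma inner_toLp_two (f : 𝓢(Rd d, ℂ)) (g : LL d 2) :
    inner ℂ (f.toLp 2 volume) g =
      pairing volume 2 2 ((f.postcompCLM (Complex.conjCLE : ℂ →L[ℝ] ℂ)).toLp 2 volume) g := by
  rw [pairing_toLp, L2.inner_def]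
  apply integral_congr_ae
  filter_upwards [f.coeFn_toLp 2 volume] with x hx
  rw [hx, SchwartzMap.postcompCLM_apply, RCLike.inner_apply, mul_comm]
  rfl

lemma lineDeriv_conj (f : 𝓢(Rd d, ℂ)) (k : Fin d) :
    (∂_{unitVec k} (f.postcompCLM (Complex.conjCLE : ℂ →L[ℝ] ℂ)) : 𝓢(Rd d, ℂ)) =
      SchwartzMap.postcompCLM (Complex.conjCLE : ℂ →L[ℝ] ℂ) (∂_{unitVec k} f) := by
  ext x
  rw [SchwartzMap.lineDerivOp_apply_eq_fderiv, SchwartzMap.postcompCLM_apply,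
    SchwartzMap.lineDerivOp_apply_eq_fderiv]
  have := ((Complex.conjCLE : ℂ →L[ℝ] ℂ).hasFDerivAt.comp x (f.hasFDerivAt x)).fderiv
  exact congrArg (fun L : Rd d →L[ℝ] ℂ => L (unitVec k)) this

/-- Density of Schwartz functions in `H¹`. -/
lemma mem_closure_of_isGradL2 {v : H1Ambient d} (hv : IsGradL2 v.fst (fun k => v.snd k)) :
    v ∈ (LinearMap.range (toH1Ambient (d := d))).topologicalClosure := by
  set K := (LinearMap.range (toH1Ambient (d := d))).topologicalClosure with hK
  have : CompleteSpace K := (Submodule.isClosed_topologicalClosure _).completeSpace_coe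
  -- It remains to see that z, which is orthogonal to the Schwartz functions and again a pair of a
  -- function and its gradient, vanishes.
  obtain ⟨y, hy, z, hz, rfl⟩ := K.exists_add_mem_mem_orthogonal v
  have hyg : IsGradL2 y.fst (fun k => y.snd k) := by
    refine closure_minimal ?_ isClosed_isGradL2 hy
    rintro _ ⟨f, rfl⟩
    exact isGradL2_toH1Ambient f
  have hzg : IsGradL2 z.fst (fun k => z.snd k) := by
    have h := hv.sub hyg
    have e1 : (y + z).fst - y.fst = z.fst := add_sub_cancel_left y.fst z.fst
    have e2 : (fun k => (y + z).snd k - y.snd k) = fun k => z.snd k :=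
      funext fun k => add_sub_cancel_left (y.snd k) (z.snd k)
    rwa [e1, e2] at h
  have horth : ∀ ζ : 𝓢(Rd d, ℂ), pairing volume 2 2 (ζ.toLp 2 volume) z.fst +
      ∑ k, pairing volume 2 2 ((∂_{unitVec k} ζ : 𝓢(Rd d, ℂ)).toLp 2 volume) (z.snd k) = 0 := by
    intro ζ
    have h := hz (toH1Ambient (ζ.postcompCLM (Complex.conjCLE : ℂ →L[ℝ] ℂ)))
      (Submodule.le_topologicalClosure _ ⟨_, rfl⟩)
    have hcc : ∀ f : 𝓢(Rd d, ℂ), (f.postcompCLM (Complex.conjCLE : ℂ →L[ℝ] ℂ)).postcompCLM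
        (Complex.conjCLE : ℂ →L[ℝ] ℂ) = f := fun f => by
      ext x; simp [SchwartzMap.postcompCLM_apply]
    rw [WithLp.prod_inner_apply, PiLp.inner_apply] at h
    have h' : inner ℂ (toH1Ambient (ζ.postcompCLM (Complex.conjCLE : ℂ →L[ℝ] ℂ))).fst z.fst +
      ∑ k, inner ℂ ((toH1Ambient (ζ.postcompCLM (Complex.conjCLE : ℂ →L[ℝ] ℂ))).snd k) (z.snd k) = 0 := h
    simpa only [toH1Ambient_fst, toH1Ambient_snd, inner_toLp_two, lineDeriv_conj, hcc] using h'
  have h0 : z.fst = 0 := by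
    refine eq_zero_of_schwartz_pairing (q' := 2) (by norm_num) (by norm_num) fun g => ?_
    -- Orthogonality to ζ, with the gradient of z moved back onto ζ, says that z pairs to zero with
    -- ζ - Δζ = g, an arbitrary Schwartz function.
    obtain ⟨ζ, hζ⟩ := exists_sub_laplacian_eq g
    have e := horth ζ
    have e2 : ∀ k : Fin d, pairing volume 2 2 ((∂_{unitVec k} ζ : 𝓢(Rd d, ℂ)).toLp 2 volume) (z.snd k) =
        - pairing volume 2 2 ((∂_{unitVec k} (∂_{unitVec k} ζ) : 𝓢(Rd d, ℂ)).toLp 2 volume) z.fst :=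
      fun k => by rw [hzg _ k, neg_neg]
    have e3 : g.toLp 2 volume = ζ.toLp 2 volume -
        ∑ k : Fin d, (∂_{unitVec k} (∂_{unitVec k} ζ) : 𝓢(Rd d, ℂ)).toLp 2 volume := by
      rw [← hζ, SchwartzMap.laplacian_eq_sum (EuclideanSpace.basisFun (Fin d) ℝ)]
      simp only [EuclideanSpace.basisFun_apply]
      have := map_sub (SchwartzMap.toLpCLM ℂ ℂ 2 (volume : Measure (Rd d))) ζ
        (∑ k : Fin d, ∂_{unitVec k} (∂_{unitVec k} ζ))
      rw [map_sum] at this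
      exact this
    rw [e3, map_sub, map_sum, sub_apply, sum_apply, sub_eq_add_neg, ← Finset.sum_neg_distrib]
    simpa only [e2] using e
  have h1 : ∀ k, z.snd k = 0 := by
    intro k
    refine eq_zero_of_schwartz_pairing (q' := 2) (by norm_num) (by norm_num) fun g => ?_
    have := hzg g k
    rw [h0, map_zero] at this
    exact neg_eq_zero.1 this.symm
  have hz0 : z = 0 := by
    have : ‖z‖ ^ 2 = 0 := by
      rw [norm_H1Ambient_sq, h0]; simp [h1]
    exact norm_eq_zero.1 (pow_eq_zero_iff two_ne_zero |>.1 this)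
  rwa [hz0, add_zero]

/-- The Sobolev inequality `‖f‖_q ≤ C ‖f‖_{H¹}` on Schwartz functions. -/
def SobolevBound (d : ℕ) (q : ℝ≥0∞) [Fact (1 ≤ q)] : Prop :=
  ∃ C : ℝ, ∀ f : 𝓢(Rd d, ℂ), ‖f.toLp q volume‖ ≤ C * ‖toH1Ambient f‖

variable (d q) in
/-- The space `H¹` inside `XS d q`. -/
def WS : Submodule ℂ (XS d q) := (LinearMap.range (toXS (d := d) q).toLinearMap).topologicalClosure

lemma toXS_mem (f : 𝓢(Rd d, ℂ)) : toXS q f ∈ WS d q :=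
  Submodule.le_topologicalClosure _ ⟨f, rfl⟩

/-- Induction principle for closed properties on `WS d q`. -/
lemma WS_induction {P : XS d q → Prop} (hP : IsClosed {V | P V}) (h : ∀ f, P (toXS q f))
    {V : XS d q} (hV : V ∈ WS d q) : P V := by
  refine closure_minimal ?_ hP hV
  rintro _ ⟨f, rfl⟩
  exact h f

/-- By the Sobolev bound, a sequence of Schwartz functions converging in H¹ is Cauchy in L^q; its
limit there supplies the missing third component. -/
lemma exists_lift (hS : SobolevBound d q) {v : H1Ambient d}
    (hv : v ∈ (LinearMap.range (toH1Ambient (d := d))).topologicalClosure) :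
    ∃ V ∈ WS d q, toAmbient V = v := by
  obtain ⟨C, hC⟩ := hS
  obtain ⟨x, hx, hlim⟩ := mem_closure_iff_seq_limit.1 hv
  choose f hf using hx
  have hcau : CauchySeq fun n => (f n).toLp q volume := by
    have hc := hlim.cauchySeq
    rw [Metric.cauchySeq_iff'] at hc ⊢
    intro ε hε
    obtain ⟨N, hN⟩ := hc (ε / (|C| + 1)) (by positivity)
    refine ⟨N, fun n hn => ?_⟩
    have h1 := hN n hn
    rw [dist_eq_norm, ← hf, ← hf, ← map_sub] at h1
    rw [dist_eq_norm]
    have e : (f n).toLp q volume - (f N).toLp q volume = (f n - f N).toLp q volume :=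
      (map_sub (SchwartzMap.toLpCLM ℂ ℂ q (volume : Measure (Rd d))) _ _).symm
    rw [e]
    have h2 := (hC (f n - f N)).trans (mul_le_mul_of_nonneg_right
      ((le_abs_self C).trans (by linarith : |C| ≤ |C| + 1)) (norm_nonneg _))
    refine h2.trans_lt ?_
    rw [lt_div_iff₀ (by positivity), mul_comm] at h1
    exact h1
  obtain ⟨w, hw⟩ := cauchySeq_tendsto_of_complete hcau
  have hx' : x = fun n => toH1Ambient (f n) := funext fun n => (hf n).symm
  rw [hx'] at hlim
  refine ⟨(v.fst, (fun k => v.snd k), w), ?_, rfl⟩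
  have h1 : Tendsto (fun n => toXS q (f n)) atTop (𝓝 (v.fst, (fun k => v.snd k), w)) := by
    refine Tendsto.prodMk_nhds ?_ (Tendsto.prodMk_nhds (tendsto_pi_nhds.2 fun k => ?_) hw)
    · exact (continuous_H1Ambient_fst.tendsto v).comp hlim
    · exact ((continuous_H1Ambient_snd k).tendsto v).comp hlim
  exact mem_closure_of_tendsto h1 (Eventually.of_forall fun n => ⟨f n, rfl⟩)

/-- The Sobolev bound, closed up: on `WS` the L^q component is controlled by the H¹ part, so the
lift from H¹ is continuous. -/
lemma exists_norm_le_of_mem_WS (hS : SobolevBound d q) :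
    ∃ C : ℝ, ∀ V ∈ WS d q, ‖V‖ ≤ C * ‖toAmbient V‖ := by
  obtain ⟨C, hC⟩ := hS
  refine ⟨max 1 C, fun V hV => ?_⟩
  refine WS_induction (P := fun V => ‖V‖ ≤ max 1 C * ‖toAmbient V‖)
    (isClosed_le continuous_norm (toAmbient.continuous.norm.const_mul _)) (fun f => ?_) hV
  have h2 : ∀ v : H1Ambient d, ‖v.fst‖ ≤ 1 * ‖v‖ ∧ ∀ k, ‖v.snd k‖ ≤ 1 * ‖v‖ := by
    intro v
    have h := norm_H1Ambient_sq v
    have hs : 0 ≤ ∑ k, ‖v.snd k‖ ^ 2 := Finset.sum_nonneg fun _ _ => by positivity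
    refine ⟨?_, fun k => ?_⟩ <;> rw [one_mul] <;> refine le_of_sq_le_sq ?_ (norm_nonneg _)
    · linarith
    · have := Finset.single_le_sum (f := fun k => ‖v.snd k‖ ^ 2) (fun _ _ => by positivity)
        (Finset.mem_univ k)
      simp only at this
      nlinarith [sq_nonneg ‖v.fst‖]
  have h3 := h2 (toH1Ambient f)
  rw [toAmbient_toXS]
  have hm : 0 ≤ max 1 C * ‖toH1Ambient f‖ :=
    mul_nonneg (zero_le_one.trans (le_max_left _ _)) (norm_nonneg _)
  have hl : 1 * ‖toH1Ambient f‖ ≤ max 1 C * ‖toH1Ambient f‖ :=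
    mul_le_mul_of_nonneg_right (le_max_left _ _) (norm_nonneg _)
  refine norm_prod_le_iff.2 ⟨h3.1.trans hl, norm_prod_le_iff.2
    ⟨(pi_norm_le_iff_of_nonneg hm).2 fun k => (h3.2 k).trans hl, (hC f).trans ?_⟩⟩
  exact mul_le_mul_of_nonneg_right (le_max_right _ _) (norm_nonneg _)

lemma isGradL2_of_mem_WS {V : XS d q} (hV : V ∈ WS d q) : IsGradL2 V.1 V.2.1 := by
  refine WS_induction (P := fun V : XS d q => IsGradL2 V.1 V.2.1) ?_ isGradL2_toXS hV
  exact (isClosed_isGradL2 (d := d)).preimage (toAmbient (q := q)).continuous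

/-- Integration by parts in `WS d q`. -/
lemma pairing_grad_of_mem_WS {V W : XS d q} (hV : V ∈ WS d q) (hW : W ∈ WS d q) (k : Fin d) :
    pairing volume 2 2 (W.2.1 k) V.1 = -pairing volume 2 2 W.1 (V.2.1 k) := by
  refine WS_induction (P := fun W : XS d q => pairing volume 2 2 (W.2.1 k) V.1 =
    -pairing volume 2 2 W.1 (V.2.1 k)) (isClosed_eq ?_ ?_) (fun f => isGradL2_of_mem_WS hV f k) hW
  · exact continuous_bilin_apply _ (by fun_prop) continuous_const
  · exact (continuous_bilin_apply _ (by fun_prop) continuous_const).neg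

/-- The L² and the L^q component define the same distribution, by continuity from Schwartz
functions, and distributions determine locally integrable functions. -/
lemma ae_eq_of_mem_WS {q' : ℝ≥0∞} [Fact (1 ≤ q')] [q'.HolderConjugate q] {V : XS d q}
    (hV : V ∈ WS d q) : V.1 =ᵐ[volume] V.2.2 := by
  have h1 : ∀ f : 𝓢(Rd d, ℂ), pairing volume 2 2 (f.toLp 2 volume) V.1 =
      pairing volume q' q (f.toLp q' volume) V.2.2 := by
    intro f
    refine WS_induction (P := fun V : XS d q => pairing volume 2 2 (f.toLp 2 volume) V.1 =
      pairing volume q' q (f.toLp q' volume) V.2.2) (isClosed_eq ?_ ?_) (fun g => ?_) hV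
    · exact continuous_bilin_apply _ continuous_const continuous_fst
    · exact continuous_bilin_apply _ continuous_const (by fun_prop)
    · rw [toXS_fst, toXS_snd, pairing_toLp_toLp, pairing_toLp_toLp]
  refine ae_eq_of_integral_contDiff_smul_eq ((Lp.memLp V.1).locallyIntegrable (by norm_num))
    ((Lp.memLp V.2.2).locallyIntegrable Fact.out) fun η hη hηc => ?_
  let f : 𝓢(Rd d, ℂ) := (hηc.comp_left (g := Complex.ofReal) rfl).toSchwartzMap
    (Complex.ofRealCLM.contDiff.comp hη)
  have h2 := h1 f
  rw [pairing_toLp, pairing_toLp] at h2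
  exact h2

/-- The lift of the H¹ part agrees with V in every component, so `WS` is exactly the set of coherent
triples. This is how membership is checked when no approximating sequence is at hand. -/
lemma mem_WS_of_isGradL2 {q' : ℝ≥0∞} [Fact (1 ≤ q')] [q'.HolderConjugate q]
    (hS : SobolevBound d q) {V : XS d q} (h : IsGradL2 V.1 V.2.1)
    (h' : V.1 =ᵐ[volume] V.2.2) : V ∈ WS d q := by
  obtain ⟨W, hW, hWV⟩ := exists_lift hS (mem_closure_of_isGradL2 (v := toAmbient V) h)
  have e1 : W.1 = V.1 := by rw [← toAmbient_fst, hWV, toAmbient_fst]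
  have e2 : W.2.1 = V.2.1 := by
    funext k
    rw [← toAmbient_snd, hWV, toAmbient_snd]
  have e3 : W.2.2 = V.2.2 := by
    apply Lp.ext
    have := ae_eq_of_mem_WS (q' := q') hW
    rw [e1] at this
    exact this.symm.trans h'
  have : W = V := Prod.ext e1 (Prod.ext e2 e3)
  rwa [← this]

/-- The continuous embedding of `H¹` in `XS d q`. -/
lemma exists_embedding (hS : SobolevBound d q) :
    ∃ J : H1 d → XS d q, Continuous J ∧ ∀ U, J U ∈ WS d q ∧ toAmbient (J U) = U.1 := by
  have h : ∀ U : H1 d, ∃ V ∈ WS d q, toAmbient V = U.1 := fun U =>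
    exists_lift hS (mem_closure_of_isGradL2 (isGradL2_of_hasWeakGradient U.2))
  choose J hJ hJ' using h
  refine ⟨J, ?_, fun U => ⟨hJ U, hJ' U⟩⟩
  obtain ⟨C, hC⟩ := exists_norm_le_of_mem_WS hS
  -- The lifts are chosen pointwise, yet the difference of two of them lies in the subspace `WS`,
  -- where the norm bound turns distances into distances.
  have hl : ∀ U V : H1 d, dist (J U) (J V) ≤ C * dist U V := fun U V => by
    have := hC _ ((WS d q).sub_mem (hJ U) (hJ V))
    rw [map_sub, hJ', hJ', ← dist_eq_norm, ← dist_eq_norm] at this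
    exact this
  exact (LipschitzWith.of_dist_le' hl).continuous

end InteractionMorawetz

end

/-! ### Translation, conjugation and multiplication by weights -/

noncomputable section
open MeasureTheory Filter Topology
open scoped ContDiff ENNReal SchwartzMap FourierTransform RealInnerProductSpace Laplacian LineDeriv
namespace InteractionMorawetz

variable {d : ℕ} {q : ℝ≥0∞} [Fact (1 ≤ q)]

section Translation

/-- The translation `f ↦ f (· + a)`. -/
def trL (a : Rd d) : LL d q →L[ℂ] LL d q :=
  (Lp.compMeasurePreservingₗᵢ ℂ (fun x : Rd d => x + a)
    (measurePreserving_add_right volume a)).toContinuousLinearMap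

lemma coeFn_trL (a : Rd d) (f : LL d q) : trL a f =ᵐ[volume] fun x => f (x + a) :=
  Lp.coeFn_compMeasurePreserving f (measurePreserving_add_right volume a)

lemma norm_trL (a : Rd d) (f : LL d q) : ‖trL a f‖ = ‖f‖ :=
  (Lp.compMeasurePreservingₗᵢ ℂ (fun x : Rd d => x + a)
    (measurePreserving_add_right volume a)).norm_map f

/-- Translation of a Schwartz function. -/
abbrev trS (a : Rd d) (f : 𝓢(Rd d, ℂ)) : 𝓢(Rd d, ℂ) := SchwartzMap.compSubConstCLM ℂ (-a) f

lemma trS_apply (a : Rd d) (f : 𝓢(Rd d, ℂ)) (x : Rd d) : trS a f x = f (x + a) := by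
  rw [SchwartzMap.compSubConstCLM_apply, sub_neg_eq_add]

lemma trL_toLp (a : Rd d) (f : 𝓢(Rd d, ℂ)) : trL a (f.toLp q volume) = (trS a f).toLp q volume := by
  apply Lp.ext
  have h := (measurePreserving_add_right volume a).quasiMeasurePreserving.ae_eq_comp
    (f.coeFn_toLp q volume)
  filter_upwards [coeFn_trL a (f.toLp q volume), (trS a f).coeFn_toLp q volume, h] with x h1 h2 h3
  rw [h1, h2, trS_apply]
  exact h3

/-- Translation on `XS d q`. -/
def trXS (a : Rd d) : XS d q →L[ℂ] XS d q :=
  ((trL a).comp (ContinuousLinearMap.fst ℂ _ _)).prod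
    ((ContinuousLinearMap.pi fun k => (trL a).comp ((ContinuousLinearMap.proj k).comp
      ((ContinuousLinearMap.fst ℂ _ _).comp (ContinuousLinearMap.snd ℂ _ _)))).prod
    ((trL a).comp ((ContinuousLinearMap.snd ℂ _ _).comp (ContinuousLinearMap.snd ℂ _ _))))

lemma trXS_fst (a : Rd d) (V : XS d q) : (trXS a V).1 = trL a V.1 := rfl
lemma trXS_grad (a : Rd d) (V : XS d q) (k : Fin d) : (trXS a V).2.1 k = trL a (V.2.1 k) := rfl
lemma trXS_snd (a : Rd d) (V : XS d q) : (trXS a V).2.2 = trL a V.2.2 := rfl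

lemma lineDeriv_trS (a : Rd d) (f : 𝓢(Rd d, ℂ)) (k : Fin d) :
    (∂_{unitVec k} (trS a f) : 𝓢(Rd d, ℂ)) = trS a (∂_{unitVec k} f) := by
  ext x
  rw [SchwartzMap.lineDerivOp_apply_eq_fderiv, trS_apply, SchwartzMap.lineDerivOp_apply_eq_fderiv,
    funext (trS_apply a f), fderiv_comp_add_right]

lemma trXS_mem (a : Rd d) {V : XS d q} (hV : V ∈ WS d q) : trXS a V ∈ WS d q := by
  refine WS_induction (P := fun V => trXS a V ∈ WS d q)
    ((Submodule.isClosed_topologicalClosure _).preimage (trXS a).continuous) (fun f => ?_) hV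
  have : trXS a (toXS q f) = toXS q (trS a f) := by
    refine Prod.ext ?_ (Prod.ext (funext fun k => ?_) ?_)
    · rw [trXS_fst, toXS_fst, toXS_fst, trL_toLp]
    · rw [trXS_grad, toXS_grad, toXS_grad, lineDeriv_trS, trL_toLp]
    · rw [trXS_snd, toXS_snd, toXS_snd, trL_toLp]
  rw [this]
  exact toXS_mem _

lemma pairing_trL {q' : ℝ≥0∞} [Fact (1 ≤ q')] [q.HolderConjugate q'] (a : Rd d) (f : LL d q)
    (g : LL d q') : pairing volume q q' f (trL a g) = pairing volume q q' (trL (-a) f) g := by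
  rw [pairing_apply, pairing_apply, ← integral_add_right_eq_self (μ := volume)
    (fun x => trL (-a) f x * g x) a]
  apply integral_congr_ae
  have h := (measurePreserving_add_right volume a).quasiMeasurePreserving.ae_eq_comp
    (coeFn_trL (-a) f)
  filter_upwards [coeFn_trL a g, h] with x h1 h2
  have h2' : trL (-a) f (x + a) = f (x + a + -a) := h2
  rw [h1, h2', add_neg_cancel_right]

lemma fourier_trS (a : Rd d) (f : 𝓢(Rd d, ℂ)) (ξ : Rd d) :
    𝓕 (trS a f) ξ = Complex.exp (-Complex.I * ((-(2 * Real.pi * ⟪a, ξ⟫) : ℝ) : ℂ)) * 𝓕 f ξ := by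
  have h := congrFun (VectorFourier.fourierIntegral_comp_add_right Real.fourierChar
    (volume : Measure (Rd d)) (innerₗ (Rd d)) f a) ξ
  rw [SchwartzMap.fourier_coe, SchwartzMap.fourier_coe]
  have e : (trS a f : Rd d → ℂ) = f ∘ fun v => v + a := funext (trS_apply a f)
  rw [e]
  refine h.trans ?_
  rw [Circle.smul_def, Real.fourierChar_apply, smul_eq_mul]
  congr 2
  simp only [innerₗ_apply_apply]
  push_cast; ring

lemma fourier_lineDeriv (f : 𝓢(Rd d, ℂ)) (k : Fin d) (ξ : Rd d) :
    𝓕 (∂_{unitVec k} f : 𝓢(Rd d, ℂ)) ξ = Complex.I * ((2 * Real.pi * ξ k : ℝ) : ℂ) * 𝓕 f ξ := by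
  have h : Function.HasTemperateGrowth (fun ξ : Rd d => inner ℝ ξ (unitVec k)) := by fun_prop
  rw [SchwartzMap.fourier_lineDerivOp_eq, smul_apply, SchwartzMap.smulLeftCLM_apply_apply h]
  simp [EuclideanSpace.inner_single_right]
  ring

lemma norm_cexp_sub_one_le (y : ℝ) : ‖Complex.exp (-Complex.I * y) - 1‖ ≤ |y| := by
  have := Real.norm_exp_I_mul_ofReal_sub_one_le (x := -y)
  simpa using this

lemma fourier_sub' (f g : 𝓢(Rd d, ℂ)) : 𝓕 (f - g) = 𝓕 f - 𝓕 g :=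
  map_sub (FourierTransform.fourierCLM ℂ 𝓢(Rd d, ℂ)) f g

lemma toLp_sub (r : ℝ≥0∞) [Fact (1 ≤ r)] (f g : 𝓢(Rd d, ℂ)) :
    (f - g).toLp r volume = f.toLp r volume - g.toLp r volume :=
  map_sub (SchwartzMap.toLpCLM ℂ ℂ r (volume : Measure (Rd d))) f g

lemma toLp_smul (r : ℝ≥0∞) [Fact (1 ≤ r)] (c : ℂ) (f : 𝓢(Rd d, ℂ)) :
    (c • f).toLp r volume = c • f.toLp r volume :=
  map_smul (SchwartzMap.toLpCLM ℂ ℂ r (volume : Measure (Rd d))) c f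

/-- On the Fourier side, |e^{iy} - 1| ≤ |y| with y = 2πhξ_k. The bound is uniform in h and survives
the passage to H¹, unlike the next one, which costs a second derivative. -/
lemma norm_trS_sub_le (h : ℝ) (k : Fin d) (f : 𝓢(Rd d, ℂ)) :
    ‖(trS (h • unitVec k) f).toLp 2 volume - f.toLp 2 volume‖ ≤
      |h| * ‖(∂_{unitVec k} f : 𝓢(Rd d, ℂ)).toLp 2 volume‖ := by
  have e : |h| * ‖(∂_{unitVec k} f : 𝓢(Rd d, ℂ)).toLp 2 volume‖ =
      ‖((h : ℂ) • ∂_{unitVec k} f : 𝓢(Rd d, ℂ)).toLp 2 volume‖ := by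
    rw [toLp_smul, norm_smul, Complex.norm_real, Real.norm_eq_abs]
  rw [e, ← toLp_sub]
  refine norm_toLp_two_le_of_fourier fun ξ => ?_
  rw [fourier_sub', FourierTransform.fourier_smul, sub_apply, smul_apply, fourier_trS,
    fourier_lineDeriv, smul_eq_mul, ← mul_assoc, ← mul_assoc, norm_mul, ← sub_one_mul, norm_mul]
  gcongr
  refine (norm_cexp_sub_one_le _).trans_eq ?_
  rw [norm_mul, norm_mul, Complex.norm_real, Complex.norm_real, Complex.norm_I, mul_one,
    Real.norm_eq_abs, Real.norm_eq_abs, ← abs_mul, abs_neg]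
  have hin : ⟪h • unitVec k, ξ⟫ = h * ξ k := by
    simp [inner_smul_left, EuclideanSpace.inner_single_left]
  rw [hin]
  congr 1
  ring

lemma norm_trS_sub_sub_le (h : ℝ) (k : Fin d) (f : 𝓢(Rd d, ℂ)) :
    ‖(trS (h • unitVec k) f).toLp 2 volume - f.toLp 2 volume -
        (h : ℂ) • (∂_{unitVec k} f : 𝓢(Rd d, ℂ)).toLp 2 volume‖ ≤
      3 * h ^ 2 * ‖(∂_{unitVec k} (∂_{unitVec k} f) : 𝓢(Rd d, ℂ)).toLp 2 volume‖ := by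
  set f2 : 𝓢(Rd d, ℂ) := ∂_{unitVec k} (∂_{unitVec k} f) with hf2
  have e : 3 * h ^ 2 * ‖f2.toLp 2 volume‖ = ‖(((3 * h ^ 2 : ℝ) : ℂ) • f2).toLp 2 volume‖ := by
    rw [toLp_smul, norm_smul, Complex.norm_real, Real.norm_of_nonneg (by positivity)]
  rw [e, ← toLp_sub, ← toLp_smul, ← toLp_sub]
  refine norm_toLp_two_le_of_fourier fun ξ => ?_
  rw [fourier_sub', fourier_sub', FourierTransform.fourier_smul, FourierTransform.fourier_smul, hf2]
  simp only [sub_apply, smul_apply, fourier_trS, fourier_lineDeriv, smul_eq_mul]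
  have hin : ⟪h • unitVec k, ξ⟫ = h * ξ k := by
    simp [inner_smul_left, EuclideanSpace.inner_single_left]
  rw [hin]
  set y : ℝ := -(2 * Real.pi * (h * ξ k)) with hy
  have e5 : Complex.exp (-Complex.I * (y : ℂ)) * 𝓕 f ξ - 𝓕 f ξ -
      (h : ℂ) * (Complex.I * ((2 * Real.pi * ξ k : ℝ) : ℂ) * 𝓕 f ξ) =
      (Complex.exp (-Complex.I * (y : ℂ)) - 1 + Complex.I * (y : ℂ)) * 𝓕 f ξ := by
    rw [hy]; push_cast; ring
  have e6 : ((3 * h ^ 2 : ℝ) : ℂ) * (Complex.I * ((2 * Real.pi * ξ k : ℝ) : ℂ) *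
      (Complex.I * ((2 * Real.pi * ξ k : ℝ) : ℂ) * 𝓕 f ξ)) = -((3 * y ^ 2 : ℝ) : ℂ) * 𝓕 f ξ := by
    rw [hy]; push_cast
    linear_combination 3 * (h : ℂ) ^ 2 * (2 * Real.pi * (ξ k : ℂ)) ^ 2 * 𝓕 f ξ * Complex.I_sq
  rw [e5, e6, norm_mul, norm_mul, norm_neg, Complex.norm_real, Real.norm_of_nonneg (by positivity)]
  gcongr
  exact norm_cexp_sub_le y

lemma norm_trL_sub_le {V : XS d q} (hV : V ∈ WS d q) (h : ℝ) (k : Fin d) :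
    ‖trL (h • unitVec k) V.1 - V.1‖ ≤ |h| * ‖V.2.1 k‖ := by
  refine WS_induction (P := fun V : XS d q => ‖trL (h • unitVec k) V.1 - V.1‖ ≤ |h| * ‖V.2.1 k‖)
    (isClosed_le ?_ ?_) (fun f => ?_) hV
  · have h1 : Continuous fun V : XS d q => trL (h • unitVec k) V.1 :=
      (trL (q := 2) (h • unitVec k)).continuous.comp continuous_fst
    exact (h1.sub continuous_fst).norm
  · fun_prop
  · rw [toXS_fst, toXS_grad, trL_toLp]
    exact norm_trS_sub_le h k f

/-- Density argument: difference quotients are bounded on H¹ uniformly in h by the partial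
derivative, and converge on Schwartz functions by the second order remainder. -/
lemma tendsto_difference_quotient {V : XS d q} (hV : V ∈ WS d q) (k : Fin d) :
    Tendsto (fun h : ℝ => ((h⁻¹ : ℝ) : ℂ) • (trL (h • unitVec k) V.1 - V.1)) (𝓝[≠] 0)
      (𝓝 (V.2.1 k)) := by
  rw [Metric.tendsto_nhds]
  intro ε hε
  obtain ⟨_, ⟨f, rfl⟩, hf⟩ := Metric.mem_closure_iff.1 hV (ε / 4) (by positivity)
  have hf' : dist V (toXS q f) < ε / 4 := hf
  have hU : V - toXS q f ∈ WS d q := (WS d q).sub_mem hV (toXS_mem f)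
  set U := V - toXS q f with hUdef
  have hUk : ‖U.2.1 k‖ < ε / 4 := by
    refine lt_of_le_of_lt ?_ (by rw [dist_eq_norm] at hf'; exact hf')
    exact (norm_le_pi_norm U.2.1 k).trans ((norm_fst_le U.2).trans (norm_snd_le U))
  set M := ‖(∂_{unitVec k} (∂_{unitVec k} f) : 𝓢(Rd d, ℂ)).toLp 2 volume‖ with hM
  have hM0 : 0 ≤ M := norm_nonneg _
  have hsmall : ∀ᶠ h : ℝ in 𝓝[≠] 0, |h| * (3 * M) < ε / 4 := by
    have : Tendsto (fun h : ℝ => |h| * (3 * M)) (𝓝[≠] 0) (𝓝 (|0| * (3 * M))) :=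
      ((continuous_abs.mul continuous_const).tendsto 0).mono_left nhdsWithin_le_nhds
    rw [abs_zero, zero_mul] at this
    exact this.eventually (gt_mem_nhds (by positivity))
  filter_upwards [hsmall, self_mem_nhdsWithin] with h h1 h0
  have h0 : h ≠ 0 := h0
  have hpos : 0 < |h| := abs_pos.2 h0
  have hinv : ‖((h⁻¹ : ℝ) : ℂ)‖ = |h|⁻¹ := by rw [Complex.norm_real, Real.norm_eq_abs, abs_inv]
  rw [dist_eq_norm]
  have hd1 : V.1 = U.1 + f.toLp 2 volume := (sub_add_cancel V.1 (toXS q f).1).symm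
  have hd2 : V.2.1 k = U.2.1 k + (∂_{unitVec k} f : 𝓢(Rd d, ℂ)).toLp 2 volume :=
    (sub_add_cancel (V.2.1 k) ((toXS q f).2.1 k)).symm
  rw [hd1, hd2, map_add, trL_toLp]
  set A := trL (h • unitVec k) U.1 - U.1 with hA
  set B := (trS (h • unitVec k) f).toLp 2 volume - f.toLp 2 volume -
        (h : ℂ) • (∂_{unitVec k} f : 𝓢(Rd d, ℂ)).toLp 2 volume with hB
  have e : ((h⁻¹ : ℝ) : ℂ) • (trL (h • unitVec k) U.1 + (trS (h • unitVec k) f).toLp 2 volume -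
      (U.1 + f.toLp 2 volume)) - (U.2.1 k + (∂_{unitVec k} f : 𝓢(Rd d, ℂ)).toLp 2 volume) =
      ((h⁻¹ : ℝ) : ℂ) • A + ((h⁻¹ : ℝ) : ℂ) • B - U.2.1 k := by
    have hc : ((h⁻¹ : ℝ) : ℂ) * (h : ℂ) = 1 := by
      rw [← Complex.ofReal_mul, inv_mul_cancel₀ h0, Complex.ofReal_one]
    rw [hA, hB, smul_sub, smul_sub, smul_sub, smul_sub, smul_smul, hc, one_smul, smul_add, smul_add]
    abel
  rw [e]
  have hA' : ‖((h⁻¹ : ℝ) : ℂ) • A‖ ≤ ‖U.2.1 k‖ := by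
    rw [norm_smul, hinv, inv_mul_le_iff₀ hpos]
    exact norm_trL_sub_le hU h k
  have hB' : ‖((h⁻¹ : ℝ) : ℂ) • B‖ ≤ |h| * (3 * M) := by
    rw [norm_smul, hinv, inv_mul_le_iff₀ hpos]
    refine (norm_trS_sub_sub_le h k f).trans_eq ?_
    rw [← sq_abs]; ring
  calc _ ≤ ‖((h⁻¹ : ℝ) : ℂ) • A‖ + ‖((h⁻¹ : ℝ) : ℂ) • B‖ + ‖U.2.1 k‖ :=
        (norm_sub_le _ _).trans (by gcongr; exact norm_add_le _ _)
    _ < ε := by linarith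

end Translation

section Conjugation

/-- Complex conjugation on `L^q`. -/
def conjL : LL d q →L[ℝ] LL d q := (Complex.conjCLE : ℂ →L[ℝ] ℂ).compLpL q volume

lemma coeFn_conjL (f : LL d q) : conjL f =ᵐ[volume] fun x => (starRingEnd ℂ) (f x) :=
  (Complex.conjCLE : ℂ →L[ℝ] ℂ).coeFn_compLp f

/-- Complex conjugation on `XS d q`. -/
def conjXS (V : XS d q) : XS d q := (conjL V.1, fun k => conjL (V.2.1 k), conjL V.2.2)

lemma continuous_conjXS : Continuous (conjXS : XS d q → XS d q) := by
  unfold conjXS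
  have h : ∀ r : ℝ≥0∞, [Fact (1 ≤ r)] → Continuous (conjL : LL d r → LL d r) :=
    fun r _ => conjL.continuous
  refine ((h 2).comp continuous_fst).prodMk (Continuous.prodMk (continuous_pi fun k => ?_) ?_)
  · exact (h 2).comp (by fun_prop)
  · exact (h q).comp (by fun_prop)

lemma conjL_toLp (f : 𝓢(Rd d, ℂ)) :
    conjL (f.toLp q volume) = (f.postcompCLM (Complex.conjCLE : ℂ →L[ℝ] ℂ)).toLp q volume := by
  apply Lp.ext
  filter_upwards [coeFn_conjL (f.toLp q volume), f.coeFn_toLp q volume,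
    (f.postcompCLM (Complex.conjCLE : ℂ →L[ℝ] ℂ)).coeFn_toLp q volume] with x h1 h2 h3
  rw [h1, h2, h3, SchwartzMap.postcompCLM_apply]
  rfl

lemma conjXS_mem {V : XS d q} (hV : V ∈ WS d q) : conjXS V ∈ WS d q := by
  refine WS_induction (P := fun V => conjXS V ∈ WS d q)
    ((Submodule.isClosed_topologicalClosure _).preimage continuous_conjXS) (fun f => ?_) hV
  have : conjXS (toXS q f) = toXS q (f.postcompCLM (Complex.conjCLE : ℂ →L[ℝ] ℂ)) := by
    refine Prod.ext ?_ (Prod.ext (funext fun k => ?_) ?_)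
    · exact conjL_toLp f
    · rw [toXS_grad, lineDeriv_conj]; exact conjL_toLp _
    · exact conjL_toLp f
  rw [this]
  exact toXS_mem _

end Conjugation

section Multiplication

/-- Multiplication by a bounded measurable real function (zero if the function is not so). -/
def mulL (Y : Rd d → ℝ) : LL d q →L[ℂ] LL d q :=
  open Classical in
  if h : MemLp (fun x => (Y x : ℂ)) ⊤ (volume : Measure (Rd d)) then
    (ContinuousLinearMap.mul ℂ ℂ).holderL volume ⊤ q q h.toLp
  else 0

lemma coeFn_mulL {Y : Rd d → ℝ} (h : MemLp (fun x => (Y x : ℂ)) ⊤ (volume : Measure (Rd d)))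
    (f : LL d q) : mulL Y f =ᵐ[volume] fun x => Y x * f x := by
  have e : mulL Y f = (ContinuousLinearMap.mul ℂ ℂ).holder q h.toLp f := by
    rw [mulL, dif_pos h]; rfl
  rw [e]
  filter_upwards [(ContinuousLinearMap.mul ℂ ℂ).coeFn_holder (r := q) h.toLp f, h.coeFn_toLp]
    with x h1 h2
  rw [h1, h2]
  rfl

/-- Continuously differentiable functions that are bounded together with their gradients. -/
structure IsWeight (Y : Rd d → ℝ) : Prop where
  contDiff : ContDiff ℝ 1 Y
  bdd : ∃ C, ∀ x, |Y x| ≤ C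
  bdd_fderiv : ∃ C, ∀ x, ‖fderiv ℝ Y x‖ ≤ C

/-- The partial derivative of a real function. -/
def pderiv (k : Fin d) (Y : Rd d → ℝ) (x : Rd d) : ℝ := fderiv ℝ Y x (unitVec k)

lemma memLp_top_of_bdd {Y : Rd d → ℝ} (hY : Continuous Y) {C : ℝ} (hC : ∀ x, |Y x| ≤ C) :
    MemLp (fun x => (Y x : ℂ)) ⊤ (volume : Measure (Rd d)) :=
  memLp_top_of_bound (Complex.continuous_ofReal.comp hY).aestronglyMeasurable C
    (ae_of_all _ fun x => by simpa using hC x)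

lemma IsWeight.memLp {Y : Rd d → ℝ} (hY : IsWeight Y) :
    MemLp (fun x => (Y x : ℂ)) ⊤ (volume : Measure (Rd d)) :=
  memLp_top_of_bdd hY.contDiff.continuous hY.bdd.choose_spec

lemma IsWeight.continuous_pderiv {Y : Rd d → ℝ} (hY : IsWeight Y) (k : Fin d) :
    Continuous (pderiv k Y) :=
  (hY.contDiff.continuous_fderiv one_ne_zero).clm_apply continuous_const

lemma IsWeight.abs_pderiv_le {Y : Rd d → ℝ} {C : ℝ} (hC : ∀ x, ‖fderiv ℝ Y x‖ ≤ C) (k : Fin d)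
    (x : Rd d) : |pderiv k Y x| ≤ C := by
  have := (fderiv ℝ Y x).le_opNorm (unitVec k)
  rw [PiLp.norm_single, norm_one, mul_one] at this
  exact this.trans (hC x)

lemma IsWeight.memLp_pderiv {Y : Rd d → ℝ} (hY : IsWeight Y) (k : Fin d) :
    MemLp (fun x => (pderiv k Y x : ℂ)) ⊤ (volume : Measure (Rd d)) :=
  memLp_top_of_bdd (hY.continuous_pderiv k) (IsWeight.abs_pderiv_le hY.bdd_fderiv.choose_spec k)

/-- Multiplication by a weight on `XS d q`. -/
def mulXS (Y : Rd d → ℝ) : XS d q →L[ℂ] XS d q :=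
  ((mulL Y).comp (ContinuousLinearMap.fst ℂ _ _)).prod
    ((ContinuousLinearMap.pi fun k => (mulL Y).comp ((ContinuousLinearMap.proj k).comp
        ((ContinuousLinearMap.fst ℂ _ _).comp (ContinuousLinearMap.snd ℂ _ _))) +
      (mulL (pderiv k Y)).comp (ContinuousLinearMap.fst ℂ _ _)).prod
    ((mulL Y).comp ((ContinuousLinearMap.snd ℂ _ _).comp (ContinuousLinearMap.snd ℂ _ _))))

lemma mulXS_fst (Y : Rd d → ℝ) (V : XS d q) : (mulXS Y V).1 = mulL Y V.1 := rfl
lemma mulXS_grad (Y : Rd d → ℝ) (V : XS d q) (k : Fin d) :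
    (mulXS Y V).2.1 k = mulL Y (V.2.1 k) + mulL (pderiv k Y) V.1 := rfl
lemma mulXS_snd (Y : Rd d → ℝ) (V : XS d q) : (mulXS Y V).2.2 = mulL Y V.2.2 := rfl

/-- For Y merely C¹ the product with a Schwartz function is not Schwartz. The product rule is
therefore verified by integration by parts, and membership follows from the characterization of `WS`
by coherence. -/
lemma mulXS_mem {q' : ℝ≥0∞} [Fact (1 ≤ q')] [q'.HolderConjugate q] (hS : SobolevBound d q)
    {Y : Rd d → ℝ} (hY : IsWeight Y) {V : XS d q} (hV : V ∈ WS d q) : mulXS Y V ∈ WS d q := by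
  refine WS_induction (P := fun V => mulXS Y V ∈ WS d q)
    ((Submodule.isClosed_topologicalClosure _).preimage (mulXS Y).continuous) (fun f => ?_) hV
  refine mem_WS_of_isGradL2 (q' := q') hS (fun η k => ?_) ?_
  · rw [mulXS_fst, mulXS_grad, pairing_toLp, pairing_toLp, toXS_fst, toXS_grad]
    set f' : 𝓢(Rd d, ℂ) := ∂_{unitVec k} f with hf'
    have hYd : ∀ x, DifferentiableAt ℝ Y x := hY.contDiff.differentiable one_ne_zero
    have hYd' : ∀ x, DifferentiableAt ℝ (fun x => (Y x : ℂ)) x := fun x =>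
      Complex.ofRealCLM.differentiableAt.comp x (hYd x)
    have hfd : ∀ x, fderiv ℝ (fun x => (Y x : ℂ) * f x) x (unitVec k) =
        Y x * f' x + pderiv k Y x * f x := by
      intro x
      rw [fderiv_fun_mul (hYd' x) f.differentiableAt]
      simp only [add_apply, smul_apply, smul_eq_mul,
        fderiv_ofReal_comp (hYd x), hf', SchwartzMap.lineDerivOp_apply_eq_fderiv, pderiv]
      ring
    have hYL : ∀ {Z : Rd d → ℝ}, MemLp (fun x => (Z x : ℂ)) ⊤ (volume : Measure (Rd d)) →
        ∀ g : 𝓢(Rd d, ℂ), MemLp (fun x => (Z x : ℂ) * g x) 2 (volume : Measure (Rd d)) :=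
      fun hZ g => (g.memLp 2 volume).mul hZ
    have i1 : Integrable (fun x => (∂_{unitVec k} η : 𝓢(Rd d, ℂ)) x * (Y x * f x)) :=
      integrable_mul_Lp ((∂_{unitVec k} η : 𝓢(Rd d, ℂ)).memLp 2 volume) (hYL hY.memLp f)
    have i2 : Integrable (fun x => η x * (Y x * f' x + pderiv k Y x * f x)) :=
      integrable_mul_Lp (η.memLp 2 volume) ((hYL hY.memLp f').add (hYL (hY.memLp_pderiv k) f))
    have i3 : Integrable (fun x => η x * (Y x * f x)) :=
      integrable_mul_Lp (η.memLp 2 volume) (hYL hY.memLp f)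
    have hibp := integral_mul_fderiv_eq_neg_fderiv_mul_of_integrable (μ := volume)
      (f := fun x => (Y x : ℂ) * f x) (g := η) (v := unitVec k)
      (by simp only [hfd]; exact i2.congr (ae_of_all _ fun x => mul_comm _ _))
      (by simp only [← SchwartzMap.lineDerivOp_apply_eq_fderiv]
          exact i1.congr (ae_of_all _ fun x => mul_comm _ _))
      (i3.congr (ae_of_all _ fun x => mul_comm _ _))
      (fun x _ => (hYd' x).mul f.differentiableAt) (fun x _ => η.differentiableAt)
    simp only [hfd, ← SchwartzMap.lineDerivOp_apply_eq_fderiv] at hibp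
    have ha : ∫ x, (∂_{unitVec k} η : 𝓢(Rd d, ℂ)) x * mulL Y (f.toLp 2 volume) x =
        ∫ x, (Y x : ℂ) * f x * (∂_{unitVec k} η : 𝓢(Rd d, ℂ)) x := by
      apply integral_congr_ae
      filter_upwards [coeFn_mulL hY.memLp (f.toLp 2 volume), f.coeFn_toLp 2 volume] with x h1 h2
      rw [h1, h2]; ring
    have hb : ∫ x, η x * (mulL Y (f'.toLp 2 volume) + mulL (pderiv k Y) (f.toLp 2 volume)) x =
        ∫ x, ((Y x : ℂ) * f' x + pderiv k Y x * f x) * η x := by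
      apply integral_congr_ae
      filter_upwards [coeFn_mulL hY.memLp (f'.toLp 2 volume), f'.coeFn_toLp 2 volume,
        coeFn_mulL (hY.memLp_pderiv k) (f.toLp 2 volume), f.coeFn_toLp 2 volume,
        Lp.coeFn_add (mulL Y (f'.toLp 2 volume)) (mulL (pderiv k Y) (f.toLp 2 volume))]
        with x h1 h2 h3 h4 h5
      rw [h5, Pi.add_apply, h1, h2, h3, h4]; ring
    rw [ha, hb, hibp]
  · rw [mulXS_fst, mulXS_snd, toXS_fst, toXS_snd]
    filter_upwards [coeFn_mulL hY.memLp (f.toLp 2 volume), f.coeFn_toLp 2 volume,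
      coeFn_mulL hY.memLp (f.toLp q volume), f.coeFn_toLp q volume] with x h1 h2 h3 h4
    rw [h1, h2, h3, h4]

end Multiplication

end InteractionMorawetz

end

/-! ### Weak solutions and the product rule -/

noncomputable section
open MeasureTheory Filter Topology
open scoped ContDiff ENNReal SchwartzMap FourierTransform RealInnerProductSpace Laplacian LineDeriv
namespace InteractionMorawetz

variable {d : ℕ} {q q' : ℝ≥0∞} [Fact (1 ≤ q)] [Fact (1 ≤ q')] [q.HolderConjugate q']

/-- The right-hand side `V ↦ i (-∫ ∇V · ∇W - ∫ V F)` of the weak equation. -/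
def rhsL (W : XS d q) (F : LL d q') : XS d q →L[ℂ] ℂ :=
  Complex.I • (-(∑ k, ((pairing volume 2 2).flip (W.2.1 k)).comp ((ContinuousLinearMap.proj k).comp
      ((ContinuousLinearMap.fst ℂ _ _).comp (ContinuousLinearMap.snd ℂ _ _)))) -
    ((pairing volume q q').flip F).comp
      ((ContinuousLinearMap.snd ℂ _ _).comp (ContinuousLinearMap.snd ℂ _ _)))

lemma rhsL_apply (W : XS d q) (F : LL d q') (V : XS d q) :
    rhsL W F V = Complex.I * (-(∑ k, pairing volume 2 2 (V.2.1 k) (W.2.1 k)) -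
      pairing volume q q' V.2.2 F) := by
  simp only [rhsL, smul_apply, smul_eq_mul, sub_apply, neg_apply, sum_apply]
  rfl

lemma continuous_rhsL {Z : Type*} [TopologicalSpace Z] {w : Z → XS d q} {F : Z → LL d q'}
    (hw : Continuous w) (hF : Continuous F) : Continuous fun z => rhsL (w z) (F z) := by
  have h1 : ∀ k : Fin d, Continuous fun z => (pairing volume 2 2).flip ((w z).2.1 k) := fun k =>
    (pairing volume 2 2).flip.continuous.comp
      ((continuous_pi_iff.1 (continuous_fst.comp (continuous_snd.comp hw))) k)
  have h2 : Continuous fun z => (pairing volume q q').flip (F z) :=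
    (pairing volume q q').flip.continuous.comp hF
  unfold rhsL
  refine Continuous.const_smul ?_ Complex.I
  refine Continuous.sub ?_ ?_
  · refine Continuous.neg ?_
    refine continuous_finsetSum Finset.univ fun k _ => ?_
    exact (h1 k).clm_comp continuous_const
  · exact h2.clm_comp continuous_const

/-- `w ∈ C(ℝ, H¹)` is a weak solution of `i ∂ₜ w + Δ w = F` with `F ∈ C(ℝ, L^q')`. -/
structure Solves (w : ℝ → XS d q) (F : ℝ → LL d q') : Prop where
  cont : Continuous w
  cont_rhs : Continuous F
  mem : ∀ t, w t ∈ WS d q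
  hasDerivAt : ∀ V ∈ WS d q, ∀ t, HasDerivAt (fun s => pairing volume 2 2 V.1 (w s).1)
    (rhsL (w t) (F t) V) t

/-- Derivatives at a point do not pass to limits of test functions, but the integrated identity
does. It is extended by density to all of `WS` and differentiated again, the right-hand side being
continuous in time in operator norm. -/
lemma solves_of_test {w : ℝ → XS d q} {F : ℝ → LL d q'} (hw : Continuous w) (hF : Continuous F)
    (hmem : ∀ t, w t ∈ WS d q)
    (h : ∀ η : Rd d → ℝ, ContDiff ℝ ∞ η → HasCompactSupport η →
      ∀ f : 𝓢(Rd d, ℂ), (∀ x, f x = η x) → ∀ t,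
      HasDerivAt (fun s => pairing volume 2 2 (f.toLp 2 volume) (w s).1)
        (rhsL (w t) (F t) (toXS q f)) t) : Solves w F := by
  have hR : Continuous fun τ => rhsL (w τ) (F τ) := continuous_rhsL hw hF
  have key : ∀ s t : ℝ, ∀ V ∈ WS d q, pairing volume 2 2 V.1 (w t).1 - pairing volume 2 2 V.1 (w s).1 =
      ∫ τ in s..t, rhsL (w τ) (F τ) V := by
    intro s t V hV
    have hint : ∀ V, (∫ τ in s..t, rhsL (w τ) (F τ)) V = ∫ τ in s..t, rhsL (w τ) (F τ) V := fun V =>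
      ContinuousLinearMap.intervalIntegral_apply (hR.intervalIntegrable s t) V
    obtain ⟨Λ, hΛ⟩ : ∃ Λ : XS d q →L[ℂ] ℂ, ∀ V, Λ V = pairing volume 2 2 V.1 (w t).1 -
        pairing volume 2 2 V.1 (w s).1 - (∫ τ in s..t, rhsL (w τ) (F τ)) V :=
      ⟨((pairing volume 2 2).flip (w t).1).comp (ContinuousLinearMap.fst ℂ _ _) -
        ((pairing volume 2 2).flip (w s).1).comp (ContinuousLinearMap.fst ℂ _ _) -
          ∫ τ in s..t, rhsL (w τ) (F τ), fun _ => rfl⟩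
    have h0 : Λ V = 0 := by
      refine WS_induction (P := fun V => Λ V = 0) (isClosed_eq Λ.continuous continuous_const)
        (fun f => toXS_ext (fun η hη hηc f hf => ?_) f) hV
      rw [hΛ, hint, toXS_fst, sub_eq_zero]
      refine (intervalIntegral.integral_eq_sub_of_hasDerivAt (fun τ _ => h η hη hηc f hf τ) ?_).symm
      exact (hR.clm_apply continuous_const).intervalIntegrable _ _
    rw [hΛ, hint, sub_eq_zero] at h0
    exact h0
  refine ⟨hw, hF, hmem, fun V hV t => ?_⟩
  have h1 : HasDerivAt (fun u => ∫ τ in t..u, rhsL (w τ) (F τ) V) (rhsL (w t) (F t) V) t :=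
    ((hR.clm_apply continuous_const).integral_hasStrictDerivAt t t).hasDerivAt
  have h2 : (fun s => pairing volume 2 2 V.1 (w s).1) =
      fun s => (∫ τ in t..s, rhsL (w τ) (F τ) V) + pairing volume 2 2 V.1 (w t).1 := by
    funext s
    rw [← key t s V hV, sub_add_cancel]
  rw [h2]
  exact h1.add_const _

namespace Solves

variable {w w₁ w₂ : ℝ → XS d q} {F F₁ F₂ : ℝ → LL d q'}

lemma sub (h₁ : Solves w₁ F₁) (h₂ : Solves w₂ F₂) :
    Solves (fun t => w₁ t - w₂ t) (fun t => F₁ t - F₂ t) := by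
  refine ⟨h₁.cont.sub h₂.cont, h₁.cont_rhs.sub h₂.cont_rhs,
    fun t => (WS d q).sub_mem (h₁.mem t) (h₂.mem t), fun V hV t => ?_⟩
  have e : rhsL (w₁ t - w₂ t) (F₁ t - F₂ t) V = rhsL (w₁ t) (F₁ t) V - rhsL (w₂ t) (F₂ t) V := by
    simp only [rhsL_apply, Prod.snd_sub, Prod.fst_sub, Pi.sub_apply, map_sub, Finset.sum_sub_distrib]
    ring
  rw [e]
  have h := (h₁.hasDerivAt V hV t).sub (h₂.hasDerivAt V hV t)
  refine h.congr_of_eventuallyEq (Eventually.of_forall fun s => ?_)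
  simp only [Prod.fst_sub, map_sub, Pi.sub_apply]

/-- The adjoint of a translation for the pairing is the opposite translation, which preserves the
space of test functions. -/
lemma translate (h : Solves w F) (a : Rd d) :
    Solves (fun t => trXS a (w t)) (fun t => trL a (F t)) := by
  refine ⟨(trXS a).continuous.comp h.cont, (trL a).continuous.comp h.cont_rhs,
    fun t => trXS_mem a (h.mem t), fun V hV t => ?_⟩
  have h1 := h.hasDerivAt (trXS (-a) V) (trXS_mem (-a) hV) t
  have e : rhsL (trXS a (w t)) (trL a (F t)) V = rhsL (w t) (F t) (trXS (-a) V) := by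
    simp only [rhsL_apply, trXS_grad, trXS_snd, pairing_trL]
  rw [e]
  refine h1.congr_of_eventuallyEq (Eventually.of_forall fun s => ?_)
  simp only [trXS_fst, pairing_trL]

/-- Differentiation of `⟨V(s), w(s) - w(t)⟩` at `s = t` for moving test functions. -/
lemma hasDerivAt_moving (h : Solves w F) {V : ℝ → XS d q} (hV : Continuous V)
    (hVm : ∀ s, V s ∈ WS d q) (t : ℝ) :
    HasDerivAt (fun s => pairing volume 2 2 (V s).1 ((w s).1 - (w t).1)) (rhsL (w t) (F t) (V t)) t := by
  have hR : Continuous fun τ => rhsL (w τ) (F τ) := continuous_rhsL h.cont h.cont_rhs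
  obtain ⟨M, hM⟩ := (isCompact_Icc (a := t - 1) (b := t + 1)).exists_bound_of_continuousOn
    hR.continuousOn
  -- The solution is Lipschitz in time as a functional on `WS`, by the mean value inequality and the
  -- local bound M for the right-hand side.
  have hbound : ∀ U ∈ WS d q, ∀ s ∈ Set.Icc (t - 1) (t + 1),
      ‖pairing volume 2 2 U.1 ((w s).1 - (w t).1)‖ ≤ M * ‖U‖ * |s - t| := by
    intro U hU s hs
    have := (convex_Icc (t - 1) (t + 1)).norm_image_sub_le_of_norm_hasDerivWithin_le
      (f := fun s => pairing volume 2 2 U.1 (w s).1) (f' := fun s => rhsL (w s) (F s) U)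
      (C := M * ‖U‖) (fun x _ => (h.hasDerivAt U hU x).hasDerivWithinAt)
      (fun x hx => (ContinuousLinearMap.le_opNorm _ _).trans
        (mul_le_mul_of_nonneg_right (hM x hx) (norm_nonneg _)))
      (⟨by linarith, by linarith⟩ : t ∈ Set.Icc (t - 1) (t + 1)) hs
    rw [map_sub]
    exact this
  have h0 := h.hasDerivAt (V t) (hVm t) t
  have h1 : HasDerivAt (fun s => pairing volume 2 2 (V t).1 ((w s).1 - (w t).1))
      (rhsL (w t) (F t) (V t)) t := by
    refine (h0.sub_const (pairing volume 2 2 (V t).1 (w t).1)).congr_of_eventuallyEq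
      (Eventually.of_forall fun s => ?_)
    simp only [map_sub]
  -- Moving the test function contributes nothing: the increment is at most M ‖V s - V t‖ |s - t|,
  -- and the first factor tends to zero.
  have h2 : HasDerivAt (fun s => pairing volume 2 2 (V s - V t).1 ((w s).1 - (w t).1)) 0 t := by
    rw [hasDerivAt_iff_isLittleO, Asymptotics.isLittleO_iff]
    intro c hc
    have hVt : Tendsto (fun s => M * ‖V s - V t‖) (𝓝 t) (𝓝 (M * ‖V t - V t‖)) :=
      (continuous_const.mul (hV.sub continuous_const).norm).tendsto t
    rw [sub_self, norm_zero, mul_zero] at hVt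
    filter_upwards [hVt.eventually (gt_mem_nhds hc),
      Icc_mem_nhds (by linarith : t - 1 < t) (by linarith : t < t + 1)] with s hs1 hs2
    have hb := hbound (V s - V t) ((WS d q).sub_mem (hVm s) (hVm t)) s hs2
    have e : pairing volume 2 2 (V s - V t).1 ((w s).1 - (w t).1) -
        pairing volume 2 2 (V t - V t).1 ((w t).1 - (w t).1) - (s - t) • (0 : ℂ) =
        pairing volume 2 2 (V s - V t).1 ((w s).1 - (w t).1) := by
      rw [sub_self (w t).1, map_zero, sub_zero, smul_zero, sub_zero]
    rw [e]
    exact hb.trans (mul_le_mul_of_nonneg_right hs1.le (abs_nonneg _))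
  have h3 := h1.add h2
  rw [add_zero] at h3
  refine h3.congr_of_eventuallyEq (Eventually.of_forall fun s => ?_)
  simp only [Pi.add_apply, Prod.fst_sub]
  rw [← add_apply, ← map_add, add_sub_cancel]

end Solves

lemma pairing_mul_conj_symm {Y : Rd d → ℝ} (hY : IsWeight Y) (a b : LL d 2) :
    pairing volume 2 2 (mulL Y (conjL a)) b =
      (starRingEnd ℂ) (pairing volume 2 2 (mulL Y (conjL b)) a) := by
  rw [pairing_apply, pairing_apply, ← integral_conj]
  apply integral_congr_ae
  filter_upwards [coeFn_mulL hY.memLp (conjL a), coeFn_mulL hY.memLp (conjL b), coeFn_conjL a,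
    coeFn_conjL b] with x h1 h2 h3 h4
  rw [h1, h2, h3, h4]
  simp only [map_mul, Complex.conj_conj, Complex.conj_ofReal]
  ring

/-- Neither factor is differentiable in L². Split ⟨a(s), b(s)⟩ into ⟨a(s), b(s) - b(t)⟩, a moving
test function for b, and ⟨a(s), b(t)⟩, which is the conjugate of a fixed test function applied to a.
-/
lemma hasDerivAt_pairing_conj [q'.HolderConjugate q] (hS : SobolevBound d q) {Y : Rd d → ℝ}
    (hY : IsWeight Y) {a b : ℝ → XS d q} {Fa Fb : ℝ → LL d q'} (ha : Solves a Fa) (hb : Solves b Fb)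
    (t : ℝ) :
    HasDerivAt (fun s => pairing volume 2 2 (mulL Y (conjL (a s).1)) (b s).1)
      (rhsL (b t) (Fb t) (mulXS Y (conjXS (a t))) +
        (starRingEnd ℂ) (rhsL (a t) (Fa t) (mulXS Y (conjXS (b t))))) t := by
  have h1 := hb.hasDerivAt_moving (V := fun s => mulXS Y (conjXS (a s)))
    ((mulXS Y).continuous.comp (continuous_conjXS.comp ha.cont))
    (fun s => mulXS_mem (q' := q') hS hY (conjXS_mem (ha.mem s))) t
  have h2 := ha.hasDerivAt (mulXS Y (conjXS (b t))) (mulXS_mem (q' := q') hS hY (conjXS_mem (hb.mem t))) t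
  have h3 := (Complex.conjCLE : ℂ →L[ℝ] ℂ).hasFDerivAt.comp_hasDerivAt t h2
  refine (h1.add h3).congr_of_eventuallyEq (Eventually.of_forall fun s => ?_)
  have e : (starRingEnd ℂ) (pairing volume 2 2 (mulL Y (conjL (b t).1)) (a s).1) =
      pairing volume 2 2 (mulL Y (conjL (a s).1)) (b t).1 := (pairing_mul_conj_symm hY _ _).symm
  have e' : ((Complex.conjCLE : ℂ →L[ℝ] ℂ) ∘ fun s => pairing volume 2 2
      (mulXS Y (conjXS (b t))).1 (a s).1) s =
      pairing volume 2 2 (mulL Y (conjL (a s).1)) (b t).1 := e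
  rw [Pi.add_apply, e', map_sub]
  exact (sub_add_cancel _ _).symm

lemma integrable_conj_mul {r r' : ℝ≥0∞} [Fact (1 ≤ r)] [Fact (1 ≤ r')] [r.HolderConjugate r']
    (f : LL d r) (g : LL d r') : Integrable (fun x => (starRingEnd ℂ) (f x) * g x) :=
  integrable_mul_Lp ((Lp.memLp f).star) (Lp.memLp g)

lemma integrable_weight_mul {Y : Rd d → ℝ}
    (hY : MemLp (fun x => (Y x : ℂ)) ⊤ (volume : Measure (Rd d))) {f : Rd d → ℂ}
    (hf : Integrable f) : Integrable (fun x => (Y x : ℂ) * f x) :=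
  memLp_one_iff_integrable.1 ((memLp_one_iff_integrable.2 hf).mul hY)

lemma pairing_mul_conj {r r' : ℝ≥0∞} [Fact (1 ≤ r)] [Fact (1 ≤ r')] [r.HolderConjugate r']
    {Y : Rd d → ℝ} (hY : MemLp (fun x => (Y x : ℂ)) ⊤ (volume : Measure (Rd d))) (f : LL d r)
    (g : LL d r') :
    pairing volume r r' (mulL Y (conjL f)) g = ∫ x, (Y x : ℂ) * ((starRingEnd ℂ) (f x) * g x) := by
  rw [pairing_apply]
  apply integral_congr_ae
  filter_upwards [coeFn_mulL hY (conjL f), coeFn_conjL f] with x h1 h2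
  rw [h1, h2, mul_assoc]

/-- The product rule for `∫ Y conj(a) b` along two weak solutions. -/
lemma hasDerivAt_integral_conj_mul [q'.HolderConjugate q] (hS : SobolevBound d q) {Y : Rd d → ℝ}
    (hY : IsWeight Y) {a b : ℝ → XS d q} {Fa Fb : ℝ → LL d q'} (ha : Solves a Fa) (hb : Solves b Fb)
    (t : ℝ) :
    HasDerivAt (fun s => ∫ x, (Y x : ℂ) * ((starRingEnd ℂ) ((a s).1 x) * (b s).1 x))
      (Complex.I * (-(∑ k, ∫ x, (pderiv k Y x : ℂ) * ((starRingEnd ℂ) ((a t).1 x) * (b t).2.1 k x -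
          (starRingEnd ℂ) ((a t).2.1 k x) * (b t).1 x)) -
        ∫ x, (Y x : ℂ) * ((starRingEnd ℂ) ((a t).2.2 x) * Fb t x -
          (starRingEnd ℂ) (Fa t x) * (b t).2.2 x))) t := by
  have h := hasDerivAt_pairing_conj hS hY ha hb t
  simp only [pairing_mul_conj hY.memLp] at h
  convert h using 1
  have conj_int : ∀ (Z : Rd d → ℝ) (f g : Rd d → ℂ),
      (starRingEnd ℂ) (∫ x, (Z x : ℂ) * ((starRingEnd ℂ) (f x) * g x)) =
      ∫ x, (Z x : ℂ) * ((starRingEnd ℂ) (g x) * f x) := by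
    intro Z f g
    rw [← integral_conj]
    congr 1; funext x
    simp only [map_mul, Complex.conj_conj, Complex.conj_ofReal]; ring
  have hfst : ∀ V : XS d q, (conjXS V).1 = conjL V.1 := fun _ => rfl
  have hgr : ∀ (V : XS d q) k, (conjXS V).2.1 k = conjL (V.2.1 k) := fun _ _ => rfl
  have hsnd : ∀ V : XS d q, (conjXS V).2.2 = conjL V.2.2 := fun _ => rfl
  simp only [rhsL_apply, mulXS_grad, mulXS_snd, hfst, hgr, hsnd, map_add, map_sub, map_neg, map_mul,
    map_sum, Complex.conj_I, add_apply, pairing_mul_conj hY.memLp, pairing_mul_conj (hY.memLp_pderiv _),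
    conj_int]
  have i1 : ∀ k, ∫ x, (pderiv k Y x : ℂ) * ((starRingEnd ℂ) ((a t).1 x) * (b t).2.1 k x -
          (starRingEnd ℂ) ((a t).2.1 k x) * (b t).1 x) =
      (∫ x, (pderiv k Y x : ℂ) * ((starRingEnd ℂ) ((a t).1 x) * (b t).2.1 k x)) -
      ∫ x, (pderiv k Y x : ℂ) * ((starRingEnd ℂ) ((a t).2.1 k x) * (b t).1 x) := by
    intro k
    rw [← integral_sub (integrable_weight_mul (hY.memLp_pderiv k) (integrable_conj_mul _ _))
      (integrable_weight_mul (hY.memLp_pderiv k) (integrable_conj_mul _ _))]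
    simp only [mul_sub]
  have i2 : ∫ x, (Y x : ℂ) * ((starRingEnd ℂ) ((a t).2.2 x) * Fb t x -
          (starRingEnd ℂ) (Fa t x) * (b t).2.2 x) =
      (∫ x, (Y x : ℂ) * ((starRingEnd ℂ) ((a t).2.2 x) * Fb t x)) -
      ∫ x, (Y x : ℂ) * ((starRingEnd ℂ) (Fa t x) * (b t).2.2 x) := by
    rw [← integral_sub (integrable_weight_mul hY.memLp (integrable_conj_mul _ _))
      (integrable_weight_mul hY.memLp (integrable_conj_mul _ _))]
    simp only [mul_sub]
  simp only [i1, i2, Finset.sum_add_distrib, Finset.sum_sub_distrib]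
  ring

end InteractionMorawetz

end

/-! ### Schur's test and Duhamel's formula -/

noncomputable section
open MeasureTheory Filter Topology
open scoped ContDiff ENNReal SchwartzMap FourierTransform RealInnerProductSpace Laplacian LineDeriv
namespace InteractionMorawetz

section Schur

variable {a b σ : ℝ}

lemma intervalIntegrable_abs_sub_rpow (hσ : σ < 1) (t c e : ℝ) :
    IntervalIntegrable (fun s => |t - s| ^ (-σ)) volume c e := by
  have h0 : ∀ c : ℝ, IntervalIntegrable (fun r : ℝ => |r| ^ (-σ)) volume 0 c := by
    intro c
    rcases le_total 0 c with hc | hc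
    · refine (intervalIntegral.intervalIntegrable_rpow' (r := -σ) (by linarith)).congr fun x hx => ?_
      rw [Set.uIoc_of_le hc] at hx
      simp only [abs_of_pos hx.1]
    · have h1 : IntervalIntegrable (fun r : ℝ => r ^ (-σ)) volume 0 (-c) :=
        intervalIntegral.intervalIntegrable_rpow' (r := -σ) (by linarith)
      have h2 := h1.comp_sub_left 0
      simp only [sub_self, zero_sub, neg_neg] at h2
      refine h2.congr fun x hx => ?_
      rw [Set.uIoc_of_ge hc] at hx
      simp only [abs_of_nonpos hx.2]
  have h1 : IntervalIntegrable (fun r : ℝ => |r| ^ (-σ)) volume (t - c) (t - e) :=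
    (h0 _).symm.trans (h0 _)
  simpa using h1.comp_sub_left t

/-- Splitting at the singularity gives two explicit powers, each at most (b-a)^{1-σ}/(1-σ); hence
the factor 2. -/
lemma integral_abs_sub_rpow_le (hσ : σ < 1) {t : ℝ} (ht : t ∈ Set.Icc a b) :
    ∫ s in a..b, |t - s| ^ (-σ) ≤ 2 * (b - a) ^ (1 - σ) / (1 - σ) := by
  have hp : ∀ L : ℝ, 0 ≤ L → ∫ r in (0 : ℝ)..L, |r| ^ (-σ) = L ^ (1 - σ) / (1 - σ) := by
    intro L hL
    have : ∫ r in (0 : ℝ)..L, |r| ^ (-σ) = ∫ r in (0 : ℝ)..L, r ^ (-σ) := by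
      refine intervalIntegral.integral_congr fun x hx => ?_
      rw [Set.uIcc_of_le hL] at hx
      simp only [abs_of_nonneg hx.1]
    rw [this, integral_rpow (Or.inl (by linarith)), Real.zero_rpow (by linarith), sub_zero,
      neg_add_eq_sub]
  have h1 : ∫ s in a..t, |t - s| ^ (-σ) = (t - a) ^ (1 - σ) / (1 - σ) := by
    rw [intervalIntegral.integral_comp_sub_left (fun r => |r| ^ (-σ)), sub_self,
      hp _ (sub_nonneg.2 ht.1)]
  have h2 : ∫ s in t..b, |t - s| ^ (-σ) = (b - t) ^ (1 - σ) / (1 - σ) := by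
    simp only [abs_sub_comm t]
    rw [intervalIntegral.integral_comp_sub_right (fun r => |r| ^ (-σ)), sub_self,
      hp _ (sub_nonneg.2 ht.2)]
  rw [← intervalIntegral.integral_add_adjacent_intervals (intervalIntegrable_abs_sub_rpow hσ t a t)
    (intervalIntegrable_abs_sub_rpow hσ t t b), h1, h2, ← add_div, two_mul]
  have : 0 < 1 - σ := by linarith
  gcongr <;> linarith [ht.1, ht.2]

lemma lintegral_abs_sub_rpow_le (hσ : σ < 1) {t : ℝ} (ht : t ∈ Set.Icc a b) :
    ∫⁻ s in Set.Ioc a b, ENNReal.ofReal (|t - s| ^ (-σ)) ≤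
      ENNReal.ofReal (2 * (b - a) ^ (1 - σ) / (1 - σ)) := by
  have hab : a ≤ b := ht.1.trans ht.2
  rw [← ofReal_integral_eq_lintegral_ofReal
    ((intervalIntegrable_iff_integrableOn_Ioc_of_le hab).1 (intervalIntegrable_abs_sub_rpow hσ t a b))
    (ae_of_all _ fun s => by positivity), ← intervalIntegral.integral_of_le hab]
  exact ENNReal.ofReal_le_ofReal (integral_abs_sub_rpow_le hσ ht)

/-- Schur's test for the kernel `|t - s|^{-σ}` on a bounded interval. -/
lemma lintegral_schur (hab : a ≤ b) (hσ : σ < 1) {C : ℝ} (hC : 0 ≤ C) {γ φ : ℝ → ℝ}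
    (hγ : Continuous γ) (hφ : Continuous φ) :
    ∫⁻ t in Set.Ioc a b, ∫⁻ s in Set.Ioc a b, ENNReal.ofReal (C * |t - s| ^ (-σ) * (γ t * φ s)) ≤
      ENNReal.ofReal (C * ((b - a) ^ (1 - σ) / (1 - σ)) * ((∫ t in a..b, γ t ^ 2) +
        ∫ t in a..b, φ t ^ 2)) := by
  set κ := 2 * (b - a) ^ (1 - σ) / (1 - σ) with hκ
  have hσ1 : 0 < 1 - σ := by linarith
  have hba : 0 ≤ b - a := sub_nonneg.2 hab
  have hκ0 : 0 ≤ κ := by positivity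
  have hmk : Measurable fun p : ℝ × ℝ => ENNReal.ofReal (|p.1 - p.2| ^ (-σ)) := by fun_prop
  -- One variable is integrated out against the kernel, at cost κ. The other half of the estimate is
  -- this one with the two times exchanged.
  have half : ∀ {γ : ℝ → ℝ}, Continuous γ → ∫⁻ t in Set.Ioc a b, ∫⁻ s in Set.Ioc a b,
      ENNReal.ofReal (C / 2 * γ t ^ 2) * ENNReal.ofReal (|t - s| ^ (-σ)) ≤
      ENNReal.ofReal (C / 2 * κ * ∫ t in a..b, γ t ^ 2) := by
    intro γ hγ
    calc _ ≤ ∫⁻ t in Set.Ioc a b, ENNReal.ofReal (C / 2 * κ * γ t ^ 2) := by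
          refine setLIntegral_mono (by fun_prop) fun t ht => ?_
          rw [lintegral_const_mul _ (by fun_prop)]
          refine (mul_le_mul_right (lintegral_abs_sub_rpow_le hσ (Set.Ioc_subset_Icc_self ht)) _).trans_eq ?_
          rw [← ENNReal.ofReal_mul (by positivity)]
          congr 1; ring
      _ = _ := by
          rw [← ofReal_integral_eq_lintegral_ofReal, ← intervalIntegral.integral_of_le hab,
            intervalIntegral.integral_const_mul]
          · exact (Continuous.integrableOn_Icc (by fun_prop)).mono_set Set.Ioc_subset_Icc_self
          · exact ae_of_all _ fun t => by positivity
  have e1 : ∫⁻ t in Set.Ioc a b, ∫⁻ s in Set.Ioc a b,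
      ENNReal.ofReal (C / 2 * φ s ^ 2) * ENNReal.ofReal (|t - s| ^ (-σ)) ≤
      ENNReal.ofReal (C / 2 * κ * ∫ t in a..b, φ t ^ 2) := by
    rw [lintegral_lintegral_swap (by
      refine Measurable.aemeasurable ?_
      have : Measurable fun p : ℝ × ℝ => ENNReal.ofReal (C / 2 * φ p.2 ^ 2) := by fun_prop
      exact this.mul hmk)]
    simp only [abs_sub_comm _]
    exact half hφ
  -- The inequality 2γφ ≤ γ² + φ² separates the two times. Working with lower integrals makes joint
  -- integrability of the singular kernel unnecessary.
  calc _ ≤ ∫⁻ t in Set.Ioc a b, ∫⁻ s in Set.Ioc a b,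
        (ENNReal.ofReal (C / 2 * γ t ^ 2) * ENNReal.ofReal (|t - s| ^ (-σ)) +
          ENNReal.ofReal (C / 2 * φ s ^ 2) * ENNReal.ofReal (|t - s| ^ (-σ))) := by
        refine lintegral_mono fun t => lintegral_mono fun s => ?_
        rw [← add_mul, ← ENNReal.ofReal_add (by positivity) (by positivity),
          ← ENNReal.ofReal_mul (by positivity)]
        refine ENNReal.ofReal_le_ofReal ?_
        have h0 : 0 ≤ C * |t - s| ^ (-σ) := by positivity
        nlinarith [mul_nonneg h0 (sq_nonneg (γ t - φ s))]
    _ = (∫⁻ t in Set.Ioc a b, ∫⁻ s in Set.Ioc a b,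
          ENNReal.ofReal (C / 2 * γ t ^ 2) * ENNReal.ofReal (|t - s| ^ (-σ))) +
        ∫⁻ t in Set.Ioc a b, ∫⁻ s in Set.Ioc a b,
          ENNReal.ofReal (C / 2 * φ s ^ 2) * ENNReal.ofReal (|t - s| ^ (-σ)) := by
        have hm : ∀ t, Measurable fun s => ENNReal.ofReal (C / 2 * γ t ^ 2) *
            ENNReal.ofReal (|t - s| ^ (-σ)) := fun t => by fun_prop
        simp only [fun t => lintegral_add_left (μ := volume.restrict (Set.Ioc a b)) (hm t)]
        rw [lintegral_add_left]
        have : Measurable fun p : ℝ × ℝ => ENNReal.ofReal (C / 2 * γ p.1 ^ 2) *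
            ENNReal.ofReal (|p.1 - p.2| ^ (-σ)) := by
          have : Measurable fun p : ℝ × ℝ => ENNReal.ofReal (C / 2 * γ p.1 ^ 2) := by fun_prop
          exact this.mul hmk
        exact this.lintegral_prod_right'
    _ ≤ _ := by
        refine (add_le_add (half hγ) e1).trans_eq ?_
        have hn : ∀ f : ℝ → ℝ, 0 ≤ ∫ t in a..b, f t ^ 2 := fun f =>
          intervalIntegral.integral_nonneg hab fun _ _ => sq_nonneg _
        rw [← ENNReal.ofReal_add (mul_nonneg (by positivity) (hn γ)) (mul_nonneg (by positivity) (hn φ))]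
        congr 1
        rw [hκ]; ring

end Schur

section Duhamel

variable {d : ℕ} {q q' : ℝ≥0∞} [Fact (1 ≤ q)] [Fact (1 ≤ q')] [q.HolderConjugate q']

/-- Since f vanishes at t, mere continuity of c suffices: f is O(s-t) there, so the variation of c
enters only as o(s-t). -/
lemma hasDerivAt_bilin_of_zero {X Y : Type*} [NormedAddCommGroup X] [NormedSpace ℂ X]
    [NormedAddCommGroup Y] [NormedSpace ℂ Y] (B : X →L[ℂ] Y →L[ℂ] ℂ) {f : ℝ → X} {f' : X}
    {c : ℝ → Y} {t : ℝ} (hf : HasDerivAt f f' t) (h0 : f t = 0) (hc : ContinuousAt c t) :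
    HasDerivAt (fun s => B (f s) (c s)) (B f' (c t)) t := by
  have h1 : HasDerivAt (fun s => B (f s) (c t)) (B f' (c t)) t :=
    ((B.flip (c t)).restrictScalars ℝ).hasFDerivAt.comp_hasDerivAt t hf
  have h2 : HasDerivAt (fun s => B (f s) (c s - c t)) 0 t := by
    rw [hasDerivAt_iff_isLittleO]
    simp only [h0, map_zero, zero_apply, sub_zero, smul_zero]
    have hO : f =O[𝓝 t] fun s => s - t := by
      have := hf.isBigO_sub
      simpa only [h0, sub_zero] using this
    have ho : (fun s => c s - c t) =o[𝓝 t] fun _ => (1 : ℝ) := by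
      rw [Asymptotics.isLittleO_one_iff]
      have : Tendsto (fun s => c s - c t) (𝓝 t) (𝓝 (c t - c t)) := hc.tendsto.sub_const _
      rwa [sub_self] at this
    have hb : (fun s => B (f s) (c s - c t)) =O[𝓝 t] fun s => ‖f s‖ * ‖c s - c t‖ := by
      refine Asymptotics.IsBigO.of_bound ‖B‖ (Eventually.of_forall fun s => ?_)
      rw [Real.norm_of_nonneg (by positivity), ← mul_assoc]
      exact B.le_opNorm₂ _ _
    refine hb.trans_isLittleO ?_
    simpa using hO.norm_left.mul_isLittleO ho.norm_left
  have h3 := h1.add h2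
  rw [add_zero] at h3
  refine h3.congr_of_eventuallyEq (Eventually.of_forall fun s => ?_)
  simp only [Pi.add_apply, map_sub, add_sub_cancel]

lemma sum_pairing_grad {V : XS d q} (hV : V ∈ WS d q) (g : 𝓢(Rd d, ℂ)) :
    ∑ k, pairing volume 2 2 ((∂_{unitVec k} g : 𝓢(Rd d, ℂ)).toLp 2 volume) (V.2.1 k) =
      -pairing volume 2 2 ((Δ g).toLp 2 volume) V.1 := by
  have h : (Δ g).toLp 2 volume =
      ∑ k : Fin d, (∂_{unitVec k} (∂_{unitVec k} g) : 𝓢(Rd d, ℂ)).toLp 2 volume := by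
    rw [SchwartzMap.laplacian_eq_sum (EuclideanSpace.basisFun (Fin d) ℝ)]
    simp only [EuclideanSpace.basisFun_apply]
    exact map_sum (SchwartzMap.toLpCLM ℂ ℂ 2 (volume : Measure (Rd d))) _ _
  rw [h, map_sum, sum_apply, ← Finset.sum_neg_distrib]
  refine Finset.sum_congr rfl fun k _ => ?_
  rw [isGradL2_of_mem_WS hV (∂_{unitVec k} g) k, neg_neg]

/-- The test function is split into its value at s and its increment. The Laplacian produced by the
backward group cancels the gradient term of the weak equation, and only the source is left. -/
lemma Solves.hasDerivAt_schrodinger_pairing {w : ℝ → XS d q} {F : ℝ → LL d q'} (h : Solves w F)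
    (g : 𝓢(Rd d, ℂ)) (t s : ℝ) :
    HasDerivAt (fun s => pairing volume 2 2 ((schrodinger (t - s) g).toLp 2 volume) (w s).1)
      (-(Complex.I * pairing volume q q' ((schrodinger (t - s) g).toLp q volume) (F s))) s := by
  set g0 := schrodinger (t - s) g with hg0
  have h1 := h.hasDerivAt (toXS q g0) (toXS_mem g0) s
  have h2 : HasDerivAt (fun r => (schrodinger (t - r) g).toLp 2 volume - g0.toLp 2 volume)
      (-(Complex.I • (Δ g0).toLp 2 volume)) s := by
    have := ((hasDerivAt_schrodinger (t - s) g).scomp s ((hasDerivAt_id s).const_sub t)).sub_const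
      (g0.toLp 2 volume)
    simpa using this
  have h3 := hasDerivAt_bilin_of_zero (pairing volume 2 2) (c := fun r => (w r).1) h2
    (by simp only [hg0, sub_self]) (continuous_fst.comp h.cont).continuousAt
  have h4 := h3.add h1
  have e : pairing volume 2 2 (-(Complex.I • (Δ g0).toLp 2 volume)) (w s).1 +
      rhsL (w s) (F s) (toXS q g0) =
      -(Complex.I * pairing volume q q' (g0.toLp q volume) (F s)) := by
    rw [rhsL_apply]
    simp only [toXS_grad, toXS_snd, sum_pairing_grad (h.mem s), map_neg, map_smul, neg_apply,
      smul_apply, smul_eq_mul]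
    ring
  rw [e] at h4
  refine h4.congr_of_eventuallyEq (Eventually.of_forall fun r => ?_)
  simp only [Pi.add_apply, map_sub, sub_apply, toXS_fst]
  ring

lemma continuous_schrodinger_two (f : 𝓢(Rd d, ℂ)) :
    Continuous fun s => (schrodinger s f).toLp 2 volume :=
  continuous_iff_continuousAt.2 fun t => (hasDerivAt_schrodinger t f).continuousAt

lemma lineDeriv_schrodinger (t : ℝ) (f : 𝓢(Rd d, ℂ)) (k : Fin d) :
    (∂_{unitVec k} (schrodinger t f) : 𝓢(Rd d, ℂ)) = schrodinger t (∂_{unitVec k} f) := by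
  apply schwartz_ext_fourier
  intro ξ
  simp only [fourier_lineDeriv, fourier_schrodinger]
  ring

/-- The group commutes with derivatives, so the orbit is continuous in H¹, and the Sobolev bound
transfers this to L^q. -/
lemma continuous_schrodinger_toLp (hS : SobolevBound d q) (f : 𝓢(Rd d, ℂ)) :
    Continuous fun s => (schrodinger s f).toLp q volume := by
  have hH : Continuous fun s => toH1Ambient (schrodinger s f) := by
    have h1 : Continuous fun s => ((schrodinger s f).toLp 2 volume,
        WithLp.toLp 2 (fun k : Fin d => (schrodinger s (∂_{unitVec k} f)).toLp 2 volume)) :=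
      (continuous_schrodinger_two f).prodMk ((PiLp.continuous_toLp 2 _).comp
        (continuous_pi fun k => continuous_schrodinger_two _))
    have h2 := (WithLp.prod_continuous_toLp 2 (LL d 2) (PiLp 2 (fun _ : Fin d => LL d 2))).comp h1
    refine h2.congr fun s => ?_
    simp only [← lineDeriv_schrodinger]
    rfl
  obtain ⟨C, hC⟩ := hS
  refine continuous_iff_continuousAt.2 fun t => ?_
  rw [ContinuousAt, tendsto_iff_norm_sub_tendsto_zero]
  have h0 : Tendsto (fun s => C * ‖toH1Ambient (schrodinger s f) - toH1Ambient (schrodinger t f)‖)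
      (𝓝 t) (𝓝 (C * ‖toH1Ambient (schrodinger t f) - toH1Ambient (schrodinger t f)‖)) :=
    ((hH.sub continuous_const).norm.const_mul C |>.tendsto t)
  rw [sub_self, norm_zero, mul_zero] at h0
  refine squeeze_zero (fun _ => norm_nonneg _) (fun s => ?_) h0
  rw [← toLp_sub, ← map_sub]
  exact hC _

/-- Duhamel's formula tested against a Schwartz function. -/
lemma Solves.duhamel (hS : SobolevBound d q) {w : ℝ → XS d q} {F : ℝ → LL d q'} (h : Solves w F)
    (g : 𝓢(Rd d, ℂ)) (a t : ℝ) :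
    pairing volume 2 2 (g.toLp 2 volume) (w t).1 =
      pairing volume 2 2 ((schrodinger (t - a) g).toLp 2 volume) (w a).1 -
      Complex.I * ∫ s in a..t, pairing volume q q' ((schrodinger (t - s) g).toLp q volume) (F s) := by
  have hc : Continuous fun s => pairing volume q q' ((schrodinger (t - s) g).toLp q volume) (F s) :=
    continuous_bilin_apply _ ((continuous_schrodinger_toLp hS g).comp (continuous_const.sub continuous_id))
      h.cont_rhs
  have := intervalIntegral.integral_eq_sub_of_hasDerivAt
    (fun s _ => h.hasDerivAt_schrodinger_pairing g t s)
    ((continuous_const.mul hc).neg.intervalIntegrable a t)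
  rw [intervalIntegral.integral_neg, intervalIntegral.integral_const_mul] at this
  simp only [sub_self, schrodinger_zero] at this
  linear_combination -this

end Duhamel

end InteractionMorawetz

end

/-! ### The local Strichartz estimate -/

noncomputable section
open MeasureTheory Filter Topology
open scoped ContDiff ENNReal SchwartzMap FourierTransform RealInnerProductSpace Laplacian LineDeriv
namespace InteractionMorawetz

variable {d : ℕ} {q q' : ℝ≥0∞} [Fact (1 ≤ q)] [Fact (1 ≤ q')] [q.HolderConjugate q']
  [q'.HolderConjugate q]

lemma inner_schrodinger_schrodinger (τ : ℝ) (f g : 𝓢(Rd d, ℂ)) :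
    inner ℂ ((schrodinger τ f).toLp 2 volume) ((schrodinger τ g).toLp 2 volume) =
      inner ℂ (f.toLp 2 volume) (g.toLp 2 volume) := by
  rw [← SchwartzMap.inner_fourier_toL2_eq, ← SchwartzMap.inner_fourier_toL2_eq f,
    SchwartzMap.inner_toL2_toL2_eq _ _ volume, SchwartzMap.inner_toL2_toL2_eq _ _ volume]
  congr 1
  funext ξ
  rw [fourier_schrodinger, fourier_schrodinger, RCLike.inner_apply, RCLike.inner_apply, map_mul]
  have h : schrodingerSymbol τ ξ * (starRingEnd ℂ) (schrodingerSymbol τ ξ) = 1 := by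
    rw [Complex.mul_conj, Complex.normSq_eq_norm_sq, norm_schrodingerSymbol]
    norm_num
  linear_combination (𝓕 g ξ * (starRingEnd ℂ) (𝓕 f ξ)) * h

lemma norm_inner_toLp_le {q q' : ℝ≥0∞} [Fact (1 ≤ q)] [Fact (1 ≤ q')] [q'.HolderConjugate q]
    (f g : 𝓢(Rd d, ℂ)) :
    ‖inner ℂ (f.toLp 2 volume) (g.toLp 2 volume)‖ ≤ ‖f.toLp q' volume‖ * ‖g.toLp q volume‖ := by
  rw [inner_toLp_two, pairing_toLp_toLp, ← pairing_toLp_toLp (q := q') (q' := q)]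
  refine (norm_pairing_le _ _).trans_eq ?_
  congr 1
  rw [SchwartzMap.norm_toLp, SchwartzMap.norm_toLp]
  congr 1
  refine eLpNorm_congr_norm_ae (ae_of_all _ fun x => ?_)
  rw [SchwartzMap.postcompCLM_apply]
  exact RCLike.norm_conj _

/-- A continuous selection. For each t the admissible Schwartz functions form a convex set, nonempty
by density, and a fixed function stays admissible for nearby times because the inequalities are
strict. The slack ε is the price for continuity in t. -/
lemma exists_almost_norming (hq : q ≠ ⊤) (hq' : q' ≠ ⊤) {v : ℝ → LL d q} (hv : Continuous v)
    {ε : ℝ} (hε : 0 < ε) :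
    ∃ g : C(ℝ, 𝓢(Rd d, ℂ)), ∀ t, ‖(g t).toLp q' volume‖ < ‖v t‖ + ε ∧
      ‖v t‖ ^ 2 - ε < (pairing volume q' q ((g t).toLp q' volume) (v t)).re := by
  let T : ℝ → Set 𝓢(Rd d, ℂ) := fun t => {f | ‖f.toLp q' volume‖ < ‖v t‖ + ε ∧
      ‖v t‖ ^ 2 - ε < (pairing volume q' q (f.toLp q' volume) (v t)).re}
  have hadd : ∀ (x y : 𝓢(Rd d, ℂ)) (a b : ℝ), (a • x + b • y).toLp q' volume =
      a • x.toLp q' volume + b • y.toLp q' volume := fun x y a b => by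
    have h1 := map_add (SchwartzMap.toLpCLM ℝ ℂ q' (volume : Measure (Rd d))) (a • x) (b • y)
    rw [map_smul, map_smul] at h1
    exact h1
  have hconv : ∀ t, Convex ℝ (T t) := by
    intro t x hx y hy a b ha hb hab
    refine ⟨?_, ?_⟩
    · rw [hadd]
      have h1 : ‖a • x.toLp q' volume + b • y.toLp q' volume‖ ≤
          a * ‖x.toLp q' volume‖ + b * ‖y.toLp q' volume‖ := by
        refine (norm_add_le _ _).trans_eq ?_
        rw [norm_smul, norm_smul, Real.norm_of_nonneg ha, Real.norm_of_nonneg hb]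
      refine h1.trans_lt ?_
      have := (convex_Iio (𝕜 := ℝ) (‖v t‖ + ε)) hx.1 hy.1 ha hb hab
      simpa using this
    · have h1 : (pairing volume q' q ((a • x + b • y).toLp q' volume) (v t)).re =
          a • (pairing volume q' q (x.toLp q' volume) (v t)).re +
          b • (pairing volume q' q (y.toLp q' volume) (v t)).re := by
        have e : ∀ (a : ℝ) (z : LL d q'), a • z = (a : ℂ) • z := fun a z =>
          (Complex.coe_smul a z).symm
        rw [hadd, e, e, map_add, map_smul, map_smul, add_apply, smul_apply, smul_apply,
          Complex.add_re, smul_eq_mul, smul_eq_mul, Complex.re_ofReal_mul, Complex.re_ofReal_mul]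
        rfl
      rw [h1]
      exact (convex_Ioi (𝕜 := ℝ) (‖v t‖ ^ 2 - ε)) hx.2 hy.2 ha hb hab
  have hopen : ∀ f : 𝓢(Rd d, ℂ), IsOpen {t | f ∈ T t} := by
    intro f
    refine (isOpen_lt continuous_const (hv.norm.add continuous_const)).inter
      (isOpen_lt ((hv.norm.pow 2).sub continuous_const) ?_)
    exact Complex.continuous_re.comp (continuous_bilin_apply _ continuous_const hv)
  have hne : ∀ t, ∃ f, f ∈ T t := by
    intro t
    obtain ⟨w, hw1, hw2⟩ := exists_norming (q' := q') hq hq' (v t)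
    have hO : IsOpen {z : LL d q' | ‖z‖ < ‖v t‖ + ε ∧ ‖v t‖ ^ 2 - ε < (pairing volume q' q z (v t)).re} :=
      (isOpen_lt continuous_norm continuous_const).inter (isOpen_lt continuous_const
        (Complex.continuous_re.comp (continuous_bilin_apply _ continuous_id continuous_const)))
    obtain ⟨f, hf⟩ := (denseRange_toLp q' hq').exists_mem_open hO ⟨w, by rw [hw1]; linarith, by
      rw [← pairing_comm, hw2, Complex.ofReal_re]; linarith⟩
    exact ⟨f, hf⟩
  exact exists_continuous_forall_mem_convex_of_local_const hconv fun t => by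
    obtain ⟨f, hf⟩ := hne t
    exact ⟨f, (hopen f).mem_nhds hf⟩

lemma continuous_schrodinger_comp {g : ℝ → 𝓢(Rd d, ℂ)} (hg : Continuous g) (a : ℝ) :
    Continuous fun t => (schrodinger (t - a) (g t)).toLp 2 volume := by
  refine continuous_iff_continuousAt.2 fun t => ?_
  rw [ContinuousAt, tendsto_iff_norm_sub_tendsto_zero]
  have h1 : Continuous fun s => (g s).toLp 2 volume :=
    (SchwartzMap.toLpCLM ℂ ℂ 2 (volume : Measure (Rd d))).continuous.comp hg
  have h2 : Continuous fun s => (schrodinger (s - a) (g t)).toLp 2 volume :=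
    (continuous_schrodinger_two (g t)).comp (continuous_id.sub continuous_const)
  have h0 : Tendsto (fun s => ‖(g s).toLp 2 volume - (g t).toLp 2 volume‖ +
      ‖(schrodinger (s - a) (g t)).toLp 2 volume - (schrodinger (t - a) (g t)).toLp 2 volume‖)
      (𝓝 t) (𝓝 (‖(g t).toLp 2 volume - (g t).toLp 2 volume‖ +
      ‖(schrodinger (t - a) (g t)).toLp 2 volume - (schrodinger (t - a) (g t)).toLp 2 volume‖)) :=
    ((h1.sub continuous_const).norm.add (h2.sub continuous_const).norm).tendsto t
  simp only [sub_self, norm_zero, add_zero] at h0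
  refine squeeze_zero (fun _ => norm_nonneg _) (fun s => ?_) h0
  have e : (schrodinger (s - a) (g s)).toLp 2 volume - (schrodinger (t - a) (g t)).toLp 2 volume =
      (schrodinger (s - a) (g s - g t)).toLp 2 volume +
      ((schrodinger (s - a) (g t)).toLp 2 volume - (schrodinger (t - a) (g t)).toLp 2 volume) := by
    rw [map_sub, toLp_sub]; abel
  rw [e]
  refine (norm_add_le _ _).trans (add_le_add_left ?_ _)
  rw [norm_schrodinger, toLp_sub]

lemma ae_sub_ne_zero (a b t : ℝ) : ∀ᵐ s ∂(volume.restrict (Set.Ioc a b)), t - s ≠ 0 := by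
  refine ae_restrict_of_ae ?_
  filter_upwards [compl_mem_ae_iff.2 (measure_singleton t)] with s hs hs'
  exact hs (sub_eq_zero.1 hs').symm

/-- The dual homogeneous Strichartz estimate, by the `TT*` method. -/
lemma norm_integral_schrodinger_sq_le {C σ : ℝ} (hC : 0 ≤ C) (hσ : σ < 1)
    (hdisp : ∀ t : ℝ, t ≠ 0 → ∀ f : 𝓢(Rd d, ℂ),
      ‖(schrodinger t f).toLp q volume‖ ≤ C * |t| ^ (-σ) * ‖f.toLp q' volume‖)
    {a b : ℝ} (hab : a ≤ b) {g : ℝ → 𝓢(Rd d, ℂ)} (hgc : Continuous g) :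
    ‖∫ t in a..b, (schrodinger (t - a) (g t)).toLp 2 volume‖ ^ 2 ≤
      C * ((b - a) ^ (1 - σ) / (1 - σ)) * (2 * ∫ t in a..b, ‖(g t).toLp q' volume‖ ^ 2) := by
  have hσ1 : 0 < 1 - σ := by linarith
  have hba : 0 ≤ b - a := sub_nonneg.2 hab
  set κ := (b - a) ^ (1 - σ) / (1 - σ) with hκ
  have hκ0 : 0 ≤ κ := by positivity
  have hne := ae_sub_ne_zero a b
  set γ : ℝ → ℝ := fun t => ‖(g t).toLp q' volume‖ with hγ
  have hgq : Continuous fun t => (g t).toLp q' volume :=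
    (SchwartzMap.toLpCLM ℂ ℂ q' (volume : Measure (Rd d))).continuous.comp hgc
  have hγc : Continuous γ := hgq.norm
  set Γ := ∫ t in a..b, γ t ^ 2 with hΓ
  have hΓ0 : 0 ≤ Γ := intervalIntegral.integral_nonneg hab fun _ _ => sq_nonneg _
  set G : ℝ → LL d 2 := fun t => (schrodinger (t - a) (g t)).toLp 2 volume with hG
  have hGc : Continuous G := continuous_schrodinger_comp hgc a
  set Ψ := ∫ t in a..b, G t with hΨ
  have e1 : ∀ v : LL d 2, inner ℂ v Ψ = ∫ t in a..b, inner ℂ v (G t) := fun v =>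
    ((innerSL ℂ v).intervalIntegral_comp_comm (hGc.intervalIntegrable a b)).symm
  -- The TT* step: ‖Ψ‖² is a double integral in s and t, to which the dispersive estimate and
  -- Schur's test apply.
  have e2 : ‖inner ℂ Ψ Ψ‖ₑ ≤ ENNReal.ofReal (C * κ * (Γ + Γ)) := by
    rw [e1 Ψ, intervalIntegral.integral_of_le hab]
    refine (enorm_integral_le_lintegral_enorm _).trans (le_trans ?_
      (lintegral_schur hab hσ hC hγc hγc))
    refine lintegral_mono fun t => ?_
    have e3 : ‖inner ℂ Ψ (G t)‖ₑ = ‖inner ℂ (G t) Ψ‖ₑ := by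
      rw [← ofReal_norm, ← ofReal_norm, norm_inner_symm]
    rw [e3, e1, intervalIntegral.integral_of_le hab]
    refine (enorm_integral_le_lintegral_enorm _).trans (lintegral_mono_ae ?_)
    filter_upwards [hne t] with s hs
    rw [← ofReal_norm]
    refine ENNReal.ofReal_le_ofReal ?_
    have hst : s - t ≠ 0 := fun h0 => hs (by linarith)
    -- By unitarity the common evolution up to time t drops out, leaving the group at time s - t.
    have e4 : schrodinger (s - a) (g s) = schrodinger (t - a) (schrodinger (s - t) (g s)) := by
      rw [← schrodinger_add]; congr 2; ring
    simp only [hG]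
    rw [e4, inner_schrodinger_schrodinger]
    refine (norm_inner_toLp_le (q := q) (q' := q') _ _).trans ?_
    refine (mul_le_mul_of_nonneg_left (hdisp _ hst (g s)) (norm_nonneg _)).trans_eq ?_
    rw [abs_sub_comm]; ring
  have e5 : ‖inner ℂ Ψ Ψ‖ = ‖Ψ‖ ^ 2 := by
    rw [inner_self_eq_norm_sq_to_K]; simp
  rw [← ofReal_norm, e5, ENNReal.ofReal_le_ofReal_iff (by positivity)] at e2
  linarith

set_option maxHeartbeats 1000000 in
/-- A local Strichartz estimate, in `L²_t L^q_x`. -/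
lemma Solves.strichartz (hq : q ≠ ⊤) (hq' : q' ≠ ⊤) (hS : SobolevBound d q) {C σ : ℝ}
    (hC : 0 ≤ C) (hσ : σ < 1)
    (hdisp : ∀ t : ℝ, t ≠ 0 → ∀ f : 𝓢(Rd d, ℂ),
      ‖(schrodinger t f).toLp q volume‖ ≤ C * |t| ^ (-σ) * ‖f.toLp q' volume‖)
    {w : ℝ → XS d q} {F : ℝ → LL d q'} (h : Solves w F) {a b : ℝ} (hab : a ≤ b) :
    ∫ t in a..b, ‖(w t).2.2‖ ^ 2 ≤ 1 / 2 * ‖(w a).1‖ ^ 2 +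
      C * (2 * (b - a) ^ (1 - σ) / (1 - σ)) * ((∫ t in a..b, ‖(w t).2.2‖ ^ 2) +
        ∫ t in a..b, ‖F t‖ ^ 2) := by
  set κ := (b - a) ^ (1 - σ) / (1 - σ) with hκ
  have hσ1 : 0 < 1 - σ := by linarith
  have hba : 0 ≤ b - a := sub_nonneg.2 hab
  have hκ0 : 0 ≤ κ := by positivity
  have hwq : Continuous fun t => (w t).2.2 := by have := h.cont; fun_prop
  set A := ∫ t in a..b, ‖(w t).2.2‖ ^ 2 with hA
  set Φ := ∫ t in a..b, ‖F t‖ ^ 2 with hΦ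
  set W := ∫ t in a..b, ‖(w t).2.2‖ with hW
  -- The norm of the solution in L²_t L^q_x is computed by pairing with a nearly norming curve g,
  -- whose own size is nearly that of w.
  have key : ∀ ε : ℝ, 0 < ε → A ≤ ε * (b - a) + 1 / 2 * ‖(w a).1‖ ^ 2 +
      C * κ * (2 * (A + 2 * ε * W + ε ^ 2 * (b - a)) + Φ) := by
    intro ε hε
    obtain ⟨g, hg⟩ := exists_almost_norming (q' := q') hq hq' hwq hε
    have hgc : Continuous fun t => g t := g.continuous
    set γ : ℝ → ℝ := fun t => ‖(g t).toLp q' volume‖ with hγ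
    have hgq : Continuous fun t => (g t).toLp q' volume :=
      (SchwartzMap.toLpCLM ℂ ℂ q' (volume : Measure (Rd d))).continuous.comp hgc
    have hg2 : Continuous fun t => (g t).toLp 2 volume :=
      (SchwartzMap.toLpCLM ℂ ℂ 2 (volume : Measure (Rd d))).continuous.comp hgc
    have hγc : Continuous γ := hgq.norm
    set Γ := ∫ t in a..b, γ t ^ 2 with hΓ
    have hΓ0 : 0 ≤ Γ := intervalIntegral.integral_nonneg hab fun _ _ => sq_nonneg _
    have hΦ0 : 0 ≤ Φ := intervalIntegral.integral_nonneg hab fun _ _ => sq_nonneg _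
    have hΓle : Γ ≤ A + 2 * ε * W + ε ^ 2 * (b - a) := by
      have e : A + 2 * ε * W + ε ^ 2 * (b - a) = ∫ t in a..b, (‖(w t).2.2‖ + ε) ^ 2 := by
        have i1 : IntervalIntegrable (fun t => ‖(w t).2.2‖ ^ 2) volume a b :=
          (hwq.norm.pow 2).intervalIntegrable _ _
        have i2 : IntervalIntegrable (fun t => 2 * ε * ‖(w t).2.2‖) volume a b :=
          (continuous_const.mul hwq.norm).intervalIntegrable _ _
        have i3 : IntervalIntegrable (fun _ => ε ^ 2) volume a b :=
          continuous_const.intervalIntegrable _ _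
        have : ∀ t, (‖(w t).2.2‖ + ε) ^ 2 = ‖(w t).2.2‖ ^ 2 + 2 * ε * ‖(w t).2.2‖ + ε ^ 2 :=
          fun t => by ring
        simp only [this]
        rw [intervalIntegral.integral_add (i1.add i2) i3, intervalIntegral.integral_add i1 i2,
          intervalIntegral.integral_const_mul, intervalIntegral.integral_const, smul_eq_mul,
          mul_comm (b - a)]
      rw [e]
      refine intervalIntegral.integral_mono_on hab ((hγc.pow 2).intervalIntegrable _ _)
        (((hwq.norm.add continuous_const).pow 2).intervalIntegrable _ _) fun t _ => ?_
      exact pow_le_pow_left₀ (norm_nonneg _) (hg t).1.le 2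
    have hne := ae_sub_ne_zero a b
    -- the homogeneous part
    set G : ℝ → LL d 2 := fun t => (schrodinger (t - a) (g t)).toLp 2 volume with hG
    have hGc : Continuous G := continuous_schrodinger_comp hgc a
    set Ψ := ∫ t in a..b, G t with hΨ
    have hΨle : ‖Ψ‖ ^ 2 ≤ C * κ * (2 * Γ) := norm_integral_schrodinger_sq_le hC hσ hdisp hab hgc
    -- the inhomogeneous part
    have hdu : ∀ t, pairing volume q' q ((g t).toLp q' volume) (w t).2.2 =
        pairing volume 2 2 (G t) (w a).1 - Complex.I *
          ∫ s in a..t, pairing volume q q' ((schrodinger (t - s) (g t)).toLp q volume) (F s) := by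
      intro t
      rw [← h.duhamel hS (g t) a t, pairing_toLp, pairing_toLp]
      apply integral_congr_ae
      filter_upwards [ae_eq_of_mem_WS (q' := q') (h.mem t)] with x hx
      rw [hx]
    set D : ℝ → ℂ := fun t => pairing volume q' q ((g t).toLp q' volume) (w t).2.2 -
      pairing volume 2 2 (G t) (w a).1 with hD
    have hDc : Continuous D := (continuous_bilin_apply _ hgq hwq).sub
      (continuous_bilin_apply _ hGc continuous_const)
    -- The retarded integral is bounded in absolute value by the integral over the whole interval,
    -- so Schur's test handles it directly.
    have hDle : ‖∫ t in a..b, D t‖ ≤ C * κ * (Γ + Φ) := by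
      have : ‖∫ t in a..b, D t‖ₑ ≤ ENNReal.ofReal (C * κ * (Γ + Φ)) := by
        rw [intervalIntegral.integral_of_le hab]
        refine (enorm_integral_le_lintegral_enorm _).trans (le_trans ?_
          (lintegral_schur hab hσ hC hγc h.cont_rhs.norm))
        refine setLIntegral_mono' measurableSet_Ioc fun t ht => ?_
        have e1 : ‖D t‖ₑ = ‖∫ s in a..t, pairing volume q q'
            ((schrodinger (t - s) (g t)).toLp q volume) (F s)‖ₑ := by
          simp only [hD, hdu t]
          rw [← ofReal_norm, ← ofReal_norm]
          congr 1
          rw [sub_sub_cancel_left, norm_neg, norm_mul, Complex.norm_I, one_mul]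
        rw [e1, intervalIntegral.integral_of_le ht.1.le]
        refine (enorm_integral_le_lintegral_enorm _).trans ?_
        refine (lintegral_mono_set (Set.Ioc_subset_Ioc_right ht.2)).trans (lintegral_mono_ae ?_)
        filter_upwards [hne t] with s hs
        rw [← ofReal_norm]
        refine ENNReal.ofReal_le_ofReal ((norm_pairing_le _ _).trans ?_)
        refine (mul_le_mul_of_nonneg_right (hdisp _ hs (g t)) (norm_nonneg _)).trans_eq ?_
        simp only [hγ]; ring
      rw [← ofReal_norm, ENNReal.ofReal_le_ofReal_iff (by positivity)] at this
      exact this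
    have hsum : ∫ t in a..b, pairing volume q' q ((g t).toLp q' volume) (w t).2.2 =
        pairing volume 2 2 Ψ (w a).1 + ∫ t in a..b, D t := by
      have e1 : pairing volume 2 2 Ψ (w a).1 = ∫ t in a..b, pairing volume 2 2 (G t) (w a).1 :=
        (((pairing volume 2 2).flip (w a).1).intervalIntegral_comp_comm
          (hGc.intervalIntegrable a b)).symm
      rw [e1, ← intervalIntegral.integral_add
        ((continuous_bilin_apply _ hGc continuous_const).intervalIntegrable a b)
        (hDc.intervalIntegrable a b)]
      simp only [hD, add_sub_cancel]
    have hlow : A - ε * (b - a) ≤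
        (∫ t in a..b, pairing volume q' q ((g t).toLp q' volume) (w t).2.2).re := by
      have hpc : Continuous fun t => pairing volume q' q ((g t).toLp q' volume) (w t).2.2 :=
        continuous_bilin_apply _ hgq hwq
      have e1 : (∫ t in a..b, pairing volume q' q ((g t).toLp q' volume) (w t).2.2).re =
          ∫ t in a..b, (pairing volume q' q ((g t).toLp q' volume) (w t).2.2).re :=
        (Complex.reCLM.intervalIntegral_comp_comm (hpc.intervalIntegrable a b)).symm
      have e2 : A - ε * (b - a) = ∫ t in a..b, (‖(w t).2.2‖ ^ 2 - ε) := by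
        have i1 : IntervalIntegrable (fun t => ‖(w t).2.2‖ ^ 2) volume a b :=
          (hwq.norm.pow 2).intervalIntegrable _ _
        rw [intervalIntegral.integral_sub i1 (continuous_const.intervalIntegrable _ _), intervalIntegral.integral_const, smul_eq_mul,
          mul_comm (b - a)]
      rw [e1, e2]
      refine intervalIntegral.integral_mono_on hab
        (((hwq.norm.pow 2).sub continuous_const).intervalIntegrable _ _)
        ((Complex.continuous_re.comp hpc).intervalIntegrable _ _) fun t _ => (hg t).2.le
    have hup : (∫ t in a..b, pairing volume q' q ((g t).toLp q' volume) (w t).2.2).re ≤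
        ‖Ψ‖ * ‖(w a).1‖ + C * κ * (Γ + Φ) := by
      rw [hsum]
      refine (Complex.re_le_norm _).trans ((norm_add_le _ _).trans (add_le_add (norm_pairing_le _ _) hDle))
    -- The square of ‖Ψ‖ is at most 2CκΓ, so after halving it merges with the retarded part into
    -- Cκ(2Γ + Φ).
    have hamgm : ‖Ψ‖ * ‖(w a).1‖ ≤ 1 / 2 * ‖(w a).1‖ ^ 2 + 1 / 2 * ‖Ψ‖ ^ 2 := by
      nlinarith [sq_nonneg (‖Ψ‖ - ‖(w a).1‖)]
    have hfin : C * κ * (2 * Γ + Φ) ≤ C * κ * (2 * (A + 2 * ε * W + ε ^ 2 * (b - a)) + Φ) := by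
      gcongr
    nlinarith
  have hlim : Tendsto (fun ε : ℝ => ε * (b - a) + 1 / 2 * ‖(w a).1‖ ^ 2 +
      C * κ * (2 * (A + 2 * ε * W + ε ^ 2 * (b - a)) + Φ)) (𝓝[>] 0)
      (𝓝 (0 * (b - a) + 1 / 2 * ‖(w a).1‖ ^ 2 +
      C * κ * (2 * (A + 2 * 0 * W + 0 ^ 2 * (b - a)) + Φ))) := by
    refine Tendsto.mono_left (Continuous.tendsto ?_ 0) nhdsWithin_le_nhds
    fun_prop
  have hfinal := ge_of_tendsto hlim (eventually_nhdsWithin_of_forall fun ε hε => key ε hε)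
  have hΦ0 : 0 ≤ Φ := intervalIntegral.integral_nonneg hab fun _ _ => sq_nonneg _
  have e : 2 * (b - a) ^ (1 - σ) / (1 - σ) = 2 * κ := by rw [hκ]; ring
  rw [e]
  -- In the limit ε → 0 the bound has Cκ(2A + Φ); it is weakened to 2Cκ(A + Φ) for symmetry.
  nlinarith [mul_nonneg (mul_nonneg hC hκ0) hΦ0]

end InteractionMorawetz

end

/-! ### Pointwise estimates for the nonlinearity and the potential -/

noncomputable section
open MeasureTheory Filter Topology
open scoped ContDiff ENNReal SchwartzMap FourierTransform RealInnerProductSpace Laplacian LineDeriv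
namespace InteractionMorawetz

section Pointwise

lemma abs_rpow_sub_rpow_le {r x y S : ℝ} (hr : 1 ≤ r) (hx : 0 ≤ x) (hy : 0 ≤ y) (hxS : x ≤ S)
    (hyS : y ≤ S) : |x ^ r - y ^ r| ≤ r * S ^ (r - 1) * |x - y| := by
  have h := (convex_Icc (0 : ℝ) S).norm_image_sub_le_of_norm_hasDerivWithin_le
    (f := fun z : ℝ => z ^ r) (f' := fun z : ℝ => r * z ^ (r - 1)) (C := r * S ^ (r - 1))
    (fun z _ => (Real.hasDerivAt_rpow_const (Or.inr hr)).hasDerivWithinAt)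
    (fun z hz => by
      have h1 : z ^ (r - 1) ≤ S ^ (r - 1) := Real.rpow_le_rpow hz.1 hz.2 (by linarith)
      have h2 : 0 ≤ z ^ (r - 1) := Real.rpow_nonneg hz.1 _
      rw [Real.norm_of_nonneg (by positivity)]
      exact mul_le_mul_of_nonneg_left h1 (by linarith))
    (⟨hy, hyS⟩ : y ∈ Set.Icc 0 S) ⟨hx, hxS⟩
  exact h

/-- For p - 1 < 1 the power |·|^{p-1} is not Lipschitz. Its increment is therefore multiplied by the
smaller modulus |b| and compared with |a|^p - |b|^p, which is Lipschitz. -/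
lemma norm_power_sub_le {p S : ℝ} (hp : 1 ≤ p) {a b : ℂ} (ha : ‖a‖ ≤ S) (hb : ‖b‖ ≤ S) :
    ‖((‖a‖ ^ (p - 1) : ℝ) : ℂ) * a - ((‖b‖ ^ (p - 1) : ℝ) : ℂ) * b‖ ≤
      (1 + p) * S ^ (p - 1) * ‖a - b‖ := by
  wlog h : ‖b‖ ≤ ‖a‖ generalizing a b
  · rw [norm_sub_rev, norm_sub_rev a]
    exact this hb ha (le_of_not_ge h)
  have hS : 0 ≤ S := (norm_nonneg a).trans ha
  have e : ((‖a‖ ^ (p - 1) : ℝ) : ℂ) * a - ((‖b‖ ^ (p - 1) : ℝ) : ℂ) * b =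
      ((‖a‖ ^ (p - 1) : ℝ) : ℂ) * (a - b) + ((‖a‖ ^ (p - 1) - ‖b‖ ^ (p - 1) : ℝ) : ℂ) * b := by
    push_cast; ring
  have hmul : ∀ x : ℝ, 0 ≤ x → x ^ (p - 1) * x = x ^ p := fun x hx => by
    rcases hx.eq_or_lt with rfl | hx
    · rw [mul_zero, Real.zero_rpow (by linarith)]
    · rw [← Real.rpow_add_one hx.ne', sub_add_cancel]
  have hmono : ‖b‖ ^ (p - 1) ≤ ‖a‖ ^ (p - 1) := Real.rpow_le_rpow (norm_nonneg _) h (by linarith)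
  have h1 : ‖a‖ ^ (p - 1) ≤ S ^ (p - 1) := Real.rpow_le_rpow (norm_nonneg _) ha (by linarith)
  have h2 : (‖a‖ ^ (p - 1) - ‖b‖ ^ (p - 1)) * ‖b‖ ≤ p * S ^ (p - 1) * ‖a - b‖ := by
    have h3 := abs_rpow_sub_rpow_le hp (norm_nonneg a) (norm_nonneg b) ha hb
    have h4 : |‖a‖ - ‖b‖| ≤ ‖a - b‖ := abs_norm_sub_norm_le a b
    have h5 : ‖a‖ ^ (p - 1) * ‖b‖ ≤ ‖a‖ ^ p := by
      rw [← hmul _ (norm_nonneg a)]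
      exact mul_le_mul_of_nonneg_left h (by positivity)
    rw [sub_mul, hmul _ (norm_nonneg b)]
    calc _ ≤ ‖a‖ ^ p - ‖b‖ ^ p := by linarith
      _ ≤ _ := (le_abs_self _).trans h3
      _ ≤ _ := mul_le_mul_of_nonneg_left h4 (by positivity)
  rw [e]
  refine (norm_add_le _ _).trans ?_
  rw [norm_mul, norm_mul, Complex.norm_real, Complex.norm_real, Real.norm_of_nonneg (by positivity),
    Real.norm_of_nonneg (sub_nonneg.2 hmono)]
  have h6 : ‖a‖ ^ (p - 1) * ‖a - b‖ ≤ S ^ (p - 1) * ‖a - b‖ :=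
    mul_le_mul_of_nonneg_right h1 (norm_nonneg _)
  linarith

variable {N : ℕ}

/-- The nonlinearity as a function on `ℂ^N`. -/
def nonlin (p : ℝ) (β : Fin N → Fin N → ℝ) (z : Fin N → ℂ) (μ : Fin N) : ℂ :=
  ∑ ν, ((β μ ν * ‖z ν‖ ^ (p + 1) * ‖z μ‖ ^ (p - 1) : ℝ) : ℂ) * z μ

/-- The potential energy density `∑ β_{μν} |z_μ|^{p+1} |z_ν|^{p+1}`. -/
def potential (p : ℝ) (β : Fin N → Fin N → ℝ) (z : Fin N → ℂ) : ℝ :=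
  ∑ μ, ∑ ν, β μ ν * (‖z μ‖ ^ (p + 1) * ‖z ν‖ ^ (p + 1))

/-- The sum of the moduli. -/
def modSum (z : Fin N → ℂ) : ℝ := ∑ ν, ‖z ν‖

lemma modSum_nonneg (z : Fin N → ℂ) : 0 ≤ modSum z := Finset.sum_nonneg fun _ _ => norm_nonneg _

lemma norm_le_modSum (z : Fin N → ℂ) (ν : Fin N) : ‖z ν‖ ≤ modSum z :=
  Finset.single_le_sum (f := fun ν => ‖z ν‖) (fun _ _ => norm_nonneg _) (Finset.mem_univ ν)

lemma modSum_add_le (a b : Fin N → ℂ) : modSum (a + b) ≤ modSum a + modSum b := by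
  rw [modSum, modSum, modSum, ← Finset.sum_add_distrib]
  exact Finset.sum_le_sum fun ν _ => norm_add_le _ _

lemma modSum_smul (s : ℝ) (a : Fin N → ℂ) : modSum (s • a) = |s| * modSum a := by
  simp [modSum, Finset.mul_sum]

/-- The Lipschitz constant of the nonlinearity. -/
def nonlinConst (p : ℝ) (β : Fin N → Fin N → ℝ) : ℝ := 2 * (1 + p) * ∑ μ, ∑ ν, |β μ ν|

lemma nonlinConst_nonneg {p : ℝ} (hp : 1 ≤ p) (β : Fin N → Fin N → ℝ) : 0 ≤ nonlinConst p β := by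
  unfold nonlinConst; positivity

/-- Each summand is telescoped into a change of the self factor |z_μ|^{p-1}z_μ and a change of the
coupling |z_ν|^{p+1}. Both cost S^{2p}, where S dominates all moduli. -/
lemma norm_nonlin_sub_le {p : ℝ} (hp : 1 ≤ p) (β : Fin N → Fin N → ℝ) {a b : Fin N → ℂ} {S : ℝ}
    (ha : modSum a ≤ S) (hb : modSum b ≤ S) (μ : Fin N) :
    ‖nonlin p β a μ - nonlin p β b μ‖ ≤ nonlinConst p β * S ^ (2 * p) * modSum (a - b) := by
  have hS : 0 ≤ S := (modSum_nonneg a).trans ha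
  have hδ : ∀ ν, ‖a ν - b ν‖ ≤ modSum (a - b) := fun ν => norm_le_modSum (a - b) ν
  have hδ0 := modSum_nonneg (a - b)
  have haS : ∀ ν, ‖a ν‖ ≤ S := fun ν => (norm_le_modSum a ν).trans ha
  have hbS : ∀ ν, ‖b ν‖ ≤ S := fun ν => (norm_le_modSum b ν).trans hb
  have e1 : S ^ (p + 1) * S ^ (p - 1) = S ^ (2 * p) := by
    rw [← Real.rpow_add_of_nonneg hS (by linarith) (by linarith)]; congr 1; ring
  have e2 : S ^ p * S ^ p = S ^ (2 * p) := by
    rw [← Real.rpow_add_of_nonneg hS (by linarith) (by linarith)]; congr 1; ring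
  have e3 : S ^ (p - 1) * S = S ^ p := by
    rcases hS.eq_or_lt with h | h
    · rw [← h, mul_zero, Real.zero_rpow (by linarith)]
    · rw [← Real.rpow_add_one h.ne', sub_add_cancel]
  have term : ∀ ν, ‖((β μ ν * ‖a ν‖ ^ (p + 1) * ‖a μ‖ ^ (p - 1) : ℝ) : ℂ) * a μ -
      ((β μ ν * ‖b ν‖ ^ (p + 1) * ‖b μ‖ ^ (p - 1) : ℝ) : ℂ) * b μ‖ ≤
      |β μ ν| * (2 * (1 + p) * S ^ (2 * p) * modSum (a - b)) := by
    intro ν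
    have e : ((β μ ν * ‖a ν‖ ^ (p + 1) * ‖a μ‖ ^ (p - 1) : ℝ) : ℂ) * a μ -
        ((β μ ν * ‖b ν‖ ^ (p + 1) * ‖b μ‖ ^ (p - 1) : ℝ) : ℂ) * b μ =
        (β μ ν : ℂ) * (((‖a ν‖ ^ (p + 1) : ℝ) : ℂ) * (((‖a μ‖ ^ (p - 1) : ℝ) : ℂ) * a μ -
          ((‖b μ‖ ^ (p - 1) : ℝ) : ℂ) * b μ) + ((‖a ν‖ ^ (p + 1) - ‖b ν‖ ^ (p + 1) : ℝ) : ℂ) *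
          (((‖b μ‖ ^ (p - 1) : ℝ) : ℂ) * b μ)) := by
      push_cast; ring
    rw [e, norm_mul, Complex.norm_real, Real.norm_eq_abs]
    refine mul_le_mul_of_nonneg_left ((norm_add_le _ _).trans ?_) (abs_nonneg _)
    have h1 : ‖((‖a ν‖ ^ (p + 1) : ℝ) : ℂ) * (((‖a μ‖ ^ (p - 1) : ℝ) : ℂ) * a μ -
          ((‖b μ‖ ^ (p - 1) : ℝ) : ℂ) * b μ)‖ ≤ S ^ (p + 1) * ((1 + p) * S ^ (p - 1) * modSum (a - b)) := by
      rw [norm_mul, Complex.norm_real, Real.norm_of_nonneg (by positivity)]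
      refine mul_le_mul (Real.rpow_le_rpow (norm_nonneg _) (haS ν) (by linarith)) ?_ (norm_nonneg _)
        (by positivity)
      exact (norm_power_sub_le hp (haS μ) (hbS μ)).trans
        (mul_le_mul_of_nonneg_left (hδ μ) (by positivity))
    have h2 : ‖((‖a ν‖ ^ (p + 1) - ‖b ν‖ ^ (p + 1) : ℝ) : ℂ) *
          (((‖b μ‖ ^ (p - 1) : ℝ) : ℂ) * b μ)‖ ≤ ((p + 1) * S ^ p * modSum (a - b)) * S ^ p := by
      rw [norm_mul, norm_mul, Complex.norm_real, Complex.norm_real, Real.norm_eq_abs,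
        Real.norm_of_nonneg (by positivity : 0 ≤ ‖b μ‖ ^ (p - 1))]
      refine mul_le_mul ?_ ?_ (by positivity) (by positivity)
      · have := abs_rpow_sub_rpow_le (r := p + 1) (by linarith) (norm_nonneg (a ν))
          (norm_nonneg (b ν)) (haS ν) (hbS ν)
        rw [add_sub_cancel_right] at this
        refine this.trans (mul_le_mul_of_nonneg_left ?_ (by positivity))
        exact (abs_norm_sub_norm_le _ _).trans (hδ ν)
      · rw [← e3]
        exact mul_le_mul (Real.rpow_le_rpow (norm_nonneg _) (hbS μ) (by linarith)) (hbS μ)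
          (norm_nonneg _) (by positivity)
    refine (add_le_add h1 h2).trans_eq ?_
    rw [← e1]
    linear_combination (p + 1) * modSum (a - b) * (e2 - e1)
  unfold nonlin
  rw [← Finset.sum_sub_distrib]
  refine (norm_sum_le _ _).trans ((Finset.sum_le_sum fun ν _ => term ν).trans ?_)
  rw [← Finset.sum_mul]
  have h3 : ∑ ν, |β μ ν| ≤ ∑ μ, ∑ ν, |β μ ν| :=
    Finset.single_le_sum (f := fun μ => ∑ ν, |β μ ν|)
      (fun _ _ => Finset.sum_nonneg fun _ _ => abs_nonneg _) (Finset.mem_univ μ)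
  calc _ ≤ (∑ μ, ∑ ν, |β μ ν|) * (2 * (1 + p) * S ^ (2 * p) * modSum (a - b)) :=
        mul_le_mul_of_nonneg_right h3 (by positivity)
    _ = _ := by unfold nonlinConst; ring

lemma nonlin_zero {p : ℝ} (β : Fin N → Fin N → ℝ) (μ : Fin N) : nonlin p β 0 μ = 0 := by
  simp [nonlin]

lemma conj_nonlin_mul_self {p : ℝ} (β : Fin N → Fin N → ℝ) (hp : 1 ≤ p) (z : Fin N → ℂ) :
    ∑ μ, ((starRingEnd ℂ) (nonlin p β z μ) * z μ).re = potential p β z := by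
  unfold potential
  refine Finset.sum_congr rfl fun μ _ => ?_
  simp only [nonlin, map_sum, map_mul, Complex.conj_ofReal, Finset.sum_mul, Complex.re_sum]
  refine Finset.sum_congr rfl fun ν _ => ?_
  rw [mul_assoc, mul_comm ((starRingEnd ℂ) (z μ)), Complex.mul_conj, Complex.normSq_eq_norm_sq,
    Complex.re_ofReal_mul, Complex.ofReal_re]
  have e : ‖z μ‖ ^ (p - 1) * ‖z μ‖ ^ 2 = ‖z μ‖ ^ (p + 1) := by
    rw [← Real.rpow_natCast, ← Real.rpow_add_of_nonneg (norm_nonneg _) (by linarith) (by norm_num)]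
    congr 1; push_cast; ring
  rw [← e]; ring

/-- The nonlinearity is, up to the factor 2(p+1), the gradient of the potential. This is where
symmetry of β enters: the two sums from the product rule coincide after exchanging the indices. -/
lemma hasDerivAt_potential_line {p : ℝ} (hp : 1 ≤ p) {β : Fin N → Fin N → ℝ}
    (hβ : ∀ μ ν, β μ ν = β ν μ) (a D : Fin N → ℂ) (s : ℝ) :
    HasDerivAt (fun s : ℝ => potential p β (a + s • D))
      (2 * (p + 1) * ∑ μ, ((starRingEnd ℂ) (nonlin p β (a + s • D) μ) * D μ).re) s := by
  set z := a + s • D with hz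
  have h1 : ∀ μ, HasDerivAt (fun s : ℝ => ‖(a + s • D) μ‖ ^ (p + 1))
      ((p + 1) * ‖z μ‖ ^ (p - 1) * ((starRingEnd ℂ) (z μ) * D μ).re) s := by
    intro μ
    have hl : HasDerivAt (fun s : ℝ => (a + s • D) μ) (D μ) s := by
      have := ((hasDerivAt_id s).smul_const (D μ)).const_add (a μ)
      simpa using this
    have hn := (hasFDerivAt_norm_rpow (z μ) (p := p + 1) (by linarith)).comp_hasDerivAt s hl
    refine HasDerivAt.congr_deriv hn ?_
    change ((p + 1) * ‖z μ‖ ^ (p + 1 - 2)) * inner ℝ (z μ) (D μ) = _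
    rw [Complex.inner, show p + 1 - 2 = p - 1 by ring, mul_comm (D μ)]
  have h2 : HasDerivAt (fun s : ℝ => potential p β (a + s • D))
      (∑ μ, ∑ ν, β μ ν * ((p + 1) * ‖z μ‖ ^ (p - 1) * ((starRingEnd ℂ) (z μ) * D μ).re *
        ‖z ν‖ ^ (p + 1) + ‖z μ‖ ^ (p + 1) * ((p + 1) * ‖z ν‖ ^ (p - 1) *
        ((starRingEnd ℂ) (z ν) * D ν).re))) s := by
    unfold potential
    exact HasDerivAt.fun_sum fun μ _ => HasDerivAt.fun_sum fun ν _ =>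
      ((h1 μ).mul (h1 ν)).const_mul (β μ ν)
  convert h2 using 1
  have e1 : ∑ μ, ∑ ν, β μ ν * (‖z μ‖ ^ (p + 1) * ((p + 1) * ‖z ν‖ ^ (p - 1) *
        ((starRingEnd ℂ) (z ν) * D ν).re)) =
      ∑ μ, ∑ ν, β μ ν * ((p + 1) * ‖z μ‖ ^ (p - 1) * ((starRingEnd ℂ) (z μ) * D μ).re *
        ‖z ν‖ ^ (p + 1)) := by
    rw [Finset.sum_comm]
    refine Finset.sum_congr rfl fun μ _ => Finset.sum_congr rfl fun ν _ => ?_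
    rw [hβ ν μ]; ring
  have e2 : ∀ μ, ((starRingEnd ℂ) (nonlin p β z μ) * D μ).re =
      ∑ ν, β μ ν * (‖z μ‖ ^ (p - 1) * ((starRingEnd ℂ) (z μ) * D μ).re * ‖z ν‖ ^ (p + 1)) := by
    intro μ
    simp only [nonlin, map_sum, map_mul, Complex.conj_ofReal, Finset.sum_mul, Complex.re_sum]
    refine Finset.sum_congr rfl fun ν _ => ?_
    rw [mul_assoc, Complex.re_ofReal_mul]; ring
  have e3 : (p + 1) * ∑ μ, ((starRingEnd ℂ) (nonlin p β z μ) * D μ).re =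
      ∑ μ, ∑ ν, β μ ν * ((p + 1) * ‖z μ‖ ^ (p - 1) * ((starRingEnd ℂ) (z μ) * D μ).re *
        ‖z ν‖ ^ (p + 1)) := by
    rw [Finset.mul_sum]
    refine Finset.sum_congr rfl fun μ _ => ?_
    rw [e2, Finset.mul_sum]
    exact Finset.sum_congr rfl fun ν _ => by ring
  rw [mul_assoc, e3]
  simp only [mul_add, Finset.sum_add_distrib]
  rw [e1, ← two_mul]

/-- The mean value theorem on the segment from a to b. The increment of the potential is thus
expressed by the nonlinearity at a point that is close to both ends whenever they are close. -/
lemma exists_potential_sub {p : ℝ} (hp : 1 ≤ p) {β : Fin N → Fin N → ℝ}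
    (hβ : ∀ μ ν, β μ ν = β ν μ) (a b : Fin N → ℂ) :
    ∃ s ∈ Set.Ioo (0 : ℝ) 1, potential p β b - potential p β a =
      2 * (p + 1) * ∑ μ, ((starRingEnd ℂ) (nonlin p β (a + s • (b - a)) μ) * (b - a) μ).re := by
  have hd := fun s => hasDerivAt_potential_line hp hβ a (b - a) s
  obtain ⟨s, hs, h⟩ := exists_hasDerivAt_eq_slope (fun s : ℝ => potential p β (a + s • (b - a)))
    (fun s => 2 * (p + 1) * ∑ μ, ((starRingEnd ℂ) (nonlin p β (a + s • (b - a)) μ) * (b - a) μ).re)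
    zero_lt_one (fun s _ => (hd s).continuousAt.continuousWithinAt) (fun s _ => hd s)
  refine ⟨s, hs, ?_⟩
  rw [h]
  simp

lemma modSum_segment_le {a b : Fin N → ℂ} {s : ℝ} (hs : s ∈ Set.Ioo (0 : ℝ) 1) :
    modSum (a + s • (b - a)) ≤ modSum a + modSum b := by
  have e : a + s • (b - a) = (1 - s) • a + s • b := by
    rw [smul_sub, sub_smul, one_smul]; abel
  rw [e]
  refine (modSum_add_le _ _).trans ?_
  rw [modSum_smul, modSum_smul, abs_of_pos hs.1, abs_of_pos (sub_pos.2 hs.2)]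
  nlinarith [modSum_nonneg a, modSum_nonneg b, hs.1, hs.2]

lemma sum_re_conj_mul_le {f D : Fin N → ℂ} {K : ℝ} (hf : ∀ μ, ‖f μ‖ ≤ K) :
    |∑ μ, ((starRingEnd ℂ) (f μ) * D μ).re| ≤ K * modSum D := by
  refine (Finset.abs_sum_le_sum_abs _ _).trans ?_
  rw [modSum, Finset.mul_sum]
  refine Finset.sum_le_sum fun μ _ => (Complex.abs_re_le_norm _).trans ?_
  rw [norm_mul, RCLike.norm_conj]
  exact mul_le_mul_of_nonneg_right (hf μ) (norm_nonneg _)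

lemma abs_potential_sub_le {p : ℝ} (hp : 1 ≤ p) {β : Fin N → Fin N → ℝ}
    (hβ : ∀ μ ν, β μ ν = β ν μ) (a b : Fin N → ℂ) :
    |potential p β b - potential p β a| ≤ 2 * (p + 1) * nonlinConst p β *
      ((modSum a + modSum b) ^ (2 * p) * (modSum a + modSum b) * modSum (b - a)) := by
  obtain ⟨s, hs, h⟩ := exists_potential_sub hp hβ a b
  set S := modSum a + modSum b with hS
  have hS0 : 0 ≤ S := add_nonneg (modSum_nonneg _) (modSum_nonneg _)
  set z := a + s • (b - a) with hz
  have hzS : modSum z ≤ S := modSum_segment_le hs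
  have hf : ∀ μ, ‖nonlin p β z μ‖ ≤ nonlinConst p β * S ^ (2 * p) * S := by
    intro μ
    have := norm_nonlin_sub_le hp β (a := z) (b := 0) (S := S) hzS (by simpa [modSum] using hS0) μ
    rw [nonlin_zero, sub_zero, sub_zero] at this
    refine this.trans (mul_le_mul_of_nonneg_left hzS ?_)
    exact mul_nonneg (nonlinConst_nonneg hp β) (by positivity)
  rw [h, abs_mul, abs_of_nonneg (by linarith)]
  refine (mul_le_mul_of_nonneg_left (sum_re_conj_mul_le hf) (by linarith)).trans_eq ?_
  ring

/-- The first order cancellation in the nonlinear term of the momentum balance. -/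
lemma abs_nonlinear_cancellation_le {p : ℝ} (hp : 1 ≤ p) {β : Fin N → Fin N → ℝ}
    (hβ : ∀ μ ν, β μ ν = β ν μ) (a b : Fin N → ℂ) :
    |∑ μ, ((starRingEnd ℂ) (a μ) * nonlin p β b μ - (starRingEnd ℂ) (nonlin p β a μ) * b μ).re -
      p / (p + 1) * (potential p β b - potential p β a)| ≤
      2 * nonlinConst p β * ((modSum a + modSum b) ^ (2 * p) * modSum (b - a) * modSum (b - a)) := by
  obtain ⟨s, hs, h⟩ := exists_potential_sub hp hβ a b
  set S := modSum a + modSum b with hS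
  set z := a + s • (b - a) with hz
  have hS0 : 0 ≤ S := add_nonneg (modSum_nonneg _) (modSum_nonneg _)
  have hzS : modSum z ≤ S := modSum_segment_le hs
  have haS : modSum a ≤ S := le_add_of_nonneg_right (modSum_nonneg _)
  have hbS : modSum b ≤ S := le_add_of_nonneg_left (modSum_nonneg _)
  have hδ0 := modSum_nonneg (b - a)
  have hK := nonlinConst_nonneg hp β
  -- The intermediate point is at distance at most that of a and b from either end, so the second
  -- factor is of first order as well.
  have hnz : ∀ μ, ‖2 * nonlin p β z μ - nonlin p β a μ - nonlin p β b μ‖ ≤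
      2 * nonlinConst p β * S ^ (2 * p) * modSum (b - a) := by
    intro μ
    have h1 := norm_nonlin_sub_le hp β hzS haS μ
    have h2 := norm_nonlin_sub_le hp β hzS hbS μ
    have e1 : modSum (z - a) ≤ modSum (b - a) := by
      rw [hz, add_sub_cancel_left, modSum_smul, abs_of_pos hs.1]
      exact mul_le_of_le_one_left hδ0 hs.2.le
    have e2 : modSum (z - b) ≤ modSum (b - a) := by
      have : z - b = (s - 1) • (b - a) := by rw [hz, sub_smul, one_smul]; abel
      rw [this, modSum_smul, abs_of_neg (by linarith [hs.2])]
      exact mul_le_of_le_one_left hδ0 (by linarith [hs.1])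
    have h3 : ‖2 * nonlin p β z μ - nonlin p β a μ - nonlin p β b μ‖ ≤
        ‖nonlin p β z μ - nonlin p β a μ‖ + ‖nonlin p β z μ - nonlin p β b μ‖ := by
      refine le_trans (le_of_eq ?_) (norm_add_le _ _)
      congr 1; ring
    have h4 : 0 ≤ nonlinConst p β * S ^ (2 * p) := by positivity
    nlinarith [mul_le_mul_of_nonneg_left e1 h4, mul_le_mul_of_nonneg_left e2 h4]
  -- Write n for the nonlinearity. Since p/(p+1) = 1 - 1/(p+1), and the increment of the potential
  -- is both Σ Re(conj n(b) b - conj n(a) a) and 2(p+1) Σ Re(conj n(z) (b-a)), the left-hand side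
  -- collapses to a pairing of 2n(z) - n(a) - n(b) with b - a.
  have e : ∑ μ, ((starRingEnd ℂ) (a μ) * nonlin p β b μ - (starRingEnd ℂ) (nonlin p β a μ) * b μ).re -
      p / (p + 1) * (potential p β b - potential p β a) =
      ∑ μ, ((starRingEnd ℂ) (2 * nonlin p β z μ - nonlin p β a μ - nonlin p β b μ) * (b - a) μ).re := by
    have h1 := conj_nonlin_mul_self β hp a
    have h2 := conj_nonlin_mul_self β hp b
    have h3 : p / (p + 1) * (potential p β b - potential p β a) =
        (potential p β b - potential p β a) -
        2 * ∑ μ, ((starRingEnd ℂ) (nonlin p β z μ) * (b - a) μ).re := by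
      have hp1 : p + 1 ≠ 0 := by linarith
      have h4 : ∑ μ, ((starRingEnd ℂ) (nonlin p β z μ) * (b - a) μ).re =
          (potential p β b - potential p β a) / (2 * (p + 1)) := by
        rw [h]; field_simp
      rw [h4]; field_simp; ring
    rw [h3, ← h1, ← h2, ← Finset.sum_sub_distrib, Finset.mul_sum, ← Finset.sum_sub_distrib,
      ← Finset.sum_sub_distrib]
    refine Finset.sum_congr rfl fun μ _ => ?_
    simp only [map_sub, map_mul, Pi.sub_apply, Complex.sub_re, Complex.mul_re, Complex.conj_re,
      Complex.conj_im, Complex.sub_im, Complex.mul_im, Complex.re_ofNat, Complex.im_ofNat]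
    simp
    ring
  rw [e]
  refine (sum_re_conj_mul_le hnz).trans_eq ?_
  ring

/-- A real multiple of z_μ: this is why the nonlinearity drops out of the mass law, component by
component. -/
lemma im_conj_mul_nonlin {p : ℝ} (β : Fin N → Fin N → ℝ) (z : Fin N → ℂ) (μ : Fin N) :
    ∃ r : ℝ, nonlin p β z μ = r * z μ := by
  refine ⟨∑ ν, β μ ν * ‖z ν‖ ^ (p + 1) * ‖z μ‖ ^ (p - 1), ?_⟩
  rw [nonlin, ← Finset.sum_mul]
  push_cast
  rfl

lemma continuous_nonlin {p : ℝ} (hp : 1 ≤ p) (β : Fin N → Fin N → ℝ) (μ : Fin N) :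
    Continuous fun z : Fin N → ℂ => nonlin p β z μ := by
  unfold nonlin
  refine continuous_finsetSum _ fun ν _ => Continuous.mul (Complex.continuous_ofReal.comp ?_)
    (continuous_apply μ)
  refine (continuous_const.mul ?_).mul ?_
  · exact (continuous_apply ν).norm.rpow_const fun _ => Or.inr (by linarith)
  · exact (continuous_apply μ).norm.rpow_const fun _ => Or.inr (by linarith)

lemma continuous_potential {p : ℝ} (hp : 1 ≤ p) (β : Fin N → Fin N → ℝ) :
    Continuous fun z : Fin N → ℂ => potential p β z := by
  unfold potential
  refine continuous_finsetSum _ fun μ _ => continuous_finsetSum _ fun ν _ => continuous_const.mul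
    (Continuous.mul ?_ ?_)
  · exact (continuous_apply μ).norm.rpow_const fun _ => Or.inr (by linarith)
  · exact (continuous_apply ν).norm.rpow_const fun _ => Or.inr (by linarith)

end Pointwise

end InteractionMorawetz

end

/-! ### The exponent 2p+2, Hölder's inequality and the Nemytskii operator -/

noncomputable section
open MeasureTheory Filter Topology
open scoped ContDiff ENNReal SchwartzMap FourierTransform RealInnerProductSpace Laplacian LineDeriv
namespace InteractionMorawetz

section Exponents

/-- The Lebesgue exponent `2p+2` of the potential energy. -/
abbrev energyExp (p : ℝ) : ℝ≥0∞ := ENNReal.ofReal (2 * p + 2)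

/-- The exponent conjugate to `2p+2`. -/
abbrev energyExp' (p : ℝ) : ℝ≥0∞ := ENNReal.ofReal ((2 * p + 2) / (2 * p + 1))

variable {p : ℝ} [hp : Fact (1 ≤ p)]

lemma one_le_energyExp : (1 : ℝ) ≤ 2 * p + 2 := by linarith [hp.out]

lemma holderConjugate_energyExp_real :
    Real.HolderConjugate (2 * p + 2) ((2 * p + 2) / (2 * p + 1)) := by
  have h1 := hp.out
  rw [Real.holderConjugate_iff]
  constructor
  · linarith
  · rw [inv_div]; field_simp; ring

instance : Fact (1 ≤ energyExp p) := ⟨by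
  rw [← ENNReal.ofReal_one]; exact ENNReal.ofReal_le_ofReal one_le_energyExp⟩

instance : Fact (1 ≤ energyExp' p) := ⟨by
  have h1 := hp.out
  rw [← ENNReal.ofReal_one]
  refine ENNReal.ofReal_le_ofReal ?_
  rw [le_div_iff₀ (by linarith)]; linarith⟩

instance : (energyExp p).HolderConjugate (energyExp' p) :=
  (holderConjugate_energyExp_real (p := p)).ennrealOfReal

instance : (energyExp' p).HolderConjugate (energyExp p) :=
  (holderConjugate_energyExp_real (p := p)).symm.ennrealOfReal

/-- The power 2p of a function in L^{2p+2} lies in L^{(p+1)/p}; its product with another such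
function lies in the dual space. This is the Hölder count behind every Lipschitz bound for the
nonlinearity. -/
instance : ENNReal.HolderTriple (ENNReal.ofReal ((p + 1) / p)) (energyExp p) (energyExp' p) := by
  have h1 := hp.out
  refine Real.HolderTriple.ennrealOfReal ⟨?_, ?_, ?_⟩
  · rw [inv_div, inv_div]; field_simp
  · apply div_pos <;> linarith
  · linarith

/-- The exponent of the Sobolev weight (1+|ξ|²)^{-1/2}. It must exceed d, which is the only
restriction relating p and the dimension. -/
instance : ENNReal.HolderTriple (ENNReal.ofReal ((2 * p + 2) / p)) 2 (energyExp' p) := by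
  have h1 := hp.out
  have : ENNReal.HolderTriple (ENNReal.ofReal ((2 * p + 2) / p)) (ENNReal.ofReal 2) (energyExp' p) := by
    refine Real.HolderTriple.ennrealOfReal ⟨?_, ?_, ?_⟩
    · rw [inv_div, inv_div]; field_simp; ring
    · apply div_pos <;> linarith
    · linarith
  simpa using this

lemma energyExp_ne_top {p : ℝ} : energyExp p ≠ ⊤ := ENNReal.ofReal_ne_top

lemma energyExp'_ne_top {p : ℝ} : energyExp' p ≠ ⊤ := ENNReal.ofReal_ne_top

lemma energyExp'_le_two : energyExp' p ≤ 2 := by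
  have h1 := hp.out
  rw [show (2 : ℝ≥0∞) = ENNReal.ofReal 2 by simp]
  refine ENNReal.ofReal_le_ofReal ?_
  rw [div_le_iff₀ (by linarith)]; linarith

lemma sobolevBound_energyExp {d : ℕ} (hd : (d : ℝ) < (2 * p + 2) / p) :
    SobolevBound d (energyExp p) :=
  exists_sobolev (q' := energyExp' p) energyExp_ne_top energyExp'_le_two hd

/-- The decay rate is |t|^{-σ} with σ = dp/(2p+2), which is below 1, hence locally integrable, under
the same condition that gives the Sobolev embedding. -/
lemma norm_schrodinger_energyExp_le {d : ℕ} {t : ℝ} (ht : t ≠ 0) (f : 𝓢(Rd d, ℂ)) :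
    ‖(schrodinger t f).toLp (energyExp p) volume‖ ≤
      (4 * Real.pi) ^ (-(d / ((2 * p + 2) / p))) * |t| ^ (-(d / ((2 * p + 2) / p))) *
        ‖f.toLp (energyExp' p) volume‖ := by
  have h1 := hp.out
  have h := norm_schrodinger_toLp_le (q := energyExp p) (q' := energyExp' p) energyExp_ne_top
    energyExp'_le_two ht f
  refine h.trans_eq ?_
  congr 1
  have hpi := Real.pi_pos
  rw [← Real.rpow_mul (by positivity), ← Real.mul_rpow (by positivity) (abs_nonneg t)]
  congr 1
  rw [ENNReal.toReal_ofReal (by apply div_nonneg <;> linarith)]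
  field_simp
  ring

end Exponents

section Holder

variable {p : ℝ} [hp : Fact (1 ≤ p)] {α : Type*} [MeasurableSpace α] {m : Measure α}

lemma eLpNorm_rpow_mul_le {A D : α → ℝ} (hA : AEStronglyMeasurable A m)
    (hD : AEStronglyMeasurable D m) (hA0 : ∀ x, 0 ≤ A x) {a δ : ℝ} (ha : 0 ≤ a)
    (hAa : eLpNorm A (energyExp p) m ≤ ENNReal.ofReal a)
    (hDδ : eLpNorm D (energyExp p) m ≤ ENNReal.ofReal δ) :
    eLpNorm (fun x => A x ^ (2 * p) * D x) (energyExp' p) m ≤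
      ENNReal.ofReal (a ^ (2 * p) * δ) := by
  have h1 := hp.out
  have hpow : eLpNorm (fun x => A x ^ (2 * p)) (ENNReal.ofReal ((p + 1) / p)) m ≤
      ENNReal.ofReal (a ^ (2 * p)) := by
    have e := eLpNorm_norm_rpow (p := ENNReal.ofReal ((p + 1) / p)) (μ := m) A
      (show 0 < 2 * p by linarith)
    have e2 : ENNReal.ofReal ((p + 1) / p) * ENNReal.ofReal (2 * p) = energyExp p := by
      rw [← ENNReal.ofReal_mul (by apply div_nonneg <;> linarith)]
      congr 1; field_simp
    rw [e2] at e
    rw [show (fun x => A x ^ (2 * p)) = fun x => ‖A x‖ ^ (2 * p) by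
      ext x; rw [Real.norm_of_nonneg (hA0 x)], e, ← ENNReal.ofReal_rpow_of_nonneg ha (by linarith)]
    exact ENNReal.rpow_le_rpow hAa (by linarith)
  have h := eLpNorm_smul_le_mul_eLpNorm (p := ENNReal.ofReal ((p + 1) / p)) (q := energyExp p)
    (r := energyExp' p) (μ := m) (f := D) (φ := fun x => A x ^ (2 * p)) hD
    ((hA.aemeasurable.pow_const (2 * p)).aestronglyMeasurable)
  refine h.trans ?_
  rw [ENNReal.ofReal_mul (by positivity)]
  exact mul_le_mul' hpow hDδ

lemma integral_rpow_mul_mul_le {A D E : α → ℝ} (hA : AEStronglyMeasurable A m)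
    (hD : AEStronglyMeasurable D m) (hE : AEStronglyMeasurable E m) (hA0 : ∀ x, 0 ≤ A x)
    (hD0 : ∀ x, 0 ≤ D x) (hE0 : ∀ x, 0 ≤ E x) {a δ ε : ℝ} (ha : 0 ≤ a) (hδ : 0 ≤ δ) (hε : 0 ≤ ε)
    (hAa : eLpNorm A (energyExp p) m ≤ ENNReal.ofReal a)
    (hDδ : eLpNorm D (energyExp p) m ≤ ENNReal.ofReal δ)
    (hEε : eLpNorm E (energyExp p) m ≤ ENNReal.ofReal ε) :
    Integrable (fun x => A x ^ (2 * p) * D x * E x) m ∧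
      ∫ x, A x ^ (2 * p) * D x * E x ∂m ≤ a ^ (2 * p) * δ * ε := by
  have hm : AEStronglyMeasurable (fun x => A x ^ (2 * p) * D x) m :=
    (hA.aemeasurable.pow_const (2 * p)).aestronglyMeasurable.mul hD
  have h := eLpNorm_smul_le_mul_eLpNorm (p := energyExp' p) (q := energyExp p)
    (r := 1) (μ := m) (f := E) (φ := fun x => A x ^ (2 * p) * D x) hE hm
  have h2 : eLpNorm (fun x => A x ^ (2 * p) * D x * E x) 1 m ≤
      ENNReal.ofReal (a ^ (2 * p) * δ * ε) := by
    refine h.trans ?_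
    rw [ENNReal.ofReal_mul (by positivity)]
    exact mul_le_mul' (eLpNorm_rpow_mul_le hA hD hA0 ha hAa hDδ) hEε
  have hint : Integrable (fun x => A x ^ (2 * p) * D x * E x) m :=
    memLp_one_iff_integrable.1 ⟨hm.mul hE, h2.trans_lt ENNReal.ofReal_lt_top⟩
  refine ⟨hint, ?_⟩
  rw [eLpNorm_one_eq_lintegral_enorm] at h2
  have h3 := integral_eq_lintegral_of_nonneg_ae (μ := m)
    (f := fun x => A x ^ (2 * p) * D x * E x)
    (ae_of_all _ fun x => mul_nonneg (mul_nonneg (Real.rpow_nonneg (hA0 x) _) (hD0 x)) (hE0 x))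
    hint.1
  rw [h3]
  refine ENNReal.toReal_le_of_le_ofReal (by positivity) (le_trans (lintegral_mono fun x => ?_) h2)
  rw [Real.enorm_of_nonneg (mul_nonneg (mul_nonneg (Real.rpow_nonneg (hA0 x) _) (hD0 x)) (hE0 x))]

end Holder

section Nemytskii

variable {d N : ℕ} {p : ℝ} [hp : Fact (1 ≤ p)]

/-- The values at `x` of a tuple of `L^q` functions. -/
def values {q : ℝ≥0∞} (f : Fin N → LL d q) (x : Rd d) : Fin N → ℂ := fun ν => f ν x

/-- The sum of the norms of a tuple. -/
def normSum {q : ℝ≥0∞} [Fact (1 ≤ q)] (f : Fin N → LL d q) : ℝ := ∑ ν, ‖f ν‖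

lemma normSum_nonneg {q : ℝ≥0∞} [Fact (1 ≤ q)] (f : Fin N → LL d q) : 0 ≤ normSum f :=
  Finset.sum_nonneg fun _ _ => norm_nonneg _

lemma continuous_normSum {q : ℝ≥0∞} [Fact (1 ≤ q)] :
    Continuous (normSum : (Fin N → LL d q) → ℝ) :=
  continuous_finsetSum _ fun ν _ => (continuous_apply ν).norm

lemma aestronglyMeasurable_values {q : ℝ≥0∞} (f : Fin N → LL d q) :
    AEStronglyMeasurable (values f) volume := by
  refine AEMeasurable.aestronglyMeasurable (aemeasurable_pi_lambda _ fun ν => ?_)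
  exact (Lp.aestronglyMeasurable (f ν)).aemeasurable

lemma continuous_modSum : Continuous (modSum : (Fin N → ℂ) → ℝ) :=
  continuous_finsetSum _ fun ν _ => (continuous_apply ν).norm

lemma eLpNorm_modSum_le {q : ℝ≥0∞} [hq : Fact (1 ≤ q)] (f : Fin N → LL d q) :
    eLpNorm (fun x => modSum (values f x)) q volume ≤ ENNReal.ofReal (normSum f) := by
  have h := eLpNorm_sum_le (s := Finset.univ) (f := fun ν (x : Rd d) => ‖f ν x‖) (p := q)
    (μ := volume) (fun ν _ => (Lp.aestronglyMeasurable (f ν)).norm) hq.out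
  have e : (∑ ν, fun x : Rd d => ‖f ν x‖) = fun x => modSum (values f x) := by
    ext x; simp [modSum, values]
  rw [e] at h
  refine h.trans_eq ?_
  rw [normSum, ENNReal.ofReal_sum_of_nonneg fun _ _ => norm_nonneg _]
  refine Finset.sum_congr rfl fun ν _ => ?_
  rw [eLpNorm_norm, Lp.norm_def, ENNReal.ofReal_toReal (Lp.eLpNorm_ne_top _)]

lemma aestronglyMeasurable_modSum {q : ℝ≥0∞} (f : Fin N → LL d q) :
    AEStronglyMeasurable (fun x => modSum (values f x)) volume :=
  continuous_modSum.comp_aestronglyMeasurable (aestronglyMeasurable_values f)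

lemma values_sub {q : ℝ≥0∞} (f g : Fin N → LL d q) :
    ∀ᵐ x, values (f - g) x = values f x - values g x := by
  have h : ∀ᵐ x, ∀ ν, (f - g) ν x = f ν x - g ν x := by
    rw [ae_all_iff]; exact fun ν => Lp.coeFn_sub (f ν) (g ν)
  filter_upwards [h] with x hx
  ext ν; exact hx ν

lemma eLpNorm_modSum_add_le {q : ℝ≥0∞} [hq : Fact (1 ≤ q)] (f g : Fin N → LL d q) :
    eLpNorm (fun x => modSum (values f x) + modSum (values g x)) q volume ≤
      ENNReal.ofReal (normSum f + normSum g) := by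
  refine (eLpNorm_add_le (aestronglyMeasurable_modSum f) (aestronglyMeasurable_modSum g)
    hq.out).trans ?_
  rw [ENNReal.ofReal_add (normSum_nonneg f) (normSum_nonneg g)]
  exact add_le_add (eLpNorm_modSum_le f) (eLpNorm_modSum_le g)

lemma eLpNorm_nonlin_sub_le (β : Fin N → Fin N → ℝ) (f g : Fin N → LL d (energyExp p)) (μ : Fin N) :
    eLpNorm (fun x => nonlin p β (values f x) μ - nonlin p β (values g x) μ) (energyExp' p) volume ≤
      ENNReal.ofReal (nonlinConst p β * ((normSum f + normSum g) ^ (2 * p) * normSum (f - g))) := by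
  have hK := nonlinConst_nonneg hp.out β
  have h1 := eLpNorm_rpow_mul_le ((aestronglyMeasurable_modSum f).add (aestronglyMeasurable_modSum g))
    (aestronglyMeasurable_modSum (f - g)) (fun x => add_nonneg (modSum_nonneg _) (modSum_nonneg _))
    (add_nonneg (normSum_nonneg f) (normSum_nonneg g)) (eLpNorm_modSum_add_le f g)
    (eLpNorm_modSum_le (f - g))
  rw [ENNReal.ofReal_mul hK]
  refine le_trans (eLpNorm_le_mul_eLpNorm_of_ae_le_mul (c := nonlinConst p β) (g := fun x =>
    (modSum (values f x) + modSum (values g x)) ^ (2 * p) * modSum (values (f - g) x)) ?_ _)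
    (mul_le_mul_right h1 _)
  filter_upwards [values_sub f g] with x hx
  have h2 := norm_nonlin_sub_le hp.out β (a := values f x) (b := values g x)
    (S := modSum (values f x) + modSum (values g x))
    (le_add_of_nonneg_right (modSum_nonneg _)) (le_add_of_nonneg_left (modSum_nonneg _)) μ
  rw [← hx] at h2
  refine h2.trans ((le_abs_self _).trans_eq ?_)
  rw [mul_assoc, abs_mul, abs_of_nonneg hK, Real.norm_eq_abs]

lemma memLp_nonlin (β : Fin N → Fin N → ℝ) (f : Fin N → LL d (energyExp p)) (μ : Fin N) :
    MemLp (fun x => nonlin p β (values f x) μ) (energyExp' p) volume := by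
  refine ⟨(continuous_nonlin hp.out β μ).comp_aestronglyMeasurable (aestronglyMeasurable_values f),
    lt_of_eq_of_lt (eLpNorm_congr_ae ?_)
      ((eLpNorm_nonlin_sub_le β f 0 μ).trans_lt ENNReal.ofReal_lt_top)⟩
  have h : ∀ᵐ x, ∀ ν, (0 : Fin N → LL d (energyExp p)) ν x = 0 := by
    rw [ae_all_iff]; exact fun ν => Lp.coeFn_zero ℂ (energyExp p) (volume : Measure (Rd d))
  filter_upwards [h] with x hx
  have : values (0 : Fin N → LL d (energyExp p)) x = 0 := funext hx
  rw [this, nonlin_zero, sub_zero]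

/-- The nonlinearity as a map `(L^{2p+2})^N → L^{(2p+2)/(2p+1)}`. -/
def nemytskii (β : Fin N → Fin N → ℝ) (f : Fin N → LL d (energyExp p)) (μ : Fin N) :
    LL d (energyExp' p) := (memLp_nonlin β f μ).toLp _

lemma coeFn_nemytskii (β : Fin N → Fin N → ℝ) (f : Fin N → LL d (energyExp p)) (μ : Fin N) :
    nemytskii β f μ =ᵐ[volume] fun x => nonlin p β (values f x) μ := MemLp.coeFn_toLp _

lemma norm_nemytskii_sub_le (β : Fin N → Fin N → ℝ) (f g : Fin N → LL d (energyExp p)) (μ : Fin N) :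
    ‖nemytskii β f μ - nemytskii β g μ‖ ≤
      nonlinConst p β * ((normSum f + normSum g) ^ (2 * p) * normSum (f - g)) := by
  have hK := nonlinConst_nonneg hp.out β
  rw [nemytskii, nemytskii, ← MemLp.toLp_sub, Lp.norm_toLp]
  refine ENNReal.toReal_le_of_le_ofReal ?_ (eLpNorm_nonlin_sub_le β f g μ)
  have := normSum_nonneg f
  have := normSum_nonneg g
  have := normSum_nonneg (f - g)
  positivity

/-- Continuity comes from the local Lipschitz bound: the difference norm tends to zero while the sum
of the norms stays bounded. -/
lemma continuous_nemytskii (β : Fin N → Fin N → ℝ) (μ : Fin N) :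
    Continuous fun f : Fin N → LL d (energyExp p) => nemytskii β f μ := by
  refine continuous_iff_continuousAt.2 fun f => ?_
  rw [ContinuousAt, tendsto_iff_norm_sub_tendsto_zero]
  refine squeeze_zero (fun _ => norm_nonneg _) (fun g => norm_nemytskii_sub_le β g f μ) ?_
  have hc : Continuous fun g : Fin N → LL d (energyExp p) =>
      nonlinConst p β * ((normSum g + normSum f) ^ (2 * p) * normSum (g - f)) := by
    refine continuous_const.mul (((continuous_normSum.add continuous_const).rpow_const fun _ =>
      Or.inr (by linarith [hp.out])).mul (continuous_normSum.comp (continuous_id.sub continuous_const)))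
  have := hc.tendsto f
  simpa [normSum] using this

lemma abs_potential_le (β : Fin N → Fin N → ℝ) (hβ : ∀ μ ν, β μ ν = β ν μ) (z : Fin N → ℂ) :
    |potential p β z| ≤ 2 * (p + 1) * nonlinConst p β * (modSum z ^ (2 * p) * modSum z * modSum z) := by
  have h := abs_potential_sub_le hp.out hβ 0 z
  have h0 : potential p β (0 : Fin N → ℂ) = 0 := by
    have : (0 : ℝ) ^ (p + 1) = 0 := Real.zero_rpow (by linarith [hp.out])
    simp [potential, this]
  have h1 : modSum (0 : Fin N → ℂ) = 0 := by simp [modSum]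
  simpa [h0, h1] using h

lemma integrable_potential {β : Fin N → Fin N → ℝ} (hβ : ∀ μ ν, β μ ν = β ν μ)
    (f : Fin N → LL d (energyExp p)) : Integrable fun x => potential p β (values f x) := by
  have h := (integral_rpow_mul_mul_le (aestronglyMeasurable_modSum f) (aestronglyMeasurable_modSum f)
    (aestronglyMeasurable_modSum f) (fun x => modSum_nonneg _) (fun x => modSum_nonneg _)
    (fun x => modSum_nonneg _) (normSum_nonneg f) (normSum_nonneg f) (normSum_nonneg f)
    (eLpNorm_modSum_le f) (eLpNorm_modSum_le f) (eLpNorm_modSum_le f)).1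
  refine (h.const_mul (2 * (p + 1) * nonlinConst p β)).mono'
    ((continuous_potential hp.out β).comp_aestronglyMeasurable (aestronglyMeasurable_values f)) ?_
  exact ae_of_all _ fun x => abs_potential_le β hβ _

lemma integral_abs_potential_sub_le {β : Fin N → Fin N → ℝ} (hβ : ∀ μ ν, β μ ν = β ν μ)
    (f g : Fin N → LL d (energyExp p)) :
    ∫ x, |potential p β (values g x) - potential p β (values f x)| ≤
      2 * (p + 1) * nonlinConst p β *
        ((normSum f + normSum g) ^ (2 * p) * (normSum f + normSum g) * normSum (g - f)) := by
  have h1p := hp.out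
  have hK := nonlinConst_nonneg hp.out β
  have hS := add_nonneg (normSum_nonneg f) (normSum_nonneg g)
  have h := integral_rpow_mul_mul_le ((aestronglyMeasurable_modSum f).add (aestronglyMeasurable_modSum g))
    ((aestronglyMeasurable_modSum f).add (aestronglyMeasurable_modSum g))
    (aestronglyMeasurable_modSum (g - f)) (fun x => add_nonneg (modSum_nonneg _) (modSum_nonneg _))
    (fun x => add_nonneg (modSum_nonneg _) (modSum_nonneg _)) (fun x => modSum_nonneg _) hS hS
    (normSum_nonneg _) (eLpNorm_modSum_add_le f g) (eLpNorm_modSum_add_le f g)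
    (eLpNorm_modSum_le (g - f))
  have h2 : 0 ≤ 2 * (p + 1) * nonlinConst p β := by positivity
  refine le_trans ?_ (mul_le_mul_of_nonneg_left h.2 h2)
  rw [← integral_const_mul]
  refine integral_mono_ae ((integrable_potential hβ g).sub (integrable_potential hβ f)).abs
    (h.1.const_mul _) ?_
  filter_upwards [values_sub g f] with x hx
  have h3 := abs_potential_sub_le hp.out hβ (values f x) (values g x)
  rw [← hx] at h3
  exact h3

/-- The integrated first order cancellation. -/
lemma abs_integral_cancellation_le {β : Fin N → Fin N → ℝ} (hβ : ∀ μ ν, β μ ν = β ν μ)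
    (f g : Fin N → LL d (energyExp p)) {Y : Rd d → ℝ} {C : ℝ} (hY : Continuous Y)
    (hC : ∀ x, |Y x| ≤ C) :
    |(∑ μ, ∫ x, Y x * ((starRingEnd ℂ) (f μ x) * nemytskii β g μ x -
        (starRingEnd ℂ) (nemytskii β f μ x) * g μ x).re) -
      p / (p + 1) * ((∫ x, Y x * potential p β (values g x)) - ∫ x, Y x * potential p β (values f x))| ≤
      C * (2 * nonlinConst p β *
        ((normSum f + normSum g) ^ (2 * p) * normSum (g - f) * normSum (g - f))) := by
  have h1p := hp.out
  have hK := nonlinConst_nonneg hp.out β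
  have hC0 : 0 ≤ C := (abs_nonneg _).trans (hC 0)
  have hS := add_nonneg (normSum_nonneg f) (normSum_nonneg g)
  have hYm : MemLp (fun x => (Y x : ℂ)) ⊤ (volume : Measure (Rd d)) := memLp_top_of_bdd hY hC
  have hYr : ∀ {G : Rd d → ℝ}, Integrable G → Integrable fun x => Y x * G x := fun {G} hG =>
    hG.bdd_mul hY.aestronglyMeasurable (ae_of_all _ fun x => hC x)
  have hi : ∀ μ, Integrable fun x => Y x * ((starRingEnd ℂ) (f μ x) * nemytskii β g μ x -
        (starRingEnd ℂ) (nemytskii β f μ x) * g μ x).re := fun μ =>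
    hYr ((integrable_conj_mul (f μ) (nemytskii β g μ)).sub
      (integrable_conj_mul (nemytskii β f μ) (g μ))).re
  have hp1 := hYr (integrable_potential hβ f)
  have hp2 := hYr (integrable_potential hβ g)
  have hpd : Integrable fun x => p / (p + 1) * (Y x * potential p β (values g x) -
      Y x * potential p β (values f x)) := (hp2.sub hp1).const_mul _
  rw [← integral_finsetSum _ fun μ _ => hi μ, ← integral_sub hp2 hp1, ← integral_const_mul,
    ← integral_sub (integrable_finsetSum _ fun μ _ => hi μ) hpd]
  have h := integral_rpow_mul_mul_le ((aestronglyMeasurable_modSum f).add (aestronglyMeasurable_modSum g))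
    (aestronglyMeasurable_modSum (g - f))
    (aestronglyMeasurable_modSum (g - f)) (fun x => add_nonneg (modSum_nonneg _) (modSum_nonneg _))
    (fun x => modSum_nonneg _) (fun x => modSum_nonneg _) hS
    (normSum_nonneg _) (normSum_nonneg _) (eLpNorm_modSum_add_le f g)
    (eLpNorm_modSum_le (g - f)) (eLpNorm_modSum_le (g - f))
  have h2 : 0 ≤ C * (2 * nonlinConst p β) := by positivity
  refine le_trans ?_ ((mul_le_mul_of_nonneg_left h.2 h2).trans_eq (by ring))
  rw [← integral_const_mul]
  rw [← Real.norm_eq_abs]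
  refine norm_integral_le_of_norm_le (h.1.const_mul _) ?_
  -- The operator is only known almost everywhere; once its values are identified, the pointwise
  -- cancellation applies at each x.
  have hn : ∀ᵐ x, ∀ μ, nemytskii β f μ x = nonlin p β (values f x) μ ∧
      nemytskii β g μ x = nonlin p β (values g x) μ := by
    rw [ae_all_iff]
    exact fun μ => (coeFn_nemytskii β f μ).and (coeFn_nemytskii β g μ)
  filter_upwards [values_sub g f, hn] with x hx hnx
  have h3 := abs_nonlinear_cancellation_le hp.out hβ (values f x) (values g x)
  rw [← hx] at h3
  have e : (∑ μ, Y x * ((starRingEnd ℂ) (f μ x) * nemytskii β g μ x -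
        (starRingEnd ℂ) (nemytskii β f μ x) * g μ x).re) - p / (p + 1) *
        (Y x * potential p β (values g x) - Y x * potential p β (values f x)) =
      Y x * (∑ μ, ((starRingEnd ℂ) (values f x μ) * nonlin p β (values g x) μ -
        (starRingEnd ℂ) (nonlin p β (values f x) μ) * values g x μ).re -
      p / (p + 1) * (potential p β (values g x) - potential p β (values f x))) := by
    rw [← Finset.mul_sum]
    simp only [fun μ => (hnx μ).1, fun μ => (hnx μ).2, values]
    ring
  rw [e, Real.norm_eq_abs, abs_mul]
  refine (mul_le_mul (hC x) h3 (abs_nonneg _) hC0).trans_eq ?_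
  simp only [Pi.add_apply]
  ring

end Nemytskii

end InteractionMorawetz

end

/-! ### The Schrödinger system and its spatial differences -/

noncomputable section
open MeasureTheory Filter Topology
open scoped ContDiff ENNReal SchwartzMap FourierTransform RealInnerProductSpace Laplacian LineDeriv
namespace InteractionMorawetz

section System

variable {d N : ℕ} {p : ℝ} [hp : Fact (1 ≤ p)]

/-- The components of the `L^{2p+2}` realization of a tuple in `XS`. -/
def energyPart (W : Fin N → XS d (energyExp p)) : Fin N → LL d (energyExp p) := fun ν => (W ν).2.2

lemma continuous_energyPart :
    Continuous (energyPart : (Fin N → XS d (energyExp p)) → Fin N → LL d (energyExp p)) :=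
  continuous_pi fun ν => continuous_snd.comp (continuous_snd.comp (continuous_apply ν))

/-- The tuple `w` solves the nonlinear Schrödinger system. -/
def SolvesSystem (β : Fin N → Fin N → ℝ) (w : ℝ → Fin N → XS d (energyExp p)) : Prop :=
  ∀ μ, Solves (fun t => w t μ) (fun t => nemytskii β (energyPart (w t)) μ)

lemma SolvesSystem.continuous {β : Fin N → Fin N → ℝ} {w : ℝ → Fin N → XS d (energyExp p)}
    (h : SolvesSystem β w) : Continuous w := continuous_pi fun μ => (h μ).cont

/-- Translation of tuples. -/
def trTuple {q : ℝ≥0∞} [Fact (1 ≤ q)] (a : Rd d) (f : Fin N → LL d q) : Fin N → LL d q :=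
  fun ν => trL a (f ν)

lemma values_trTuple {q : ℝ≥0∞} [Fact (1 ≤ q)] (a : Rd d) (f : Fin N → LL d q) :
    ∀ᵐ x, values (trTuple a f) x = values f (x + a) := by
  have h : ∀ᵐ x, ∀ ν, trTuple a f ν x = f ν (x + a) := by
    rw [ae_all_iff]; exact fun ν => coeFn_trL a (f ν)
  filter_upwards [h] with x hx
  exact funext hx

lemma normSum_trTuple {q : ℝ≥0∞} [Fact (1 ≤ q)] (a : Rd d) (f : Fin N → LL d q) :
    normSum (trTuple a f) = normSum f :=
  Finset.sum_congr rfl fun ν _ => norm_trL a (f ν)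

lemma nemytskii_trTuple (β : Fin N → Fin N → ℝ) (a : Rd d) (f : Fin N → LL d (energyExp p))
    (μ : Fin N) : nemytskii β (trTuple a f) μ = trL a (nemytskii β f μ) := by
  refine Lp.ext ?_
  have h1 := (measurePreserving_add_right volume a).quasiMeasurePreserving.ae
    (coeFn_nemytskii β f μ)
  filter_upwards [coeFn_nemytskii β (trTuple a f) μ, coeFn_trL a (nemytskii β f μ),
    values_trTuple a f, h1] with x h2 h3 h4 h5
  rw [h2, h3, h4, h5]

lemma SolvesSystem.translate_sub {β : Fin N → Fin N → ℝ} {w : ℝ → Fin N → XS d (energyExp p)}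
    (h : SolvesSystem β w) (a : Rd d) (μ : Fin N) :
    Solves (fun t => trXS a (w t μ) - w t μ)
      (fun t => nemytskii β (trTuple a (energyPart (w t))) μ - nemytskii β (energyPart (w t)) μ) := by
  have h1 := ((h μ).translate a).sub (h μ)
  simpa only [nemytskii_trTuple] using h1

lemma exists_pos_rpow_le {A B κ : ℝ} (hκ : 0 < κ) (hA : 0 < A) :
    ∃ ε : ℝ, 0 < ε ∧ ε ≤ 1 ∧ B * (2 * ε) ^ κ ≤ A := by
  have hc : Tendsto (fun ε : ℝ => B * (2 * ε) ^ κ) (𝓝[>] 0) (𝓝 0) := by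
    have : Continuous fun ε : ℝ => B * (2 * ε) ^ κ :=
      continuous_const.mul ((continuous_const.mul continuous_id).rpow_const fun _ => Or.inr hκ.le)
    have h2 := (this.tendsto 0).mono_left (nhdsWithin_le_nhds (s := Set.Ioi 0))
    simpa [Real.zero_rpow hκ.ne'] using h2
  have h1 : ∀ᶠ ε : ℝ in 𝓝[>] 0, ε ≤ 1 :=
    nhdsWithin_le_nhds (eventually_le_nhds zero_lt_one)
  obtain ⟨ε, h2, h3, h4⟩ := ((hc.eventually (eventually_le_nhds hA)).and
    (h1.and self_mem_nhdsWithin)).exists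
  exact ⟨ε, h4, h3, h2⟩

/-- Local in time space-time bound on the differences of a solution. -/
theorem SolvesSystem.exists_difference_bound {β : Fin N → Fin N → ℝ}
    {w : ℝ → Fin N → XS d (energyExp p)} (h : SolvesSystem β w)
    (hd : (d : ℝ) < (2 * p + 2) / p) (t₀ : ℝ) (k : Fin d) :
    ∃ ε : ℝ, 0 < ε ∧ ∃ C : ℝ, ∀ δ : ℝ, ∫ t in (t₀ - ε)..(t₀ + ε),
      normSum (trTuple (δ • unitVec k) (energyPart (w t)) - energyPart (w t)) ^ 2 ≤ C * δ ^ 2 := by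
  have h1p := hp.out
  have hw := h.continuous
  set σ : ℝ := d / ((2 * p + 2) / p) with hσdef
  have hs : 0 < (2 * p + 2) / p := by apply div_pos <;> linarith
  have hσ : σ < 1 := (div_lt_one hs).2 hd
  set C₁ : ℝ := (4 * Real.pi) ^ (-σ) with hC₁
  have hC₁0 : 0 ≤ C₁ := by have := Real.pi_pos; positivity
  have hK := nonlinConst_nonneg h1p β
  obtain ⟨M, hM⟩ : ∃ M, ∀ t ∈ Set.Icc (t₀ - 1) (t₀ + 1), normSum (energyPart (w t)) ≤ M := by
    obtain ⟨M, hM⟩ := (isCompact_Icc.image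
      (continuous_normSum.comp (continuous_energyPart.comp hw))).bddAbove
    exact ⟨M, fun t ht => hM ⟨t, ht, rfl⟩⟩
  -- All bounds are taken on the unit interval around t₀, before ε ≤ 1 is chosen, since the initial
  -- time t₀ - ε depends on ε.
  obtain ⟨M', hM'⟩ : ∃ M', ∀ t ∈ Set.Icc (t₀ - 1) (t₀ + 1), ∀ μ, ‖(w t μ).2.1 k‖ ≤ M' := by
    have hc : Continuous fun t => ∑ μ, ‖(w t μ).2.1 k‖ := by fun_prop
    obtain ⟨M', hM'⟩ := (isCompact_Icc.image hc).bddAbove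
    refine ⟨M', fun t ht μ => le_trans ?_ (hM' ⟨t, ht, rfl⟩)⟩
    exact Finset.single_le_sum (f := fun μ => ‖(w t μ).2.1 k‖) (fun _ _ => norm_nonneg _)
      (Finset.mem_univ μ)
  have hM0 : 0 ≤ M := (normSum_nonneg _).trans (hM t₀ ⟨by linarith, by linarith⟩)
  set L : ℝ := nonlinConst p β * (M + M) ^ (2 * p) with hL
  have hL0 : 0 ≤ L := by positivity
  -- The half-length ε makes the Strichartz constant, times the factor collecting the Lipschitz
  -- bound and the sum over components, at most 1/2. It does not depend on the shift δ.
  obtain ⟨ε, hε, hε1, hεc⟩ := exists_pos_rpow_le (A := 1 / 2)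
    (B := C₁ * (2 / (1 - σ)) * (1 + N * (L ^ 2 * N))) (κ := 1 - σ) (by linarith) (by norm_num)
  refine ⟨ε, hε, N * (N * M' ^ 2), fun δ => ?_⟩
  set D : ℝ → Fin N → LL d (energyExp p) := fun t =>
    trTuple (δ • unitVec k) (energyPart (w t)) - energyPart (w t) with hD
  have hDcont : Continuous D := by
    refine continuous_pi fun ν => ?_
    exact (((trL (δ • unitVec k)).continuous.comp ((continuous_apply ν).comp
      (continuous_energyPart.comp hw))).sub ((continuous_apply ν).comp (continuous_energyPart.comp hw)))
  have hDc : ∀ μ, Continuous fun t => ‖D t μ‖ ^ 2 := fun μ =>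
    (((continuous_apply μ).comp hDcont).norm).pow 2
  have hsum : ∀ t, normSum (D t) ^ 2 ≤ N * ∑ μ, ‖D t μ‖ ^ 2 := fun t => by
    have := sq_sum_le_card_mul_sum_sq (s := Finset.univ) (f := fun μ => ‖D t μ‖)
    simpa [normSum] using this
  have hab : t₀ - ε ≤ t₀ + ε := by linarith
  have hIcc : ∀ t ∈ Set.Icc (t₀ - ε) (t₀ + ε), t ∈ Set.Icc (t₀ - 1) (t₀ + 1) := fun t ht =>
    ⟨by linarith [ht.1], by linarith [ht.2]⟩
  set X : ℝ := ∫ t in (t₀ - ε)..(t₀ + ε), ∑ μ, ‖D t μ‖ ^ 2 with hX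
  have hXc : Continuous fun t => ∑ μ, ‖D t μ‖ ^ 2 := continuous_finsetSum _ fun μ _ => hDc μ
  have hX0 : 0 ≤ X := intervalIntegral.integral_nonneg hab fun t _ => by positivity
  have hXeq : X = ∑ μ, ∫ t in (t₀ - ε)..(t₀ + ε), ‖D t μ‖ ^ 2 :=
    intervalIntegral.integral_finsetSum fun μ _ => (hDc μ).intervalIntegrable _ _
  -- The translated solution has the same norms, so the local Lipschitz constant L of the
  -- nonlinearity is uniform in δ.
  have hF : ∀ t ∈ Set.Icc (t₀ - ε) (t₀ + ε), ∀ μ,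
      ‖nemytskii β (trTuple (δ • unitVec k) (energyPart (w t))) μ - nemytskii β (energyPart (w t)) μ‖ ^ 2 ≤
        L ^ 2 * N * ∑ μ, ‖D t μ‖ ^ 2 := by
    intro t ht μ
    have h1 := norm_nemytskii_sub_le β (trTuple (δ • unitVec k) (energyPart (w t)))
      (energyPart (w t)) μ
    have h2 : nonlinConst p β * ((normSum (trTuple (δ • unitVec k) (energyPart (w t))) +
        normSum (energyPart (w t))) ^ (2 * p) * normSum (D t)) ≤ L * normSum (D t) := by
      rw [hL, mul_assoc, normSum_trTuple]
      refine mul_le_mul_of_nonneg_left (mul_le_mul_of_nonneg_right ?_ (normSum_nonneg _)) hK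
      have := hM t (hIcc t ht)
      have h0 := normSum_nonneg (energyPart (w t))
      exact Real.rpow_le_rpow (by linarith) (by linarith) (by linarith)
    calc _ ≤ (L * normSum (D t)) ^ 2 := pow_le_pow_left₀ (norm_nonneg _) (h1.trans h2) 2
      _ = L ^ 2 * normSum (D t) ^ 2 := mul_pow _ _ _
      _ ≤ L ^ 2 * (N * ∑ μ, ‖D t μ‖ ^ 2) := mul_le_mul_of_nonneg_left (hsum t) (by positivity)
      _ = _ := by ring
  have hterm : ∀ μ, ∫ t in (t₀ - ε)..(t₀ + ε), ‖D t μ‖ ^ 2 ≤ 1 / 2 * (δ ^ 2 * M' ^ 2) +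
      C₁ * (2 * (2 * ε) ^ (1 - σ) / (1 - σ)) * ((∫ t in (t₀ - ε)..(t₀ + ε), ‖D t μ‖ ^ 2) +
        L ^ 2 * N * X) := by
    intro μ
    have hSt := (h.translate_sub (δ • unitVec k) μ).strichartz energyExp_ne_top energyExp'_ne_top
      (sobolevBound_energyExp hd) hC₁0 hσ
      (fun t ht f => norm_schrodinger_energyExp_le ht f) hab
    rw [show t₀ + ε - (t₀ - ε) = 2 * ε by ring] at hSt
    refine hSt.trans (add_le_add ?_ (mul_le_mul_of_nonneg_left (add_le_add le_rfl ?_) ?_))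
    -- The initial difference is of size |δ| because u is in H¹ at that time; this is the source of
    -- the factor δ².
    · refine mul_le_mul_of_nonneg_left ?_ (by norm_num)
      have h1 := norm_trL_sub_le ((h μ).mem (t₀ - ε)) δ k
      have h2 := hM' (t₀ - ε) (hIcc _ ⟨le_rfl, hab⟩) μ
      calc _ ≤ (|δ| * M') ^ 2 := pow_le_pow_left₀ (norm_nonneg _)
            (h1.trans (mul_le_mul_of_nonneg_left h2 (abs_nonneg _))) 2
        _ = _ := by rw [mul_pow, sq_abs]
    · rw [hX, ← intervalIntegral.integral_const_mul]
      refine intervalIntegral.integral_mono_on hab ?_ ((hXc.const_mul _).intervalIntegrable _ _)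
        fun t ht => hF t ht μ
      exact ((h.translate_sub (δ • unitVec k) μ).cont_rhs.norm.pow 2).intervalIntegrable _ _
    · have : 0 < 1 - σ := by linarith
      positivity
  -- Summed over the components, the Strichartz bounds contain at most half of X on the right. That
  -- half is finite and is absorbed next.
  have hXle : X ≤ N * (1 / 2 * (δ ^ 2 * M' ^ 2)) + 1 / 2 * X := by
    have h1 := Finset.sum_le_sum fun μ (_ : μ ∈ Finset.univ) => hterm μ
    rw [← hXeq, Finset.sum_add_distrib, Finset.sum_const, ← Finset.mul_sum, Finset.sum_add_distrib,
      ← hXeq] at h1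
    simp only [Finset.sum_const, Finset.card_univ, Fintype.card_fin, nsmul_eq_mul] at h1
    refine h1.trans (add_le_add (le_of_eq (by ring)) ?_)
    refine le_trans (le_of_eq ?_) (mul_le_mul_of_nonneg_right hεc hX0)
    ring
  have hfin : X ≤ N * (δ ^ 2 * M' ^ 2) := by linarith
  calc ∫ t in (t₀ - ε)..(t₀ + ε), normSum (D t) ^ 2
      ≤ ∫ t in (t₀ - ε)..(t₀ + ε), N * ∑ μ, ‖D t μ‖ ^ 2 :=
        intervalIntegral.integral_mono_on hab
          (((continuous_normSum.comp hDcont).pow 2).intervalIntegrable _ _)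
          ((hXc.const_mul _).intervalIntegrable _ _) fun t _ => hsum t
    _ = N * X := by rw [intervalIntegral.integral_const_mul]
    _ ≤ N * (N * (δ ^ 2 * M' ^ 2)) := mul_le_mul_of_nonneg_left hfin (Nat.cast_nonneg N)
    _ = _ := by ring

/-- The condition reads (d-2)p < 2: automatic for d ≤ 2, and p < 2 for d = 3. -/
lemma coe_momentum_exponent_lt (hd3 : d ≤ 3) (hp3 : d = 3 → p < 2) : (d : ℝ) < (2 * p + 2) / p := by
  have h1p := hp.out
  rw [lt_div_iff₀ (by linarith)]
  interval_cases d
  · norm_num; linarith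
  · norm_num; linarith
  · norm_num
  · have := hp3 rfl
    norm_num; linarith

/-- The lift of a global solution. -/
lemma exists_solvesSystem (hd : (d : ℝ) < (2 * p + 2) / p) {β : Fin N → Fin N → ℝ}
    {u : ℝ → Fin N → H1 d} (hu : IsGlobalSolution p β u) :
    ∃ w : ℝ → Fin N → XS d (energyExp p), SolvesSystem β w ∧
      ∀ t μ, toAmbient (w t μ) = (u t μ).1 := by
  obtain ⟨J, hJc, hJ⟩ := exists_embedding (sobolevBound_energyExp (p := p) hd)
  set w : ℝ → Fin N → XS d (energyExp p) := fun t μ => J (u t μ) with hw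
  have hwc : Continuous w := continuous_pi fun μ => hJc.comp ((continuous_apply μ).comp hu.continuous)
  have hfn : ∀ t μ, (w t μ).1 = (u t μ).1.fst := fun t μ => by
    rw [← (hJ (u t μ)).2]; rfl
  have hpd : ∀ t μ k, (w t μ).2.1 k = (u t μ).1.snd k := fun t μ k => by
    rw [← (hJ (u t μ)).2]; rfl
  refine ⟨w, fun μ => ?_, fun t μ => (hJ (u t μ)).2⟩
  refine solves_of_test ((continuous_apply μ).comp hwc)
    ((continuous_nemytskii β μ).comp (continuous_energyPart.comp hwc)) (fun t => (hJ _).1) ?_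
  intro η hη hηc f hf t
  have h := hu.equation μ η hη hηc t
  have e1 : (fun s => pairing volume 2 2 (f.toLp 2 volume) (w s μ).1) =
      fun s => ∫ x, η x • (u s μ).fn x := by
    ext s
    rw [pairing_apply]
    refine integral_congr_ae ?_
    filter_upwards [f.coeFn_toLp 2 volume] with x hx
    rw [hx, hf, hfn]; simp [H1.fn]
  rw [e1]
  refine h.congr_deriv ?_
  rw [rhsL_apply]
  congr 2
  · congr 1
    refine Finset.sum_congr rfl fun k _ => ?_
    rw [pairing_apply]
    refine integral_congr_ae ?_
    filter_upwards [(∂_{unitVec k} f : 𝓢(Rd d, ℂ)).coeFn_toLp 2 volume] with x hx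
    rw [toXS_grad, hx, hpd]
    have hf' : ⇑f = fun x => (η x : ℂ) := funext hf
    have : (∂_{unitVec k} f : 𝓢(Rd d, ℂ)) x = (fderiv ℝ η x (unitVec k) : ℂ) := by
      rw [SchwartzMap.lineDerivOp_apply_eq_fderiv, hf',
        fderiv_ofReal_comp (hη.differentiable (by simp) x)]
    rw [this]; simp [H1.pd]
  · rw [pairing_apply]
    refine integral_congr_ae ?_
    -- The equation is written with the L² representative of u, the Nemytskii operator with the
    -- L^{2p+2} one; they agree almost everywhere.
    have hval : ∀ᵐ x, ∀ ν, (u t ν).fn x = energyPart (w t) ν x := by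
      rw [ae_all_iff]
      intro ν
      have := ae_eq_of_mem_WS (q' := energyExp' p) (hJ (u t ν)).1
      filter_upwards [this] with x hx
      change (u t ν).1.fst x = (w t ν).2.2 x
      rw [← hx, ← hfn]
    filter_upwards [f.coeFn_toLp (energyExp p) volume, coeFn_nemytskii β (energyPart (w t)) μ, hval]
      with x hx h2 h3
    change _ = (f.toLp (energyExp p) volume) x * _
    rw [hx, hf, h2]
    simp [nonlinearity, nonlin, values, h3]

end System

end InteractionMorawetz

end

/-! ### Mass conservation and momentum balance at finite translation -/

noncomputable section
open MeasureTheory Filter Topology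
open scoped ContDiff ENNReal SchwartzMap FourierTransform RealInnerProductSpace Laplacian LineDeriv
namespace InteractionMorawetz

section WeightedPairing

variable {d : ℕ}

/-- The sesquilinear form `∫ Y conj(a) b`. -/
def weightedPairing (Y : Rd d → ℝ) (a b : LL d 2) : ℂ := pairing volume 2 2 (mulL Y (conjL a)) b

lemma weightedPairing_eq {Y : Rd d → ℝ}
    (hY : MemLp (fun x => (Y x : ℂ)) ⊤ (volume : Measure (Rd d))) (a b : LL d 2) :
    weightedPairing Y a b = ∫ x, (Y x : ℂ) * ((starRingEnd ℂ) (a x) * b x) :=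
  pairing_mul_conj hY a b

lemma weightedPairing_add_right (Y : Rd d → ℝ) (a b c : LL d 2) :
    weightedPairing Y a (b + c) = weightedPairing Y a b + weightedPairing Y a c := map_add _ _ _

lemma weightedPairing_smul_right (Y : Rd d → ℝ) (a b : LL d 2) (c : ℂ) :
    weightedPairing Y a (c • b) = c * weightedPairing Y a b := map_smul _ _ _

lemma norm_weightedPairing_le (Y : Rd d → ℝ) (a b : LL d 2) :
    ‖weightedPairing Y a b‖ ≤ ‖mulL Y (conjL a)‖ * ‖b‖ := norm_pairing_le _ _

lemma continuous_weightedPairing (Y : Rd d → ℝ) :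
    Continuous fun ab : LL d 2 × LL d 2 => weightedPairing Y ab.1 ab.2 :=
  continuous_bilin_apply _ ((mulL Y).continuous.comp (conjL.continuous.comp continuous_fst))
    continuous_snd

lemma integrable_weight_conj_mul {Y : Rd d → ℝ}
    (hY : MemLp (fun x => (Y x : ℂ)) ⊤ (volume : Measure (Rd d))) (a b : LL d 2) :
    Integrable fun x => (Y x : ℂ) * ((starRingEnd ℂ) (a x) * b x) :=
  integrable_weight_mul hY (integrable_conj_mul a b)

lemma re_weightedPairing {Y : Rd d → ℝ}
    (hY : MemLp (fun x => (Y x : ℂ)) ⊤ (volume : Measure (Rd d))) (a b : LL d 2) :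
    (weightedPairing Y a b).re = ∫ x, Y x * ((starRingEnd ℂ) (a x) * b x).re := by
  rw [weightedPairing_eq hY]
  refine (integral_re (integrable_weight_conj_mul hY a b)).symm.trans ?_
  congr 1; ext x
  exact Complex.re_ofReal_mul _ _

lemma im_weightedPairing {Y : Rd d → ℝ}
    (hY : MemLp (fun x => (Y x : ℂ)) ⊤ (volume : Measure (Rd d))) (a b : LL d 2) :
    (weightedPairing Y a b).im = ∫ x, Y x * ((starRingEnd ℂ) (a x) * b x).im := by
  rw [weightedPairing_eq hY]
  refine (integral_im (integrable_weight_conj_mul hY a b)).symm.trans ?_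
  congr 1; ext x
  exact Complex.im_ofReal_mul _ _

lemma weightedPairing_conj_symm {Y : Rd d → ℝ}
    (hY : MemLp (fun x => (Y x : ℂ)) ⊤ (volume : Measure (Rd d))) (a b : LL d 2) :
    weightedPairing Y a b = (starRingEnd ℂ) (weightedPairing Y b a) := by
  rw [weightedPairing_eq hY, weightedPairing_eq hY, ← integral_conj]
  congr 1; ext x
  simp only [map_mul, Complex.conj_conj, Complex.conj_ofReal]
  ring

variable {q : ℝ≥0∞} [Fact (1 ≤ q)]

/-- Integration by parts. -/
lemma weightedPairing_grad {q' : ℝ≥0∞} [Fact (1 ≤ q')] [q'.HolderConjugate q] (hS : SobolevBound d q) {Y : Rd d → ℝ} (hY : IsWeight Y) {V W : XS d q}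
    (hV : V ∈ WS d q) (hW : W ∈ WS d q) (k : Fin d) :
    weightedPairing Y V.1 (W.2.1 k) =
      -weightedPairing Y (V.2.1 k) W.1 - weightedPairing (pderiv k Y) V.1 W.1 := by
  have h := pairing_grad_of_mem_WS hW (mulXS_mem (q' := q') hS hY (conjXS_mem hV)) k
  rw [mulXS_grad, mulXS_fst, map_add, add_apply] at h
  change weightedPairing Y (V.2.1 k) W.1 + weightedPairing (pderiv k Y) V.1 W.1 =
    -weightedPairing Y V.1 (W.2.1 k) at h
  rw [← neg_eq_iff_eq_neg] at h
  rw [← h]; ring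

lemma hasDerivAt_weightedPairing {q' : ℝ≥0∞} [Fact (1 ≤ q')] [q.HolderConjugate q']
    [q'.HolderConjugate q] (hS : SobolevBound d q) {Y : Rd d → ℝ} (hY : IsWeight Y)
    {a b : ℝ → XS d q} {Fa Fb : ℝ → LL d q'} (ha : Solves a Fa) (hb : Solves b Fb) (t : ℝ) :
    HasDerivAt (fun s => weightedPairing Y (a s).1 (b s).1)
      (Complex.I * (-(∑ k, (weightedPairing (pderiv k Y) (a t).1 ((b t).2.1 k) -
          weightedPairing (pderiv k Y) ((a t).2.1 k) (b t).1)) -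
        ∫ x, (Y x : ℂ) * ((starRingEnd ℂ) ((a t).2.2 x) * Fb t x -
          (starRingEnd ℂ) (Fa t x) * (b t).2.2 x))) t := by
  have h := hasDerivAt_integral_conj_mul hS hY ha hb t
  simp only [weightedPairing_eq hY.memLp, weightedPairing_eq (hY.memLp_pderiv _)]
  refine h.congr_deriv ?_
  congr 4 with k
  rw [← integral_sub (integrable_weight_conj_mul (hY.memLp_pderiv k) _ _)
    (integrable_weight_conj_mul (hY.memLp_pderiv k) _ _)]
  simp only [mul_sub]

end WeightedPairing

section Mass

variable {d N : ℕ} {p : ℝ} [hp : Fact (1 ≤ p)]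

lemma conj_mul_nemytskii_cancel (β : Fin N → Fin N → ℝ) (f : Fin N → LL d (energyExp p)) (μ : Fin N) :
    ∀ᵐ x, (starRingEnd ℂ) (f μ x) * nemytskii β f μ x -
      (starRingEnd ℂ) (nemytskii β f μ x) * f μ x = 0 := by
  filter_upwards [coeFn_nemytskii β f μ] with x hx
  obtain ⟨r, hr⟩ := im_conj_mul_nonlin (p := p) β (values f x) μ
  rw [hx, hr]
  simp only [values, map_mul, Complex.conj_ofReal]
  ring

/-- Local conservation of mass. -/
lemma SolvesSystem.hasDerivAt_mass {β : Fin N → Fin N → ℝ} {w : ℝ → Fin N → XS d (energyExp p)}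
    (h : SolvesSystem β w) (hd : (d : ℝ) < (2 * p + 2) / p) {Y : Rd d → ℝ} (hY : IsWeight Y)
    (μ : Fin N) (t : ℝ) :
    HasDerivAt (fun s => (weightedPairing Y (w s μ).1 (w s μ).1).re)
      (2 * ∑ k, (weightedPairing (pderiv k Y) (w t μ).1 ((w t μ).2.1 k)).im) t := by
  have h1 := hasDerivAt_weightedPairing (sobolevBound_energyExp hd) hY (h μ) (h μ) t
  -- The source contributes the imaginary part of conj(u) times a real multiple of u, which is zero.
  have h2 : ∫ x, (Y x : ℂ) * ((starRingEnd ℂ) ((w t μ).2.2 x) * nemytskii β (energyPart (w t)) μ x -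
      (starRingEnd ℂ) (nemytskii β (energyPart (w t)) μ x) * (w t μ).2.2 x) = 0 := by
    refine integral_eq_zero_of_ae ?_
    filter_upwards [conj_mul_nemytskii_cancel β (energyPart (w t)) μ] with x hx
    change (Y x : ℂ) * (_ * _ - _ * (energyPart (w t) μ x)) = 0
    exact (congrArg (fun z => (Y x : ℂ) * z) hx).trans (mul_zero _)
  rw [h2] at h1
  have h3 := Complex.reCLM.hasFDerivAt.comp_hasDerivAt t h1
  refine HasDerivAt.congr_deriv h3 ?_
  rw [Complex.reCLM_apply, sub_zero, mul_neg, Complex.neg_re, Complex.I_mul_re, neg_neg, Complex.im_sum,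
    Finset.mul_sum]
  refine Finset.sum_congr rfl fun k _ => ?_
  rw [weightedPairing_conj_symm (hY.memLp_pderiv k) ((w t μ).2.1 k)]
  simp
  ring

end Mass

section Momentum

variable {d N : ℕ} {p : ℝ} [hp : Fact (1 ≤ p)]

/-- The difference `u(x+a) - u(x)`. -/
abbrev diffL {q : ℝ≥0∞} [Fact (1 ≤ q)] (a : Rd d) (f : LL d q) : LL d q := trL a f - f

/-- The nonlinear contribution to the momentum balance at finite translation. -/
def forcing (β : Fin N → Fin N → ℝ) (Y : Rd d → ℝ) (f g : Fin N → LL d (energyExp p)) : ℝ :=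
  ∑ μ, ∫ x, Y x * ((starRingEnd ℂ) (f μ x) * nemytskii β g μ x -
        (starRingEnd ℂ) (nemytskii β f μ x) * g μ x).re

lemma continuous_forcing (β : Fin N → Fin N → ℝ) {Y : Rd d → ℝ} (hY : IsWeight Y) :
    Continuous fun fg : (Fin N → LL d (energyExp p)) × (Fin N → LL d (energyExp p)) =>
      forcing β Y fg.1 fg.2 := by
  have e : ∀ fg : (Fin N → LL d (energyExp p)) × (Fin N → LL d (energyExp p)),
      forcing β Y fg.1 fg.2 = ∑ μ,
        (pairing volume (energyExp p) (energyExp' p) (mulL Y (conjL (fg.1 μ))) (nemytskii β fg.2 μ) -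
        pairing volume (energyExp' p) (energyExp p) (mulL Y (conjL (nemytskii β fg.1 μ))) (fg.2 μ)).re := by
    intro fg
    refine Finset.sum_congr rfl fun μ _ => ?_
    have i1 := integrable_weight_mul hY.memLp (integrable_conj_mul (fg.1 μ) (nemytskii β fg.2 μ))
    have i2 := integrable_weight_mul hY.memLp (integrable_conj_mul (nemytskii β fg.1 μ) (fg.2 μ))
    rw [pairing_mul_conj hY.memLp, pairing_mul_conj hY.memLp, ← integral_sub i1 i2]
    refine Eq.trans ?_ (integral_re (i1.sub i2))
    congr 1; ext x
    simp only [Pi.sub_apply, ← mul_sub]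
    exact (Complex.re_ofReal_mul _ _).symm
  simp only [e]
  refine continuous_finsetSum _ fun μ _ => Complex.continuous_re.comp (Continuous.sub ?_ ?_)
  · exact continuous_bilin_apply _ ((mulL Y).continuous.comp (conjL.continuous.comp
      ((continuous_apply μ).comp continuous_fst))) ((continuous_nemytskii β μ).comp continuous_snd)
  · exact continuous_bilin_apply _ ((mulL Y).continuous.comp (conjL.continuous.comp
      ((continuous_nemytskii β μ).comp continuous_fst))) ((continuous_apply μ).comp continuous_snd)

/-- The linear part of the momentum balance, with `D` in the place of `∂ₖu`. -/
def linearBalance (Y : Rd d → ℝ) (W : Fin N → XS d (energyExp p)) (D : Fin N → LL d 2) : ℝ :=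
  ∑ μ, ∑ l, (2 * weightedPairing (pderiv l Y) ((W μ).2.1 l) (D μ) +
    weightedPairing (pderiv l (pderiv l Y)) (W μ).1 (D μ)).re

/-- Momentum balance at finite translation. -/
lemma SolvesSystem.hasDerivAt_translated_momentum {β : Fin N → Fin N → ℝ}
    {w : ℝ → Fin N → XS d (energyExp p)} (h : SolvesSystem β w) (hd : (d : ℝ) < (2 * p + 2) / p)
    {Y : Rd d → ℝ} (hY : IsWeight Y) (hY' : ∀ l, IsWeight (pderiv l Y)) (a : Rd d) (t : ℝ) :
    HasDerivAt (fun s => ∑ μ, (weightedPairing Y (w s μ).1 (trL a (w s μ).1)).im)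
      (linearBalance Y (w t) (fun μ => diffL a (w t μ).1) -
        forcing β Y (energyPart (w t)) (trTuple a (energyPart (w t)))) t := by
  have hS := sobolevBound_energyExp (p := p) hd
  unfold linearBalance forcing
  rw [← Finset.sum_sub_distrib]
  refine HasDerivAt.fun_sum fun μ _ => ?_
  have h1 := hasDerivAt_weightedPairing hS hY (h μ) ((h μ).translate a) t
  have h3 := Complex.imCLM.hasFDerivAt.comp_hasDerivAt t h1
  refine HasDerivAt.congr_deriv h3 ?_
  rw [Complex.imCLM_apply, Complex.I_mul_im, Complex.sub_re, Complex.neg_re, Complex.re_sum]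
  congr 1
  · rw [← Finset.sum_neg_distrib]
    refine Finset.sum_congr rfl fun l _ => ?_
    have hm := (h μ).mem t
    have hD : trXS a (w t μ) - w t μ ∈ WS d (energyExp p) := Submodule.sub_mem _ (trXS_mem a hm) hm
    -- The derivative sitting on the difference is moved to Y and u. Only the difference itself then
    -- remains, and it may be divided by the length of the translation.
    have hibp := weightedPairing_grad (q' := energyExp' p) hS (hY' l) hm hD l
    have e1 : trXS a (w t μ) = w t μ + (trXS a (w t μ) - w t μ) := by abel
    have hsym := weightedPairing_conj_symm (hY.memLp_pderiv l) ((w t μ).2.1 l) (w t μ).1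
    rw [e1]
    simp only [Prod.fst_add, Prod.snd_add, Pi.add_apply, weightedPairing_add_right, hibp]
    rw [hsym]
    change _ = (2 * weightedPairing (pderiv l Y) ((w t μ).2.1 l) (trXS a (w t μ) - w t μ).1 +
      weightedPairing (pderiv l (pderiv l Y)) (w t μ).1 (trXS a (w t μ) - w t μ).1).re
    simp only [Complex.sub_re, Complex.add_re, Complex.neg_re, Complex.conj_re, Complex.mul_re,
      Complex.re_ofNat, Complex.im_ofNat]
    ring
  · have i1 := integrable_weight_mul hY.memLp (integrable_conj_mul (w t μ).2.2
      (nemytskii β (trTuple a (energyPart (w t))) μ))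
    have i2 := integrable_weight_mul hY.memLp (integrable_conj_mul
      (nemytskii β (energyPart (w t)) μ) (trTuple a (energyPart (w t)) μ))
    refine Eq.trans ?_ ((integral_re (i1.sub i2)).symm.trans ?_)
    · congr 2; ext x
      rw [nemytskii_trTuple]
      simp only [Pi.sub_apply, ← mul_sub]
      rfl
    · congr 1; ext x
      simp only [Pi.sub_apply, ← mul_sub]
      exact Complex.re_ofReal_mul _ _

end Momentum

end InteractionMorawetz

end

/-! ### The momentum balance in the limit of vanishing translation -/

noncomputable section
open MeasureTheory Filter Topology
open scoped ContDiff ENNReal SchwartzMap FourierTransform RealInnerProductSpace Laplacian LineDeriv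
namespace InteractionMorawetz

section Limit

/-- A differential equation passes to the limit if the error terms vanish in `L¹` in time. -/
lemma hasDerivAt_of_tendsto_integral {f A E : ℝ → ℝ → ℝ} {J Q B : ℝ → ℝ} {t₀ ε C : ℝ} (hε : 0 < ε)
    (hd : ∀ h, h ≠ 0 → ∀ t, HasDerivAt (f h) (A h t + E h t) t)
    (hA : ∀ h, h ≠ 0 → Continuous (A h)) (hE : ∀ h, h ≠ 0 → Continuous (E h))
    (hB : Continuous B) (hQ : Continuous Q)
    (hJ : ∀ t, Tendsto (fun h => f h t) (𝓝[≠] 0) (𝓝 (J t)))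
    (hAQ : ∀ t, Tendsto (fun h => A h t) (𝓝[≠] 0) (𝓝 (Q t)))
    (hAB : ∀ h, h ≠ 0 → ∀ t, |A h t| ≤ B t)
    (hEC : ∀ h, h ≠ 0 → ∫ t in (t₀ - ε)..(t₀ + ε), |E h t| ≤ C * |h|) :
    HasDerivAt J (Q t₀) t₀ := by
  -- Pointwise derivatives cannot be passed to the limit when the errors are small only on average
  -- in time. The integrated equation can, and its limit has a continuous integrand.
  have key : ∀ t ∈ Set.Ioo (t₀ - ε) (t₀ + ε), J t = J t₀ + ∫ s in t₀..t, Q s := by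
    intro t ht
    have h1 : ∀ h, h ≠ 0 → f h t = f h t₀ + (∫ s in t₀..t, A h s) + ∫ s in t₀..t, E h s := by
      intro h hh
      have hi := intervalIntegral.integral_eq_sub_of_hasDerivAt (fun s _ => hd h hh s)
        (((hA h hh).add (hE h hh)).intervalIntegrable t₀ t)
      rw [intervalIntegral.integral_add ((hA h hh).intervalIntegrable _ _)
        ((hE h hh).intervalIntegrable _ _)] at hi
      linarith
    have h2 : Tendsto (fun h => ∫ s in t₀..t, A h s) (𝓝[≠] 0) (𝓝 (∫ s in t₀..t, Q s)) := by
      refine intervalIntegral.tendsto_integral_filter_of_dominated_convergence B ?_ ?_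
        (hB.intervalIntegrable _ _) (ae_of_all _ fun s _ => hAQ s)
      · filter_upwards [self_mem_nhdsWithin] with h hh
        exact (hA h hh).aestronglyMeasurable
      · filter_upwards [self_mem_nhdsWithin] with h hh
        exact ae_of_all _ fun s _ => hAB h hh s
    have h3 : Tendsto (fun h => ∫ s in t₀..t, E h s) (𝓝[≠] 0) (𝓝 0) := by
      refine squeeze_zero_norm' (a := fun h => C * |h|) ?_ ?_
      · filter_upwards [self_mem_nhdsWithin] with h hh
        refine (intervalIntegral.norm_integral_le_integral_norm_uIoc).trans (le_trans ?_ (hEC h hh))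
        rw [intervalIntegral.integral_of_le (by linarith : t₀ - ε ≤ t₀ + ε)]
        refine setIntegral_mono_set ?_ (ae_of_all _ fun s => abs_nonneg _) ?_
        · exact ((hE h hh).abs.intervalIntegrable (t₀ - ε) (t₀ + ε)).1
        · refine Eventually.of_forall fun s hs => ?_
          rcases Set.mem_uIoc.1 hs with hs | hs
          · exact ⟨by linarith [hs.1], by linarith [hs.2, ht.2]⟩
          · exact ⟨by linarith [hs.1, ht.1], by linarith [hs.2]⟩
      · have : Continuous fun h : ℝ => C * |h| := by fun_prop
        have h4 := (this.tendsto 0).mono_left (nhdsWithin_le_nhds (s := {0}ᶜ))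
        simpa using h4
    have h5 : Tendsto (fun h => f h t) (𝓝[≠] 0) (𝓝 (J t₀ + (∫ s in t₀..t, Q s) + 0)) := by
      refine (((hJ t₀).add h2).add h3).congr' ?_
      filter_upwards [self_mem_nhdsWithin] with h hh
      exact (h1 h hh).symm
    rw [tendsto_nhds_unique (hJ t) h5, add_zero]
  have h6 : HasDerivAt (fun t => J t₀ + ∫ s in t₀..t, Q s) (Q t₀) t₀ :=
    (intervalIntegral.integral_hasDerivAt_right (hQ.intervalIntegrable _ _)
      (hQ.stronglyMeasurableAtFilter _ _) hQ.continuousAt).const_add _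
  refine h6.congr_of_eventuallyEq ?_
  filter_upwards [Ioo_mem_nhds (by linarith : t₀ - ε < t₀) (by linarith : t₀ < t₀ + ε)] with t ht
  exact key t ht

end Limit

section Momentum

variable {d N : ℕ} {p : ℝ} [hp : Fact (1 ≤ p)]

lemma integral_abs_potential_le {β : Fin N → Fin N → ℝ} (hβ : ∀ μ ν, β μ ν = β ν μ)
    (f : Fin N → LL d (energyExp p)) :
    ∫ x, |potential p β (values f x)| ≤ 2 * (p + 1) * nonlinConst p β *
      (normSum f ^ (2 * p) * normSum f * normSum f) := by
  have h1p := hp.out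
  have hK := nonlinConst_nonneg h1p β
  have h := (integral_rpow_mul_mul_le (aestronglyMeasurable_modSum f) (aestronglyMeasurable_modSum f)
    (aestronglyMeasurable_modSum f) (fun x => modSum_nonneg _) (fun x => modSum_nonneg _)
    (fun x => modSum_nonneg _) (normSum_nonneg f) (normSum_nonneg f) (normSum_nonneg f)
    (eLpNorm_modSum_le f) (eLpNorm_modSum_le f) (eLpNorm_modSum_le f))
  have h2 : 0 ≤ 2 * (p + 1) * nonlinConst p β := by positivity
  refine le_trans ?_ (mul_le_mul_of_nonneg_left h.2 h2)
  rw [← integral_const_mul]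
  exact integral_mono (integrable_potential hβ f).abs (h.1.const_mul _)
    fun x => abs_potential_le β hβ _

lemma integrable_weight_mul_potential {β : Fin N → Fin N → ℝ} (hβ : ∀ μ ν, β μ ν = β ν μ)
    (f : Fin N → LL d (energyExp p)) {Y : Rd d → ℝ} {C : ℝ} (hY : Continuous Y)
    (hC : ∀ x, |Y x| ≤ C) : Integrable fun x => Y x * potential p β (values f x) :=
  (integrable_potential hβ f).bdd_mul hY.aestronglyMeasurable (ae_of_all _ fun x => hC x)

lemma abs_integral_weight_mul_potential_le {β : Fin N → Fin N → ℝ} (hβ : ∀ μ ν, β μ ν = β ν μ)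
    (f : Fin N → LL d (energyExp p)) {Y : Rd d → ℝ} {C : ℝ} (hC : ∀ x, |Y x| ≤ C) :
    |∫ x, Y x * potential p β (values f x)| ≤ C * ∫ x, |potential p β (values f x)| := by
  rw [← Real.norm_eq_abs, ← integral_const_mul]
  refine norm_integral_le_of_norm_le ((integrable_potential hβ f).abs.const_mul C)
    (ae_of_all _ fun x => ?_)
  rw [norm_mul]
  exact mul_le_mul_of_nonneg_right (hC x) (abs_nonneg _)

lemma continuous_integral_weight_mul_potential {β : Fin N → Fin N → ℝ} (hβ : ∀ μ ν, β μ ν = β ν μ)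
    {Y : Rd d → ℝ} {C : ℝ} (hY : Continuous Y) (hC : ∀ x, |Y x| ≤ C) :
    Continuous fun f : Fin N → LL d (energyExp p) => ∫ x, Y x * potential p β (values f x) := by
  have h1p := hp.out
  refine continuous_iff_continuousAt.2 fun f => ?_
  rw [ContinuousAt, tendsto_iff_norm_sub_tendsto_zero]
  refine squeeze_zero (g := fun g => C * (2 * (p + 1) * nonlinConst p β *
    ((normSum f + normSum g) ^ (2 * p) * (normSum f + normSum g) * normSum (g - f))))
    (fun _ => norm_nonneg _) (fun g => ?_) ?_
  · have hC0 : 0 ≤ C := (abs_nonneg _).trans (hC 0)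
    refine le_trans ?_ (mul_le_mul_of_nonneg_left (integral_abs_potential_sub_le hβ f g) hC0)
    rw [← integral_sub (integrable_weight_mul_potential hβ g hY hC)
      (integrable_weight_mul_potential hβ f hY hC), ← integral_const_mul]
    refine norm_integral_le_of_norm_le (((integrable_potential hβ g).sub
      (integrable_potential hβ f)).abs.const_mul C) (ae_of_all _ fun x => ?_)
    rw [← mul_sub, norm_mul]
    exact mul_le_mul_of_nonneg_right (hC x) (abs_nonneg _)
  · have hc : Continuous fun g : Fin N → LL d (energyExp p) => C * (2 * (p + 1) * nonlinConst p β *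
        ((normSum f + normSum g) ^ (2 * p) * (normSum f + normSum g) * normSum (g - f))) := by
      have hs : Continuous fun g : Fin N → LL d (energyExp p) => normSum f + normSum g :=
        continuous_const.add continuous_normSum
      exact continuous_const.mul (continuous_const.mul
        (((hs.rpow_const fun _ => Or.inr (by linarith)).mul hs).mul
          (continuous_normSum.comp (continuous_id.sub continuous_const))))
    have := hc.tendsto f
    simpa [normSum] using this

lemma IsWeight.abs_sub_le {Y : Rd d → ℝ} (hY : IsWeight Y) {C : ℝ} (hC : ∀ x, ‖fderiv ℝ Y x‖ ≤ C)
    (x y : Rd d) : |Y x - Y y| ≤ C * ‖x - y‖ :=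
  Convex.norm_image_sub_le_of_norm_fderiv_le (𝕜 := ℝ) (s := Set.univ)
    (fun x _ => hY.contDiff.differentiable (by simp) x) (fun x _ => hC x) convex_univ
    (Set.mem_univ y) (Set.mem_univ x)

lemma integral_weight_mul_potential_trTuple (β : Fin N → Fin N → ℝ) (a : Rd d)
    (f : Fin N → LL d (energyExp p)) (Y : Rd d → ℝ) :
    ∫ x, Y x * potential p β (values (trTuple a f) x) =
      ∫ x, Y (x - a) * potential p β (values f x) := by
  rw [← integral_add_right_eq_self (fun x => Y (x - a) * potential p β (values f x)) a]
  refine integral_congr_ae ?_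
  filter_upwards [values_trTuple a f] with x hx
  rw [hx, add_sub_cancel_right]

/-- The difference quotient of the weight. -/
def weightQuotient (Y : Rd d → ℝ) (k : Fin d) (δ : ℝ) (x : Rd d) : ℝ :=
  -(δ⁻¹ * (Y (x - δ • unitVec k) - Y x))

lemma continuous_weightQuotient {Y : Rd d → ℝ} (hY : IsWeight Y) (k : Fin d) (δ : ℝ) :
    Continuous (weightQuotient Y k δ) := by
  have := hY.contDiff.continuous
  unfold weightQuotient
  fun_prop

lemma abs_weightQuotient_le {Y : Rd d → ℝ} (hY : IsWeight Y) {C : ℝ}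
    (hC : ∀ x, ‖fderiv ℝ Y x‖ ≤ C) (k : Fin d) {δ : ℝ} (hδ : δ ≠ 0) (x : Rd d) :
    |weightQuotient Y k δ x| ≤ C := by
  have h := hY.abs_sub_le hC (x - δ • unitVec k) x
  have e : ‖x - δ • unitVec k - x‖ = |δ| := by
    rw [sub_sub_cancel_left, norm_neg, norm_smul, PiLp.norm_single]; simp
  rw [e] at h
  rw [weightQuotient, abs_neg, abs_mul, abs_inv, inv_mul_le_iff₀ (abs_pos.2 hδ)]
  linarith

lemma tendsto_weightQuotient {Y : Rd d → ℝ} (hY : IsWeight Y) (k : Fin d) (x : Rd d) :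
    Tendsto (fun δ => weightQuotient Y k δ x) (𝓝[≠] 0) (𝓝 (pderiv k Y x)) := by
  have hl : HasDerivAt (fun δ : ℝ => x - δ • unitVec k) (-unitVec k) 0 := by
    have := ((hasDerivAt_id (0 : ℝ)).smul_const (unitVec k)).const_sub x
    simpa using this
  have hf : HasFDerivAt Y (fderiv ℝ Y x) (x - (0 : ℝ) • unitVec k) := by
    rw [zero_smul, sub_zero]; exact (hY.contDiff.differentiable (by simp) x).hasFDerivAt
  have h := hasDerivAt_iff_tendsto_slope.1 (hf.comp_hasDerivAt (0 : ℝ) hl)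
  have h2 := h.neg
  rw [map_neg, neg_neg] at h2
  refine h2.congr fun δ => ?_
  rw [slope_def_field, weightQuotient]
  simp only [Function.comp_apply, zero_smul, sub_zero]
  rw [div_eq_inv_mul]

lemma tendsto_integral_weightQuotient {β : Fin N → Fin N → ℝ} (hβ : ∀ μ ν, β μ ν = β ν μ)
    {Y : Rd d → ℝ} (hY : IsWeight Y) (k : Fin d) (f : Fin N → LL d (energyExp p)) :
    Tendsto (fun δ => ∫ x, weightQuotient Y k δ x * potential p β (values f x)) (𝓝[≠] 0)
      (𝓝 (∫ x, pderiv k Y x * potential p β (values f x))) := by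
  obtain ⟨C, hC⟩ := hY.bdd_fderiv
  refine tendsto_integral_filter_of_dominated_convergence
    (fun x => C * |potential p β (values f x)|) ?_ ?_ ((integrable_potential hβ f).abs.const_mul C) ?_
  · exact Eventually.of_forall fun δ => (continuous_weightQuotient hY k δ).aestronglyMeasurable.mul
      (integrable_potential hβ f).1
  · filter_upwards [self_mem_nhdsWithin] with δ hδ
    refine ae_of_all _ fun x => ?_
    rw [norm_mul]
    exact mul_le_mul_of_nonneg_right (abs_weightQuotient_le hY hC k hδ x) (abs_nonneg _)
  · exact ae_of_all _ fun x => (tendsto_weightQuotient hY k x).mul_const _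

lemma linearBalance_smul {p : ℝ} (Y : Rd d → ℝ) (W : Fin N → XS d (energyExp p)) (D : Fin N → LL d 2) (c : ℝ) :
    linearBalance Y W (fun μ => (c : ℂ) • D μ) = c * linearBalance Y W D := by
  simp only [linearBalance, weightedPairing_smul_right, Finset.mul_sum]
  refine Finset.sum_congr rfl fun μ _ => Finset.sum_congr rfl fun l _ => ?_
  rw [mul_left_comm, ← mul_add, Complex.re_ofReal_mul]

lemma continuous_linearBalance (Y : Rd d → ℝ) :
    Continuous fun z : (Fin N → XS d (energyExp p)) × (Fin N → LL d 2) => linearBalance Y z.1 z.2 := by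
  have h1 : ∀ μ, Continuous fun z : (Fin N → XS d (energyExp p)) × (Fin N → LL d 2) => (z.1 μ).1 :=
    fun μ => continuous_fst.comp ((continuous_apply μ).comp continuous_fst)
  have h2 : ∀ μ (l : Fin d), Continuous fun z : (Fin N → XS d (energyExp p)) × (Fin N → LL d 2) =>
      (z.1 μ).2.1 l := fun μ l => (continuous_apply l).comp (continuous_fst.comp
    (continuous_snd.comp ((continuous_apply μ).comp continuous_fst)))
  have h3 : ∀ μ, Continuous fun z : (Fin N → XS d (energyExp p)) × (Fin N → LL d 2) => z.2 μ :=
    fun μ => (continuous_apply μ).comp continuous_snd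
  refine continuous_finsetSum _ fun μ _ => continuous_finsetSum _ fun l _ => ?_
  have h4 := (continuous_weightedPairing (pderiv l Y)).comp ((h2 μ l).prodMk (h3 μ))
  have h5 := (continuous_weightedPairing (pderiv l (pderiv l Y))).comp ((h1 μ).prodMk (h3 μ))
  exact Complex.continuous_re.comp ((continuous_const.mul h4).add h5)

/-- The majorant of the linear part of the momentum balance. -/
def linearMajorant (Y : Rd d → ℝ) (W : Fin N → XS d (energyExp p)) (k : Fin d) : ℝ :=
  ∑ μ, ∑ l, (2 * ‖mulL (pderiv l Y) (conjL ((W μ).2.1 l))‖ +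
    ‖mulL (pderiv l (pderiv l Y)) (conjL (W μ).1)‖) * ‖(W μ).2.1 k‖

lemma continuous_linearMajorant (Y : Rd d → ℝ) (k : Fin d) :
    Continuous fun W : Fin N → XS d (energyExp p) => linearMajorant Y W k := by
  have hc : Continuous (conjL : LL d 2 →L[ℝ] LL d 2) := conjL.continuous
  refine continuous_finsetSum _ fun μ _ => continuous_finsetSum _ fun l _ => Continuous.mul
    ((continuous_const.mul ((mulL _).continuous.comp (hc.comp ?_)).norm).add
      ((mulL _).continuous.comp (hc.comp ?_)).norm) ?_
  all_goals fun_prop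

lemma abs_linearBalance_le {p : ℝ} (Y : Rd d → ℝ) (W : Fin N → XS d (energyExp p)) (k : Fin d)
    {D : Fin N → LL d 2} (hD : ∀ μ, ‖D μ‖ ≤ ‖(W μ).2.1 k‖) :
    |linearBalance Y W D| ≤ linearMajorant Y W k := by
  refine (Finset.abs_sum_le_sum_abs _ _).trans (Finset.sum_le_sum fun μ _ =>
    (Finset.abs_sum_le_sum_abs _ _).trans (Finset.sum_le_sum fun l _ => ?_))
  refine (Complex.abs_re_le_norm _).trans ((norm_add_le _ _).trans ?_)
  rw [norm_mul, Complex.norm_ofNat, add_mul, mul_assoc]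
  refine add_le_add (mul_le_mul_of_nonneg_left ?_ (by norm_num)) ?_
  · exact (norm_weightedPairing_le _ _ _).trans (mul_le_mul_of_nonneg_left (hD μ) (norm_nonneg _))
  · exact (norm_weightedPairing_le _ _ _).trans (mul_le_mul_of_nonneg_left (hD μ) (norm_nonneg _))

/-- The part of the nonlinear contribution which is of second order in the difference. -/
def forcingDefect (β : Fin N → Fin N → ℝ) (Y : Rd d → ℝ) (f g : Fin N → LL d (energyExp p)) : ℝ :=
  forcing β Y f g - p / (p + 1) * ((∫ x, Y x * potential p β (values g x)) -
    ∫ x, Y x * potential p β (values f x))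

lemma continuous_forcingDefect {β : Fin N → Fin N → ℝ} (hβ : ∀ μ ν, β μ ν = β ν μ) {Y : Rd d → ℝ}
    (hY : IsWeight Y) {f g : ℝ → Fin N → LL d (energyExp p)} (hf : Continuous f)
    (hg : Continuous g) : Continuous fun t => forcingDefect β Y (f t) (g t) := by
  obtain ⟨C, hC⟩ := hY.bdd
  have h1 := continuous_integral_weight_mul_potential (p := p) hβ hY.contDiff.continuous hC
  have h2 := (continuous_forcing (p := p) β hY).comp (hf.prodMk hg)
  exact h2.sub (continuous_const.mul ((h1.comp hg).sub (h1.comp hf)))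

lemma abs_forcingDefect_le {β : Fin N → Fin N → ℝ} (hβ : ∀ μ ν, β μ ν = β ν μ) {Y : Rd d → ℝ}
    {C M : ℝ} (hY : Continuous Y) (hC : ∀ x, |Y x| ≤ C) {f g : Fin N → LL d (energyExp p)}
    (hf : normSum f ≤ M) (hg : normSum g ≤ M) :
    |forcingDefect β Y f g| ≤ C * (2 * nonlinConst p β) * (M + M) ^ (2 * p) * normSum (g - f) ^ 2 := by
  have h1p := hp.out
  have hK := nonlinConst_nonneg h1p β
  have hC0 : 0 ≤ C := (abs_nonneg _).trans (hC 0)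
  refine (abs_integral_cancellation_le hβ f g hY hC).trans ?_
  have h2 := normSum_nonneg (g - f)
  have h3 : (normSum f + normSum g) ^ (2 * p) ≤ (M + M) ^ (2 * p) :=
    Real.rpow_le_rpow (add_nonneg (normSum_nonneg f) (normSum_nonneg g)) (by linarith) (by linarith)
  have h4 : 0 ≤ C * (2 * nonlinConst p β) * normSum (g - f) ^ 2 := by positivity
  have h5 := mul_le_mul_of_nonneg_left h3 h4
  linarith

/-- The integral of Y ū u is real, so its imaginary part vanishes. The translate may therefore be
replaced by the difference, and division by δ leaves a difference quotient. -/
lemma tendsto_translated_momentum {p : ℝ} {W : Fin N → XS d (energyExp p)} {Y : Rd d → ℝ} (hY : IsWeight Y)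
    {k : Fin d} (h : ∀ μ, Tendsto (fun δ : ℝ => ((δ⁻¹ : ℝ) : ℂ) • diffL (δ • unitVec k) (W μ).1)
      (𝓝[≠] 0) (𝓝 ((W μ).2.1 k))) :
    Tendsto (fun δ : ℝ => δ⁻¹ * ∑ μ, (weightedPairing Y (W μ).1 (trL (δ • unitVec k) (W μ).1)).im)
      (𝓝[≠] 0) (𝓝 (∑ μ, (weightedPairing Y (W μ).1 ((W μ).2.1 k)).im)) := by
  have hJ0 : ∀ μ, (weightedPairing Y (W μ).1 (W μ).1).im = 0 := fun μ => by
    have := congrArg Complex.im (weightedPairing_conj_symm hY.memLp (W μ).1 (W μ).1)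
    rw [Complex.conj_im] at this
    linarith
  have h1 : Tendsto (fun δ : ℝ => ∑ μ, (weightedPairing Y (W μ).1
      (((δ⁻¹ : ℝ) : ℂ) • diffL (δ • unitVec k) (W μ).1)).im) (𝓝[≠] 0)
      (𝓝 (∑ μ, (weightedPairing Y (W μ).1 ((W μ).2.1 k)).im)) := by
    refine tendsto_finsetSum _ fun μ _ => ?_
    have hv : Continuous fun v : LL d 2 => weightedPairing Y (W μ).1 v :=
      (pairing volume 2 2 (mulL Y (conjL (W μ).1))).continuous
    have hc : Continuous fun v : LL d 2 => (weightedPairing Y (W μ).1 v).im :=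
      Complex.continuous_im.comp hv
    exact (hc.tendsto ((W μ).2.1 k)).comp (h μ)
  refine h1.congr fun δ => ?_
  rw [Finset.mul_sum]
  refine Finset.sum_congr rfl fun μ _ => ?_
  have e : trL (δ • unitVec k) (W μ).1 = (W μ).1 + diffL (δ • unitVec k) (W μ).1 :=
    (add_sub_cancel _ _).symm
  rw [e, weightedPairing_smul_right, Complex.im_ofReal_mul, weightedPairing_add_right, Complex.add_im,
    hJ0, zero_add]

lemma tendsto_linearBalance {W : Fin N → XS d (energyExp p)} (Y : Rd d → ℝ)
    {k : Fin d} (h : ∀ μ, Tendsto (fun δ : ℝ => ((δ⁻¹ : ℝ) : ℂ) • diffL (δ • unitVec k) (W μ).1)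
      (𝓝[≠] 0) (𝓝 ((W μ).2.1 k))) :
    Tendsto (fun δ : ℝ => δ⁻¹ * linearBalance Y W (fun μ => diffL (δ • unitVec k) (W μ).1)) (𝓝[≠] 0)
      (𝓝 (linearBalance Y W (fun μ => (W μ).2.1 k))) := by
  have hv : Continuous fun D : Fin N → LL d 2 => (W, D) := Continuous.prodMk_right _
  have hc := (continuous_linearBalance Y).comp hv
  have h1 := (hc.tendsto (fun μ => (W μ).2.1 k)).comp (tendsto_pi_nhds.2 h)
  refine h1.congr fun δ => ?_
  exact linearBalance_smul Y W (fun μ => diffL (δ • unitVec k) (W μ).1) δ⁻¹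

/-- Discrete integration by parts: the translation is moved from the solution, whose potential is
not differentiable in x, to the weight, whose difference quotient is bounded and converges. -/
lemma integral_weightQuotient_mul_potential {β : Fin N → Fin N → ℝ} (hβ : ∀ μ ν, β μ ν = β ν μ)
    {Y : Rd d → ℝ} (hY : IsWeight Y) (k : Fin d) (δ : ℝ) (f : Fin N → LL d (energyExp p)) :
    ∫ x, weightQuotient Y k δ x * potential p β (values f x) =
      -(δ⁻¹ * ((∫ x, Y x * potential p β (values (trTuple (δ • unitVec k) f) x)) -
        ∫ x, Y x * potential p β (values f x))) := by
  obtain ⟨C₀, hC₀⟩ := hY.bdd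
  have hYt : Continuous fun x => Y (x - δ • unitVec k) := by
    have := hY.contDiff.continuous
    fun_prop
  rw [integral_weight_mul_potential_trTuple, ← integral_sub
    (integrable_weight_mul_potential hβ _ hYt fun x => hC₀ _)
    (integrable_weight_mul_potential hβ _ hY.contDiff.continuous hC₀), ← integral_const_mul,
    ← integral_neg]
  congr 1; ext x
  rw [weightQuotient]; ring

/-- The local momentum balance. -/
theorem SolvesSystem.hasDerivAt_momentum {β : Fin N → Fin N → ℝ} (hβ : ∀ μ ν, β μ ν = β ν μ)
    {w : ℝ → Fin N → XS d (energyExp p)} (h : SolvesSystem β w) (hd : (d : ℝ) < (2 * p + 2) / p)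
    {Y : Rd d → ℝ} (hY : IsWeight Y) (hY' : ∀ l, IsWeight (pderiv l Y)) (k : Fin d) (t₀ : ℝ) :
    HasDerivAt (fun s => ∑ μ, (weightedPairing Y (w s μ).1 ((w s μ).2.1 k)).im)
      (linearBalance Y (w t₀) (fun μ => (w t₀ μ).2.1 k) +
        p / (p + 1) * ∫ x, pderiv k Y x * potential p β (values (energyPart (w t₀)) x)) t₀ := by
  have h1p := hp.out
  have hw := h.continuous
  have hwe : Continuous fun t => energyPart (w t) := continuous_energyPart.comp hw
  have hK := nonlinConst_nonneg h1p β
  obtain ⟨C₀, hC₀⟩ := hY.bdd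
  obtain ⟨C₁, hC₁⟩ := hY.bdd_fderiv
  have hC₁0 : 0 ≤ C₁ := (norm_nonneg _).trans (hC₁ 0)
  have hC₀0 : 0 ≤ C₀ := (abs_nonneg _).trans (hC₀ 0)
  obtain ⟨ε, hε, C, hC⟩ := h.exists_difference_bound hd t₀ k
  obtain ⟨M, hM⟩ : ∃ M, ∀ t ∈ Set.Icc (t₀ - ε) (t₀ + ε), normSum (energyPart (w t)) ≤ M := by
    obtain ⟨M, hM⟩ := (isCompact_Icc.image (continuous_normSum.comp hwe)).bddAbove
    exact ⟨M, fun t ht => hM ⟨t, ht, rfl⟩⟩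
  have hM0 : 0 ≤ M := (normSum_nonneg _).trans (hM t₀ ⟨by linarith, by linarith⟩)
  obtain ⟨T, hT⟩ : ∃ T : ℝ → ℝ → Fin N → LL d (energyExp p),
      ∀ δ t, T δ t = trTuple (δ • unitVec k) (energyPart (w t)) := ⟨_, fun _ _ => rfl⟩
  have hTc : ∀ δ, Continuous (T δ) := fun δ => by
    simp only [funext (hT δ)]
    exact continuous_pi fun ν =>
      (trL (δ • unitVec k)).continuous.comp ((continuous_apply ν).comp hwe)
  -- The main part of the derivative: the linear terms, and the first order part of the forcing
  -- after discrete integration by parts.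
  obtain ⟨A, hA⟩ : ∃ A : ℝ → ℝ → ℝ, ∀ δ t, A δ t =
      δ⁻¹ * linearBalance Y (w t) (fun μ => diffL (δ • unitVec k) (w t μ).1) +
      p / (p + 1) * ∫ x, weightQuotient Y k δ x * potential p β (values (energyPart (w t)) x) :=
    ⟨_, fun _ _ => rfl⟩
  -- The error is the quadratic defect of the forcing, divided by δ. It need not be small at any
  -- given time, only on average.
  obtain ⟨E, hE⟩ : ∃ E : ℝ → ℝ → ℝ, ∀ δ t, E δ t =
      -(δ⁻¹ * forcingDefect β Y (energyPart (w t)) (T δ t)) := ⟨_, fun _ _ => rfl⟩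
  have hquotient : ∀ t μ, Tendsto (fun δ : ℝ => ((δ⁻¹ : ℝ) : ℂ) • diffL (δ • unitVec k) (w t μ).1)
      (𝓝[≠] 0) (𝓝 ((w t μ).2.1 k)) := fun t μ => tendsto_difference_quotient ((h μ).mem t) k
  have hEc : ∀ δ, Continuous (E δ) := fun δ => by
    simp only [funext (hE δ)]
    exact (continuous_const.mul (continuous_forcingDefect hβ hY hwe (hTc δ))).neg
  refine hasDerivAt_of_tendsto_integral (f := fun δ t => δ⁻¹ * ∑ μ, (weightedPairing Y (w t μ).1
    (trL (δ • unitVec k) (w t μ).1)).im) (A := A) (E := E)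
    (Q := fun t => linearBalance Y (w t) (fun μ => (w t μ).2.1 k) +
        p / (p + 1) * ∫ x, pderiv k Y x * potential p β (values (energyPart (w t)) x))
    (B := fun t => linearMajorant Y (w t) k + p / (p + 1) * (C₁ * (2 * (p + 1) * nonlinConst p β *
      (normSum (energyPart (w t)) ^ (2 * p) * normSum (energyPart (w t)) *
        normSum (energyPart (w t))))))
    (C := C₀ * (2 * nonlinConst p β) * (M + M) ^ (2 * p) * C) hε ?_ ?_ (fun δ _ => hEc δ) ?_ ?_
    (fun t => tendsto_translated_momentum hY (hquotient t)) ?_ ?_ ?_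
  · intro δ hδ t
    refine ((h.hasDerivAt_translated_momentum hd hY hY' (δ • unitVec k) t).const_mul δ⁻¹).congr_deriv ?_
    rw [hA, hE, integral_weightQuotient_mul_potential hβ hY, hT, forcingDefect]
    ring
  · intro δ hδ
    simp only [funext (hA δ)]
    have h2 : Continuous fun t => fun μ => diffL (δ • unitVec k) (w t μ).1 := by
      refine continuous_pi fun μ => ?_
      have h1 : Continuous fun t => (w t μ).1 := by fun_prop
      exact ((trL (δ • unitVec k)).continuous.comp h1).sub h1
    have h3 := (continuous_linearBalance Y).comp (hw.prodMk h2)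
    have h4 := (continuous_integral_weight_mul_potential (p := p) hβ
        (continuous_weightQuotient hY k δ) (abs_weightQuotient_le hY hC₁ k hδ)).comp hwe
    exact (continuous_const.mul h3).add (continuous_const.mul h4)
  · have hn : Continuous fun t => normSum (energyPart (w t)) := continuous_normSum.comp hwe
    have h2 := (continuous_linearMajorant Y k).comp hw
    have h3 := ((hn.rpow_const fun _ => Or.inr (show 0 ≤ 2 * p by linarith)).mul hn).mul hn
    exact h2.add (continuous_const.mul (continuous_const.mul (continuous_const.mul h3)))
  · have h1 : Continuous fun t => fun μ => (w t μ).2.1 k := by fun_prop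
    have h2 := (continuous_linearBalance Y).comp (hw.prodMk h1)
    have h3 := (continuous_integral_weight_mul_potential (p := p) hβ (hY.continuous_pderiv k)
        (IsWeight.abs_pderiv_le hC₁ k)).comp hwe
    exact h2.add (continuous_const.mul h3)
  · intro t
    simp only [hA]
    exact (tendsto_linearBalance Y (hquotient t)).add
      ((tendsto_integral_weightQuotient hβ hY k _).const_mul _)
  · intro δ hδ t
    rw [hA]
    refine (abs_add_le _ _).trans (add_le_add ?_ ?_)
    · rw [← linearBalance_smul]
      refine abs_linearBalance_le _ _ _ fun μ => ?_
      rw [norm_smul, Complex.norm_real, Real.norm_eq_abs, abs_inv, inv_mul_le_iff₀ (abs_pos.2 hδ)]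
      exact norm_trL_sub_le ((h μ).mem t) δ k
    · have hpp : 0 ≤ p / (p + 1) := by positivity
      rw [abs_mul, abs_of_nonneg hpp]
      refine mul_le_mul_of_nonneg_left ?_ hpp
      exact (abs_integral_weight_mul_potential_le hβ _ (abs_weightQuotient_le hY hC₁ k hδ)).trans
        (mul_le_mul_of_nonneg_left (integral_abs_potential_le hβ _) hC₁0)
  · intro δ hδ
    have hab : t₀ - ε ≤ t₀ + ε := by linarith
    have hpt : ∀ t ∈ Set.Icc (t₀ - ε) (t₀ + ε), |E δ t| ≤ |δ|⁻¹ * (C₀ * (2 * nonlinConst p β) *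
        (M + M) ^ (2 * p)) * normSum (T δ t - energyPart (w t)) ^ 2 := by
      intro t ht
      have h1 := abs_forcingDefect_le hβ hY.contDiff.continuous hC₀ (hM t ht) (g := T δ t)
        (by rw [hT, normSum_trTuple]; exact hM t ht)
      rw [hE, abs_neg, abs_mul, abs_inv, mul_assoc]
      exact mul_le_mul_of_nonneg_left h1 (by positivity)
    have hnc : Continuous fun t => normSum (T δ t - energyPart (w t)) ^ 2 :=
      (continuous_normSum.comp ((hTc δ).sub hwe)).pow 2
    -- The squared difference integrates to at most C δ², so one power of |δ| is left after the
    -- division.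
    refine (intervalIntegral.integral_mono_on hab ((hEc δ).abs.intervalIntegrable _ _)
      ((hnc.const_mul _).intervalIntegrable _ _) hpt).trans ?_
    rw [intervalIntegral.integral_const_mul]
    have h7 : 0 ≤ |δ|⁻¹ * (C₀ * (2 * nonlinConst p β) * (M + M) ^ (2 * p)) := by positivity
    have h9 := hC δ
    simp only [← hT] at h9
    refine (mul_le_mul_of_nonneg_left h9 h7).trans_eq ?_
    rw [← sq_abs δ]
    have h8 : |δ| ≠ 0 := abs_ne_zero.2 hδ
    field_simp

end Momentum

end InteractionMorawetz

end

/-! ### Bounded derivatives, Hessians of convex functions and the radial weight -/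

noncomputable section
open MeasureTheory Filter Topology
open scoped ContDiff ENNReal SchwartzMap FourierTransform RealInnerProductSpace Laplacian LineDeriv
namespace InteractionMorawetz

section BoundedDerivatives

variable {d : ℕ}

/-- `Y` is of class `C^n` with bounded derivatives of all orders `0, …, n`. -/
structure SmoothBdd (n : ℕ) (Y : Rd d → ℝ) : Prop where
  contDiff : ContDiff ℝ n Y
  bdd : ∀ k ≤ n, ∃ C, ∀ x, ‖iteratedFDeriv ℝ k Y x‖ ≤ C

lemma contDiff_pderiv {n : ℕ} {Y : Rd d → ℝ} (h : ContDiff ℝ (n + 1 : ℕ) Y) (k : Fin d) :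
    ContDiff ℝ n (pderiv k Y) :=
  (h.fderiv_right (m := n) (by norm_cast)).clm_apply contDiff_const

lemma norm_iteratedFDeriv_pderiv_le {n j : ℕ} {Y : Rd d → ℝ} (h : ContDiff ℝ (n + 1 : ℕ) Y)
    (hj : j ≤ n) (k : Fin d) (x : Rd d) :
    ‖iteratedFDeriv ℝ j (pderiv k Y) x‖ ≤ ‖iteratedFDeriv ℝ (j + 1) Y x‖ := by
  have h1 : ContDiff ℝ n (fderiv ℝ Y) := h.fderiv_right (m := n) (by norm_cast)
  have h2 := norm_iteratedFDeriv_clm_apply_const (c := unitVec k) (h1.contDiffAt (x := x))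
    (show (j : ℕ∞ω) ≤ n by exact_mod_cast hj)
  rw [norm_iteratedFDeriv_fderiv, PiLp.norm_single, norm_one, one_mul] at h2
  exact h2

lemma smoothBdd_pderiv {n : ℕ} {Y : Rd d → ℝ} (h : ContDiff ℝ (n + 1 : ℕ) Y)
    (hb : ∀ k, 1 ≤ k → k ≤ n + 1 → ∃ C, ∀ x, ‖iteratedFDeriv ℝ k Y x‖ ≤ C) (k : Fin d) :
    SmoothBdd n (pderiv k Y) := by
  refine ⟨contDiff_pderiv h k, fun j hj => ?_⟩
  obtain ⟨C, hC⟩ := hb (j + 1) (by omega) (by omega)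
  exact ⟨C, fun x => (norm_iteratedFDeriv_pderiv_le h hj k x).trans (hC x)⟩

namespace SmoothBdd

variable {n : ℕ} {Y : Rd d → ℝ}

lemma pderiv (h : SmoothBdd (n + 1) Y) (k : Fin d) : SmoothBdd n (pderiv k Y) :=
  smoothBdd_pderiv h.contDiff (fun k _ hk => h.bdd k hk) k

lemma mono {m : ℕ} (h : SmoothBdd n Y) (hm : m ≤ n) : SmoothBdd m Y :=
  ⟨h.contDiff.of_le (by exact_mod_cast hm), fun k hk => h.bdd k (hk.trans hm)⟩

lemma exists_bound (h : SmoothBdd n Y) : ∃ C, ∀ x, |Y x| ≤ C := by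
  obtain ⟨C, hC⟩ := h.bdd 0 (Nat.zero_le _)
  exact ⟨C, fun x => by simpa using hC x⟩

lemma continuous (h : SmoothBdd n Y) : Continuous Y := h.contDiff.continuous

lemma isWeight (h : SmoothBdd (n + 1) Y) : IsWeight Y := by
  obtain ⟨C, hC⟩ := h.bdd 1 (by omega)
  refine ⟨h.contDiff.of_le (by norm_cast; omega), h.exists_bound, C, fun x => ?_⟩
  have := hC x
  rwa [norm_iteratedFDeriv_one] at this

end SmoothBdd

lemma pderiv_comp_sub (Y : Rd d → ℝ) (k : Fin d) (y : Rd d) :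
    pderiv k (fun x => Y (x - y)) = fun x => pderiv k Y (x - y) := by
  ext x
  rw [pderiv, fderiv_comp_sub]; rfl

lemma fderiv_comp_neg_apply (Y : Rd d → ℝ) (x : Rd d) :
    fderiv ℝ (fun x => Y (-x)) x = -fderiv ℝ Y (-x) := by
  have := fderiv_comp_smul (𝕜 := ℝ) (f := Y) (x := x) (-1)
  simpa using this

lemma fderiv_comp_const_sub (Y : Rd d → ℝ) (x y : Rd d) :
    fderiv ℝ (fun y => Y (x - y)) y = -fderiv ℝ Y (x - y) := by
  have h1 : (fun y => Y (x - y)) = fun y => (fun z => Y (-z)) (y - x) := by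
    ext y; simp only [neg_sub]
  rw [h1, fderiv_comp_sub (f := fun z => Y (-z)), fderiv_comp_neg_apply, neg_sub]

lemma pderiv_const_sub (Y : Rd d → ℝ) (k : Fin d) (x : Rd d) :
    pderiv k (fun y => Y (x - y)) = fun y => -pderiv k Y (x - y) := by
  ext y
  rw [pderiv, fderiv_comp_const_sub]; rfl

lemma pderiv_neg_of_even {Y : Rd d → ℝ} (h : ∀ x, Y (-x) = Y x) (k : Fin d) (x : Rd d) :
    pderiv k Y (-x) = -pderiv k Y x := by
  have h1 : Y = fun x => Y (-x) := by ext x; rw [h]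
  rw [pderiv, pderiv]
  conv_rhs => rw [h1, fderiv_comp_neg_apply]
  simp

lemma pderiv_neg_of_odd {Y : Rd d → ℝ} (h : ∀ x, Y (-x) = -Y x) (k : Fin d) (x : Rd d) :
    pderiv k Y (-x) = pderiv k Y x := by
  have h1 : Y = fun x => -Y (-x) := by ext x; rw [h, neg_neg]
  rw [pderiv, pderiv]
  conv_rhs => rw [h1, fderiv_fun_neg, fderiv_comp_neg_apply]
  simp

lemma pderiv_comm {Y : Rd d → ℝ} (h : ContDiff ℝ 2 Y) (k l : Fin d) (x : Rd d) :
    pderiv k (pderiv l Y) x = pderiv l (pderiv k Y) x := by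
  have hs := (h.contDiffAt (x := x)).isSymmSndFDerivAt (by simp)
  have hd : DifferentiableAt ℝ (fderiv ℝ Y) x :=
    (h.fderiv_right (m := 1) (by norm_num)).differentiable (by simp) x
  have e : ∀ a b : Fin d, pderiv a (pderiv b Y) x = fderiv ℝ (fderiv ℝ Y) x (unitVec a) (unitVec b) := by
    intro a b
    change fderiv ℝ (fun x => fderiv ℝ Y x (unitVec b)) x (unitVec a) = _
    rw [fderiv_clm_apply hd (differentiableAt_const _)]
    simp
  rw [e, e, hs.eq]

lemma pderiv_pderiv_comm {Y : Rd d → ℝ} (h : ContDiff ℝ 3 Y) (k l : Fin d) :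
    pderiv l (pderiv l (pderiv k Y)) = pderiv k (pderiv l (pderiv l Y)) := by
  have h1 : pderiv l (pderiv k Y) = pderiv k (pderiv l Y) :=
    funext fun x => pderiv_comm (h.of_le (by norm_num)) l k x
  rw [h1]
  exact funext fun x => pderiv_comm (contDiff_pderiv (n := 2) h l) l k x

lemma pderiv_sum_comp_sub {ι : Type*} [Fintype ι] {Y : ι → Rd d → ℝ}
    (h : ∀ i, Differentiable ℝ (Y i)) (l : Fin d) (y : Rd d) :
    pderiv l (fun x => ∑ i, Y i (x - y)) = fun x => ∑ i, pderiv l (Y i) (x - y) := by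
  ext x
  have hd : ∀ i ∈ Finset.univ, DifferentiableAt ℝ (fun x => Y i (x - y)) x := fun i _ =>
    ((h i).comp (differentiable_id.sub_const y)) x
  rw [pderiv, fderiv_fun_sum hd, sum_apply]
  exact Finset.sum_congr rfl fun i _ => congrFun (pderiv_comp_sub (Y i) l y) x

lemma IsWeight.comp_sub {Y : Rd d → ℝ} (h : IsWeight Y) (y : Rd d) : IsWeight fun x => Y (x - y) := by
  obtain ⟨C, hC⟩ := h.bdd
  obtain ⟨C', hC'⟩ := h.bdd_fderiv
  refine ⟨h.contDiff.comp (contDiff_id.sub contDiff_const), ⟨C, fun x => hC _⟩, C', fun x => ?_⟩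
  rw [fderiv_comp_sub]
  exact hC' _

lemma IsWeight.const_sub {Y : Rd d → ℝ} (h : IsWeight Y) (x : Rd d) : IsWeight fun y => Y (x - y) := by
  obtain ⟨C, hC⟩ := h.bdd
  obtain ⟨C', hC'⟩ := h.bdd_fderiv
  refine ⟨h.contDiff.comp (contDiff_const.sub contDiff_id), ⟨C, fun x => hC _⟩, C', fun y => ?_⟩
  rw [fderiv_comp_const_sub, norm_neg]
  exact hC' _

lemma laplacian_eq_sum_pderiv {Y : Rd d → ℝ} (h : ContDiff ℝ 2 Y) (x : Rd d) :
    Laplacian.laplacian Y x = ∑ k, pderiv k (pderiv k Y) x := by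
  have hd : DifferentiableAt ℝ (fderiv ℝ Y) x :=
    (h.fderiv_right (m := 1) (by norm_num)).differentiable (by simp) x
  rw [InnerProductSpace.laplacian_eq_iteratedFDeriv_orthonormalBasis Y (EuclideanSpace.basisFun (Fin d) ℝ)]
  refine Finset.sum_congr rfl fun k _ => ?_
  rw [iteratedFDeriv_two_apply]
  change _ = fderiv ℝ (fun x => fderiv ℝ Y x (unitVec k)) x (unitVec k)
  rw [fderiv_clm_apply hd (differentiableAt_const _)]
  simp

lemma fderiv_apply_eq_sum (Y : Rd d → ℝ) (x v : Rd d) : fderiv ℝ Y x v = ∑ k, v k * pderiv k Y x := by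
  have h : v = ∑ k, v k • unitVec k := by
    have := (EuclideanSpace.basisFun (Fin d) ℝ).sum_repr v
    simpa using this.symm
  conv_lhs => rw [h]
  simp [map_sum, pderiv]

/-- The Hessian of a convex function is positive semidefinite. -/
lemma ConvexOn.hessian_nonneg {Y : Rd d → ℝ} (hc : ConvexOn ℝ Set.univ Y) (h : ContDiff ℝ 2 Y)
    (x v : Rd d) : 0 ≤ ∑ k, ∑ l, pderiv l (pderiv k Y) x * (v k * v l) := by
  have hl : ∀ s : ℝ, HasDerivAt (fun s : ℝ => x + s • v) v s := fun s => by
    have := ((hasDerivAt_id s).smul_const v).const_add x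
    simpa using this
  have h1 : ∀ s : ℝ, HasDerivAt (fun s : ℝ => Y (x + s • v)) (fderiv ℝ Y (x + s • v) v) s := fun s =>
    ((h.differentiable (by simp) _).hasFDerivAt).comp_hasDerivAt s (hl s)
  have hconv : ConvexOn ℝ Set.univ fun s : ℝ => Y (x + s • v) := by
    have := hc.comp_affineMap (AffineMap.lineMap x (x + v) : ℝ →ᵃ[ℝ] Rd d)
    rw [Set.preimage_univ] at this
    refine this.congr fun s _ => ?_
    simp [AffineMap.lineMap_apply, add_comm]
  -- The restriction to the line x + sv is convex, so its derivative is monotone and its second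
  -- derivative at s = 0, which is the Hessian form, is nonnegative.
  have hmono := hconv.monotoneOn_deriv fun s _ => (h1 s).differentiableAt
  rw [monotoneOn_univ] at hmono
  have hd : deriv (fun s : ℝ => Y (x + s • v)) = fun s => ∑ k, v k * pderiv k Y (x + s • v) := by
    ext s; rw [(h1 s).deriv, fderiv_apply_eq_sum]
  have h2 : HasDerivAt (deriv fun s : ℝ => Y (x + s • v))
      (∑ k, v k * fderiv ℝ (pderiv k Y) x v) 0 := by
    rw [hd]
    refine HasDerivAt.fun_sum fun k _ => HasDerivAt.const_mul _ ?_
    have hk : DifferentiableAt ℝ (pderiv k Y) (x + (0 : ℝ) • v) :=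
      (contDiff_pderiv (n := 1) h k).differentiable (by simp) _
    have := hk.hasFDerivAt.comp_hasDerivAt (0 : ℝ) (hl 0)
    rw [zero_smul, add_zero] at this
    exact this
  have h3 : 0 ≤ deriv (deriv fun s : ℝ => Y (x + s • v)) 0 := hmono.deriv_nonneg
  rw [h2.deriv] at h3
  refine h3.trans_eq (Finset.sum_congr rfl fun k _ => ?_)
  rw [fderiv_apply_eq_sum, Finset.mul_sum]
  exact Finset.sum_congr rfl fun l _ => by ring

end BoundedDerivatives

section Potential

variable {d : ℕ} {φ : ℝ → ℝ}

lemma psi_eq (x y : Rd d) : psi φ x y = radial d φ (x - y) := rfl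

lemma radial_neg (x : Rd d) : radial d φ (-x) = radial d φ x := by simp [radial]

lemma gradPsi_apply (x y : Rd d) (k : Fin d) :
    gradPsi φ x y k = pderiv k (radial d φ) (x - y) := by
  have h1 : inner ℝ (gradPsi φ x y) (unitVec k) = fderiv ℝ (fun z => psi φ z y) x (unitVec k) := by
    rw [gradPsi, ← InnerProductSpace.toDual_apply_apply (𝕜 := ℝ), toDual_gradient]
  have h2 : fderiv ℝ (fun z => psi φ z y) x (unitVec k) = pderiv k (radial d φ) (x - y) :=
    congrFun (pderiv_comp_sub (radial d φ) k y) x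
  rw [← h2, ← h1]
  simp [EuclideanSpace.inner_single_right]

lemma lapPsi_eq (h : ContDiff ℝ 4 (radial d φ)) (x y : Rd d) :
    lapPsi φ x y = ∑ k, pderiv k (pderiv k (radial d φ)) (x - y) := by
  have h2 : ContDiff ℝ 2 fun z => psi φ z y :=
    (h.of_le (by norm_num)).comp (contDiff_id.sub contDiff_const)
  rw [lapPsi, laplacian_eq_sum_pderiv h2]
  refine Finset.sum_congr rfl fun k _ => ?_
  have h3 := pderiv_comp_sub (radial d φ) k y
  change pderiv k (pderiv k fun z => radial d φ (z - y)) x = _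
  rw [h3, pderiv_comp_sub]

lemma bilapPsi_eq (h : ContDiff ℝ 4 (radial d φ)) (x y : Rd d) :
    bilapPsi φ x y =
      ∑ k, ∑ l, pderiv l (pderiv l (pderiv k (pderiv k (radial d φ)))) (x - y) := by
  have hk : ∀ k : Fin d, ContDiff ℝ 2 (pderiv k (pderiv k (radial d φ))) := fun k =>
    contDiff_pderiv (n := 2) (contDiff_pderiv (n := 3) h k) k
  have hs : ContDiff ℝ 2 fun z => ∑ k, pderiv k (pderiv k (radial d φ)) (z - y) :=
    ContDiff.sum fun k _ => (hk k).comp (contDiff_id.sub contDiff_const)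
  have e : (fun z => lapPsi φ z y) = fun z => ∑ k, pderiv k (pderiv k (radial d φ)) (z - y) := by
    ext z; rw [lapPsi_eq h]
  rw [bilapPsi, e, laplacian_eq_sum_pderiv hs, Finset.sum_comm]
  refine Finset.sum_congr rfl fun l _ => ?_
  have hk' : ∀ k : Fin d, ContDiff ℝ 1 (pderiv l (pderiv k (pderiv k (radial d φ)))) := fun k =>
    contDiff_pderiv (n := 1) (hk k) l
  rw [pderiv_sum_comp_sub fun k => (hk k).differentiable (by simp),
    pderiv_sum_comp_sub fun k => (hk' k).differentiable (by simp)]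

lemma smoothBdd_pderiv_radial (h : ContDiff ℝ 4 (radial d φ))
    (hb : ∀ k : ℕ, 1 ≤ k → k ≤ 4 → ∃ C : ℝ, ∀ x, ‖iteratedFDeriv ℝ k (radial d φ) x‖ ≤ C)
    (k : Fin d) : SmoothBdd 3 (pderiv k (radial d φ)) :=
  smoothBdd_pderiv (n := 3) h hb k

/-- The trace of a positive semidefinite Hessian, evaluated on the unit vectors. -/
lemma lapPsi_nonneg (hc : ConvexOn ℝ Set.univ (radial d φ)) (h : ContDiff ℝ 4 (radial d φ))
    (x y : Rd d) : 0 ≤ lapPsi φ x y := by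
  rw [lapPsi_eq h]
  refine Finset.sum_nonneg fun k _ => ?_
  have := ConvexOn.hessian_nonneg hc (h.of_le (by norm_num)) (x - y) (unitVec k)
  simpa [Pi.single_apply] using this

/-- The origin is the midpoint of x and -x, where an even function takes equal values. -/
lemma radial_zero_le (hc : ConvexOn ℝ Set.univ (radial d φ)) (x : Rd d) :
    radial d φ 0 ≤ radial d φ x := by
  have h := hc.2 (Set.mem_univ x) (Set.mem_univ (-x)) (show (0 : ℝ) ≤ 1 / 2 by norm_num)
    (show (0 : ℝ) ≤ 1 / 2 by norm_num) (by norm_num)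
  rw [smul_neg, add_neg_cancel, radial_neg] at h
  simp only [smul_eq_mul] at h
  linarith

end Potential

end InteractionMorawetz

end

/-! ### Densities, their balance laws and interaction integrals -/

noncomputable section
open MeasureTheory Filter Topology
open scoped ContDiff ENNReal SchwartzMap FourierTransform RealInnerProductSpace Laplacian LineDeriv
namespace InteractionMorawetz

section Density

variable {d N : ℕ}

lemma integral_norm_conj_mul_le (a b : LL d 2) :
    ∫ x, ‖(starRingEnd ℂ) (a x) * b x‖ ≤ ‖a‖ * ‖b‖ := by
  have h1 := (ContinuousLinearMap.mul ℂ ℂ).coeFn_holder (r := 1) (conjL a) b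
  have h2 : ‖(ContinuousLinearMap.mul ℂ ℂ).holder 1 (conjL a) b‖ =
      ∫ x, ‖(starRingEnd ℂ) (a x) * b x‖ := by
    rw [L1.norm_eq_integral_norm]
    refine integral_congr_ae ?_
    filter_upwards [h1, coeFn_conjL a] with x hx hx2
    rw [hx, hx2]; rfl
  rw [← h2]
  refine ((ContinuousLinearMap.mul ℂ ℂ).norm_holder_apply_apply_le (conjL a) b).trans ?_
  have h3 : ‖conjL a‖ ≤ ‖a‖ := by
    refine Lp.norm_le_norm_of_ae_le ?_
    filter_upwards [coeFn_conjL a] with x hx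
    rw [hx, RCLike.norm_conj]
  have h4 : ‖ContinuousLinearMap.mul ℂ ℂ‖ ≤ 1 := ContinuousLinearMap.opNorm_mul_le _ _
  calc _ ≤ 1 * ‖a‖ * ‖b‖ := by gcongr
    _ = _ := by rw [one_mul]

/-- The real density `∑ T(conj(a_μ) b_μ)`. -/
def density (T : ℂ →L[ℝ] ℝ) (a b : Fin N → LL d 2) (x : Rd d) : ℝ :=
  ∑ μ, T ((starRingEnd ℂ) (a μ x) * b μ x)

lemma integrable_density (T : ℂ →L[ℝ] ℝ) (a b : Fin N → LL d 2) : Integrable (density T a b) :=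
  integrable_finsetSum _ fun μ _ => T.integrable_comp (integrable_conj_mul (a μ) (b μ))

lemma integral_abs_density_le (T : ℂ →L[ℝ] ℝ) (a b : Fin N → LL d 2) :
    ∫ x, |density T a b x| ≤ ∑ μ, ‖T‖ * (‖a μ‖ * ‖b μ‖) := by
  have hi : ∀ μ, Integrable fun x => ‖T‖ * ‖(starRingEnd ℂ) (a μ x) * b μ x‖ := fun μ =>
    (integrable_conj_mul (a μ) (b μ)).norm.const_mul _
  calc ∫ x, |density T a b x| ≤ ∫ x, ∑ μ, ‖T‖ * ‖(starRingEnd ℂ) (a μ x) * b μ x‖ := by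
        refine integral_mono (integrable_density T a b).abs (integrable_finsetSum _ fun μ _ => hi μ)
          fun x => ?_
        exact (Finset.abs_sum_le_sum_abs _ _).trans (Finset.sum_le_sum fun μ _ => T.le_opNorm _)
    _ = ∑ μ, ‖T‖ * ∫ x, ‖(starRingEnd ℂ) (a μ x) * b μ x‖ := by
        rw [integral_finsetSum _ fun μ _ => hi μ]
        simp only [integral_const_mul]
    _ ≤ _ := Finset.sum_le_sum fun μ _ => mul_le_mul_of_nonneg_left
        (integral_norm_conj_mul_le _ _) (norm_nonneg _)

lemma density_sub (T : ℂ →L[ℝ] ℝ) (a b a' b' : Fin N → LL d 2) :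
    ∀ᵐ x, density T a b x - density T a' b' x = density T (a - a') b x + density T a' (b - b') x := by
  have h : ∀ᵐ x, ∀ μ, (a - a') μ x = a μ x - a' μ x ∧ (b - b') μ x = b μ x - b' μ x := by
    rw [ae_all_iff]; exact fun μ => (Lp.coeFn_sub (a μ) (a' μ)).and (Lp.coeFn_sub (b μ) (b' μ))
  filter_upwards [h] with x hx
  unfold density
  rw [← Finset.sum_sub_distrib, ← Finset.sum_add_distrib]
  refine Finset.sum_congr rfl fun μ _ => ?_
  rw [(hx μ).1, (hx μ).2, ← map_sub, ← map_add]
  congr 1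
  rw [map_sub]; ring

/-- Curves continuous in L² have products continuous in L¹, by telescoping and Cauchy–Schwarz. This
supplies the strong continuity needed to differentiate double integrals. -/
lemma tendsto_density (T : ℂ →L[ℝ] ℝ) {a b : ℝ → Fin N → LL d 2} (ha : Continuous a)
    (hb : Continuous b) (t₀ : ℝ) :
    Tendsto (fun t => ∫ x, |density T (a t) (b t) x - density T (a t₀) (b t₀) x|) (𝓝 t₀) (𝓝 0) := by
  refine squeeze_zero (g := fun t => (∑ μ, ‖T‖ * (‖(a t - a t₀) μ‖ * ‖b t μ‖)) +
    ∑ μ, ‖T‖ * (‖a t₀ μ‖ * ‖(b t - b t₀) μ‖)) (fun t => integral_nonneg fun x => abs_nonneg _)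
    (fun t => ?_) ?_
  · refine le_trans ?_ (add_le_add (integral_abs_density_le T _ _) (integral_abs_density_le T _ _))
    rw [← integral_add (integrable_density T _ _).abs (integrable_density T _ _).abs]
    refine integral_mono_ae ((integrable_density T _ _).sub (integrable_density T _ _)).abs
      ((integrable_density T _ _).abs.add (integrable_density T _ _).abs) ?_
    filter_upwards [density_sub T (a t) (b t) (a t₀) (b t₀)] with x hx
    rw [hx]
    exact abs_add_le _ _
  · have hc : Continuous fun t => (∑ μ, ‖T‖ * (‖(a t - a t₀) μ‖ * ‖b t μ‖)) +
        ∑ μ, ‖T‖ * (‖a t₀ μ‖ * ‖(b t - b t₀) μ‖) := by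
      simp only [Pi.sub_apply]
      have h1 : ∀ μ, Continuous fun t => a t μ := fun μ => (continuous_apply μ).comp ha
      have h2 : ∀ μ, Continuous fun t => b t μ := fun μ => (continuous_apply μ).comp hb
      exact (continuous_finsetSum _ fun μ _ => continuous_const.mul
        (((h1 μ).sub continuous_const).norm.mul (h2 μ).norm)).add
        (continuous_finsetSum _ fun μ _ => continuous_const.mul
        (continuous_const.mul ((h2 μ).sub continuous_const).norm))
    simpa using hc.tendsto t₀

lemma abs_integral_mul_le {Y A : Rd d → ℝ} {C : ℝ} (hC : ∀ x, |Y x| ≤ C) (hA : Integrable A) :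
    |∫ x, Y x * A x| ≤ C * ∫ x, |A x| := by
  rw [← Real.norm_eq_abs, ← integral_const_mul]
  refine norm_integral_le_of_norm_le (hA.abs.const_mul C) (ae_of_all _ fun x => ?_)
  rw [norm_mul]
  exact mul_le_mul_of_nonneg_right (hC x) (abs_nonneg _)

lemma integral_mul_density_re {Y : Rd d → ℝ}
    (hY : MemLp (fun x => (Y x : ℂ)) ⊤ (volume : Measure (Rd d))) (a b : Fin N → LL d 2) :
    ∫ x, Y x * density Complex.reCLM a b x = ∑ μ, (weightedPairing Y (a μ) (b μ)).re := by
  simp only [re_weightedPairing hY, density, Finset.mul_sum]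
  refine integral_finsetSum _ fun μ _ => ?_
  refine (integrable_weight_conj_mul hY (a μ) (b μ)).re.congr (ae_of_all _ fun x => ?_)
  exact Complex.re_ofReal_mul _ _

lemma integral_mul_density_im {Y : Rd d → ℝ}
    (hY : MemLp (fun x => (Y x : ℂ)) ⊤ (volume : Measure (Rd d))) (a b : Fin N → LL d 2) :
    ∫ x, Y x * density Complex.imCLM a b x = ∑ μ, (weightedPairing Y (a μ) (b μ)).im := by
  simp only [im_weightedPairing hY, density, Finset.mul_sum]
  refine integral_finsetSum _ fun μ _ => ?_
  refine (integrable_weight_conj_mul hY (a μ) (b μ)).im.congr (ae_of_all _ fun x => ?_)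
  exact Complex.im_ofReal_mul _ _

end Density

section Balance

variable {d N : ℕ} {p : ℝ}

/-- The total mass density. -/
abbrev massD (W : Fin N → XS d (energyExp p)) : Rd d → ℝ :=
  density Complex.reCLM (fun μ => (W μ).1) (fun μ => (W μ).1)

/-- The total momentum density. -/
abbrev currentD (k : Fin d) (W : Fin N → XS d (energyExp p)) : Rd d → ℝ :=
  density Complex.imCLM (fun μ => (W μ).1) (fun μ => (W μ).2.1 k)

/-- Half the gradient of the total mass density. -/
abbrev gradD (k : Fin d) (W : Fin N → XS d (energyExp p)) : Rd d → ℝ :=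
  density Complex.reCLM (fun μ => (W μ).1) (fun μ => (W μ).2.1 k)

/-- The kinetic stress tensor. -/
abbrev stressD (l k : Fin d) (W : Fin N → XS d (energyExp p)) : Rd d → ℝ :=
  density Complex.reCLM (fun μ => (W μ).2.1 l) (fun μ => (W μ).2.1 k)

/-- The potential energy density. -/
abbrev potentialD (β : Fin N → Fin N → ℝ) (W : Fin N → XS d (energyExp p)) (x : Rd d) : ℝ :=
  potential p β (values (energyPart W) x)

variable [hp : Fact (1 ≤ p)]

lemma SolvesSystem.hasDerivAt_massD {β : Fin N → Fin N → ℝ} {w : ℝ → Fin N → XS d (energyExp p)}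
    (h : SolvesSystem β w) (hd : (d : ℝ) < (2 * p + 2) / p) {Y : Rd d → ℝ} (hY : IsWeight Y) (t : ℝ) :
    HasDerivAt (fun s => ∫ x, Y x * massD (w s) x)
      (2 * ∑ k, ∫ x, pderiv k Y x * currentD k (w t) x) t := by
  simp only [integral_mul_density_re hY.memLp, integral_mul_density_im (hY.memLp_pderiv _)]
  refine (HasDerivAt.fun_sum fun μ _ => h.hasDerivAt_mass hd hY μ t).congr_deriv ?_
  rw [← Finset.mul_sum, Finset.sum_comm]

lemma SolvesSystem.hasDerivAt_currentD {β : Fin N → Fin N → ℝ} (hβ : ∀ μ ν, β μ ν = β ν μ)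
    {w : ℝ → Fin N → XS d (energyExp p)} (h : SolvesSystem β w) (hd : (d : ℝ) < (2 * p + 2) / p)
    {Y : Rd d → ℝ} (hY : IsWeight Y) (hY' : ∀ l, IsWeight (pderiv l Y)) (k : Fin d) (t : ℝ) :
    HasDerivAt (fun s => ∫ x, Y x * currentD k (w s) x)
      ((∑ l, (2 * (∫ x, pderiv l Y x * stressD l k (w t) x) +
        ∫ x, pderiv l (pderiv l Y) x * gradD k (w t) x)) +
        p / (p + 1) * ∫ x, pderiv k Y x * potentialD β (w t) x) t := by
  simp only [integral_mul_density_im hY.memLp]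
  refine (h.hasDerivAt_momentum hβ hd hY hY' k t).congr_deriv ?_
  congr 1
  rw [linearBalance, Finset.sum_comm]
  refine Finset.sum_congr rfl fun l _ => ?_
  rw [integral_mul_density_re (hY.memLp_pderiv l), integral_mul_density_re ((hY' l).memLp_pderiv l),
    Finset.mul_sum, ← Finset.sum_add_distrib]
  refine Finset.sum_congr rfl fun μ _ => ?_
  simp

/-- Integration by parts yields the term Re ∫ Y conj(V) ∂_kV together with its conjugate; their real
parts agree, whence the factor 2. -/
lemma integral_pderiv_mul_re (hS : SobolevBound d (energyExp p)) {Y : Rd d → ℝ} (hY : IsWeight Y)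
    {V : XS d (energyExp p)} (hV : V ∈ WS d (energyExp p)) (k : Fin d) :
    (weightedPairing (pderiv k Y) V.1 V.1).re = -2 * (weightedPairing Y V.1 (V.2.1 k)).re := by
  have h := weightedPairing_grad (q' := energyExp' p) hS hY hV hV k
  rw [weightedPairing_conj_symm hY.memLp (V.2.1 k)] at h
  have h2 := congrArg Complex.re h
  simp only [Complex.sub_re, Complex.neg_re, Complex.conj_re] at h2
  linarith

/-- Integration by parts for the mass density. -/
lemma integral_pderiv_mul_massD (hS : SobolevBound d (energyExp p)) {Y : Rd d → ℝ} (hY : IsWeight Y)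
    {W : Fin N → XS d (energyExp p)} (hW : ∀ μ, W μ ∈ WS d (energyExp p)) (k : Fin d) :
    ∫ x, pderiv k Y x * massD W x = -2 * ∫ x, Y x * gradD k W x := by
  rw [integral_mul_density_re (hY.memLp_pderiv k), integral_mul_density_re hY.memLp, Finset.mul_sum]
  exact Finset.sum_congr rfl fun μ _ => integral_pderiv_mul_re hS hY (hW μ) k

end Balance

section Interact

variable {d : ℕ}

/-- The double integral `∬ K(x-y) A(x) B(y) dx dy`. -/
def interact (K A B : Rd d → ℝ) : ℝ := ∫ z : Rd d × Rd d, K (z.1 - z.2) * (A z.1 * B z.2)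

lemma integrable_interact {K A B : Rd d → ℝ} {C : ℝ} (hK : Continuous K) (hC : ∀ x, |K x| ≤ C)
    (hA : Integrable A) (hB : Integrable B) :
    Integrable fun z : Rd d × Rd d => K (z.1 - z.2) * (A z.1 * B z.2) :=
  (hA.mul_prod hB).bdd_mul (hK.comp (continuous_fst.sub continuous_snd)).aestronglyMeasurable
    (ae_of_all _ fun _ => hC _)

lemma interact_eq_right {K A B : Rd d → ℝ} {C : ℝ} (hK : Continuous K) (hC : ∀ x, |K x| ≤ C)
    (hA : Integrable A) (hB : Integrable B) :
    interact K A B = ∫ x, A x * ∫ y, K (x - y) * B y := by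
  refine (integral_prod _ (integrable_interact hK hC hA hB)).trans ?_
  congr 1; ext x
  rw [← integral_const_mul]
  congr 1; ext y
  ring

lemma interact_eq_left {K A B : Rd d → ℝ} {C : ℝ} (hK : Continuous K) (hC : ∀ x, |K x| ≤ C)
    (hA : Integrable A) (hB : Integrable B) :
    interact K A B = ∫ y, (∫ x, K (x - y) * A x) * B y := by
  refine (integral_prod_symm _ (integrable_interact hK hC hA hB)).trans ?_
  congr 1; ext y
  rw [← integral_mul_const]
  congr 1; ext x
  ring

lemma interact_swap (K A B : Rd d → ℝ) : interact K A B = interact (fun x => K (-x)) B A := by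
  have h := integral_prod_swap (μ := (volume : Measure (Rd d))) (ν := (volume : Measure (Rd d)))
    (fun z : Rd d × Rd d => K (-(z.1 - z.2)) * (B z.1 * A z.2))
  refine Eq.trans ?_ h
  refine integral_congr_ae (ae_of_all _ fun z => ?_)
  simp only [Prod.fst_swap, Prod.snd_swap, neg_sub]
  ring

lemma abs_interact_le {K A B : Rd d → ℝ} {C : ℝ} (hC : ∀ x, |K x| ≤ C)
    (hA : Integrable A) (hB : Integrable B) :
    |interact K A B| ≤ C * ((∫ x, |A x|) * ∫ y, |B y|) := by
  rw [← integral_prod_mul, ← integral_const_mul, ← Real.norm_eq_abs]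
  refine norm_integral_le_of_norm_le ((hA.abs.mul_prod hB.abs).const_mul C) (ae_of_all _ fun z => ?_)
  rw [norm_mul, norm_mul]
  exact mul_le_mul_of_nonneg_right (hC _) (by positivity)

lemma tendsto_interact {K : Rd d → ℝ} {A B : ℝ → Rd d → ℝ} {C : ℝ} (hK : Continuous K)
    (hC : ∀ x, |K x| ≤ C) (hA : ∀ t, Integrable (A t)) (hB : ∀ t, Integrable (B t)) {t₀ : ℝ}
    (hAc : Tendsto (fun t => ∫ x, |A t x - A t₀ x|) (𝓝 t₀) (𝓝 0))
    (hBc : Tendsto (fun t => ∫ x, |B t x - B t₀ x|) (𝓝 t₀) (𝓝 0)) :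
    Tendsto (fun t => interact K (A t) (B t)) (𝓝 t₀) (𝓝 (interact K (A t₀) (B t₀))) := by
  rw [tendsto_iff_norm_sub_tendsto_zero]
  have hC0 : 0 ≤ C := (abs_nonneg _).trans (hC 0)
  refine squeeze_zero (g := fun t => C * ((∫ x, |A t x - A t₀ x|) *
    ((∫ x, |B t x - B t₀ x|) + ∫ x, |B t₀ x|)) +
    C * ((∫ x, |A t₀ x|) * ∫ x, |B t x - B t₀ x|)) (fun _ => norm_nonneg _) (fun t => ?_) ?_
  · have hdA := (hA t).sub (hA t₀)
    have hdB := (hB t).sub (hB t₀)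
    have e : interact K (A t) (B t) - interact K (A t₀) (B t₀) =
        interact K (A t - A t₀) (B t) + interact K (A t₀) (B t - B t₀) := by
      unfold interact
      rw [← integral_sub (integrable_interact hK hC (hA t) (hB t))
        (integrable_interact hK hC (hA t₀) (hB t₀)),
        ← integral_add (integrable_interact hK hC hdA (hB t))
        (integrable_interact hK hC (hA t₀) hdB)]
      congr 1; ext z
      simp only [Pi.sub_apply]; ring
    rw [e]
    refine (abs_add_le _ _).trans (add_le_add ((abs_interact_le hC hdA (hB t)).trans ?_)
      (abs_interact_le hC (hA t₀) hdB))
    refine mul_le_mul_of_nonneg_left (mul_le_mul_of_nonneg_left ?_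
      (integral_nonneg fun x => abs_nonneg _)) hC0
    have hdB' : Integrable fun x => |B t x - B t₀ x| := hdB.abs
    rw [← integral_add hdB' (hB t₀).abs]
    refine integral_mono (hB t).abs (hdB'.add (hB t₀).abs) fun x => ?_
    have := abs_add_le (B t x - B t₀ x) (B t₀ x)
    rwa [sub_add_cancel] at this
  · have h1 := (hAc.mul (hBc.add_const (∫ x, |B t₀ x|))).const_mul C
    have h2 := (hBc.const_mul (∫ x, |A t₀ x|)).const_mul C
    simpa using h1.add h2

lemma abs_slope_le {f f' : ℝ → ℝ} {M ε t₀ : ℝ} (hf : ∀ t, HasDerivAt f (f' t) t)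
    (hM : ∀ t ∈ Set.Icc (t₀ - ε) (t₀ + ε), |f' t| ≤ M) {t : ℝ}
    (ht : t ∈ Set.Icc (t₀ - ε) (t₀ + ε)) (hne : t ≠ t₀) (hε : 0 ≤ ε) : |slope f t₀ t| ≤ M := by
  have h := Convex.norm_image_sub_le_of_norm_hasDerivWithin_le (f := f) (f' := f') (C := M)
    (fun t _ => (hf t).hasDerivWithinAt) (fun t ht => hM t ht) (convex_Icc (t₀ - ε) (t₀ + ε))
    (⟨by linarith, by linarith⟩ : t₀ ∈ Set.Icc (t₀ - ε) (t₀ + ε)) ht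
  rw [slope_def_field, abs_div, div_le_iff₀ (abs_pos.2 (sub_ne_zero.2 hne))]
  exact h

lemma tendsto_integral_slope_mul {f f' : ℝ → Rd d → ℝ} {M ε t₀ : ℝ} (hε : 0 < ε)
    (hf : ∀ y t, HasDerivAt (fun s => f s y) (f' t y) t)
    (hM : ∀ t ∈ Set.Icc (t₀ - ε) (t₀ + ε), ∀ y, |f' t y| ≤ M)
    (hfm : ∀ t, AEStronglyMeasurable (f t) volume) {B : Rd d → ℝ} (hB : Integrable B) :
    Tendsto (fun t => ∫ y, slope (fun s => f s y) t₀ t * B y) (𝓝[≠] t₀)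
      (𝓝 (∫ y, f' t₀ y * B y)) := by
  have hmem : ∀ᶠ t in 𝓝[≠] t₀, t ∈ Set.Icc (t₀ - ε) (t₀ + ε) :=
    nhdsWithin_le_nhds (Icc_mem_nhds (by linarith) (by linarith))
  refine tendsto_integral_filter_of_dominated_convergence (fun y => M * |B y|) ?_ ?_
    (hB.abs.const_mul M) ?_
  · refine Eventually.of_forall fun t => ?_
    simp only [slope_def_field]
    exact ((((hfm t).sub (hfm t₀)).mul_const ((t - t₀)⁻¹)).mul hB.1)
  · filter_upwards [hmem, self_mem_nhdsWithin] with t ht hne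
    refine ae_of_all _ fun y => ?_
    rw [norm_mul]
    exact mul_le_mul_of_nonneg_right (abs_slope_le (hf y) (fun t ht => hM t ht y) ht hne hε.le)
      (abs_nonneg _)
  · exact ae_of_all _ fun y => (hasDerivAt_iff_tendsto_slope.1 (hf y t₀)).mul_const _

/-- Differentiation of an interaction integral. -/
theorem hasDerivAt_interact {K : Rd d → ℝ} {A B α β : ℝ → Rd d → ℝ} {C : ℝ} {b : ℝ → ℝ}
    (hK : Continuous K) (hC : ∀ x, |K x| ≤ C) (hA : ∀ t, Integrable (A t))
    (hB : ∀ t, Integrable (B t)) {t₀ : ℝ}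
    (hAc : Tendsto (fun t => ∫ x, |A t x - A t₀ x|) (𝓝 t₀) (𝓝 0))
    (hα : ∀ y t, HasDerivAt (fun s => ∫ x, K (x - y) * A s x) (α t y) t)
    (hβ : ∀ x t, HasDerivAt (fun s => ∫ y, K (x - y) * B s y) (β t x) t) (hb : Continuous b)
    (hαb : ∀ t y, |α t y| ≤ b t) (hβb : ∀ t x, |β t x| ≤ b t) :
    HasDerivAt (fun t => interact K (A t) (B t))
      ((∫ y, α t₀ y * B t₀ y) + ∫ x, A t₀ x * β t₀ x) t₀ := by
  obtain ⟨M, hM⟩ := ((isCompact_Icc (a := t₀ - 1) (b := t₀ + 1)).image hb).bddAbove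
  have hMb : ∀ t ∈ Set.Icc (t₀ - 1) (t₀ + 1), b t ≤ M := fun t ht => hM ⟨t, ht, rfl⟩
  have hMα : ∀ t ∈ Set.Icc (t₀ - 1) (t₀ + 1), ∀ y, |α t y| ≤ M := fun t ht y =>
    (hαb t y).trans (hMb t ht)
  have hMβ : ∀ t ∈ Set.Icc (t₀ - 1) (t₀ + 1), ∀ y, |β t y| ≤ M := fun t ht y =>
    (hβb t y).trans (hMb t ht)
  have hKm : AEStronglyMeasurable (fun z : Rd d × Rd d => K (z.1 - z.2)) (volume.prod volume) :=
    (hK.comp (continuous_fst.sub continuous_snd)).aestronglyMeasurable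
  have hbm : ∀ t, AEStronglyMeasurable (fun x => ∫ y, K (x - y) * B t y) volume := fun t =>
    (hKm.mul ((hB t).1.comp_snd)).integral_prod_right'
  have ham : ∀ t, AEStronglyMeasurable (fun y => ∫ x, K (x - y) * A t x) volume := fun t => by
    have h1 : AEStronglyMeasurable (fun z : Rd d × Rd d => K (z.2 - z.1) * A t z.2)
        (volume.prod volume) :=
      (hK.comp (continuous_snd.sub continuous_fst)).aestronglyMeasurable.mul ((hA t).1.comp_snd)
    exact h1.integral_prod_right'
  -- The difference quotient is split: A varies with B frozen at t₀, then B varies with A taken at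
  -- time t. In both parts the kernel integral in one variable is differentiable for each value of
  -- the other, with bounded slopes.
  have T1 := tendsto_integral_slope_mul (f := fun t y => ∫ x, K (x - y) * A t x) one_pos hα hMα ham
    (hB t₀)
  have T2 := tendsto_integral_slope_mul (f := fun t x => ∫ y, K (x - y) * B t y) one_pos hβ hMβ hbm
    (hA t₀)
  have hmem : ∀ᶠ t in 𝓝[≠] t₀, t ∈ Set.Icc (t₀ - 1) (t₀ + 1) :=
    nhdsWithin_le_nhds (Icc_mem_nhds (by linarith) (by linarith))
  have hsl : ∀ t ∈ Set.Icc (t₀ - 1) (t₀ + 1), t ≠ t₀ → ∀ x,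
      |slope (fun s => ∫ y, K (x - y) * B s y) t₀ t| ≤ M := fun t ht hne x =>
    abs_slope_le (hβ x) (fun t ht => hMβ t ht x) ht hne zero_le_one
  have hslm : ∀ t, AEStronglyMeasurable
      (fun x => slope (fun s => ∫ y, K (x - y) * B s y) t₀ t) volume := fun t => by
    simp only [slope_def_field]
    exact ((hbm t).sub (hbm t₀)).mul_const ((t - t₀)⁻¹)
  have hsli : ∀ t ∈ Set.Icc (t₀ - 1) (t₀ + 1), t ≠ t₀ → ∀ {G : Rd d → ℝ}, Integrable G →
      Integrable fun x => slope (fun s => ∫ y, K (x - y) * B s y) t₀ t * G x :=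
    fun t ht hne G hG => hG.bdd_mul (hslm t) (ae_of_all _ fun x => hsl t ht hne x)
  -- Replacing A(t) by A(t₀) in the second part is harmless: the slopes are bounded by M and A is
  -- continuous in L¹.
  have T3 : Tendsto (fun t => ∫ x, slope (fun s => ∫ y, K (x - y) * B s y) t₀ t *
      (A t x - A t₀ x)) (𝓝[≠] t₀) (𝓝 0) := by
    refine squeeze_zero_norm' (a := fun t => M * ∫ x, |A t x - A t₀ x|) ?_ ?_
    · filter_upwards [hmem, self_mem_nhdsWithin] with t ht hne
      exact abs_integral_mul_le (hsl t ht hne) ((hA t).sub (hA t₀))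
    · simpa using (hAc.mono_left nhdsWithin_le_nhds).const_mul M
  rw [hasDerivAt_iff_tendsto_slope]
  have T := T1.add (T2.add T3)
  rw [add_zero] at T
  simp only [mul_comm (β t₀ _)] at T
  refine T.congr' ?_
  filter_upwards [hmem, self_mem_nhdsWithin] with t ht hne
  have hne' : t - t₀ ≠ 0 := sub_ne_zero.2 hne
  have i2 : Integrable fun x => slope (fun s => ∫ y, K (x - y) * B s y) t₀ t * (A t x - A t₀ x) :=
    hsli t ht hne ((hA t).sub (hA t₀))
  rw [← integral_add (hsli t ht hne (hA t₀)) i2]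
  have e1 : ∫ y, slope (fun s => ∫ x, K (x - y) * A s x) t₀ t * B t₀ y =
      (t - t₀)⁻¹ * (interact K (A t) (B t₀) - interact K (A t₀) (B t₀)) := by
    rw [interact_eq_left hK hC (hA t) (hB t₀), interact_eq_left hK hC (hA t₀) (hB t₀),
      ← integral_sub, ← integral_const_mul]
    · congr 1; ext y; rw [slope_def_field]; ring
    · have := (integrable_interact hK hC (hA t) (hB t₀)).integral_prod_right
      refine this.congr (ae_of_all _ fun y => ?_)
      simp only [← mul_assoc]
      exact integral_mul_const _ _
    · have := (integrable_interact hK hC (hA t₀) (hB t₀)).integral_prod_right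
      refine this.congr (ae_of_all _ fun y => ?_)
      simp only [← mul_assoc]
      exact integral_mul_const _ _
  have e2 : ∫ x, (slope (fun s => ∫ y, K (x - y) * B s y) t₀ t * A t₀ x +
      slope (fun s => ∫ y, K (x - y) * B s y) t₀ t * (A t x - A t₀ x)) =
      (t - t₀)⁻¹ * (interact K (A t) (B t) - interact K (A t) (B t₀)) := by
    rw [interact_eq_right hK hC (hA t) (hB t), interact_eq_right hK hC (hA t) (hB t₀),
      ← integral_sub, ← integral_const_mul]
    · congr 1; ext y; rw [slope_def_field]; ring
    · have := (integrable_interact hK hC (hA t) (hB t)).integral_prod_left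
      refine this.congr (ae_of_all _ fun x => ?_)
      simp only [mul_left_comm (K _)]
      exact integral_const_mul _ _
    · have := (integrable_interact hK hC (hA t) (hB t₀)).integral_prod_left
      refine this.congr (ae_of_all _ fun x => ?_)
      simp only [mul_left_comm (K _)]
      exact integral_const_mul _ _
  rw [e1, e2, slope_def_field]
  ring

end Interact

end InteractionMorawetz

end

/-! ### The derivative of the interaction current -/

noncomputable section
open MeasureTheory Filter Topology
open scoped ContDiff ENNReal SchwartzMap FourierTransform RealInnerProductSpace Laplacian LineDeriv
namespace InteractionMorawetz

section L1Continuity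

variable {d : ℕ}

/-- `A` is a continuous curve in `L¹`. -/
structure L1Continuous (A : ℝ → Rd d → ℝ) : Prop where
  integrable : ∀ t, Integrable (A t)
  tendsto : ∀ t₀, Tendsto (fun t => ∫ x, |A t x - A t₀ x|) (𝓝 t₀) (𝓝 0)

lemma L1Continuous.continuous_norm {A : ℝ → Rd d → ℝ} (h : L1Continuous A) :
    Continuous fun t => ∫ x, |A t x| := by
  refine continuous_iff_continuousAt.2 fun t₀ => ?_
  rw [ContinuousAt, tendsto_iff_norm_sub_tendsto_zero]
  refine squeeze_zero (fun _ => norm_nonneg _) (fun t => ?_) (h.tendsto t₀)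
  rw [← integral_sub (h.integrable t).abs (h.integrable t₀).abs]
  refine norm_integral_le_of_norm_le ((h.integrable t).sub (h.integrable t₀)).abs
    (ae_of_all _ fun x => ?_)
  exact abs_abs_sub_abs_le_abs_sub _ _

lemma L1Continuous.interact {K : Rd d → ℝ} {A B : ℝ → Rd d → ℝ} {C : ℝ} (hK : Continuous K)
    (hC : ∀ x, |K x| ≤ C) (hA : L1Continuous A) (hB : L1Continuous B) :
    Continuous fun t => interact K (A t) (B t) :=
  continuous_iff_continuousAt.2 fun t₀ => tendsto_interact hK hC hA.integrable hB.integrable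
    (hA.tendsto t₀) (hB.tendsto t₀)

variable {N : ℕ} {p : ℝ}

lemma l1Continuous_density (T : ℂ →L[ℝ] ℝ) {a b : ℝ → Fin N → LL d 2} (ha : Continuous a)
    (hb : Continuous b) : L1Continuous fun t => density T (a t) (b t) :=
  ⟨fun _ => integrable_density T _ _, fun t₀ => tendsto_density T ha hb t₀⟩

variable [hp : Fact (1 ≤ p)] {w : ℝ → Fin N → XS d (energyExp p)}

lemma continuous_tuple_fst (hw : Continuous w) : Continuous fun t => fun μ => (w t μ).1 :=
  continuous_pi fun μ => continuous_fst.comp ((continuous_apply μ).comp hw)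

lemma continuous_tuple_grad (hw : Continuous w) (k : Fin d) :
    Continuous fun t => fun μ => (w t μ).2.1 k :=
  continuous_pi fun μ => (continuous_apply k).comp (continuous_fst.comp (continuous_snd.comp
    ((continuous_apply μ).comp hw)))

lemma l1Continuous_massD (hw : Continuous w) : L1Continuous fun t => massD (w t) :=
  l1Continuous_density _ (continuous_tuple_fst hw) (continuous_tuple_fst hw)

lemma l1Continuous_currentD (hw : Continuous w) (k : Fin d) :
    L1Continuous fun t => currentD k (w t) :=
  l1Continuous_density _ (continuous_tuple_fst hw) (continuous_tuple_grad hw k)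

lemma l1Continuous_gradD (hw : Continuous w) (k : Fin d) : L1Continuous fun t => gradD k (w t) :=
  l1Continuous_density _ (continuous_tuple_fst hw) (continuous_tuple_grad hw k)

lemma l1Continuous_stressD (hw : Continuous w) (l k : Fin d) :
    L1Continuous fun t => stressD l k (w t) :=
  l1Continuous_density _ (continuous_tuple_grad hw l) (continuous_tuple_grad hw k)

lemma l1Continuous_potentialD {β : Fin N → Fin N → ℝ} (hβ : ∀ μ ν, β μ ν = β ν μ)
    (hw : Continuous w) : L1Continuous fun t => potentialD β (w t) := by
  have h1p := hp.out
  refine ⟨fun t => integrable_potential hβ _, fun t₀ => ?_⟩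
  have hwe : Continuous fun t => energyPart (w t) := continuous_energyPart.comp hw
  refine squeeze_zero (g := fun t => 2 * (p + 1) * nonlinConst p β *
    ((normSum (energyPart (w t₀)) + normSum (energyPart (w t))) ^ (2 * p) *
      (normSum (energyPart (w t₀)) + normSum (energyPart (w t))) *
      normSum (energyPart (w t) - energyPart (w t₀))))
    (fun t => integral_nonneg fun x => abs_nonneg _)
    (fun t => integral_abs_potential_sub_le hβ (energyPart (w t₀)) (energyPart (w t))) ?_
  have hs : Continuous fun t => normSum (energyPart (w t₀)) + normSum (energyPart (w t)) :=
    continuous_const.add (continuous_normSum.comp hwe)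
  have hd : Continuous fun t => normSum (energyPart (w t) - energyPart (w t₀)) :=
    continuous_normSum.comp (hwe.sub continuous_const)
  have hc : Continuous fun t => 2 * (p + 1) * nonlinConst p β *
      ((normSum (energyPart (w t₀)) + normSum (energyPart (w t))) ^ (2 * p) *
      (normSum (energyPart (w t₀)) + normSum (energyPart (w t))) *
      normSum (energyPart (w t) - energyPart (w t₀))) := continuous_const.mul
    (((hs.rpow_const fun _ => Or.inr (show 0 ≤ 2 * p by linarith)).mul hs).mul hd)
  have := hc.tendsto t₀
  simpa [normSum] using this

end L1Continuity

section Rate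

variable {d N : ℕ} {p : ℝ} [hp : Fact (1 ≤ p)]

/-- The time derivative of `∑_k ∬ K_k(x-y) J_k(x) m(y)`, for one value of `k`. -/
def currentRate (β : Fin N → Fin N → ℝ) (K : Rd d → ℝ) (k : Fin d) (W : Fin N → XS d (energyExp p)) :
    ℝ :=
  ((∑ l, (2 * interact (pderiv l K) (stressD l k W) (massD W) +
    interact (pderiv l (pderiv l K)) (gradD k W) (massD W))) +
    p / (p + 1) * interact (pderiv k K) (potentialD β W) (massD W)) -
    2 * ∑ l, interact (pderiv l K) (currentD k W) (currentD l W)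

/-- For frozen y the momentum balance is applied with weight K(· - y), for frozen x mass
conservation with weight K(x - ·). The minus sign before the product of currents comes from
differentiating K(x - y) in y. All derivatives are bounded uniformly in the frozen variable by L¹
norms that are continuous in time. -/
theorem SolvesSystem.hasDerivAt_interact_current {β : Fin N → Fin N → ℝ}
    (hβ : ∀ μ ν, β μ ν = β ν μ) {w : ℝ → Fin N → XS d (energyExp p)} (h : SolvesSystem β w)
    (hd : (d : ℝ) < (2 * p + 2) / p) {K : Rd d → ℝ} (hK : SmoothBdd 3 K) (k : Fin d) (t : ℝ) :
    HasDerivAt (fun s => interact K (currentD k (w s)) (massD (w s))) (currentRate β K k (w t)) t := by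
  have h1p := hp.out
  have hw := h.continuous
  obtain ⟨C, hC⟩ := hK.exists_bound
  have hK1 : ∀ l, SmoothBdd 2 (pderiv l K) := fun l => hK.pderiv l
  have hK2 : ∀ l, SmoothBdd 1 (pderiv l (pderiv l K)) := fun l => (hK1 l).pderiv l
  choose C₁ hC₁ using fun l => (hK1 l).exists_bound
  choose C₂ hC₂ using fun l => (hK2 l).exists_bound
  have hm := l1Continuous_massD hw
  have hJ := fun l => l1Continuous_currentD hw l
  have hR := l1Continuous_gradD hw k
  have hS := fun l => l1Continuous_stressD hw l k
  have hG := l1Continuous_potentialD hβ hw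
  obtain ⟨α, hα⟩ : ∃ α : ℝ → Rd d → ℝ, ∀ t y, α t y =
      (∑ l, (2 * (∫ x, pderiv l K (x - y) * stressD l k (w t) x) +
        ∫ x, pderiv l (pderiv l K) (x - y) * gradD k (w t) x)) +
        p / (p + 1) * ∫ x, pderiv k K (x - y) * potentialD β (w t) x := ⟨_, fun _ _ => rfl⟩
  obtain ⟨γ, hγ⟩ : ∃ γ : ℝ → Rd d → ℝ, ∀ t x, γ t x =
      -(2 * ∑ l, ∫ y, pderiv l K (x - y) * currentD l (w t) y) := ⟨_, fun _ _ => rfl⟩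
  have hpp : 0 ≤ p / (p + 1) := by positivity
  have key := hasDerivAt_interact (K := K) (A := fun t => currentD k (w t)) (B := fun t => massD (w t))
    (α := α) (β := γ) (C := C) (t₀ := t)
    (b := fun t => ((∑ l, (2 * (C₁ l * ∫ x, |stressD l k (w t) x|) +
      C₂ l * ∫ x, |gradD k (w t) x|)) + p / (p + 1) * (C₁ k * ∫ x, |potentialD β (w t) x|)) +
      2 * ∑ l, C₁ l * ∫ x, |currentD l (w t) x|) hK.continuous hC (hJ k).integrable hm.integrable
    ((hJ k).tendsto t) ?_ ?_ ?_ ?_ ?_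
  · refine key.congr_deriv ?_
    rw [currentRate, sub_eq_add_neg]
    have i1 : ∀ l, Integrable fun y => (∫ x, pderiv l K (x - y) * stressD l k (w t) x) * massD (w t) y :=
      fun l => by
        refine (integrable_interact (hK1 l).continuous (hC₁ l) ((hS l).integrable t)
          (hm.integrable t)).integral_prod_right.congr (ae_of_all _ fun y => ?_)
        simp only [← mul_assoc]
        exact integral_mul_const _ _
    have i2 : ∀ l, Integrable fun y => (∫ x, pderiv l (pderiv l K) (x - y) * gradD k (w t) x) *
        massD (w t) y := fun l => by
        refine (integrable_interact (hK2 l).continuous (hC₂ l) (hR.integrable t)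
          (hm.integrable t)).integral_prod_right.congr (ae_of_all _ fun y => ?_)
        simp only [← mul_assoc]
        exact integral_mul_const _ _
    have i3 : Integrable fun y => (∫ x, pderiv k K (x - y) * potentialD β (w t) x) * massD (w t) y := by
        refine (integrable_interact (hK1 k).continuous (hC₁ k) (hG.integrable t)
          (hm.integrable t)).integral_prod_right.congr (ae_of_all _ fun y => ?_)
        simp only [← mul_assoc]
        exact integral_mul_const _ _
    have i4 : ∀ l, Integrable fun x => currentD k (w t) x *
        ∫ y, pderiv l K (x - y) * currentD l (w t) y := fun l => by
        refine (integrable_interact (hK1 l).continuous (hC₁ l) ((hJ k).integrable t)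
          ((hJ l).integrable t)).integral_prod_left.congr (ae_of_all _ fun x => ?_)
        simp only [mul_left_comm (pderiv l K _)]
        exact integral_const_mul _ _
    congr 1
    -- Fubini with the mass as outer factor: the inner integrals then add up to the derivative `α`
    -- of the momentum, tested in x.
    · simp only [fun l => interact_eq_left (hK1 l).continuous (hC₁ l) ((hS l).integrable t)
        (hm.integrable t), fun l => interact_eq_left (hK2 l).continuous (hC₂ l) (hR.integrable t)
        (hm.integrable t), interact_eq_left (hK1 k).continuous (hC₁ k) (hG.integrable t)
        (hm.integrable t), ← integral_const_mul]
      have i5 : ∀ l, Integrable fun y => 2 * ((∫ x, pderiv l K (x - y) * stressD l k (w t) x) *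
          massD (w t) y) := fun l => (i1 l).const_mul 2
      have i6 : ∀ l, Integrable fun y => 2 * ((∫ x, pderiv l K (x - y) * stressD l k (w t) x) *
          massD (w t) y) + (∫ x, pderiv l (pderiv l K) (x - y) * gradD k (w t) x) *
        massD (w t) y := fun l => (i5 l).add (i2 l)
      have i7 := i3.const_mul (p / (p + 1))
      simp only [fun l => (integral_add (i5 l) (i2 l)).symm]
      rw [← integral_finsetSum _ fun l _ => i6 l, ← integral_add (integrable_finsetSum _ fun l _ => i6 l) i7]
      congr 1; ext y
      rw [hα, add_mul, Finset.sum_mul]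
      congr 1
      · exact Finset.sum_congr rfl fun l _ => by ring
      · ring
    · simp only [fun l => interact_eq_right (hK1 l).continuous (hC₁ l) ((hJ k).integrable t)
        ((hJ l).integrable t)]
      rw [← integral_finsetSum _ fun l _ => i4 l, ← integral_const_mul, ← integral_neg]
      congr 1; ext x
      rw [hγ, ← Finset.mul_sum]
      ring
  · intro y s
    rw [hα]
    have hY : IsWeight fun x => K (x - y) := (hK.isWeight).comp_sub y
    have hY' : ∀ l, IsWeight (pderiv l fun x => K (x - y)) := fun l => by
      rw [pderiv_comp_sub]; exact ((hK1 l).isWeight).comp_sub y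
    have := h.hasDerivAt_currentD hβ hd hY hY' k s
    simpa only [pderiv_comp_sub] using this
  · intro x s
    rw [hγ]
    have hY : IsWeight fun y => K (x - y) := (hK.isWeight).const_sub x
    refine (h.hasDerivAt_massD hd hY s).congr_deriv ?_
    simp only [pderiv_const_sub, neg_mul, integral_neg, Finset.sum_neg_distrib, mul_neg]
  · refine Continuous.add (Continuous.add (continuous_finsetSum _ fun l _ => ?_) ?_) ?_
    · exact (continuous_const.mul (continuous_const.mul (hS l).continuous_norm)).add
        (continuous_const.mul hR.continuous_norm)
    · exact continuous_const.mul (continuous_const.mul hG.continuous_norm)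
    · exact continuous_const.mul (continuous_finsetSum _ fun l _ =>
        continuous_const.mul (hJ l).continuous_norm)
  · intro s y
    rw [hα]
    have h0 : 0 ≤ 2 * ∑ l, C₁ l * ∫ x, |currentD l (w s) x| :=
      mul_nonneg zero_le_two (Finset.sum_nonneg fun l _ => mul_nonneg
        ((abs_nonneg _).trans (hC₁ l 0)) (integral_nonneg fun x => abs_nonneg _))
    refine le_trans ?_ (le_add_of_nonneg_right h0)
    refine (abs_add_le _ _).trans (add_le_add ((Finset.abs_sum_le_sum_abs _ _).trans
      (Finset.sum_le_sum fun l _ => (abs_add_le _ _).trans (add_le_add ?_ ?_))) ?_)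
    · rw [abs_mul, abs_two]
      exact mul_le_mul_of_nonneg_left (abs_integral_mul_le (fun x => hC₁ l _) ((hS l).integrable s))
        zero_le_two
    · exact abs_integral_mul_le (fun x => hC₂ l _) (hR.integrable s)
    · rw [abs_mul, abs_of_nonneg hpp]
      exact mul_le_mul_of_nonneg_left (abs_integral_mul_le (fun x => hC₁ k _) (hG.integrable s)) hpp
  · intro s x
    rw [hγ, abs_neg, abs_mul, abs_two]
    have h0 : 0 ≤ (∑ l, (2 * (C₁ l * ∫ x, |stressD l k (w s) x|) +
      C₂ l * ∫ x, |gradD k (w s) x|)) + p / (p + 1) * (C₁ k * ∫ x, |potentialD β (w s) x|) := by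
      have e1 : ∀ l, 0 ≤ C₁ l := fun l => (abs_nonneg _).trans (hC₁ l 0)
      have e2 : ∀ l, 0 ≤ C₂ l := fun l => (abs_nonneg _).trans (hC₂ l 0)
      have e3 : ∀ f : Rd d → ℝ, 0 ≤ ∫ x, |f x| := fun f => integral_nonneg fun x => abs_nonneg _
      exact add_nonneg (Finset.sum_nonneg fun l _ => add_nonneg
        (mul_nonneg zero_le_two (mul_nonneg (e1 l) (e3 _))) (mul_nonneg (e2 l) (e3 _)))
        (mul_nonneg hpp (mul_nonneg (e1 k) (e3 _)))
    refine le_trans ?_ (le_add_of_nonneg_left h0)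
    refine mul_le_mul_of_nonneg_left ((Finset.abs_sum_le_sum_abs _ _).trans
      (Finset.sum_le_sum fun l _ => ?_)) zero_le_two
    exact abs_integral_mul_le (fun y => hC₁ l _) ((hJ l).integrable s)

end Rate

end InteractionMorawetz

end

/-! ### Positivity of the Hessian term and the two lower bounds -/

noncomputable section
open MeasureTheory Filter Topology
open scoped ContDiff ENNReal SchwartzMap FourierTransform RealInnerProductSpace Laplacian LineDeriv
namespace InteractionMorawetz

section Pointwise

variable {d : ℕ} {H : Fin d → Fin d → ℝ}

/-- Real and imaginary parts contribute separately, since Re(conj(c_l) c_k) is the sum of the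
products of the real parts and of the imaginary parts. -/
lemma hermitian_form_nonneg (hpos : ∀ v : Fin d → ℝ, 0 ≤ ∑ k, ∑ l, H k l * (v k * v l))
    (c : Fin d → ℂ) : 0 ≤ ∑ k, ∑ l, H k l * ((starRingEnd ℂ) (c l) * c k).re := by
  refine (add_nonneg (hpos fun k => (c k).re) (hpos fun k => (c k).im)).trans_eq ?_
  rw [← Finset.sum_add_distrib]
  refine Finset.sum_congr rfl fun k _ => ?_
  rw [← Finset.sum_add_distrib]
  refine Finset.sum_congr rfl fun l _ => ?_
  simp only [Complex.mul_re, Complex.conj_re, Complex.conj_im]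
  ring

/-- The pointwise inequality behind the positivity of the interaction of stresses and currents. -/
lemma interaction_form_nonneg (hsymm : ∀ k l, H k l = H l k)
    (hpos : ∀ v : Fin d → ℝ, 0 ≤ ∑ k, ∑ l, H k l * (v k * v l)) (a b : ℂ) (A B : Fin d → ℂ) :
    0 ≤ ∑ k, ∑ l, H k l * (((starRingEnd ℂ) (A l) * A k).re * ((starRingEnd ℂ) b * b).re +
      ((starRingEnd ℂ) a * a).re * ((starRingEnd ℂ) (B l) * B k).re -
      2 * (((starRingEnd ℂ) a * A k).im * ((starRingEnd ℂ) b * B l).im)) := by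
  -- Half the sum of the Hermitian forms at b̄A + aB̄ and at bA - aB. In the sum, the real cross
  -- terms combine into the product of the currents Im(āA) and Im(b̄B), symmetrized in k and l; the
  -- symmetry of H removes the symmetrization.
  have h1 := hermitian_form_nonneg hpos fun k => (starRingEnd ℂ) b * A k + a * (starRingEnd ℂ) (B k)
  have h2 := hermitian_form_nonneg hpos fun k => b * A k - a * B k
  have h3 : ∑ k, ∑ l, H k l * (((starRingEnd ℂ) a * A k).im * ((starRingEnd ℂ) b * B l).im) =
      ∑ k, ∑ l, H k l * (((starRingEnd ℂ) a * A l).im * ((starRingEnd ℂ) b * B k).im) := by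
    rw [Finset.sum_comm]
    exact Finset.sum_congr rfl fun k _ => Finset.sum_congr rfl fun l _ => by rw [hsymm l k]
  have h4 : ∑ k, ∑ l, H k l * (((starRingEnd ℂ) (A l) * A k).re * ((starRingEnd ℂ) b * b).re +
      ((starRingEnd ℂ) a * a).re * ((starRingEnd ℂ) (B l) * B k).re -
      2 * (((starRingEnd ℂ) a * A k).im * ((starRingEnd ℂ) b * B l).im)) =
      1 / 2 * ((∑ k, ∑ l, H k l * ((starRingEnd ℂ) ((starRingEnd ℂ) b * A l +
        a * (starRingEnd ℂ) (B l)) * ((starRingEnd ℂ) b * A k + a * (starRingEnd ℂ) (B k))).re) +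
      ∑ k, ∑ l, H k l * ((starRingEnd ℂ) (b * A l - a * B l) * (b * A k - a * B k)).re) -
      ((∑ k, ∑ l, H k l * (((starRingEnd ℂ) a * A k).im * ((starRingEnd ℂ) b * B l).im)) -
      ∑ k, ∑ l, H k l * (((starRingEnd ℂ) a * A l).im * ((starRingEnd ℂ) b * B k).im)) := by
    simp only [← Finset.sum_add_distrib, ← Finset.sum_sub_distrib, Finset.mul_sum]
    refine Finset.sum_congr rfl fun k _ => Finset.sum_congr rfl fun l _ => ?_
    simp only [map_mul, map_add, map_sub, Complex.conj_conj, Complex.mul_re, Complex.mul_im,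
      Complex.add_re, Complex.add_im, Complex.sub_re, Complex.sub_im, Complex.conj_re, Complex.conj_im]
    ring
  rw [h4, h3, sub_self, sub_zero]
  linarith

end Pointwise

section Bounds

variable {d N : ℕ} {p : ℝ}

/-- Positivity of the interaction of stresses and currents. -/
lemma interact_stress_current_nonneg {H : Fin d → Fin d → Rd d → ℝ} {C : Fin d → Fin d → ℝ}
    (hc : ∀ k l, Continuous (H k l)) (hC : ∀ k l x, |H k l x| ≤ C k l)
    (heven : ∀ k l x, H k l (-x) = H k l x) (hsymm : ∀ k l x, H k l x = H l k x)
    (hpos : ∀ x, ∀ v : Fin d → ℝ, 0 ≤ ∑ k, ∑ l, H k l x * (v k * v l))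
    (W : Fin N → XS d (energyExp p)) :
    0 ≤ ∑ k, ∑ l, (interact (H k l) (stressD l k W) (massD W) -
      interact (H k l) (currentD k W) (currentD l W)) := by
  have iS : ∀ l k : Fin d, Integrable (stressD l k W) := fun l k => integrable_density _ _ _
  have im : Integrable (massD W) := integrable_density _ _ _
  have iJ : ∀ k : Fin d, Integrable (currentD k W) := fun k => integrable_density _ _ _
  have i1 := fun k l => integrable_interact (hc k l) (hC k l) (iS l k) im
  have i2 := fun k l => integrable_interact (hc k l) (hC k l) im (iS l k)
  have i3 := fun k l => integrable_interact (hc k l) (hC k l) (iJ k) (iJ l)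
  have hsw : ∀ k l, interact (H k l) (stressD l k W) (massD W) =
      interact (H k l) (massD W) (stressD l k W) := fun k l => by
    rw [interact_swap]
    simp only [heven]
  -- The kernel is even, so the stress may be placed at x or at y. Averaging both produces the
  -- integrand that is nonnegative pointwise.
  have e : 2 * ∑ k, ∑ l, (interact (H k l) (stressD l k W) (massD W) -
      interact (H k l) (currentD k W) (currentD l W)) =
      ∫ z : Rd d × Rd d, ∑ k, ∑ l, H k l (z.1 - z.2) * (stressD l k W z.1 * massD W z.2 +
        massD W z.1 * stressD l k W z.2 - 2 * (currentD k W z.1 * currentD l W z.2)) := by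
    have i4 : ∀ k l, Integrable fun z : Rd d × Rd d =>
        H k l (z.1 - z.2) * (stressD l k W z.1 * massD W z.2 +
        massD W z.1 * stressD l k W z.2 - 2 * (currentD k W z.1 * currentD l W z.2)) := fun k l => by
      refine (((i1 k l).add (i2 k l)).sub ((i3 k l).const_mul 2)).congr (ae_of_all _ fun z => ?_)
      simp only [Pi.sub_apply, Pi.add_apply]
      ring
    rw [integral_finsetSum _ fun k _ => integrable_finsetSum _ fun l _ => i4 k l, Finset.mul_sum]
    refine Finset.sum_congr rfl fun k _ => ?_
    rw [integral_finsetSum _ fun l _ => i4 k l, Finset.mul_sum]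
    refine Finset.sum_congr rfl fun l _ => ?_
    have e1 : 2 * (interact (H k l) (stressD l k W) (massD W) -
        interact (H k l) (currentD k W) (currentD l W)) =
        interact (H k l) (stressD l k W) (massD W) + interact (H k l) (massD W) (stressD l k W) -
        2 * interact (H k l) (currentD k W) (currentD l W) := by
      rw [← hsw]; ring
    rw [e1]
    unfold interact
    have i12 : Integrable fun z : Rd d × Rd d =>
        H k l (z.1 - z.2) * (stressD l k W z.1 * massD W z.2) +
        H k l (z.1 - z.2) * (massD W z.1 * stressD l k W z.2) := (i1 k l).add (i2 k l)
    rw [← integral_add (i1 k l) (i2 k l), ← integral_const_mul,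
      ← integral_sub i12 ((i3 k l).const_mul 2)]
    congr 1; ext z
    ring
  have hnn : 0 ≤ ∫ z : Rd d × Rd d, ∑ k, ∑ l, H k l (z.1 - z.2) * (stressD l k W z.1 * massD W z.2 +
        massD W z.1 * stressD l k W z.2 - 2 * (currentD k W z.1 * currentD l W z.2)) := by
    refine integral_nonneg fun z => ?_
    -- The densities are sums over components; the inequality is used for each pair (μ, κ), with the
    -- first component at x and the second at y.
    have h : ∀ μ κ : Fin N, _ := fun μ κ => interaction_form_nonneg
      (H := fun k l => H k l (z.1 - z.2)) (fun k l => hsymm k l _) (hpos _) ((W μ).1 z.1) ((W κ).1 z.2)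
      (fun k => (W μ).2.1 k z.1) (fun k => (W κ).2.1 k z.2)
    refine (Finset.sum_nonneg fun μ (_ : μ ∈ Finset.univ) => Finset.sum_nonneg
      fun κ (_ : κ ∈ Finset.univ) => h μ κ).trans_eq ?_
    rw [Finset.sum_congr rfl fun μ _ => Finset.sum_comm, Finset.sum_comm]
    refine Finset.sum_congr rfl fun k _ => ?_
    rw [Finset.sum_congr rfl fun μ _ => Finset.sum_comm, Finset.sum_comm]
    refine Finset.sum_congr rfl fun l _ => ?_
    simp only [massD, currentD, stressD, density, Complex.reCLM_apply, Complex.imCLM_apply]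
    rw [Finset.sum_mul_sum, Finset.sum_mul_sum, Finset.sum_mul_sum]
    simp only [Finset.mul_sum, ← Finset.sum_add_distrib, ← Finset.sum_sub_distrib]
  linarith

variable [hp : Fact (1 ≤ p)]

/-- Integration by parts in y for fixed x: the sign from K(x - y) cancels the sign of the
integration by parts, and `gradD` is half the gradient of the mass. -/
lemma interact_pderiv_right (hS : SobolevBound d (energyExp p)) {K : Rd d → ℝ} (hK : SmoothBdd 1 K)
    (k : Fin d) {A : Rd d → ℝ} (hA : Integrable A) {W : Fin N → XS d (energyExp p)}
    (hW : ∀ μ, W μ ∈ WS d (energyExp p)) :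
    interact (pderiv k K) A (massD W) = 2 * interact K A (gradD k W) := by
  obtain ⟨C, hC⟩ := hK.exists_bound
  obtain ⟨C', hC'⟩ := (hK.pderiv k).exists_bound
  rw [interact_eq_right (hK.pderiv k).continuous hC' hA (integrable_density _ _ _),
    interact_eq_right hK.continuous hC hA (integrable_density _ _ _), ← integral_const_mul]
  congr 1; ext x
  have h := integral_pderiv_mul_massD hS (hK.isWeight.const_sub x) hW k
  rw [pderiv_const_sub] at h
  simp only [neg_mul, integral_neg] at h
  rw [neg_inj] at h
  rw [h]; ring

lemma interact_pderiv_left (hS : SobolevBound d (energyExp p)) {K : Rd d → ℝ} (hK : SmoothBdd 1 K)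
    (k : Fin d) {B : Rd d → ℝ} (hB : Integrable B) {W : Fin N → XS d (energyExp p)}
    (hW : ∀ μ, W μ ∈ WS d (energyExp p)) :
    interact (pderiv k K) (massD W) B = -2 * interact K (gradD k W) B := by
  obtain ⟨C, hC⟩ := hK.exists_bound
  obtain ⟨C', hC'⟩ := (hK.pderiv k).exists_bound
  rw [interact_eq_left (hK.pderiv k).continuous hC' (integrable_density _ _ _) hB,
    interact_eq_left hK.continuous hC (integrable_density _ _ _) hB, ← integral_const_mul]
  congr 1; ext y
  have h := integral_pderiv_mul_massD hS (hK.isWeight.comp_sub y) hW k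
  rw [pderiv_comp_sub] at h
  rw [h]; ring

/-- The time derivative of the interaction current. -/
def morawetzRate (β : Fin N → Fin N → ℝ) (Φ : Rd d → ℝ) (W : Fin N → XS d (energyExp p)) : ℝ :=
  4 * ∑ k, currentRate β (pderiv k Φ) k W

/-- The rate is the left-hand side plus eight times the Hessian form of stresses and currents, which
is nonnegative by convexity and is dropped. -/
lemma le_morawetzRate {p : ℝ} {β : Fin N → Fin N → ℝ} {Φ : Rd d → ℝ} (hΦ : ContDiff ℝ 4 Φ)
    (hb : ∀ k, SmoothBdd 3 (pderiv k Φ)) (heven : ∀ x, Φ (-x) = Φ x)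
    (hpos : ∀ x, ∀ v : Rd d, 0 ≤ ∑ k, ∑ l, pderiv l (pderiv k Φ) x * (v k * v l))
    (W : Fin N → XS d (energyExp p)) :
    4 * (∑ k, ∑ l, interact (pderiv l (pderiv l (pderiv k Φ))) (gradD k W) (massD W)) +
      4 * p / (p + 1) * ∑ k, interact (pderiv k (pderiv k Φ)) (potentialD β W) (massD W) ≤
      morawetzRate β Φ W := by
  choose C hC using fun k l => ((hb k).pderiv l).exists_bound
  have h := interact_stress_current_nonneg (H := fun k l => pderiv l (pderiv k Φ)) (C := C)
    (fun k l => ((hb k).pderiv l).continuous) hC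
    (fun k l x => pderiv_neg_of_odd (pderiv_neg_of_even heven k) l x)
    (fun k l x => pderiv_comm (hΦ.of_le (by norm_num)) l k x)
    (fun x v => by simpa using hpos x (WithLp.toLp 2 v)) W
  have e : morawetzRate β Φ W =
      4 * (∑ k, ∑ l, interact (pderiv l (pderiv l (pderiv k Φ))) (gradD k W) (massD W)) +
      4 * p / (p + 1) * (∑ k, interact (pderiv k (pderiv k Φ)) (potentialD β W) (massD W)) +
      8 * ∑ k, ∑ l, (interact (pderiv l (pderiv k Φ)) (stressD l k W) (massD W) -
      interact (pderiv l (pderiv k Φ)) (currentD k W) (currentD l W)) := by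
    rw [morawetzRate]
    simp only [currentRate, Finset.sum_add_distrib, Finset.sum_sub_distrib, ← Finset.mul_sum]
    ring
  rw [e]
  linarith

/-- The derivative ∂_k of the kernel is moved onto the mass at y, leaving ΔΦ between two gradients;
this gives the first lower bound. -/
lemma sum_interact_grad_mass_eq_grad_grad (hS : SobolevBound d (energyExp p)) {Φ : Rd d → ℝ}
    (hΦ : ContDiff ℝ 4 Φ) (hb : ∀ k, SmoothBdd 3 (pderiv k Φ)) {W : Fin N → XS d (energyExp p)}
    (hW : ∀ μ, W μ ∈ WS d (energyExp p)) :
    ∑ k, ∑ l, interact (pderiv l (pderiv l (pderiv k Φ))) (gradD k W) (massD W) =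
      2 * ∑ k, ∑ l, interact (pderiv l (pderiv l Φ)) (gradD k W) (gradD k W) := by
  simp only [Finset.mul_sum]
  refine Finset.sum_congr rfl fun k _ => Finset.sum_congr rfl fun l _ => ?_
  rw [show pderiv l (pderiv l (pderiv k Φ)) = pderiv k (pderiv l (pderiv l Φ)) from
    pderiv_pderiv_comm (hΦ.of_le (by norm_num)) k l]
  exact interact_pderiv_right hS (((hb l).pderiv l).mono (by norm_num)) k (integrable_density _ _ _) hW

/-- The gradient at x is moved onto the kernel instead, which completes Δ²Φ between two masses; this
gives the second lower bound. -/
lemma sum_interact_grad_mass_eq_mass_mass (hS : SobolevBound d (energyExp p)) {Φ : Rd d → ℝ}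
    (hΦ : ContDiff ℝ 4 Φ) (hb : ∀ k, SmoothBdd 3 (pderiv k Φ)) {W : Fin N → XS d (energyExp p)}
    (hW : ∀ μ, W μ ∈ WS d (energyExp p)) :
    ∑ k, ∑ l, interact (pderiv l (pderiv l (pderiv k Φ))) (gradD k W) (massD W) =
      -(1 / 2) * ∑ k, ∑ l, interact (pderiv l (pderiv l (pderiv k (pderiv k Φ)))) (massD W) (massD W) := by
  rw [Finset.sum_comm (f := fun k l => interact (pderiv l (pderiv l (pderiv k (pderiv k Φ)))) _ _)]
  simp only [Finset.mul_sum]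
  refine Finset.sum_congr rfl fun k _ => Finset.sum_congr rfl fun l _ => ?_
  rw [show pderiv l (pderiv l (pderiv k Φ)) = pderiv k (pderiv l (pderiv l Φ)) from
    pderiv_pderiv_comm (hΦ.of_le (by norm_num)) k l,
    interact_pderiv_left hS (((hb l).pderiv l).pderiv k) k (integrable_density _ _ _) hW]
  ring

end Bounds

end InteractionMorawetz

end

/-! ### Back from tuples to the components of the solution -/

noncomputable section
open MeasureTheory Filter Topology
open scoped ContDiff ENNReal SchwartzMap FourierTransform RealInnerProductSpace Laplacian LineDeriv
namespace InteractionMorawetz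

section Components

variable {d N : ℕ} {p : ℝ}

/-- The components of the momentum density. -/
def momentumComp (k : Fin d) (U : H1 d) (x : Rd d) : ℝ := ((starRingEnd ℂ) (U.fn x) * U.pd k x).im

/-- The components of half the gradient of the mass density. -/
def halfGradComp (k : Fin d) (U : H1 d) (x : Rd d) : ℝ := ((starRingEnd ℂ) (U.fn x) * U.pd k x).re

/-- The gradient of the mass density. -/
def massGradient (U : H1 d) (x : Rd d) : Rd d := WithLp.toLp 2 fun k => 2 * halfGradComp k U x

/-- The interaction energy density of two components. -/
def pairPotential (p : ℝ) (U V : H1 d) (x : Rd d) : ℝ := ‖U.fn x‖ ^ (p + 1) * ‖V.fn x‖ ^ (p + 1)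

lemma massDensity_eq_re (U : H1 d) (x : Rd d) :
    massDensity U x = ((starRingEnd ℂ) (U.fn x) * U.fn x).re := by
  rw [massDensity, ← Complex.normSq_eq_conj_mul_self, Complex.ofReal_re, Complex.normSq_eq_norm_sq]

lemma massDensity_nonneg (U : H1 d) (x : Rd d) : 0 ≤ massDensity U x := sq_nonneg _

lemma integrable_massDensity (U : H1 d) : Integrable (massDensity U) := by
  refine (integrable_conj_mul U.1.fst U.1.fst).re.congr (ae_of_all _ fun x => ?_)
  exact (massDensity_eq_re U x).symm

lemma integrable_momentumComp (k : Fin d) (U : H1 d) : Integrable (momentumComp k U) :=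
  (integrable_conj_mul U.1.fst (U.1.snd k)).im

lemma integrable_halfGradComp (k : Fin d) (U : H1 d) : Integrable (halfGradComp k U) :=
  (integrable_conj_mul U.1.fst (U.1.snd k)).re

lemma integrable_massGradient (U : H1 d) : Integrable (massGradient U) := by
  have h : ∀ x, massGradient U x = ∑ k, (2 * halfGradComp k U x) • unitVec k := fun x => by
    ext i
    simp [massGradient, unitVec, Pi.single_apply]
  rw [show massGradient U = _ from funext h]
  exact integrable_finsetSum _ fun k _ => ((integrable_halfGradComp k U).const_mul 2).smul_const _

variable [hp : Fact (1 ≤ p)] {u : Fin N → H1 d} {W : Fin N → XS d (energyExp p)}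

lemma sum_massDensity (hW : ∀ μ, toAmbient (W μ) = (u μ).1) (x : Rd d) :
    ∑ μ, massDensity (u μ) x = massD W x := by
  refine Finset.sum_congr rfl fun μ _ => ?_
  rw [massDensity_eq_re, H1.fn, ← hW]
  rfl

lemma sum_momentumComp (hW : ∀ μ, toAmbient (W μ) = (u μ).1) (k : Fin d) (x : Rd d) :
    ∑ μ, momentumComp k (u μ) x = currentD k W x := by
  refine Finset.sum_congr rfl fun μ _ => ?_
  rw [momentumComp, H1.fn, H1.pd, ← hW]
  rfl

lemma sum_halfGradComp (hW : ∀ μ, toAmbient (W μ) = (u μ).1) (k : Fin d) (x : Rd d) :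
    ∑ μ, halfGradComp k (u μ) x = gradD k W x := by
  refine Finset.sum_congr rfl fun μ _ => ?_
  rw [halfGradComp, H1.fn, H1.pd, ← hW]
  rfl


lemma fn_ae_eq {U : H1 d} {V : XS d (energyExp p)} (hU : toAmbient V = U.1)
    (hV : V ∈ WS d (energyExp p)) : U.fn =ᵐ[volume] V.2.2 := by
  have h := ae_eq_of_mem_WS (q' := energyExp' p) hV
  unfold H1.fn
  rw [← hU]
  exact h

lemma integrable_norm_rpow_energyExp (f : LL d (energyExp p)) :
    Integrable fun x => ‖f x‖ ^ (2 * p + 2) := by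
  have h1 : (1 : ℝ) ≤ 2 * p + 2 := one_le_energyExp
  have h := (Lp.memLp f).integrable_norm_rpow (by simp; linarith) energyExp_ne_top
  rwa [ENNReal.toReal_ofReal (by linarith)] at h

/-- A product is at most the sum of the squares, and these squares are |U|^{2p+2} and |V|^{2p+2},
integrable by the Sobolev embedding. -/
lemma integrable_pairPotential {U V : H1 d} {A B : XS d (energyExp p)} (hU : toAmbient A = U.1)
    (hA : A ∈ WS d (energyExp p)) (hV : toAmbient B = V.1) (hB : B ∈ WS d (energyExp p)) :
    Integrable (pairPotential p U V) := by
  have h1 : (1 : ℝ) ≤ p := hp.out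
  have hm : ∀ U : H1 d, AEStronglyMeasurable (fun x => ‖U.fn x‖ ^ (p + 1)) volume := fun U =>
    ((Real.continuous_rpow_const (by linarith)).comp_aestronglyMeasurable
      (Lp.aestronglyMeasurable U.1.fst).norm)
  refine ((integrable_norm_rpow_energyExp A.2.2).add (integrable_norm_rpow_energyExp B.2.2)).mono'
    ((hm U).mul (hm V)) ?_
  filter_upwards [fn_ae_eq hU hA, fn_ae_eq hV hB] with x hx hy
  rw [pairPotential, hx, hy, Pi.add_apply, Real.norm_of_nonneg (by positivity)]
  have e : ∀ a : ℝ, 0 ≤ a → a ^ (2 * p + 2) = (a ^ (p + 1)) ^ 2 := fun a ha => by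
    rw [← Real.rpow_mul_natCast ha]; congr 1; push_cast; ring
  rw [e _ (norm_nonneg _), e _ (norm_nonneg _)]
  nlinarith [sq_nonneg (‖A.2.2 x‖ ^ (p + 1) - ‖B.2.2 x‖ ^ (p + 1)),
    sq_nonneg (‖A.2.2 x‖ ^ (p + 1)), sq_nonneg (‖B.2.2 x‖ ^ (p + 1))]

lemma sum_pairPotential {β : Fin N → Fin N → ℝ} (hW : ∀ μ, toAmbient (W μ) = (u μ).1)
    (hmem : ∀ μ, W μ ∈ WS d (energyExp p)) :
    (fun x => ∑ μ, ∑ ν, β μ ν * pairPotential p (u μ) (u ν) x) =ᵐ[volume] potentialD β W := by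
  have h : ∀ᵐ x, ∀ μ, (u μ).fn x = (W μ).2.2 x := by
    rw [ae_all_iff]; exact fun μ => fn_ae_eq (hW μ) (hmem μ)
  filter_upwards [h] with x hx
  simp only [pairPotential, hx]
  rfl

/-- A test function is a weight, so this is the integration by parts for the mass of a tuple with a
single component. -/
lemma hasWeakGradient_massDensity (hd : (d : ℝ) < (2 * p + 2) / p) {U : H1 d}
    {V : XS d (energyExp p)} (hU : toAmbient V = U.1) (hV : V ∈ WS d (energyExp p)) :
    HasWeakGradient (massDensity U) (fun k x => massGradient U x k) := by
  refine ⟨(integrable_massDensity U).locallyIntegrable,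
    fun k => ((integrable_halfGradComp k U).const_mul 2).locallyIntegrable, fun η hη hc k => ?_⟩
  have hY : IsWeight η := by
    refine ⟨hη.of_le (by simp), ?_, ?_⟩
    · exact hc.exists_bound_of_continuous hη.continuous
    · exact (hc.fderiv (𝕜 := ℝ)).exists_bound_of_continuous (hη.continuous_fderiv (by simp))
  have h := integral_pderiv_mul_massD (sobolevBound_energyExp hd) hY (W := fun _ : Fin 1 => V)
    (fun _ => hV) k
  have h1 := sum_massDensity (u := fun _ : Fin 1 => U) (W := fun _ : Fin 1 => V) (fun _ => hU)
  have h2 := sum_halfGradComp (u := fun _ : Fin 1 => U) (W := fun _ : Fin 1 => V) (fun _ => hU) k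
  simp only [Fin.sum_univ_one] at h1 h2
  simp only [← h1, ← h2] at h
  refine h.trans ?_
  rw [neg_mul, ← integral_const_mul]
  congr 2; ext x
  simp only [massGradient, smul_eq_mul]
  ring

end Components

section SumInteract

variable {d N : ℕ}

lemma integral_sum_kernel {ι : Type*} [Fintype ι] {K : ι → Rd d → ℝ} {A B : ι → Rd d → ℝ} {C : ι → ℝ}
    (hK : ∀ i, Continuous (K i)) (hC : ∀ i x, |K i x| ≤ C i) (hA : ∀ i, Integrable (A i))
    (hB : ∀ i, Integrable (B i)) {f : Rd d × Rd d → ℝ}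
    (hf : ∀ z, f z = ∑ i, K i (z.1 - z.2) * (A i z.1 * B i z.2)) :
    Integrable f ∧ ∫ z, f z = ∑ i, interact (K i) (A i) (B i) := by
  have hi := fun i => integrable_interact (hK i) (hC i) (hA i) (hB i)
  simp only [funext hf]
  exact ⟨integrable_finsetSum _ fun i _ => hi i, integral_finsetSum _ fun i _ => hi i⟩

lemma sum_sum_interact {ι κ : Type*} [Fintype ι] [Fintype κ] {K : Rd d → ℝ} {C : ℝ} (hK : Continuous K)
    (hC : ∀ x, |K x| ≤ C) {A : ι → Rd d → ℝ} {B : κ → Rd d → ℝ} (hA : ∀ i, Integrable (A i))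
    (hB : ∀ j, Integrable (B j)) :
    ∑ i, ∑ j, interact K (A i) (B j) =
      interact K (fun x => ∑ i, A i x) (fun y => ∑ j, B j y) := by
  have hi := fun i j => integrable_interact hK hC (hA i) (hB j)
  unfold interact
  rw [← Finset.sum_congr rfl fun i _ => integral_finsetSum Finset.univ fun j _ => hi i j,
    ← integral_finsetSum _ fun i _ => integrable_finsetSum _ fun j _ => hi i j]
  congr 1; ext z
  rw [Finset.sum_mul_sum, Finset.mul_sum]
  exact Finset.sum_congr rfl fun i _ => (Finset.mul_sum _ _ _).symm

lemma interact_congr_left {K A A' B : Rd d → ℝ} (h : A =ᵐ[volume] A') :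
    interact K A B = interact K A' B := by
  refine integral_congr_ae ?_
  have := (Measure.quasiMeasurePreserving_fst (μ := (volume : Measure (Rd d)))
    (ν := (volume : Measure (Rd d)))).ae h
  filter_upwards [this] with z hz
  rw [hz]

lemma const_mul_interact (c : ℝ) (K A B : Rd d → ℝ) :
    c * interact K A B = interact K (fun x => c * A x) B := by
  rw [interact, interact, ← integral_const_mul]
  congr 1; ext z; ring

end SumInteract

end InteractionMorawetz

end

/-! ### The integrals of the statement as interaction integrals -/

noncomputable section
open MeasureTheory Filter Topology
open scoped ContDiff ENNReal SchwartzMap FourierTransform RealInnerProductSpace Laplacian LineDeriv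
namespace InteractionMorawetz

section Integrands

variable {d N : ℕ} {p : ℝ} {φ : ℝ → ℝ}

lemma inner_Rd_eq_sum (a b : Rd d) : inner ℝ a b = ∑ k, a k * b k := by
  rw [PiLp.inner_apply]
  exact Finset.sum_congr rfl fun k _ => by simp [mul_comm]

/-- The gradient of ψ is expanded into partial derivatives of Φ at x - y. These are bounded, so each
term is a bounded kernel against two integrable densities; the other integrands are treated alike.
-/
lemma currentIntegrand_integral (hb : ∀ k : Fin d, SmoothBdd 3 (pderiv k (radial d φ))) (U V : H1 d) :
    Integrable (currentIntegrand φ U V) ∧ ∫ z, currentIntegrand φ U V z =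
      ∑ k, interact (pderiv k (radial d φ)) (momentumComp k U) (massDensity V) := by
  choose C hC using fun k => (hb k).exists_bound
  refine integral_sum_kernel (fun k => (hb k).continuous) hC (fun k => integrable_momentumComp k U)
    (fun _ => integrable_massDensity V) fun z => ?_
  rw [currentIntegrand, inner_Rd_eq_sum, Finset.sum_mul]
  refine Finset.sum_congr rfl fun k _ => ?_
  rw [gradPsi_apply, momentumDensity, momentumComp]
  ring

lemma bilapIntegrand_integral (h : ContDiff ℝ 4 (radial d φ))
    (hb : ∀ k : Fin d, SmoothBdd 3 (pderiv k (radial d φ))) (U V : H1 d) :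
    Integrable (bilapIntegrand φ U V) ∧ ∫ z, bilapIntegrand φ U V z =
      ∑ k, ∑ l, interact (pderiv l (pderiv l (pderiv k (pderiv k (radial d φ)))))
        (massDensity U) (massDensity V) := by
  choose C hC using fun i : Fin d × Fin d => ((((hb i.1).pderiv i.1).pderiv i.2).pderiv i.2).exists_bound
  rw [← Fintype.sum_prod_type' (f := fun k l => interact _ (massDensity U) (massDensity V))]
  refine integral_sum_kernel (fun i : Fin d × Fin d =>
    ((((hb i.1).pderiv i.1).pderiv i.2).pderiv i.2).continuous) hC
    (fun _ => integrable_massDensity U) (fun _ => integrable_massDensity V) fun z => ?_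
  rw [bilapIntegrand, bilapPsi_eq h, ← Fintype.sum_prod_type', Finset.mul_sum]
  exact Finset.sum_congr rfl fun i _ => mul_comm _ _

lemma gradientIntegrand_integral (h : ContDiff ℝ 4 (radial d φ))
    (hb : ∀ k : Fin d, SmoothBdd 3 (pderiv k (radial d φ))) (U V : H1 d) :
    Integrable (gradientIntegrand φ (massGradient U) (massGradient V)) ∧
      ∫ z, gradientIntegrand φ (massGradient U) (massGradient V) z =
      ∑ k, ∑ l, interact (pderiv l (pderiv l (radial d φ)))
        (fun x => 2 * halfGradComp k U x) (fun x => 2 * halfGradComp k V x) := by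
  choose C hC using fun i : Fin d × Fin d => ((hb i.2).pderiv i.2).exists_bound
  rw [← Fintype.sum_prod_type' (f := fun k l => interact (pderiv l (pderiv l (radial d φ)))
        (fun x => 2 * halfGradComp k U x) (fun x => 2 * halfGradComp k V x))]
  refine integral_sum_kernel (fun i : Fin d × Fin d => ((hb i.2).pderiv i.2).continuous) hC
    (fun i => (integrable_halfGradComp i.1 U).const_mul 2)
    (fun i => (integrable_halfGradComp i.1 V).const_mul 2) fun z => ?_
  rw [gradientIntegrand, lapPsi_eq h, inner_Rd_eq_sum, Finset.sum_mul_sum, Finset.sum_comm,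
    Fintype.sum_prod_type]
  rfl

lemma nonlinearIntegrand_integral (h : ContDiff ℝ 4 (radial d φ))
    (hb : ∀ k : Fin d, SmoothBdd 3 (pderiv k (radial d φ))) {U V : H1 d} (Z : H1 d)
    (hUV : Integrable (pairPotential p U V)) :
    Integrable (nonlinearIntegrand p φ U V Z) ∧ ∫ z, nonlinearIntegrand p φ U V Z z =
      ∑ k, interact (pderiv k (pderiv k (radial d φ))) (pairPotential p U V) (massDensity Z) := by
  choose C hC using fun k => ((hb k).pderiv k).exists_bound
  refine integral_sum_kernel (fun k => ((hb k).pderiv k).continuous) hC (fun _ => hUV)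
    (fun _ => integrable_massDensity Z) fun z => ?_
  rw [nonlinearIntegrand, lapPsi_eq h, Finset.mul_sum]
  exact Finset.sum_congr rfl fun k _ => mul_comm _ _

end Integrands

section Totals

variable {d N : ℕ} {p : ℝ} [hp : Fact (1 ≤ p)] {φ : ℝ → ℝ} {u : ℝ → Fin N → H1 d} {t : ℝ}
  {W : Fin N → XS d (energyExp p)}

lemma interactionCurrent_eq (hb : ∀ k : Fin d, SmoothBdd 3 (pderiv k (radial d φ)))
    (hW : ∀ μ, toAmbient (W μ) = (u t μ).1) :
    interactionCurrent φ u t =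
      4 * ∑ k, interact (pderiv k (radial d φ)) (currentD k W) (massD W) := by
  rw [interactionCurrent]
  congr 1
  simp only [(currentIntegrand_integral hb _ _).2]
  rw [Finset.sum_congr rfl fun μ _ => Finset.sum_comm, Finset.sum_comm]
  refine Finset.sum_congr rfl fun k _ => ?_
  obtain ⟨C, hC⟩ := (hb k).exists_bound
  rw [sum_sum_interact (hb k).continuous hC (fun μ => integrable_momentumComp k (u t μ))
    fun κ => integrable_massDensity (u t κ)]
  simp only [sum_massDensity hW, sum_momentumComp hW]

lemma sum_bilapIntegrand (h : ContDiff ℝ 4 (radial d φ))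
    (hb : ∀ k : Fin d, SmoothBdd 3 (pderiv k (radial d φ)))
    (hW : ∀ μ, toAmbient (W μ) = (u t μ).1) :
    ∑ μ, ∑ κ, (∫ z, bilapIntegrand φ (u t μ) (u t κ) z) =
      ∑ k, ∑ l, interact (pderiv l (pderiv l (pderiv k (pderiv k (radial d φ)))))
        (massD W) (massD W) := by
  simp only [(bilapIntegrand_integral h hb _ _).2]
  rw [Finset.sum_congr rfl fun μ _ => Finset.sum_comm, Finset.sum_comm]
  refine Finset.sum_congr rfl fun k _ => ?_
  rw [Finset.sum_congr rfl fun μ _ => Finset.sum_comm, Finset.sum_comm]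
  refine Finset.sum_congr rfl fun l _ => ?_
  have hc := (((hb k).pderiv k).pderiv l).pderiv l
  obtain ⟨C, hC⟩ := hc.exists_bound
  rw [sum_sum_interact hc.continuous hC (fun μ => integrable_massDensity (u t μ))
    fun κ => integrable_massDensity (u t κ)]
  simp only [sum_massDensity hW]

lemma sum_gradientIntegrand (h : ContDiff ℝ 4 (radial d φ))
    (hb : ∀ k : Fin d, SmoothBdd 3 (pderiv k (radial d φ)))
    (hW : ∀ μ, toAmbient (W μ) = (u t μ).1) :
    ∑ μ, ∑ κ, (∫ z, gradientIntegrand φ (massGradient (u t μ)) (massGradient (u t κ)) z) =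
      4 * ∑ k, ∑ l, interact (pderiv l (pderiv l (radial d φ))) (gradD k W) (gradD k W) := by
  simp only [(gradientIntegrand_integral h hb _ _).2]
  rw [Finset.sum_congr rfl fun μ _ => Finset.sum_comm, Finset.sum_comm, Finset.mul_sum]
  refine Finset.sum_congr rfl fun k _ => ?_
  rw [Finset.sum_congr rfl fun μ _ => Finset.sum_comm, Finset.sum_comm, Finset.mul_sum]
  refine Finset.sum_congr rfl fun l _ => ?_
  have hc := (hb l).pderiv l
  obtain ⟨C, hC⟩ := hc.exists_bound
  rw [sum_sum_interact hc.continuous hC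
    (fun μ => (integrable_halfGradComp k (u t μ)).const_mul 2)
    fun κ => (integrable_halfGradComp k (u t κ)).const_mul 2]
  simp only [← Finset.mul_sum, sum_halfGradComp hW]
  rw [interact, interact, ← integral_const_mul]
  congr 1; ext z; ring

/-- Linearity collects the pair potentials into the potential density. That density uses the
L^{2p+2} representatives, so it is identified only almost everywhere. -/
lemma nonlinearTerm_eq {β : Fin N → Fin N → ℝ} (h : ContDiff ℝ 4 (radial d φ))
    (hb : ∀ k : Fin d, SmoothBdd 3 (pderiv k (radial d φ)))
    (hW : ∀ μ, toAmbient (W μ) = (u t μ).1) (hmem : ∀ μ, W μ ∈ WS d (energyExp p)) :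
    nonlinearTerm p β φ u t = 4 * p / (p + 1) *
      ∑ k, interact (pderiv k (pderiv k (radial d φ))) (potentialD β W) (massD W) := by
  have hi : ∀ μ ν, Integrable (pairPotential p (u t μ) (u t ν)) := fun μ ν =>
    integrable_pairPotential (hW μ) (hmem μ) (hW ν) (hmem ν)
  rw [nonlinearTerm]
  congr 1
  simp only [(nonlinearIntegrand_integral h hb _ (hi _ _)).2, Finset.mul_sum, const_mul_interact]
  rw [Finset.sum_congr rfl fun μ _ => Finset.sum_congr rfl fun ν _ => Finset.sum_comm,
    Finset.sum_congr rfl fun μ _ => Finset.sum_comm, Finset.sum_comm]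
  refine Finset.sum_congr rfl fun k _ => ?_
  have hc := (hb k).pderiv k
  obtain ⟨C, hC⟩ := hc.exists_bound
  rw [← Fintype.sum_prod_type' (f := fun μ ν => ∑ κ, interact (pderiv k (pderiv k (radial d φ)))
      (fun x => β μ ν * pairPotential p (u t μ) (u t ν) x) (massDensity (u t κ))),
    sum_sum_interact (A := fun (i : Fin N × Fin N) x => β i.1 i.2 * pairPotential p (u t i.1) (u t i.2) x)
      hc.continuous hC (fun i => (hi i.1 i.2).const_mul _) fun κ => integrable_massDensity (u t κ)]
  simp only [sum_massDensity hW]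
  refine interact_congr_left ?_
  filter_upwards [sum_pairPotential (β := β) hW hmem] with x hx
  rw [← hx, Fintype.sum_prod_type]

lemma nonlinearTerm_nonneg {β : Fin N → Fin N → ℝ} (hβ : ∀ μ ν, 0 ≤ β μ ν)
    (hc : ConvexOn ℝ Set.univ (radial d φ)) (h : ContDiff ℝ 4 (radial d φ)) (t : ℝ) :
    0 ≤ nonlinearTerm p β φ u t := by
  have hp' : 1 ≤ p := hp.out
  refine mul_nonneg (by positivity) (Finset.sum_nonneg fun μ _ => Finset.sum_nonneg fun ν _ =>
    Finset.sum_nonneg fun κ _ => mul_nonneg (hβ μ ν) (integral_nonneg fun z => ?_))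
  exact mul_nonneg (mul_nonneg (by positivity) (massDensity_nonneg _ _)) (lapPsi_nonneg hc h _ _)

/-- The current is differentiable, and its derivative is the Morawetz rate. -/
theorem SolvesSystem.hasDerivAt_interactionCurrent {β : Fin N → Fin N → ℝ}
    (hβ : ∀ μ ν, β μ ν = β ν μ) {w : ℝ → Fin N → XS d (energyExp p)} (hw : SolvesSystem β w)
    (hd : (d : ℝ) < (2 * p + 2) / p) (hb : ∀ k : Fin d, SmoothBdd 3 (pderiv k (radial d φ)))
    (hW : ∀ t μ, toAmbient (w t μ) = (u t μ).1) (t : ℝ) :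
    HasDerivAt (interactionCurrent φ u) (morawetzRate β (radial d φ) (w t)) t := by
  rw [show interactionCurrent φ u = _ from funext fun t => interactionCurrent_eq hb (hW t)]
  exact (HasDerivAt.fun_sum fun k _ => hw.hasDerivAt_interact_current hβ hd (hb k) k t).const_mul 4

lemma le_morawetzRate_gradient {β : Fin N → Fin N → ℝ} (hd : (d : ℝ) < (2 * p + 2) / p)
    (hc : ConvexOn ℝ Set.univ (radial d φ)) (h : ContDiff ℝ 4 (radial d φ))
    (hb : ∀ k : Fin d, SmoothBdd 3 (pderiv k (radial d φ)))
    (hW : ∀ μ, toAmbient (W μ) = (u t μ).1) (hmem : ∀ μ, W μ ∈ WS d (energyExp p)) :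
    2 * ∑ μ, ∑ κ, (∫ z, gradientIntegrand φ (massGradient (u t μ)) (massGradient (u t κ)) z) +
      nonlinearTerm p β φ u t ≤ morawetzRate β (radial d φ) W := by
  refine le_trans (le_of_eq ?_) (le_morawetzRate h hb radial_neg
    (InteractionMorawetz.ConvexOn.hessian_nonneg hc (h.of_le (by norm_num))) W)
  rw [sum_gradientIntegrand h hb hW, nonlinearTerm_eq h hb hW hmem,
    sum_interact_grad_mass_eq_grad_grad (sobolevBound_energyExp hd) h hb hmem]
  ring

lemma le_morawetzRate_bilap {β : Fin N → Fin N → ℝ} (hd : (d : ℝ) < (2 * p + 2) / p)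
    (hc : ConvexOn ℝ Set.univ (radial d φ)) (h : ContDiff ℝ 4 (radial d φ))
    (hb : ∀ k : Fin d, SmoothBdd 3 (pderiv k (radial d φ)))
    (hW : ∀ μ, toAmbient (W μ) = (u t μ).1) (hmem : ∀ μ, W μ ∈ WS d (energyExp p)) :
    -2 * ∑ μ, ∑ κ, (∫ z, bilapIntegrand φ (u t μ) (u t κ) z) +
      nonlinearTerm p β φ u t ≤ morawetzRate β (radial d φ) W := by
  refine le_trans (le_of_eq ?_) (le_morawetzRate h hb radial_neg
    (InteractionMorawetz.ConvexOn.hessian_nonneg hc (h.of_le (by norm_num))) W)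
  rw [sum_bilapIntegrand h hb hW, nonlinearTerm_eq h hb hW hmem,
    sum_interact_grad_mass_eq_mass_mass (sobolevBound_energyExp hd) h hb hmem]
  ring

end Totals

end InteractionMorawetz

end

/-! ### Truncated weights and the interaction of bounded kernels -/

noncomputable section
open MeasureTheory Filter Topology
open scoped ContDiff ENNReal SchwartzMap FourierTransform RealInnerProductSpace Laplacian LineDeriv
namespace InteractionMorawetz

section Truncation

variable {d : ℕ} {Ψ : Rd d → ℝ} {ε : ℝ}

/-- The bounded regularization `Ψ / (1 + ε Ψ)` of a nonnegative function. -/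
def truncate (ε : ℝ) (Ψ : Rd d → ℝ) (x : Rd d) : ℝ := Ψ x / (1 + ε * Ψ x)

lemma one_le_truncate_denom (hΨ : ∀ x, 0 ≤ Ψ x) (hε : 0 ≤ ε) (x : Rd d) : 1 ≤ 1 + ε * Ψ x :=
  le_add_of_nonneg_right (mul_nonneg hε (hΨ x))

lemma truncate_nonneg (hΨ : ∀ x, 0 ≤ Ψ x) (hε : 0 ≤ ε) (x : Rd d) : 0 ≤ truncate ε Ψ x :=
  div_nonneg (hΨ x) (zero_le_one.trans (one_le_truncate_denom hΨ hε x))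

lemma truncate_le (hΨ : ∀ x, 0 ≤ Ψ x) (hε : 0 ≤ ε) (x : Rd d) : truncate ε Ψ x ≤ Ψ x :=
  div_le_self (hΨ x) (one_le_truncate_denom hΨ hε x)

lemma abs_truncate_le (hΨ : ∀ x, 0 ≤ Ψ x) (hε : 0 < ε) (x : Rd d) : |truncate ε Ψ x| ≤ 1 / ε := by
  have h := one_le_truncate_denom hΨ hε.le x
  rw [abs_of_nonneg (truncate_nonneg hΨ hε.le x), truncate, div_le_div_iff₀ (by linarith) hε]
  linarith

lemma contDiff_truncate (hd : ContDiff ℝ 1 Ψ) (hΨ : ∀ x, 0 ≤ Ψ x) (hε : 0 ≤ ε) :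
    ContDiff ℝ 1 (truncate ε Ψ) :=
  hd.div (contDiff_const.add (contDiff_const.mul hd)) fun x =>
    (zero_lt_one.trans_le (one_le_truncate_denom hΨ hε x)).ne'

/-- The map s ↦ s/(1+εs) has derivative (1+εs)^{-2} ≤ 1 for s ≥ 0. Thus the truncation is bounded
while its gradient is dominated by that of Ψ, uniformly in ε. -/
lemma fderiv_truncate (hd : ContDiff ℝ 1 Ψ) (hΨ : ∀ x, 0 ≤ Ψ x) (hε : 0 ≤ ε) (x : Rd d) :
    fderiv ℝ (truncate ε Ψ) x = (1 / (1 + ε * Ψ x) ^ 2) • fderiv ℝ Ψ x := by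
  have h := (hd.differentiable one_ne_zero x).hasFDerivAt
  have hne : 1 + ε * Ψ x ≠ 0 := (zero_lt_one.trans_le (one_le_truncate_denom hΨ hε x)).ne'
  have hr : HasDerivAt (fun s : ℝ => s / (1 + ε * s)) (1 / (1 + ε * Ψ x) ^ 2) (Ψ x) := by
    refine ((hasDerivAt_id (Ψ x)).fun_div (((hasDerivAt_id (Ψ x)).const_mul ε).const_add 1)
      hne).congr_deriv ?_
    simp only [id]
    ring
  exact (hr.comp_hasFDerivAt x h).fderiv

lemma pderiv_truncate (hd : ContDiff ℝ 1 Ψ) (hΨ : ∀ x, 0 ≤ Ψ x) (hε : 0 ≤ ε) (k : Fin d) (x : Rd d) :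
    pderiv k (truncate ε Ψ) x = 1 / (1 + ε * Ψ x) ^ 2 * pderiv k Ψ x := by
  rw [pderiv, fderiv_truncate hd hΨ hε]
  rfl

lemma abs_inv_denom_sq_le (hΨ : ∀ x, 0 ≤ Ψ x) (hε : 0 ≤ ε) (x : Rd d) :
    |1 / (1 + ε * Ψ x) ^ 2| ≤ 1 := by
  rw [abs_of_nonneg (by positivity)]
  exact div_le_one_of_le₀ (one_le_pow₀ (one_le_truncate_denom hΨ hε x)) (by positivity)

lemma norm_fderiv_truncate_le (hd : ContDiff ℝ 1 Ψ) (hΨ : ∀ x, 0 ≤ Ψ x) (hε : 0 ≤ ε) (x : Rd d) :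
    ‖fderiv ℝ (truncate ε Ψ) x‖ ≤ ‖fderiv ℝ Ψ x‖ := by
  rw [fderiv_truncate hd hΨ hε, norm_smul, Real.norm_eq_abs]
  exact mul_le_of_le_one_left (norm_nonneg _) (abs_inv_denom_sq_le hΨ hε x)

lemma isWeight_truncate (hd : ContDiff ℝ 1 Ψ) (hΨ : ∀ x, 0 ≤ Ψ x) {C : ℝ}
    (hC : ∀ x, ‖fderiv ℝ Ψ x‖ ≤ C) (hε : 0 < ε) : IsWeight (truncate ε Ψ) :=
  ⟨contDiff_truncate hd hΨ hε.le, ⟨_, abs_truncate_le hΨ hε⟩,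
    C, fun x => (norm_fderiv_truncate_le hd hΨ hε.le x).trans (hC x)⟩

lemma tendsto_truncate_denom (x : Rd d) :
    Tendsto (fun ε : ℝ => 1 + ε * Ψ x) (𝓝 0) (𝓝 1) := by
  have h : Continuous fun ε : ℝ => 1 + ε * Ψ x := by fun_prop
  simpa using h.tendsto 0

lemma tendsto_truncate (x : Rd d) : Tendsto (fun ε => truncate ε Ψ x) (𝓝 0) (𝓝 (Ψ x)) := by
  have h := (tendsto_const_nhds (x := Ψ x)).div (tendsto_truncate_denom (Ψ := Ψ) x) one_ne_zero
  rw [div_one] at h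
  exact h

end Truncation

section InteractionDerivative

variable {d N : ℕ} {p : ℝ} [hp : Fact (1 ≤ p)] {β : Fin N → Fin N → ℝ}
  {w : ℝ → Fin N → XS d (energyExp p)}

lemma massD_nonneg {p : ℝ} (W : Fin N → XS d (energyExp p)) (x : Rd d) : 0 ≤ massD W x := by
  refine Finset.sum_nonneg fun μ _ => ?_
  rw [← Complex.normSq_eq_conj_mul_self]
  exact Complex.normSq_nonneg _

/-- The interaction current of the kernel `K`. -/
def kernelCurrent (K : Rd d → ℝ) (W : Fin N → XS d (energyExp p)) : ℝ :=
  4 * ∑ k, interact (pderiv k K) (currentD k W) (massD W)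

/-- The bound of the interaction current by the bound of the gradient of the kernel. -/
def currentBound (C : ℝ) (W : Fin N → XS d (energyExp p)) : ℝ :=
  4 * ∑ k, C * ((∫ x, |currentD k W x|) * ∫ x, |massD W x|)

lemma abs_kernelCurrent_le {p : ℝ} {K : Rd d → ℝ} {C : ℝ} (hC : ∀ x, ‖fderiv ℝ K x‖ ≤ C)
    (W : Fin N → XS d (energyExp p)) : |kernelCurrent K W| ≤ currentBound C W := by
  rw [kernelCurrent, currentBound, abs_mul, abs_of_pos (four_pos : (0 : ℝ) < 4)]
  refine mul_le_mul_of_nonneg_left ((Finset.abs_sum_le_sum_abs _ _).trans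
    (Finset.sum_le_sum fun k _ => ?_)) (by norm_num)
  exact abs_interact_le (IsWeight.abs_pderiv_le hC k) (integrable_density _ _ _)
    (integrable_density _ _ _)

lemma continuous_currentBound (C : ℝ) (hw : Continuous w) : Continuous fun t => currentBound C (w t) :=
  continuous_const.mul (continuous_finsetSum _ fun k _ => continuous_const.mul
    ((l1Continuous_currentD hw k).continuous_norm.mul (l1Continuous_massD hw).continuous_norm))

lemma continuous_kernelCurrent {K : Rd d → ℝ} (hK : ContDiff ℝ 1 K) {C : ℝ}
    (hC : ∀ x, ‖fderiv ℝ K x‖ ≤ C) (hw : Continuous w) : Continuous fun t => kernelCurrent K (w t) :=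
  continuous_const.mul (continuous_finsetSum _ fun k _ =>
    (l1Continuous_currentD hw k).interact
      ((hK.continuous_fderiv one_ne_zero).clm_apply continuous_const)
      (IsWeight.abs_pderiv_le hC k) (l1Continuous_massD hw))

/-- The interaction functional of a bounded kernel. -/
theorem SolvesSystem.hasDerivAt_interact_mass (h : SolvesSystem β w)
    (hd : (d : ℝ) < (2 * p + 2) / p) {K : Rd d → ℝ} (hK : IsWeight K) (heven : ∀ x, K (-x) = K x)
    (t : ℝ) : HasDerivAt (fun s => interact K (massD (w s)) (massD (w s)))
      (kernelCurrent K (w t)) t := by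
  obtain ⟨C, hC⟩ := hK.bdd
  obtain ⟨C', hC'⟩ := hK.bdd_fderiv
  have hm := l1Continuous_massD h.continuous
  have hk : ∀ k y, pderiv k (fun x => K (x - y)) = fun x => pderiv k K (x - y) := fun k y => by
    rw [pderiv_comp_sub]
  have h1 : ∀ y t, HasDerivAt (fun s => ∫ x, K (x - y) * massD (w s) x)
      (2 * ∑ k, ∫ x, pderiv k K (x - y) * currentD k (w t) x) t := fun y t => by
    have := h.hasDerivAt_massD hd (hK.comp_sub y) t
    simpa only [hk] using this
  have hb : ∀ t y, |2 * ∑ k, ∫ x, pderiv k K (x - y) * currentD k (w t) x| ≤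
      2 * ∑ k, C' * ∫ x, |currentD k (w t) x| := fun t y => by
    rw [abs_mul, abs_two]
    refine mul_le_mul_of_nonneg_left ((Finset.abs_sum_le_sum_abs _ _).trans
      (Finset.sum_le_sum fun k _ => ?_)) (by norm_num)
    exact abs_integral_mul_le (fun x => IsWeight.abs_pderiv_le hC' k _) (integrable_density _ _ _)
  refine (hasDerivAt_interact hK.contDiff.continuous hC hm.integrable hm.integrable (hm.tendsto t)
    h1 (fun x t => ?_) (continuous_const.mul (continuous_finsetSum _ fun k _ => continuous_const.mul
      (l1Continuous_currentD h.continuous k).continuous_norm)) hb hb).congr_deriv ?_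
  -- By evenness of the kernel, the derivative in the other variable is the same statement.
  · refine (h1 x t).congr_of_eventuallyEq (Eventually.of_forall fun s => ?_)
    refine integral_congr_ae (ae_of_all _ fun y => ?_)
    simp only
    rw [← heven, neg_sub]
  · have e : ∀ k, interact (pderiv k K) (currentD k (w t)) (massD (w t)) =
        ∫ y, (∫ x, pderiv k K (x - y) * currentD k (w t) x) * massD (w t) y := fun k =>
      interact_eq_left (hK.continuous_pderiv k) (IsWeight.abs_pderiv_le hC' k)
        (integrable_density _ _ _) (hm.integrable t)
    have hint : ∀ k, Integrable fun y => (∫ x, pderiv k K (x - y) * currentD k (w t) x) *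
        massD (w t) y := fun k => by
      have := (integrable_interact (hK.continuous_pderiv k) (IsWeight.abs_pderiv_le hC' k)
        (integrable_density Complex.imCLM (fun μ => (w t μ).1) (fun μ => (w t μ).2.1 k))
        (hm.integrable t)).integral_prod_right
      refine this.congr (ae_of_all _ fun y => ?_)
      simp only
      rw [← integral_mul_const]
      congr 1; ext x; ring
    have e2 : ∫ y, (2 * ∑ k, ∫ x, pderiv k K (x - y) * currentD k (w t) x) * massD (w t) y =
        2 * ∑ k, interact (pderiv k K) (currentD k (w t)) (massD (w t)) := by
      simp only [e, mul_assoc, integral_const_mul, Finset.sum_mul]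
      rw [integral_finsetSum _ fun k _ => hint k]
    rw [show (∫ x, massD (w t) x * (2 * ∑ k, ∫ z, pderiv k K (z - x) * currentD k (w t) z)) =
      ∫ y, (2 * ∑ k, ∫ x, pderiv k K (x - y) * currentD k (w t) x) * massD (w t) y from
      integral_congr_ae (ae_of_all _ fun y => mul_comm _ _), e2, kernelCurrent]
    ring

end InteractionDerivative

end InteractionMorawetz

end

/-! ### The interaction functional of an unbounded weight -/

noncomputable section
open MeasureTheory Filter Topology
open scoped ContDiff ENNReal SchwartzMap FourierTransform RealInnerProductSpace Laplacian LineDeriv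
namespace InteractionMorawetz

section Unbounded

variable {d N : ℕ} {p : ℝ} [hp : Fact (1 ≤ p)] {β : Fin N → Fin N → ℝ}
  {w : ℝ → Fin N → XS d (energyExp p)} {Ψ : Rd d → ℝ} {C : ℝ}

/-- Dominated convergence: the kernels are bounded by C uniformly in ε and converge pointwise, even
where Ψ itself is not integrable against the masses. -/
lemma tendsto_kernelCurrent_truncate {p : ℝ} (hΨd : ContDiff ℝ 1 Ψ) (hΨ : ∀ x, 0 ≤ Ψ x)
    (hC : ∀ x, ‖fderiv ℝ Ψ x‖ ≤ C) (W : Fin N → XS d (energyExp p)) :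
    Tendsto (fun ε => kernelCurrent (truncate ε Ψ) W) (𝓝[≥] 0) (𝓝 (kernelCurrent Ψ W)) := by
  refine Tendsto.const_mul _ (tendsto_finsetSum _ fun k _ => ?_)
  have hJ : Integrable (currentD k W) := integrable_density _ _ _
  have hm : Integrable (massD W) := integrable_density _ _ _
  refine tendsto_integral_filter_of_dominated_convergence
    (fun z => C * (|currentD k W z.1| * |massD W z.2|)) ?_ ?_
    ((hJ.abs.mul_prod hm.abs).const_mul C) (ae_of_all _ fun z => Tendsto.mul_const _ ?_)
  · filter_upwards [self_mem_nhdsWithin] with ε hε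
    exact (integrable_interact
      (((contDiff_truncate hΨd hΨ hε).continuous_fderiv one_ne_zero).clm_apply continuous_const)
      (IsWeight.abs_pderiv_le (fun x => (norm_fderiv_truncate_le hΨd hΨ hε x).trans (hC x)) k) hJ hm).1
  · filter_upwards [self_mem_nhdsWithin] with ε hε
    refine ae_of_all _ fun z => ?_
    rw [norm_mul, norm_mul]
    exact mul_le_mul_of_nonneg_right (IsWeight.abs_pderiv_le
      (fun x => (norm_fderiv_truncate_le hΨd hΨ hε x).trans (hC x)) k _) (by positivity)
  · have h := ((tendsto_const_nhds (x := (1 : ℝ))).div ((tendsto_truncate_denom (Ψ := Ψ)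
      (z.1 - z.2)).pow 2) (by norm_num)).mul_const (pderiv k Ψ (z.1 - z.2))
    rw [one_pow, div_one, one_mul] at h
    refine (h.mono_left nhdsWithin_le_nhds).congr' ?_
    filter_upwards [self_mem_nhdsWithin] with ε hε
    exact (pderiv_truncate hΨd hΨ hε k _).symm

/-- Integrability of the mass interaction with the kernel `Ψ`. -/
def FiniteInteraction (Ψ : Rd d → ℝ) (W : Fin N → XS d (energyExp p)) : Prop :=
  Integrable fun z : Rd d × Rd d => Ψ (z.1 - z.2) * (massD W z.1 * massD W z.2)

lemma integrable_truncate {p : ℝ} (hΨd : ContDiff ℝ 1 Ψ) (hΨ : ∀ x, 0 ≤ Ψ x) {ε : ℝ} (hε : 0 < ε)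
    (W : Fin N → XS d (energyExp p)) : FiniteInteraction (truncate ε Ψ) W :=
  integrable_interact (contDiff_truncate hΨd hΨ hε.le).continuous (abs_truncate_le hΨ hε)
    (integrable_density _ _ _) (integrable_density _ _ _)

lemma interact_truncate_le {p : ℝ} (hΨd : ContDiff ℝ 1 Ψ) (hΨ : ∀ x, 0 ≤ Ψ x) {ε : ℝ} (hε : 0 < ε)
    {W : Fin N → XS d (energyExp p)} (hW : FiniteInteraction Ψ W) :
    interact (truncate ε Ψ) (massD W) (massD W) ≤ interact Ψ (massD W) (massD W) :=
  integral_mono (integrable_truncate hΨd hΨ hε W) hW fun _ =>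
    mul_le_mul_of_nonneg_right (truncate_le hΨ hε.le _)
      (mul_nonneg (massD_nonneg W _) (massD_nonneg W _))

/-- Fatou's lemma along ε = 1/(n+1): the truncations are nonnegative and converge pointwise to Ψ. -/
lemma finiteInteraction_of_bounded {p : ℝ} (hΨd : ContDiff ℝ 1 Ψ) (hΨ : ∀ x, 0 ≤ Ψ x)
    {W : Fin N → XS d (energyExp p)} {R : ℝ}
    (hR : ∀ ε > 0, interact (truncate ε Ψ) (massD W) (massD W) ≤ R) : FiniteInteraction Ψ W := by
  have hmm : Integrable fun z : Rd d × Rd d => massD W z.1 * massD W z.2 :=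
    (integrable_density _ _ _).mul_prod (integrable_density _ _ _)
  have hnn : ∀ z : Rd d × Rd d, 0 ≤ massD W z.1 * massD W z.2 := fun z =>
    mul_nonneg (massD_nonneg W _) (massD_nonneg W _)
  have hm : ∀ {K : Rd d → ℝ}, Continuous K → AEStronglyMeasurable
      (fun z : Rd d × Rd d => K (z.1 - z.2) * (massD W z.1 * massD W z.2)) volume := fun hK =>
    (hK.comp (continuous_fst.sub continuous_snd)).aestronglyMeasurable.mul hmm.1
  set e : ℕ → ℝ := fun n => 1 / ((n : ℝ) + 1)
  have he : ∀ n, 0 < e n := fun n => Nat.one_div_pos_of_nat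
  refine ⟨hm hΨd.continuous, ?_⟩
  rw [hasFiniteIntegral_iff_ofReal (ae_of_all _ fun z => mul_nonneg (hΨ _) (hnn z))]
  have h1 : ∀ n, ∫⁻ z : Rd d × Rd d, ENNReal.ofReal (truncate (e n) Ψ (z.1 - z.2) *
      (massD W z.1 * massD W z.2)) ≤ ENNReal.ofReal R := fun n => by
    rw [← ofReal_integral_eq_lintegral_ofReal (integrable_truncate hΨd hΨ (he n) W)
      (ae_of_all _ fun z => mul_nonneg (truncate_nonneg hΨ (he n).le _) (hnn z))]
    exact ENNReal.ofReal_le_ofReal (hR _ (he n))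
  refine lt_of_le_of_lt (le_trans (le_of_eq ?_) ((lintegral_liminf_le' (u := atTop)
    (f := fun (n : ℕ) (z : Rd d × Rd d) => ENNReal.ofReal (truncate (e n) Ψ (z.1 - z.2) *
      (massD W z.1 * massD W z.2))) fun n =>
      (hm (contDiff_truncate hΨd hΨ (he n).le).continuous).aemeasurable.ennreal_ofReal).trans
    (liminf_le_of_frequently_le' (Frequently.of_forall h1)))) ENNReal.ofReal_lt_top
  refine lintegral_congr fun z => (Tendsto.liminf_eq ?_).symm
  exact ENNReal.tendsto_ofReal (((tendsto_truncate _).comp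
    tendsto_one_div_add_atTop_nhds_zero_nat).mul_const _)

lemma tendsto_interact_truncate {p : ℝ} (hΨd : ContDiff ℝ 1 Ψ) (hΨ : ∀ x, 0 ≤ Ψ x)
    {W : Fin N → XS d (energyExp p)} (hW : FiniteInteraction Ψ W) :
    Tendsto (fun ε => interact (truncate ε Ψ) (massD W) (massD W)) (𝓝[>] 0)
      (𝓝 (interact Ψ (massD W) (massD W))) := by
  refine tendsto_integral_filter_of_dominated_convergence _ ?_ ?_ hW (ae_of_all _ fun z =>
    ((tendsto_truncate _).mono_left nhdsWithin_le_nhds).mul_const _)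
  · filter_upwards [self_mem_nhdsWithin] with ε hε
    exact (integrable_truncate hΨd hΨ hε W).1
  · filter_upwards [self_mem_nhdsWithin] with ε hε
    refine ae_of_all _ fun z => ?_
    have hnn := mul_nonneg (massD_nonneg W z.1) (massD_nonneg W z.2)
    rw [Real.norm_of_nonneg (mul_nonneg (truncate_nonneg hΨ (le_of_lt hε) _) hnn)]
    exact mul_le_mul_of_nonneg_right (truncate_le hΨ (le_of_lt hε) _) hnn

/-- Each truncated functional grows at a rate bounded by the gradient bound of Ψ alone. It is thus
bounded at time t uniformly in ε as soon as it is so at t₀. -/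
lemma SolvesSystem.finiteInteraction (h : SolvesSystem β w) (hd : (d : ℝ) < (2 * p + 2) / p)
    (hΨd : ContDiff ℝ 1 Ψ) (hΨ : ∀ x, 0 ≤ Ψ x) (hC : ∀ x, ‖fderiv ℝ Ψ x‖ ≤ C)
    (heven : ∀ x, Ψ (-x) = Ψ x) {t₀ : ℝ} (h₀ : FiniteInteraction Ψ (w t₀)) (t : ℝ) :
    FiniteInteraction Ψ (w t) := by
  obtain ⟨M, hM⟩ := ((isCompact_uIcc (a := t₀) (b := t)).image
    (continuous_currentBound C h.continuous)).bddAbove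
  refine finiteInteraction_of_bounded hΨd hΨ
    (R := interact Ψ (massD (w t₀)) (massD (w t₀)) + M * |t - t₀|) fun ε hε => ?_
  have hder := fun s => h.hasDerivAt_interact_mass hd (isWeight_truncate hΨd hΨ hC hε)
    (fun x => by rw [truncate, truncate, heven]) s
  have hmv := Convex.norm_image_sub_le_of_norm_hasDerivWithin_le
    (C := M) (fun s _ => (hder s).hasDerivWithinAt)
    (fun s hs => (abs_kernelCurrent_le (fun x => (norm_fderiv_truncate_le hΨd hΨ hε.le x).trans
      (hC x)) (w s)).trans (hM ⟨s, hs, rfl⟩)) (convex_uIcc t₀ t) Set.left_mem_uIcc Set.right_mem_uIcc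
  have h1 := (le_abs_self _).trans hmv
  have h2 := interact_truncate_le hΨd hΨ hε h₀
  rw [Real.norm_eq_abs] at h1
  linarith

/-- The interaction functional of an unbounded kernel with bounded gradient. -/
theorem SolvesSystem.hasDerivAt_interact_mass_of_finite (h : SolvesSystem β w)
    (hd : (d : ℝ) < (2 * p + 2) / p) (hΨd : ContDiff ℝ 1 Ψ) (hΨ : ∀ x, 0 ≤ Ψ x)
    (hC : ∀ x, ‖fderiv ℝ Ψ x‖ ≤ C) (heven : ∀ x, Ψ (-x) = Ψ x)
    (hfin : ∀ t, FiniteInteraction Ψ (w t)) (t₀ : ℝ) :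
    HasDerivAt (fun s => interact Ψ (massD (w s)) (massD (w s))) (kernelCurrent Ψ (w t₀)) t₀ := by
  -- The limit lemma works with a punctured neighbourhood of 0, whereas truncation needs a positive
  -- parameter; |ε| reconciles the two.
  have habs : Tendsto (fun ε : ℝ => |ε|) (𝓝[≠] 0) (𝓝[>] 0) := by
    refine tendsto_nhdsWithin_iff.2 ⟨?_, ?_⟩
    · simpa using (continuous_abs.tendsto (0 : ℝ)).mono_left nhdsWithin_le_nhds
    · filter_upwards [self_mem_nhdsWithin] with ε hε using abs_pos.2 hε
  have hCε : ∀ ε : ℝ, ∀ x, ‖fderiv ℝ (truncate |ε| Ψ) x‖ ≤ C := fun ε x =>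
    (norm_fderiv_truncate_le hΨd hΨ (abs_nonneg ε) x).trans (hC x)
  -- There is no error term here, so the lemma is used with E = 0 and C = 0.
  refine hasDerivAt_of_tendsto_integral (ε := 1) (C := 0) (E := fun _ _ => 0)
    (f := fun ε s => interact (truncate |ε| Ψ) (massD (w s)) (massD (w s)))
    (A := fun ε s => kernelCurrent (truncate |ε| Ψ) (w s)) (B := fun s => currentBound C (w s))
    (Q := fun s => kernelCurrent Ψ (w s)) one_pos (fun ε hε s => ?_) (fun ε hε => ?_)
    (fun ε hε => continuous_const) (continuous_currentBound C h.continuous)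
    (continuous_kernelCurrent hΨd hC h.continuous)
    (fun s => (tendsto_interact_truncate hΨd hΨ (hfin s)).comp habs)
    (fun s => (tendsto_kernelCurrent_truncate hΨd hΨ hC (w s)).comp
      (habs.mono_right (nhdsWithin_mono _ Set.Ioi_subset_Ici_self)))
    (fun ε hε s => abs_kernelCurrent_le (hCε ε) (w s)) (fun ε hε => by simp)
  · rw [add_zero]
    exact h.hasDerivAt_interact_mass hd (isWeight_truncate hΨd hΨ hC (abs_pos.2 hε))
      (fun x => by rw [truncate, truncate, heven]) s
  · exact continuous_kernelCurrent (contDiff_truncate hΨd hΨ (abs_nonneg ε)) (hCε ε) h.continuous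

end Unbounded

section Interaction

variable {d N : ℕ} {p : ℝ} [hp : Fact (1 ≤ p)] {β : Fin N → Fin N → ℝ} {φ : ℝ → ℝ}
  {w : ℝ → Fin N → XS d (energyExp p)} {u : ℝ → Fin N → H1 d}

/-- The convex weight normalized to vanish at the origin. -/
def centered (d : ℕ) (φ : ℝ → ℝ) (x : Rd d) : ℝ := radial d φ x - radial d φ 0

lemma fderiv_centered (x : Rd d) : fderiv ℝ (centered d φ) x = fderiv ℝ (radial d φ) x :=
  fderiv_sub_const _

lemma interactionIntegrand_eq (U V : H1 d) (z : Rd d × Rd d) :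
    interactionIntegrand φ U V z = centered d φ (z.1 - z.2) * (massDensity U z.1 * massDensity V z.2) +
      radial d φ 0 * (massDensity U z.1 * massDensity V z.2) := by
  rw [interactionIntegrand, psi_eq, centered]
  ring

lemma integrable_interactionIntegrand_iff (U V : H1 d) :
    Integrable (interactionIntegrand φ U V) ↔ Integrable fun z : Rd d × Rd d =>
      centered d φ (z.1 - z.2) * (massDensity U z.1 * massDensity V z.2) := by
  have h : Integrable fun z : Rd d × Rd d =>
      radial d φ 0 * (massDensity U z.1 * massDensity V z.2) :=
    ((integrable_massDensity U).mul_prod (integrable_massDensity V)).const_mul _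
  rw [funext (interactionIntegrand_eq U V)]
  exact integrable_add_iff_integrable_left' h

lemma sum_centered {t : ℝ} {W : Fin N → XS d (energyExp p)} (hW : ∀ μ, toAmbient (W μ) = (u t μ).1)
    (z : Rd d × Rd d) : centered d φ (z.1 - z.2) * (massD W z.1 * massD W z.2) =
      ∑ μ, ∑ κ, centered d φ (z.1 - z.2) * (massDensity (u t μ) z.1 * massDensity (u t κ) z.2) := by
  rw [← sum_massDensity hW, ← sum_massDensity hW, Finset.sum_mul_sum, Finset.mul_sum]
  exact Finset.sum_congr rfl fun μ _ => Finset.mul_sum _ _ _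

/-- After subtraction of Φ(0), which changes each integrand by an integrable function, all summands
are nonnegative. Their sum is then integrable exactly when each of them is. -/
lemma interactionFinite_iff (hc : ConvexOn ℝ Set.univ (radial d φ)) (hφ : ContDiff ℝ 4 (radial d φ))
    {t : ℝ} {W : Fin N → XS d (energyExp p)} (hW : ∀ μ, toAmbient (W μ) = (u t μ).1) :
    InteractionFinite φ u t ↔ FiniteInteraction (centered d φ) W := by
  simp only [InteractionFinite, integrable_interactionIntegrand_iff, FiniteInteraction, sum_centered hW]
  refine ⟨fun h => integrable_finsetSum _ fun μ _ => integrable_finsetSum _ fun κ _ => h μ κ,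
    fun h μ κ => h.mono' ?_ (ae_of_all _ fun z => ?_)⟩
  · exact (((hφ.continuous.sub continuous_const).comp
      (continuous_fst.sub continuous_snd)).aestronglyMeasurable.mul
      ((integrable_massDensity _).mul_prod (integrable_massDensity _)).1)
  · have hnn : ∀ μ κ, 0 ≤ centered d φ (z.1 - z.2) *
        (massDensity (u t μ) z.1 * massDensity (u t κ) z.2) := fun μ κ =>
      mul_nonneg (sub_nonneg.2 (radial_zero_le hc _))
        (mul_nonneg (massDensity_nonneg _ _) (massDensity_nonneg _ _))
    rw [Real.norm_of_nonneg (hnn μ κ)]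
    refine (Finset.single_le_sum (f := fun κ => centered d φ (z.1 - z.2) *
      (massDensity (u t μ) z.1 * massDensity (u t κ) z.2)) (fun κ _ => hnn μ κ)
      (Finset.mem_univ κ)).trans ?_
    exact Finset.single_le_sum (f := fun μ => ∑ κ, centered d φ (z.1 - z.2) *
      (massDensity (u t μ) z.1 * massDensity (u t κ) z.2))
      (fun μ _ => Finset.sum_nonneg fun κ _ => hnn μ κ) (Finset.mem_univ μ)

/-- The constant Φ(0) contributes a multiple of the squared total mass, which is conserved and does
not affect the derivative. -/
lemma interaction_eq {t : ℝ} {W : Fin N → XS d (energyExp p)} (hW : ∀ μ, toAmbient (W μ) = (u t μ).1)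
    (h : InteractionFinite φ u t) : interaction φ u t =
      interact (centered d φ) (massD W) (massD W) + radial d φ 0 * (∫ x, massD W x) ^ 2 := by
  have h1 : ∀ μ κ, Integrable fun z : Rd d × Rd d =>
      centered d φ (z.1 - z.2) * (massDensity (u t μ) z.1 * massDensity (u t κ) z.2) := fun μ κ =>
    (integrable_interactionIntegrand_iff _ _).1 (h μ κ)
  have h2 : ∀ μ κ, Integrable fun z : Rd d × Rd d =>
      radial d φ 0 * (massDensity (u t μ) z.1 * massDensity (u t κ) z.2) := fun μ κ =>
    ((integrable_massDensity _).mul_prod (integrable_massDensity _)).const_mul _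
  have e2 : ∫ x, massD W x = ∑ μ, ∫ x, massDensity (u t μ) x := by
    rw [← integral_finsetSum _ fun μ _ => integrable_massDensity (u t μ)]
    simp only [sum_massDensity hW]
  rw [interaction, interact, e2, sq, Finset.sum_mul_sum]
  simp only [sum_centered hW, interactionIntegrand_eq, integral_add (h1 _ _) (h2 _ _),
    Finset.sum_add_distrib, Finset.mul_sum]
  congr 1
  · rw [integral_finsetSum _ fun μ _ => integrable_finsetSum _ fun κ _ => h1 μ κ]
    exact Finset.sum_congr rfl fun μ _ => (integral_finsetSum _ fun κ _ => h1 μ κ).symm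
  · refine Finset.sum_congr rfl fun μ _ => Finset.sum_congr rfl fun κ _ => ?_
    rw [integral_const_mul, ← integral_prod_mul]
    rfl

/-- The constant 1 is an admissible weight, with vanishing gradient. -/
lemma SolvesSystem.hasDerivAt_total_mass (h : SolvesSystem β w) (hd : (d : ℝ) < (2 * p + 2) / p)
    (t : ℝ) : HasDerivAt (fun s => ∫ x, massD (w s) x) 0 t := by
  have h1 := h.hasDerivAt_massD hd (Y := fun _ => (1 : ℝ))
    ⟨contDiff_const, ⟨1, fun x => by simp⟩, 0, fun x => by simp⟩ t
  simpa [pderiv] using h1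

theorem SolvesSystem.hasDerivAt_interaction (h : SolvesSystem β w)
    (hd : (d : ℝ) < (2 * p + 2) / p) (hc : ConvexOn ℝ Set.univ (radial d φ))
    (hφ : ContDiff ℝ 4 (radial d φ)) (hb : ∀ k : Fin d, SmoothBdd 3 (pderiv k (radial d φ)))
    {C : ℝ} (hC : ∀ x, ‖fderiv ℝ (radial d φ) x‖ ≤ C)
    (hW : ∀ t μ, toAmbient (w t μ) = (u t μ).1) {t₀ : ℝ} (h₀ : InteractionFinite φ u t₀) (t : ℝ) :
    InteractionFinite φ u t ∧ HasDerivAt (interaction φ u) (interactionCurrent φ u t) t := by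
  have hΨd : ContDiff ℝ 1 (centered d φ) := (hφ.of_le (by norm_num)).sub contDiff_const
  have hΨ : ∀ x, 0 ≤ centered d φ x := fun x => sub_nonneg.2 (radial_zero_le hc x)
  have hC' : ∀ x, ‖fderiv ℝ (centered d φ) x‖ ≤ C := fun x => by rw [fderiv_centered]; exact hC x
  have heven : ∀ x, centered d φ (-x) = centered d φ x := fun x => by
    rw [centered, radial_neg, centered]
  have hfin : ∀ t, FiniteInteraction (centered d φ) (w t) := fun t =>
    h.finiteInteraction hd hΨd hΨ hC' heven ((interactionFinite_iff hc hφ (hW t₀)).1 h₀) t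
  have hfin' : ∀ t, InteractionFinite φ u t := fun t =>
    (interactionFinite_iff hc hφ (hW t)).2 (hfin t)
  refine ⟨hfin' t, ?_⟩
  rw [show interaction φ u = _ from funext fun t => interaction_eq (hW t) (hfin' t)]
  refine ((h.hasDerivAt_interact_mass_of_finite hd hΨd hΨ hC' heven hfin t).add
    (((h.hasDerivAt_total_mass hd t).pow 2).const_mul _)).congr_deriv ?_
  rw [interactionCurrent_eq hb (hW t), kernelCurrent]
  have e : ∀ k : Fin d, pderiv k (centered d φ) = pderiv k (radial d φ) := fun k => by
    ext x; rw [pderiv, fderiv_centered, pderiv]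
  simp [e]

end Interaction

end InteractionMorawetz

end

theorem lemma2p2 {d N : ℕ} (hd1 : 1 ≤ d) (hd3 : d ≤ 3)
    (p : ℝ) (hp : 1 ≤ p) (hp3 : d = 3 → p < 2)
    (β : Fin N → Fin N → ℝ) (hβ : ∀ μ ν, 0 ≤ β μ ν) (hβsymm : ∀ μ ν, β μ ν = β ν μ)
    (u : ℝ → Fin N → H1 d) (hu : IsGlobalSolution p β u)
    (φ : ℝ → ℝ) (hφconv : ConvexOn ℝ Set.univ (radial d φ))
    (hφreg : ContDiff ℝ 4 (radial d φ))
    (hφdecay : ∀ k : ℕ, 1 ≤ k → k ≤ 4 →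
      ∃ C : ℝ, ∀ x, ‖iteratedFDeriv ℝ k (radial d φ) x‖ ≤ C) :
    -- all integrals except those in `I(t)` converge absolutely, for every solution
    (∀ t μ κ, Integrable (currentIntegrand φ (u t μ) (u t κ)) volume ∧
      Integrable (bilapIntegrand φ (u t μ) (u t κ)) volume ∧
      ∀ ν, Integrable (nonlinearIntegrand p φ (u t μ) (u t ν) (u t κ)) volume) ∧
    -- `gradm t μ` is the (integrable) weak gradient of `m_{u_μ(t)}`, and `ddI` is `Ï`
    ∃ (gradm : ℝ → Fin N → Rd d → Rd d) (ddI : ℝ → ℝ),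
      (∀ t μ, Integrable (gradm t μ) volume ∧
        HasWeakGradient (massDensity (u t μ)) (fun k x => gradm t μ x k)) ∧
      (∀ t μ κ, Integrable (gradientIntegrand φ (gradm t μ) (gradm t κ)) volume) ∧
      -- if `I` is finite at one time, it is finite at all times, and the current is `İ`
      ((∃ t₀, InteractionFinite φ u t₀) → ∀ t, InteractionFinite φ u t ∧
        HasDerivAt (interaction φ u) (interactionCurrent φ u t) t ∧
        HasDerivAt (deriv (interaction φ u)) (ddI t) t) ∧
      -- in any case the current is differentiable, with derivative `ddI`
      (∀ t, HasDerivAt (interactionCurrent φ u) (ddI t) t) ∧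
      (∀ t, 0 ≤ nonlinearTerm p β φ u t) ∧
      (∀ t, 2 * ∑ μ, ∑ κ, (∫ z, gradientIntegrand φ (gradm t μ) (gradm t κ) z)
          + nonlinearTerm p β φ u t ≤ ddI t) ∧
      (∀ t, -2 * ∑ μ, ∑ κ, (∫ z, bilapIntegrand φ (u t μ) (u t κ) z)
          + nonlinearTerm p β φ u t ≤ ddI t) := by
  have : Fact (1 ≤ p) := ⟨hp⟩
  have hd := InteractionMorawetz.coe_momentum_exponent_lt (p := p) hd3 hp3
  obtain ⟨w, hw, hW⟩ := InteractionMorawetz.exists_solvesSystem hd hu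
  have hmem : ∀ t μ, w t μ ∈ InteractionMorawetz.WS d (InteractionMorawetz.energyExp p) :=
    fun t μ => (hw μ).mem t
  have hb := InteractionMorawetz.smoothBdd_pderiv_radial hφreg hφdecay
  obtain ⟨C, hC⟩ := hφdecay 1 le_rfl (by norm_num)
  simp only [norm_iteratedFDeriv_one] at hC
  have hM := hw.hasDerivAt_interactionCurrent (φ := φ) hβsymm hd hb hW
  refine ⟨fun t μ κ => ⟨(InteractionMorawetz.currentIntegrand_integral hb _ _).1,
    (InteractionMorawetz.bilapIntegrand_integral hφreg hb _ _).1, fun ν =>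
    (InteractionMorawetz.nonlinearIntegrand_integral hφreg hb _
      (InteractionMorawetz.integrable_pairPotential (hW t μ) (hmem t μ) (hW t ν) (hmem t ν))).1⟩,
    fun t μ => InteractionMorawetz.massGradient (u t μ),
    fun t => InteractionMorawetz.morawetzRate β (radial d φ) (w t),
    fun t μ => ⟨InteractionMorawetz.integrable_massGradient _,
      InteractionMorawetz.hasWeakGradient_massDensity hd (hW t μ) (hmem t μ)⟩,
    fun t μ κ => (InteractionMorawetz.gradientIntegrand_integral hφreg hb _ _).1, ?_, hM,
    fun t => InteractionMorawetz.nonlinearTerm_nonneg hβ hφconv hφreg t,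
    fun t => InteractionMorawetz.le_morawetzRate_gradient hd hφconv hφreg hb (hW t) (hmem t),
    fun t => InteractionMorawetz.le_morawetzRate_bilap hd hφconv hφreg hb (hW t) (hmem t)⟩
  rintro ⟨t₀, h₀⟩ t
  have h := hw.hasDerivAt_interaction hd hφconv hφreg hb hC hW h₀
  refine ⟨(h t).1, (h t).2, ?_⟩
  -- The first derivative equals the current at every time, so the derivative of the current, known
  -- in any case, is the second derivative of I.
  rw [show deriv (interaction φ u) = interactionCurrent φ u from funext fun s => (h s).2.deriv]
  exact hM t
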